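/- Let $R$ be a commutative ring and $0\le k\le n$. Every algebra below is generated by elements having a positive integer weight; an element of weight $m$ is given $\mathbb Z$-degree $2m$ and parity $m \bmod 2$, and tensor products of algebras are super tensor products, $(a\otimes b)(a'\otimes b')=(-1)^{|b||a'|}aa'\otimes bb'$. *Definitions.* $\mathrm{OPol}_n=R\langle x_1,\dots,x_n\rangle/(x_ix_j+x_jx_i,\ i\ne j)$ with $x_i$ of weight $1$; a permutation acts by $w(x_i)=(-1)^{\ell(w)}x_{w(i)}$; $\partial_i$ is the operator with $\partial_i(x_j)=1$ for $j\in\{i,i+1\}$, $\partial_i(x_j)=0$ otherwise, and $\partial_i(fg)=\partial_i(f)g+s_i(f)\partial_i(g)$; $O\Lambda_n=\bigcap_i\ker\partial_i$. With $\tilde x_i=(-1)^{i-1}x_i$, $\varepsilon_r=\sum_{i_1<\dots<i_r}\tilde x_{i_1}\cdots\tilde x_{i_r}$ and $h_r=\sum_{i_1\le\dots\le i_r}\tilde x_{i_1}\cdots\tilde x_{i_r}$ in $O\Lambda_n$; $h_\lambda=h_{\lambda_1}h_{\lambda_2}\cdots$; and $s_\lambda=(-1)^{\binom n3}\bigl(\partial_{w_0}(x_1^{\lambda_1}\cdots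 x_n^{\lambda_n}x_1^{n-1}x_2^{n-2}\cdots x_n^0)\bigr)^{w_0}$ with $\partial_{w_0}=\partial_1(\partial_2\partial_1)\cdots(\partial_{n-1}\cdots\partial_1)$, for partitions $\lambda$ with at most $n$ parts. $A_n$ is the supercommutative algebra generated by even $\chi_i$ of weight $2i$ ($1\le i\le\lfloor n/2\rfloor$) and an odd $d$ of weight $1$, with $d^2=0$ and, if $n$ is even, $d\chi_{n/2}=0$ (where $\chi_0=1$); $A_n$ is commutative. Put $c_{2i}=\chi_i$, $c_{2i+1}=d\chi_i$. Finally $M_k^n=(O\Lambda_k\otimes A_n)/\langle h'_m : n-k+1\le m\le n\rangle$ with $h'_m=\sum_{r=0}^m(-1)^rh_{m-r}\otimes c_r$ (two-sided ideal), an $A_n$-module by right multiplication. *Statement.* There are a unique $R$-algebra homomorphism $\rho:O\Lambda_n\to O\Lambda_k\otimes O\Lambda_{n-k}$ with $\rho(\varepsilon_r)=\sum_{j=0}^r(-1)^{(r-j)j}\varepsilon_{r-j}\otimes\varepsilon_j$ for all $r$, and a unique $R$-algebra homomorphism $\pi:O\Lambda_n\to A_n$ with $\pi(\varepsilon_r)=(-1)^{\binom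 r2}c_r$ for all $r$. Let $OH=(O\Lambda_k\otimes O\Lambda_{n-k})\otimes_{O\Lambda_n}A_n$ be the odd equivariant Grassmannian bimodule, where $O\Lambda_n$ acts on the right of the first factor by $m\cdot x=m\rho(x)$ and on the left of $A_n$ through $\pi$. Then: 1. $OH$ is an $(M_k^n,M_k^n)$-bimodule such that, for homogeneous elements, $$(f\otimes a)\cdot(g\otimes s\otimes b)=(-1)^{|a|(|g|+|s|)}\,fg\otimes s\otimes ab,\qquad (g\otimes 1\otimes b)\cdot(f\otimes a)=(-1)^{|b||f|}\,gf\otimes 1\otimes ba,$$ and the right action of $1\otimes a$ is multiplication by $a$ on the factor $A_n$. 2. The map $\beta:M_k^n\to OH$, $f\otimes a\mapsto f\otimes1\otimes a$, is a well-defined isomorphism of $(M_k^n,M_k^n)$-bimodules that preserves weights in both directions. 3. $M_k^n$ and $OH$ are graded $A_n$-supermodules and are free over $A_n$. Over partitions $\lambda$ with at most $k$ parts, all at most $n-k$: the $h_\lambda\otimes1$ form a basis of $M_k^n$, and so do the $s_\lambda\otimes 1$; the $h_\lambda\otimes1\otimes1$ form a basis of $OH$, and so do the $s_\lambda\otimes1\otimes1$.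 Moreover the $1\otimes s_\mu\otimes1$, over partitions $\mu$ with at most $n-k$ parts, all at most $k$, form a basis of $OH$. (All these $s_\lambda$, $s_\mu$ are odd symmetric.) 4. $M_k^n$ and $OH$ both have graded rank $(\pi q)^{k(n-k)}\begin{bmatrix}n\\k\end{bmatrix}_{q,\pi}$ over $A_n$: each has a finite homogeneous $A_n$-basis for which the sum of $q^{\text{degree}}\pi^{\text{parity}}$ equals this element of $\mathbb Z[q^{\pm1},\pi]/(\pi^2-1)$, where $[m]_{q,\pi}=\sum_{i=0}^{m-1}\pi^iq^{m-1-2i}$ and $\begin{bmatrix}n\\k\end{bmatrix}_{q,\pi}=[n]^!_{q,\pi}/([k]^!_{q,\pi}[n-k]^!_{q,\pi})$. -/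

import Mathlib

open scoped TensorProduct DirectSum

namespace OddGrassmannian

noncomputable section

section SkewPolynomials

/-- The defining relations `x_i x_j + x_j x_i = 0` (`i ≠ j`) of skew polynomials. -/
inductive SkewRel (R : Type*) [CommRing R] (n : ℕ) :
    FreeAlgebra R (Fin n) → FreeAlgebra R (Fin n) → Prop
  | anticomm (i j : Fin n) (hij : i ≠ j) :
      SkewRel R n (FreeAlgebra.ι R i * FreeAlgebra.ι R j + FreeAlgebra.ι R j * FreeAlgebra.ι R i) 0

/-- The algebra of skew polynomials `R⟨x_1, …, x_n⟩ / (x_i x_j + x_j x_i, i ≠ j)`.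
The variable `x_i` of the literature is `xVar R n i` with `i` counted from `0`. -/
def OPol (R : Type*) [CommRing R] (n : ℕ) : Type _ := RingQuot (SkewRel R n)

instance (R : Type*) [CommRing R] (n : ℕ) : Ring (OPol R n) :=
  inferInstanceAs (Ring (RingQuot (SkewRel R n)))

instance (R : Type*) [CommRing R] (n : ℕ) : Algebra R (OPol R n) :=
  inferInstanceAs (Algebra R (RingQuot (SkewRel R n)))

variable (R : Type*) [CommRing R] (n : ℕ)

/-- The generators of the algebra of skew polynomials. -/
def xVar (i : Fin n) : OPol R n := RingQuot.mkAlgHom R (SkewRel R n) (FreeAlgebra.ι R i)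

theorem X_anticomm (i j : Fin n) (hij : i ≠ j) : xVar R n i * xVar R n j + xVar R n j * xVar R n i = 0 := by
  have h := RingQuot.mkAlgHom_rel R (SkewRel.anticomm (R := R) i j hij)
  rw [map_add, map_mul, map_mul, map_zero] at h
  exact h

/-- The universal property of skew polynomials. -/
def OPol.lift {S : Type*} [Ring S] [Algebra R S] (f : Fin n → S)
    (hf : ∀ i j, i ≠ j → f i * f j + f j * f i = 0) : OPol R n →ₐ[R] S :=
  RingQuot.liftAlgHom R ⟨FreeAlgebra.lift R f, by
    rintro _ _ ⟨i, j, hij⟩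
    simpa using hf i j hij⟩

@[simp]
theorem OPol.lift_X {S : Type*} [Ring S] [Algebra R S] (f : Fin n → S)
    (hf : ∀ i j, i ≠ j → f i * f j + f j * f i = 0) (i : Fin n) :
    OPol.lift R n f hf (xVar R n i) = f i := by
  unfold OPol.lift xVar
  erw [RingQuot.liftAlgHom_mkAlgHom_apply]
  simp

variable {R n} in
theorem OPol.algHom_ext {S : Type*} [Ring S] [Algebra R S] {f g : OPol R n →ₐ[R] S}
    (h : ∀ i, f (xVar R n i) = g (xVar R n i)) : f = g := by
  apply RingQuot.ringQuot_ext'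
  ext i
  exact h i

/-- The action `w(x_i) = (-1)^{ℓ(w)} x_{w(i)}` of a permutation on skew polynomials, by algebra
automorphisms; note `(-1)^{ℓ(w)} = sign w`. -/
def permAct (w : Equiv.Perm (Fin n)) : OPol R n →ₐ[R] OPol R n :=
  OPol.lift R n (fun i => Equiv.Perm.sign w • xVar R n (w i)) (fun i j hij => by
    have h := X_anticomm R n (w i) (w j) (fun h => hij (w.injective h))
    rcases Int.units_eq_one_or (Equiv.Perm.sign w) with hs | hs
    · simpa [hs] using h
    · simpa [hs] using h)

@[simp]
theorem permAct_X (w : Equiv.Perm (Fin n)) (i : Fin n) :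
    permAct R n w (xVar R n i) = Equiv.Perm.sign w • xVar R n (w i) := by
  simp [permAct]

/-- The simple transposition exchanging `i` and `i + 1` (counted from `0`). -/
def simpleSwap {n : ℕ} (i : ℕ) (hi : i + 1 < n) : Equiv.Perm (Fin n) :=
  Equiv.swap ⟨i, by omega⟩ ⟨i + 1, hi⟩

theorem permAct_simpleSwap_X (i : ℕ) (hi : i + 1 < n) (j : Fin n) :
    permAct R n (simpleSwap i hi) (xVar R n j) = - xVar R n (simpleSwap i hi j) := by
  have : Equiv.Perm.sign (simpleSwap i hi) = -1 := by
    unfold simpleSwap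
    exact Equiv.Perm.sign_swap (by simp [Fin.ext_iff])
  rw [permAct_X, this, Units.neg_smul, one_smul]

/-- The values `∂_i(x_j)`: `1` if `j = i, i + 1` and `0` otherwise. -/
def divDiffX (i : ℕ) (j : Fin n) : OPol R n := if j.1 = i ∨ j.1 = i + 1 then 1 else 0

/-- The algebra homomorphism `f ↦ (s_i f, ∂_i f; 0, f)` to upper triangular matrices. It encodes
the rule `∂_i (f g) = ∂_i(f) g + s_i(f) ∂_i(g)`. -/
def divDiffHom (i : ℕ) (hi : i + 1 < n) : OPol R n →ₐ[R] Matrix (Fin 2) (Fin 2) (OPol R n) :=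
  OPol.lift R n
    (fun j => !![permAct R n (simpleSwap i hi) (xVar R n j), divDiffX R n i j; 0, xVar R n j])
    (fun j l hjl => by
      have h1 := X_anticomm R n j l hjl
      have h2 := X_anticomm R n (simpleSwap i hi j) (simpleSwap i hi l)
        (fun h => hjl ((simpleSwap i hi).injective h))
      have h3 : divDiffX R n i l * (xVar R n j - xVar R n (simpleSwap i hi j))
          + divDiffX R n i j * (xVar R n l - xVar R n (simpleSwap i hi l)) = 0 := by
        have key : ∀ m : Fin n, ¬ (m.1 = i ∨ m.1 = i + 1) → simpleSwap i hi m = m := by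
          intro m hm
          apply Equiv.swap_apply_of_ne_of_ne <;> (rw [Ne, Fin.ext_iff]; tauto)
        have e1 : simpleSwap i hi ⟨i, by omega⟩ = ⟨i + 1, hi⟩ := Equiv.swap_apply_left _ _
        have e2 : simpleSwap i hi ⟨i + 1, hi⟩ = ⟨i, by omega⟩ := Equiv.swap_apply_right _ _
        by_cases hj : j.1 = i ∨ j.1 = i + 1
        · by_cases hl : l.1 = i ∨ l.1 = i + 1
          · have : (j = ⟨i, by omega⟩ ∧ l = ⟨i + 1, hi⟩) ∨ (j = ⟨i + 1, hi⟩ ∧ l = ⟨i, by omega⟩) := by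
              simp only [Ne, Fin.ext_iff] at hjl ⊢
              omega
            rcases this with ⟨rfl, rfl⟩ | ⟨rfl, rfl⟩
            · rw [e1, e2]; simp [divDiffX]
            · rw [e1, e2]; simp [divDiffX]
          · rw [key l hl]; simp [divDiffX, hl]
        · by_cases hl : l.1 = i ∨ l.1 = i + 1
          · rw [key j hj]; simp [divDiffX, hj]
          · simp [divDiffX, hj, hl]
      have h4 : ∀ m : Fin n, ∀ y : OPol R n, y * divDiffX R n i m = divDiffX R n i m * y := by
        intro m y
        unfold divDiffX
        split_ifs <;> simp
      simp only [permAct_simpleSwap_X, Matrix.mul_fin_two]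
      ext a b
      fin_cases a <;> fin_cases b
      · simpa using h2
      · simp only [mul_sub] at h3
        simp [h4]
        rw [← h3]
        abel
      · simp
      · simpa using h1)

/-- The `i`-th odd divided difference operator `∂_i` (with `i` counted from `0`). -/
def divDiff (i : ℕ) (hi : i + 1 < n) : OPol R n →ₗ[R] OPol R n where
  toFun f := divDiffHom R n i hi f 0 1
  map_add' f g := by simp
  map_smul' c f := by simp

theorem OPol.induction {motive : OPol R n → Prop}
    (algebraMap : ∀ r, motive (algebraMap R (OPol R n) r)) (X : ∀ j, motive (xVar R n j))
    (mul : ∀ f g, motive f → motive g → motive (f * g))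
    (add : ∀ f g, motive f → motive g → motive (f + g)) (f : OPol R n) : motive f := by
  let q : FreeAlgebra R (Fin n) →ₐ[R] OPol R n := RingQuot.mkAlgHom R (SkewRel R n)
  have hq : ∀ a, motive (q a) := by
    intro a
    induction a using FreeAlgebra.induction with
    | grade0 r => rw [AlgHom.commutes]; exact algebraMap r
    | grade1 j => exact X j
    | mul a b ha hb => rw [map_mul]; exact mul _ _ ha hb
    | add a b ha hb => rw [map_add]; exact add _ _ ha hb
  obtain ⟨a, rfl⟩ : ∃ a, q a = f := RingQuot.mkAlgHom_surjective R (SkewRel R n) f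
  exact hq a

theorem divDiffHom_apply (i : ℕ) (hi : i + 1 < n) (f : OPol R n) :
    divDiffHom R n i hi f 0 0 = permAct R n (simpleSwap i hi) f ∧
      divDiffHom R n i hi f 1 0 = 0 ∧ divDiffHom R n i hi f 1 1 = f := by
  induction f using OPol.induction with
  | algebraMap r => simp [Matrix.algebraMap_matrix_apply]
  | X j =>
    unfold divDiffHom
    rw [OPol.lift_X]
    simp
  | mul a b ha hb =>
    obtain ⟨a1, a2, a3⟩ := ha
    obtain ⟨b1, b2, b3⟩ := hb
    simp only [map_mul, Matrix.mul_apply, Fin.sum_univ_two, a1, a2, a3, b1, b2, b3]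
    refine ⟨by simp, by simp, by simp⟩
  | add a b ha hb =>
    obtain ⟨a1, a2, a3⟩ := ha
    obtain ⟨b1, b2, b3⟩ := hb
    simp only [map_add, Matrix.add_apply, a1, a2, a3, b1, b2, b3]
    refine ⟨by simp, by simp, by simp⟩

theorem divDiff_X (i : ℕ) (hi : i + 1 < n) (j : Fin n) :
    divDiff R n i hi (xVar R n j) = if j.1 = i ∨ j.1 = i + 1 then 1 else 0 := by
  change divDiffHom R n i hi (xVar R n j) 0 1 = _
  unfold divDiffHom
  rw [OPol.lift_X]
  simp [divDiffX]

theorem divDiff_mul (i : ℕ) (hi : i + 1 < n) (f g : OPol R n) :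
    divDiff R n i hi (f * g) =
      divDiff R n i hi f * g + permAct R n (simpleSwap i hi) f * divDiff R n i hi g := by
  change divDiffHom R n i hi (f * g) 0 1 = _
  rw [map_mul, Matrix.mul_apply, Fin.sum_univ_two, (divDiffHom_apply R n i hi f).1,
    (divDiffHom_apply R n i hi g).2.2, add_comm]
  rfl

theorem divDiff_algebraMap (i : ℕ) (hi : i + 1 < n) (r : R) :
    divDiff R n i hi (algebraMap R (OPol R n) r) = 0 := by
  change divDiffHom R n i hi (algebraMap R (OPol R n) r) 0 1 = _
  rw [AlgHom.commutes]
  simp [Matrix.algebraMap_matrix_apply]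

/-- The subspace of skew polynomials of polynomial degree `m`. Such elements have `ℤ`-degree `2m`
and parity `m` modulo `2`. -/
def skewGrading (m : ℕ) : Submodule R (OPol R n) := Submodule.span R (Set.range (xVar R n)) ^ m

theorem X_mem (j : Fin n) : xVar R n j ∈ Submodule.span R (Set.range (xVar R n)) ^ 1 := by
  rw [pow_one]
  exact Submodule.subset_span ⟨j, rfl⟩

instance : SetLike.GradedMonoid (skewGrading R n) :=
  inferInstanceAs (SetLike.GradedMonoid fun m => Submodule.span R (Set.range (xVar R n)) ^ m)

/-- The decomposition of skew polynomials into homogeneous components. -/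
def skewDecompose : OPol R n →ₐ[R] ⨁ m, skewGrading R n m :=
  OPol.lift R n (fun j => DirectSum.of (fun m => skewGrading R n m) 1 ⟨xVar R n j, X_mem R n j⟩)
    (fun i j hij => by
      rw [DirectSum.of_mul_of, DirectSum.of_mul_of, ← map_add]
      convert map_zero (DirectSum.of (fun m => skewGrading R n m) (1 + 1))
      ext
      exact X_anticomm R n i j hij)

theorem skewDecompose_X (j : Fin n) : skewDecompose R n (xVar R n j) =
    DirectSum.of (fun m => skewGrading R n m) 1 ⟨xVar R n j, X_mem R n j⟩ := by
  simp [skewDecompose]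

theorem skewDecompose_mem (m : ℕ) (f : OPol R n) (hf : f ∈ skewGrading R n m) :
    skewDecompose R n f = DirectSum.of (fun m => skewGrading R n m) m ⟨f, hf⟩ := by
  unfold skewGrading at hf
  induction hf using Submodule.pow_induction_on_left' with
  | algebraMap r => rw [AlgHom.commutes, DirectSum.algebraMap_apply]; rfl
  | add x y i hx hy ihx ihy => rw [map_add, ihx, ihy, ← map_add]; rfl
  | mem_mul v hv i x hx ih =>
    have hv' : ∃ h : v ∈ skewGrading R n 1,
        skewDecompose R n v = DirectSum.of (fun m => skewGrading R n m) 1 ⟨v, h⟩ := by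
      induction hv using Submodule.span_induction with
      | mem x h =>
        obtain ⟨j, rfl⟩ := h
        exact ⟨X_mem R n j, skewDecompose_X R n j⟩
      | zero =>
        refine ⟨Submodule.zero_mem _, ?_⟩
        rw [map_zero]
        exact (map_zero (DirectSum.of (fun m => skewGrading R n m) 1)).symm
      | add x y _ _ hx hy =>
        obtain ⟨h1, h2⟩ := hx
        obtain ⟨h3, h4⟩ := hy
        refine ⟨Submodule.add_mem _ h1 h3, ?_⟩
        rw [map_add, h2, h4, ← map_add]
        rfl
      | smul a x _ hx =>
        obtain ⟨h1, h2⟩ := hx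
        refine ⟨Submodule.smul_mem _ a h1, ?_⟩
        rw [map_smul, h2]
        exact ((DirectSum.lof R ℕ (fun m => skewGrading R n m) 1).map_smul a ⟨x, h1⟩).symm
    obtain ⟨h1, h2⟩ := hv'
    rw [map_mul, ih, h2, DirectSum.of_mul_of]
    exact DirectSum.of_eq_of_gradedMonoid_eq (Sigma.subtype_ext (add_comm _ _) rfl)

instance : GradedAlgebra (skewGrading R n) :=
  GradedAlgebra.ofAlgHom (skewGrading R n) (skewDecompose R n)
    (by
      apply OPol.algHom_ext
      intro j
      rw [AlgHom.comp_apply, skewDecompose_X, DirectSum.coeAlgHom_of]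
      rfl)
    (fun m x => skewDecompose_mem R n m x x.2)

theorem divDiff_skewGrading (i : ℕ) (hi : i + 1 < n) (m : ℕ) :
    ∀ f ∈ skewGrading R n (m + 1), divDiff R n i hi f ∈ skewGrading R n m := by
  have hs : ∀ v ∈ Submodule.span R (Set.range (xVar R n)),
      permAct R n (simpleSwap i hi) v ∈ Submodule.span R (Set.range (xVar R n)) ∧
        ∃ r, divDiff R n i hi v = algebraMap R _ r := by
    intro v hv
    induction hv using Submodule.span_induction with
    | mem x h =>
      obtain ⟨j, rfl⟩ := h
      rw [permAct_simpleSwap_X, divDiff_X]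
      refine ⟨Submodule.neg_mem _ (Submodule.subset_span ⟨_, rfl⟩), ?_⟩
      split_ifs
      · exact ⟨1, (map_one _).symm⟩
      · exact ⟨0, (map_zero _).symm⟩
    | zero => exact ⟨by simp, 0, by simp⟩
    | add x y _ _ hx hy =>
      obtain ⟨h1, r, h2⟩ := hx
      obtain ⟨h3, s, h4⟩ := hy
      exact ⟨by rw [map_add]; exact Submodule.add_mem _ h1 h3, r + s, by
        rw [map_add, map_add, h2, h4]⟩
    | smul a x _ hx =>
      obtain ⟨h1, r, h2⟩ := hx
      exact ⟨by rw [map_smul]; exact Submodule.smul_mem _ a h1, a * r, by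
        rw [map_smul, h2, map_mul, Algebra.smul_def]⟩
  induction m with
  | zero =>
    intro f hf
    unfold skewGrading at hf ⊢
    rw [zero_add, pow_one] at hf
    obtain ⟨-, r, hr⟩ := hs f hf
    rw [hr, pow_zero]
    exact Submodule.algebraMap_mem r
  | succ m ih =>
    intro f hf
    unfold skewGrading at hf
    rw [pow_succ'] at hf
    induction hf using Submodule.mul_induction_on' with
    | mem_mul_mem v hv y hy =>
      rw [divDiff_mul]
      obtain ⟨h1, r, hr⟩ := hs v hv
      refine Submodule.add_mem _ ?_ ?_
      · rw [hr, ← Algebra.smul_def]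
        exact Submodule.smul_mem _ _ hy
      · unfold skewGrading
        rw [pow_succ']
        exact Submodule.mul_mem_mul h1 (ih y hy)
    | add x _ y _ hx hy =>
      rw [map_add]
      exact Submodule.add_mem _ hx hy

theorem divDiff_skewGrading_zero (i : ℕ) (hi : i + 1 < n) :
    ∀ f ∈ skewGrading R n 0, divDiff R n i hi f = 0 := by
  intro f hf
  unfold skewGrading at hf
  rw [pow_zero] at hf
  obtain ⟨r, rfl⟩ := Submodule.mem_one.mp hf
  exact divDiff_algebraMap R n i hi r

end SkewPolynomials

section OddSymmetric

variable (R : Type*) [CommRing R] (n : ℕ)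

/-- The algebra of odd symmetric polynomials, the intersection of the kernels of the odd divided
difference operators. -/
def OSym : Subalgebra R (OPol R n) where
  carrier := {f | ∀ (i : ℕ) (hi : i + 1 < n), divDiff R n i hi f = 0}
  mul_mem' := by
    intro f g hf hg i hi
    rw [divDiff_mul, hf i hi, hg i hi, zero_mul, mul_zero, add_zero]
  add_mem' := by
    intro f g hf hg i hi
    rw [map_add, hf i hi, hg i hi, add_zero]
  algebraMap_mem' := fun r i hi => divDiff_algebraMap R n i hi r

theorem mem_OSym (f : OPol R n) :
    f ∈ OSym R n ↔ ∀ (i : ℕ) (hi : i + 1 < n), divDiff R n i hi f = 0 := Iff.rfl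

/-- The grading of odd symmetric polynomials by polynomial degree. An element of `oddSymGrading m`
has `ℤ`-degree `2m` and parity `m` modulo `2`. -/
def oddSymGrading (m : ℕ) : Submodule R (OSym R n) :=
  (skewGrading R n m).comap (OSym R n).val.toLinearMap

theorem mem_oddSymGrading (m : ℕ) (f : OSym R n) :
    f ∈ oddSymGrading R n m ↔ (f : OPol R n) ∈ skewGrading R n m := Iff.rfl

theorem divDiff_component (i : ℕ) (hi : i + 1 < n) (m : ℕ) (f : OPol R n) :
    divDiff R n i hi (DirectSum.decompose (skewGrading R n) f (m + 1) : OPol R n) =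
      (DirectSum.decompose (skewGrading R n) (divDiff R n i hi f) m : OPol R n) := by
  induction f using DirectSum.Decomposition.inductionOn (skewGrading R n) with
  | zero => simp
  | @homogeneous l f =>
    cases l with
    | zero =>
      rw [divDiff_skewGrading_zero R n i hi f f.2,
        DirectSum.decompose_of_mem_ne (skewGrading R n) f.2 (by omega)]
      simp
    | succ l =>
      have h := divDiff_skewGrading R n i hi l f f.2
      by_cases hm : l = m
      · subst hm
        rw [DirectSum.decompose_of_mem_same _ f.2, DirectSum.decompose_of_mem_same _ h]
      · rw [DirectSum.decompose_of_mem_ne _ f.2 (by omega),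
          DirectSum.decompose_of_mem_ne _ h hm, map_zero]
  | add f g hf hg =>
    rw [DirectSum.decompose_add, DirectSum.add_apply, map_add, DirectSum.decompose_add,
      DirectSum.add_apply, Submodule.coe_add, map_add, hf, hg, Submodule.coe_add]

theorem component_mem_OSym (m : ℕ) (f : OPol R n) (hf : f ∈ OSym R n) :
    (DirectSum.decompose (skewGrading R n) f m : OPol R n) ∈ OSym R n := by
  intro i hi
  cases m with
  | zero => exact divDiff_skewGrading_zero R n i hi _ (SetLike.coe_mem _)
  | succ m => rw [divDiff_component, hf i hi]; simp

instance : SetLike.GradedMonoid (oddSymGrading R n) where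
  one_mem := SetLike.GradedOne.one_mem (A := skewGrading R n)
  mul_mem _ _ _ _ hf hg := SetLike.GradedMul.mul_mem (A := skewGrading R n) hf hg

theorem oddSym_isInternal : DirectSum.IsInternal (oddSymGrading R n) := by
  classical
  let F : (⨁ m, oddSymGrading R n m) →+ ⨁ m, skewGrading R n m :=
    DirectSum.map (fun m => ((OSym R n).val.toLinearMap.restrict
      (p := oddSymGrading R n m) (q := skewGrading R n m) (fun _ h => h)).toAddMonoidHom)
  have hF : ∀ x, DirectSum.coeAddMonoidHom (skewGrading R n) (F x) =
      ((DirectSum.coeAddMonoidHom (oddSymGrading R n) x : OSym R n) : OPol R n) := by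
    intro x
    induction x using DirectSum.induction_on with
    | zero => simp
    | of m x =>
      rw [DirectSum.coeAddMonoidHom_of, DirectSum.map_of, DirectSum.coeAddMonoidHom_of]
      rfl
    | add x y hx hy => rw [map_add, map_add, map_add, hx, hy]; rfl
  constructor
  · intro x y hxy
    have h1 : F x = F y := by
      apply (DirectSum.Decomposition.isInternal (skewGrading R n)).1
      rw [hF, hF, hxy]
    ext m
    have h2 := congrArg (fun z => ((z m : skewGrading R n m) : OPol R n)) h1
    simp only [F, DirectSum.map_apply] at h2
    exact h2
  · intro f
    refine ⟨∑ m ∈ (DirectSum.decompose (skewGrading R n) (f : OPol R n)).support,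
      DirectSum.of (fun m => oddSymGrading R n m) m
        ⟨⟨_, component_mem_OSym R n m f f.2⟩,
          (DirectSum.decompose (skewGrading R n) (f : OPol R n) m).2⟩, ?_⟩
    rw [map_sum]
    simp only [DirectSum.coeAddMonoidHom_of]
    apply Subtype.ext
    rw [AddSubmonoidClass.coe_finsetSum]
    exact DirectSum.sum_support_decompose (skewGrading R n) (f : OPol R n)

instance : GradedAlgebra (oddSymGrading R n) where
  toDecomposition := (oddSym_isInternal R n).chooseDecomposition

/-- The signed variables `(-1)^(i-1) x_i` (for `i` counted from `1`). -/
def xTilde (i : Fin n) : OPol R n := (-1) ^ (i : ℕ) * xVar R n i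

/-- Sum over all length `r` sublists of a list of the ordered products of the entries. -/
def listEps {S : Type*} [Ring S] (l : List S) (r : ℕ) : S :=
  ((l.sublistsLen r).map List.prod).sum

/-- The odd elementary symmetric polynomial: the sum of all `x̃_{i_1} ⋯ x̃_{i_r}` with
`i_1 < ⋯ < i_r`, that is, over all length `r` sublists of `x̃_1, …, x̃_n`. -/
def epsPoly (r : ℕ) : OPol R n := listEps (List.ofFn (xTilde R n)) r

/-- The odd complete symmetric polynomial: the sum of all `x̃_{i_1} ⋯ x̃_{i_r}` with
`i_1 ≤ ⋯ ≤ i_r`, that is, of all `x̃_1^{a_1} ⋯ x̃_n^{a_n}` with `a_1 + ⋯ + a_n = r`. -/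
def hPoly (r : ℕ) : OPol R n :=
  ∑ a ∈ Finset.Nat.antidiagonalTuple n r, (List.ofFn fun i => xTilde R n i ^ a i).prod

theorem mk_listEps {S : Type*} [Ring S] (l : List S) :
    PowerSeries.mk (listEps l) = (l.map fun a => 1 + PowerSeries.C a * PowerSeries.X).prod := by
  induction l with
  | nil =>
    ext r
    cases r with
    | zero => simp [listEps]
    | succ r => simp [listEps, PowerSeries.coeff_one]
  | cons a l ih =>
    rw [List.map_cons, List.prod_cons, ← ih]
    ext r
    cases r with
    | zero => simp [listEps, add_mul, mul_assoc]
    | succ r =>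
      rw [add_mul, one_mul, map_add, mul_assoc, PowerSeries.coeff_C_mul,
        PowerSeries.coeff_succ_X_mul, PowerSeries.coeff_mk, PowerSeries.coeff_mk,
        PowerSeries.coeff_mk]
      simp [listEps, List.sublistsLen_succ_cons, List.sum_map_mul_left, Function.comp_def]

theorem mk_complete {S : Type*} [Ring S] (n : ℕ) (v : Fin n → S) :
    PowerSeries.mk (fun r => ∑ a ∈ Finset.Nat.antidiagonalTuple n r,
      (List.ofFn fun i => v i ^ a i).prod) =
      (List.ofFn fun i => PowerSeries.mk fun r => v i ^ r).prod := by
  induction n with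
  | zero =>
    ext r
    cases r with
    | zero => simp
    | succ r => simp [PowerSeries.coeff_one]
  | succ n ih =>
    rw [List.ofFn_succ, List.prod_cons, ← ih]
    ext r
    rw [PowerSeries.coeff_mul, PowerSeries.coeff_mk]
    have key : ∀ F : (Fin (n + 1) → ℕ) → S, ∑ a ∈ Finset.Nat.antidiagonalTuple (n + 1) r, F a =
        ∑ p ∈ Finset.HasAntidiagonal.antidiagonal r, ∑ a ∈ Finset.Nat.antidiagonalTuple n p.2,
          F (Fin.cons p.1 a) := by
      intro F
      have e1 : ∀ (k m : ℕ) (G : (Fin k → ℕ) → S), ∑ a ∈ Finset.Nat.antidiagonalTuple k m, G a =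
          ((List.Nat.antidiagonalTuple k m).map G).sum := by
        intro k m G
        rfl
      rw [e1, List.Nat.antidiagonalTuple, List.map_flatMap, List.flatMap_def, List.sum_flatten,
        List.map_map]
      simp only [e1, List.map_map, Function.comp_def]
      rfl
    rw [key]
    refine Finset.sum_congr rfl fun p _ => ?_
    rw [PowerSeries.coeff_mk, PowerSeries.coeff_mk, Finset.mul_sum]
    refine Finset.sum_congr rfl fun a _ => ?_
    rw [List.ofFn_succ, List.prod_cons]
    simp

/-- Power series whose coefficients are killed by one divided difference operator. -/
def constSeries (i : ℕ) (hi : i + 1 < n) : Submonoid (PowerSeries (OPol R n)) where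
  carrier := {F | ∀ r, divDiff R n i hi (PowerSeries.coeff r F) = 0}
  one_mem' := by
    intro r
    rw [PowerSeries.coeff_one]
    split_ifs
    · simpa using divDiff_algebraMap R n i hi 1
    · simp
  mul_mem' := by
    intro F G hF hG r
    rw [PowerSeries.coeff_mul, map_sum]
    refine Finset.sum_eq_zero fun p _ => ?_
    rw [divDiff_mul, hF, hG, zero_mul, mul_zero, add_zero]

theorem divDiff_xTilde (i : ℕ) (hi : i + 1 < n) (j : Fin n) :
    divDiff R n i hi (xTilde R n j) =
      (-1) ^ (j : ℕ) * if j.1 = i ∨ j.1 = i + 1 then 1 else 0 := by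
  unfold xTilde
  rcases neg_one_pow_eq_or (OPol R n) (j : ℕ) with h | h
  · rw [h, one_mul, one_mul, divDiff_X]
  · rw [h, neg_one_mul, neg_one_mul, map_neg, divDiff_X]

theorem prod_mem_constSeries (i : ℕ) (hi : i + 1 < n) (F : Fin n → PowerSeries (OPol R n))
    (hF : ∀ j : Fin n, j.1 ≠ i → j.1 ≠ i + 1 → F j ∈ constSeries R n i hi)
    (hF2 : F ⟨i, by omega⟩ * F ⟨i + 1, hi⟩ ∈ constSeries R n i hi) :
    (List.ofFn F).prod ∈ constSeries R n i hi := by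
  have hlen : (List.ofFn F).length = n := List.length_ofFn
  have hsplit : List.ofFn F = (List.ofFn F).take i ++
      (F ⟨i, by omega⟩ :: F ⟨i + 1, hi⟩ :: (List.ofFn F).drop (i + 2)) := by
    conv_lhs => rw [← List.take_append_drop i (List.ofFn F)]
    rw [List.drop_eq_getElem_cons (i := i) (by omega),
      List.drop_eq_getElem_cons (i := i + 1) (by omega)]
    simp
  rw [hsplit, List.prod_append, List.prod_cons, List.prod_cons, ← mul_assoc (F _)]
  refine mul_mem (Submonoid.list_prod_mem _ ?_) (mul_mem hF2 (Submonoid.list_prod_mem _ ?_))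
  · intro x hx
    obtain ⟨j, hj, rfl⟩ := List.mem_take_iff_getElem.mp hx
    rw [List.getElem_ofFn]
    exact hF _ (by simp; omega) (by simp; omega)
  · intro x hx
    obtain ⟨j, hj, rfl⟩ := List.mem_drop_iff_getElem.mp hx
    rw [List.getElem_ofFn]
    exact hF _ (by simp; omega) (by simp; omega)

theorem divDiff_xTilde_add (i : ℕ) (hi : i + 1 < n) :
    divDiff R n i hi (xTilde R n ⟨i, by omega⟩ + xTilde R n ⟨i + 1, hi⟩) = 0 := by
  rw [map_add, divDiff_xTilde, divDiff_xTilde]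
  simp [pow_succ]

theorem permAct_xTilde (i : ℕ) (hi : i + 1 < n) :
    permAct R n (simpleSwap i hi) (xTilde R n ⟨i, by omega⟩) = xTilde R n ⟨i + 1, hi⟩ ∧
    permAct R n (simpleSwap i hi) (xTilde R n ⟨i + 1, hi⟩) = xTilde R n ⟨i, by omega⟩ := by
  have e1 : simpleSwap i hi ⟨i, by omega⟩ = ⟨i + 1, hi⟩ := Equiv.swap_apply_left _ _
  have e2 : simpleSwap i hi ⟨i + 1, hi⟩ = ⟨i, by omega⟩ := Equiv.swap_apply_right _ _
  unfold xTilde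
  constructor
  · rw [map_mul, map_pow, map_neg, map_one, permAct_simpleSwap_X, e1]
    simp [pow_succ]
  · rw [map_mul, map_pow, map_neg, map_one, permAct_simpleSwap_X, e2]
    simp [pow_succ]

theorem divDiff_xTilde_mul (i : ℕ) (hi : i + 1 < n) :
    divDiff R n i hi (xTilde R n ⟨i, by omega⟩ * xTilde R n ⟨i + 1, hi⟩) = 0 ∧
    divDiff R n i hi (xTilde R n ⟨i + 1, hi⟩ * xTilde R n ⟨i, by omega⟩) = 0 := by
  obtain ⟨h1, h2⟩ := permAct_xTilde R n i hi
  rw [divDiff_mul, divDiff_mul, h1, h2, divDiff_xTilde, divDiff_xTilde]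
  rcases neg_one_pow_eq_or (OPol R n) i with h | h <;> simp [pow_succ, h]

theorem epsPoly_mem (r : ℕ) : epsPoly R n r ∈ OSym R n := by
  intro i hi
  have h : PowerSeries.mk (listEps (List.ofFn (xTilde R n))) ∈ constSeries R n i hi := by
    rw [mk_listEps, List.map_ofFn]
    apply prod_mem_constSeries
    · intro j h1 h2 r
      rcases r with _ | r
      · simpa using divDiff_algebraMap R n i hi 1
      · simp only [Function.comp_apply, map_add, PowerSeries.coeff_one, PowerSeries.coeff_C_mul,
          PowerSeries.coeff_X]
        rcases r with _ | r
        · simp [divDiff_xTilde, h1, h2]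
        · simp
    · intro r
      have e : ∀ a b : OPol R n, (1 + PowerSeries.C a * PowerSeries.X) *
          (1 + PowerSeries.C b * PowerSeries.X) = 1 + PowerSeries.C (a + b) * PowerSeries.X +
            PowerSeries.C (a * b) * PowerSeries.X ^ 2 := by
        intro a b
        have hx : PowerSeries.X * PowerSeries.C b = PowerSeries.C b * PowerSeries.X :=
          (PowerSeries.commute_X (PowerSeries.C b)).symm.eq
        rw [mul_add, mul_one, add_mul, one_mul, map_add, map_mul, add_mul, pow_two, mul_assoc,
          ← mul_assoc PowerSeries.X, hx]
        simp only [mul_assoc, add_assoc]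
      simp only [Function.comp_apply]
      rw [e, map_add, map_add, PowerSeries.coeff_C_mul, map_add, map_add]
      simp only [PowerSeries.coeff_one, PowerSeries.coeff_C_mul, PowerSeries.coeff_X,
        PowerSeries.coeff_X_pow]
      have := divDiff_algebraMap R n i hi 1
      rw [map_one] at this
      have h1 := divDiff_xTilde_add R n i hi
      have h2 := (divDiff_xTilde_mul R n i hi).1
      rw [map_add] at h1
      split_ifs <;> simp [this, h1, h2]
  simpa [epsPoly] using h r

theorem hPoly_mem (r : ℕ) : hPoly R n r ∈ OSym R n := by
  intro i hi
  have h : PowerSeries.mk (fun r => hPoly R n r) ∈ constSeries R n i hi := by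
    unfold hPoly
    rw [mk_complete]
    have hone : divDiff R n i hi 1 = 0 := by simpa using divDiff_algebraMap R n i hi 1
    apply prod_mem_constSeries
    · intro j h1 h2 r
      rw [PowerSeries.coeff_mk]
      induction r with
      | zero => simpa using hone
      | succ r ih => rw [pow_succ, divDiff_mul, ih, divDiff_xTilde]; simp [h1, h2]
    · set a := xTilde R n ⟨i, by omega⟩ with ha
      set b := xTilde R n ⟨i + 1, hi⟩ with hb
      set c : ℕ → OPol R n := fun r => PowerSeries.coeff r
        ((PowerSeries.mk fun r => a ^ r) * (PowerSeries.mk fun r => b ^ r)) with hc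
      have hc' : ∀ r, c r = ∑ p ∈ Finset.HasAntidiagonal.antidiagonal r, a ^ p.1 * b ^ p.2 := by
        intro r
        simp [hc, PowerSeries.coeff_mul]
      have s1 : ∀ r, c (r + 1) = a * c r + b ^ (r + 1) := by
        intro r
        rw [hc', hc', Finset.Nat.antidiagonal_succ, Finset.sum_cons, Finset.sum_map,
          Finset.mul_sum]
        simp [pow_succ', mul_assoc, add_comm]
      have rec2 : ∀ r, c (r + 2) = (a + b) * c (r + 1) - (b * a) * c r := by
        intro r
        have h1 := s1 (r + 1)
        have h2 := s1 r
        rw [h1, h2, pow_succ' b (r + 1)]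
        noncomm_ring
      have main : ∀ r, divDiff R n i hi (c r) = 0 ∧ divDiff R n i hi (c (r + 1)) = 0 := by
        intro r
        induction r with
        | zero =>
          refine ⟨by simpa [hc'] using hone, ?_⟩
          rw [s1]
          simpa [hc'] using divDiff_xTilde_add R n i hi
        | succ r ih =>
          refine ⟨ih.2, ?_⟩
          rw [rec2, map_sub, divDiff_mul, divDiff_mul, ih.1, ih.2, divDiff_xTilde_add,
            (divDiff_xTilde_mul R n i hi).2]
          simp
      exact fun r => (main r).1
  simpa using h r

/-- The odd elementary symmetric polynomials as elements of the algebra of odd symmetric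
polynomials. -/
def eps (r : ℕ) : OSym R n := ⟨epsPoly R n r, epsPoly_mem R n r⟩

/-- The odd complete symmetric polynomials as elements of the algebra of odd symmetric
polynomials. -/
def hSym (r : ℕ) : OSym R n := ⟨hPoly R n r, hPoly_mem R n r⟩

/-- The word `1 (2 1) (3 2 1) ⋯ (n-1 ⋯ 1)` of the longest permutation, with letters counted
from `0`. -/
def longestWord (n : ℕ) : List ℕ := (List.range n).flatMap fun m => (List.range m).reverse

/-- The operator `∂_{w_0} = ∂_1 (∂_2 ∂_1) ⋯ (∂_{n-1} ⋯ ∂_1)`; the rightmost operator is applied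
first. All letters of the word are valid indices, so that the default value is never used. -/
def divDiffLongest (f : OPol R n) : OPol R n :=
  (longestWord n).foldr (fun i g => if hi : i + 1 < n then divDiff R n i hi g else 0) f

/-- The odd Schur polynomial
`(-1)^(n choose 3) (∂_{w_0}(x_1^{λ_1} ⋯ x_n^{λ_n} x_1^{n-1} x_2^{n-2} ⋯ x_n^0))^{w_0}`. -/
def schurPoly (l : Fin n → ℕ) : OPol R n :=
  (-1) ^ n.choose 3 * permAct R n Fin.revPerm (divDiffLongest R n
    ((List.ofFn fun i => xVar R n i ^ l i).prod *
      (List.ofFn fun i : Fin n => xVar R n i ^ (n - 1 - (i : ℕ))).prod))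

/-- The odd Schur polynomial as an element of the algebra of odd symmetric polynomials. -/
def schur (l : Fin n → ℕ) (hl : schurPoly R n l ∈ OSym R n) : OSym R n := ⟨schurPoly R n l, hl⟩

/-- Partitions with at most `k` parts, all of size at most `m`. -/
def BoxPartition (k m : ℕ) : Type := {l : Fin k → Fin (m + 1) // Antitone l}

/-- The parts of a partition. -/
def BoxPartition.part {k m : ℕ} (l : BoxPartition k m) (i : Fin k) : ℕ := (l.1 i : ℕ)

/-- The size of a partition. -/
def BoxPartition.size {k m : ℕ} (l : BoxPartition k m) : ℕ := ∑ i, l.part i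

/-- The product `h_{λ_1} h_{λ_2} ⋯ h_{λ_k}`. -/
def hPart {k : ℕ} (l : Fin k → ℕ) : OSym R k := (List.ofFn fun i => hSym R k (l i)).prod

end OddSymmetric

section CoefficientAlgebra

variable (R : Type*) [CommRing R] (n : ℕ)

/-- The variable `χ_i` in a polynomial ring, with `χ_0 = 1`, and `χ_i = 0` for `i > ⌊n/2⌋`. -/
def chiPoly (i : ℕ) : MvPolynomial (Option (Fin (n / 2))) R :=
  if i = 0 then 1 else if hi : i - 1 < n / 2 then MvPolynomial.X (some ⟨i - 1, hi⟩) else 0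

/-- The variable `d` in a polynomial ring. -/
def dPoly : MvPolynomial (Option (Fin (n / 2))) R := MvPolynomial.X none

/-- The relations `d^2 = 0`, and `d χ_{n/2} = 0` if `n` is even. -/
def coeffIdeal : Ideal (MvPolynomial (Option (Fin (n / 2))) R) :=
  Ideal.span ({dPoly R n ^ 2} ∪ {p | Even n ∧ p = dPoly R n * chiPoly R n (n / 2)})

/-- The algebra `A_n` generated by `χ_1, …, χ_{⌊n/2⌋}` (even) and `d` (odd) with relations
`d^2 = 0` and `d χ_{n/2} = 0` if `n` is even. Since the `χ_i` are even and `d` is the only odd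
generator and has square zero, the supercommutative algebra with this presentation is the
commutative one. -/
def CoeffAlg : Type _ := MvPolynomial (Option (Fin (n / 2))) R ⧸ coeffIdeal R n

instance : CommRing (CoeffAlg R n) :=
  inferInstanceAs (CommRing (MvPolynomial (Option (Fin (n / 2))) R ⧸ coeffIdeal R n))

instance : Algebra R (CoeffAlg R n) :=
  inferInstanceAs (Algebra R (MvPolynomial (Option (Fin (n / 2))) R ⧸ coeffIdeal R n))

/-- The quotient map onto `A_n`. -/
def CoeffAlg.mk : MvPolynomial (Option (Fin (n / 2))) R →ₐ[R] CoeffAlg R n :=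
  Ideal.Quotient.mkₐ R (coeffIdeal R n)

/-- The weights of the generators: `1` for `d` and `2i` for `χ_i`. -/
def coeffWeight : Option (Fin (n / 2)) → ℕ
  | none => 1
  | some i => 2 * ((i : ℕ) + 1)

/-- The grading of `A_n` by weight. An element of weight `m` has `ℤ`-degree `2m` and parity `m`
modulo `2`. -/
def coeffGrading (m : ℕ) : Submodule R (CoeffAlg R n) :=
  (MvPolynomial.weightedHomogeneousSubmodule R (coeffWeight n) m).map
    (CoeffAlg.mk R n).toLinearMap

/-- The elements `c_i` of `A_n`: `χ_{i/2}` for `i` even and `d χ_{(i-1)/2}` for `i` odd. They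
vanish for `i > n`. -/
def cElt (i : ℕ) : CoeffAlg R n :=
  CoeffAlg.mk R n
    (if Even i then chiPoly R n (i / 2) else dPoly R n * chiPoly R n ((i - 1) / 2))

instance : SetLike.GradedMonoid (coeffGrading R n) where
  one_mem := ⟨1, MvPolynomial.isWeightedHomogeneous_one R _, rfl⟩
  mul_mem := by
    rintro i j _ _ ⟨p, hp, rfl⟩ ⟨q, hq, rfl⟩
    exact ⟨p * q, MvPolynomial.IsWeightedHomogeneous.mul hp hq, rfl⟩

attribute [local instance] MvPolynomial.weightedGradedAlgebra

theorem chiPoly_homogeneous (i : ℕ) :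
    (chiPoly R n i).IsWeightedHomogeneous (coeffWeight n) (2 * i) := by
  unfold chiPoly
  split_ifs with h1 h2
  · subst h1
    exact MvPolynomial.isWeightedHomogeneous_one R _
  · have h := MvPolynomial.isWeightedHomogeneous_X R (coeffWeight n) (some ⟨i - 1, h2⟩)
    have e : coeffWeight n (some ⟨i - 1, h2⟩) = 2 * i := by
      simp only [coeffWeight]
      omega
    rwa [e] at h
  · exact MvPolynomial.isWeightedHomogeneous_zero R _ _

theorem dPoly_homogeneous : (dPoly R n).IsWeightedHomogeneous (coeffWeight n) 1 :=
  MvPolynomial.isWeightedHomogeneous_X R (coeffWeight n) none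

/-- The map of direct sums induced by the quotient map. -/
def coeffSumMap : (⨁ m, MvPolynomial.weightedHomogeneousSubmodule R (coeffWeight n) m) →ₐ[R]
    ⨁ m, coeffGrading R n m :=
  DirectSum.toAlgebra R _
    (fun m => DirectSum.lof R ℕ (fun m => coeffGrading R n m) m ∘ₗ
      (CoeffAlg.mk R n).toLinearMap.restrict
        (p := MvPolynomial.weightedHomogeneousSubmodule R (coeffWeight n) m)
        (q := coeffGrading R n m) (fun p hp => ⟨p, hp, rfl⟩))
    rfl
    (fun {i j} p q => by
      simp only [LinearMap.comp_apply, DirectSum.lof_eq_of]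
      rw [DirectSum.of_mul_of]
      congr 1)

/-- The decomposition of polynomials into homogeneous components, followed by the quotient map. -/
def coeffPreDecompose : MvPolynomial (Option (Fin (n / 2))) R →ₐ[R] ⨁ m, coeffGrading R n m :=
  (coeffSumMap R n).comp (DirectSum.decomposeAlgEquiv
    (MvPolynomial.weightedHomogeneousSubmodule R (coeffWeight n))).toAlgHom

theorem coeffPreDecompose_mem (m : ℕ) (p : MvPolynomial (Option (Fin (n / 2))) R)
    (hp : p.IsWeightedHomogeneous (coeffWeight n) m) :
    coeffPreDecompose R n p = DirectSum.of (fun m => coeffGrading R n m) m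
      ⟨CoeffAlg.mk R n p, p, hp, rfl⟩ := by
  change coeffSumMap R n (DirectSum.decompose
    (MvPolynomial.weightedHomogeneousSubmodule R (coeffWeight n)) p) = _
  rw [DirectSum.decompose_of_mem _ hp]
  exact DirectSum.toAddMonoid_of _ _ _

/-- The decomposition of `A_n` into homogeneous components. -/
def coeffDecompose : CoeffAlg R n →ₐ[R] ⨁ m, coeffGrading R n m :=
  Ideal.Quotient.liftₐ (coeffIdeal R n) (coeffPreDecompose R n) (by
    have hz : ∀ m p, p.IsWeightedHomogeneous (coeffWeight n) m → p ∈ coeffIdeal R n →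
        coeffPreDecompose R n p = 0 := by
      intro m p hp hI
      rw [coeffPreDecompose_mem R n m p hp]
      convert map_zero (DirectSum.of (fun m => coeffGrading R n m) m)
      ext
      exact Ideal.Quotient.eq_zero_iff_mem.mpr hI
    intro p hp
    have hle : coeffIdeal R n ≤ RingHom.ker (coeffPreDecompose R n).toRingHom := by
      unfold coeffIdeal
      rw [Ideal.span_le]
      rintro q hq
      have hq' : q ∈ coeffIdeal R n := Ideal.subset_span hq
      rcases hq with hq | ⟨-, hq⟩
      · rw [Set.mem_singleton_iff] at hq
        subst hq
        exact hz _ _ ((dPoly_homogeneous R n).pow 2) hq'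
      · subst hq
        exact hz _ _ ((dPoly_homogeneous R n).mul (chiPoly_homogeneous R n _)) hq'
    exact hle hp)

instance : GradedAlgebra (coeffGrading R n) :=
  GradedAlgebra.ofAlgHom (coeffGrading R n) (coeffDecompose R n)
    (by
      apply Ideal.Quotient.algHom_ext
      apply MvPolynomial.algHom_ext
      intro i
      change DirectSum.coeAlgHom (coeffGrading R n) (coeffPreDecompose R n (MvPolynomial.X i)) = _
      rw [coeffPreDecompose_mem R n _ _ (MvPolynomial.isWeightedHomogeneous_X R (coeffWeight n) i),
        DirectSum.coeAlgHom_of]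
      rfl)
    (fun m x => by
      obtain ⟨_, p, hp, rfl⟩ := x
      exact coeffPreDecompose_mem R n m p hp)

end CoefficientAlgebra

section Grassmannian

variable (R : Type*) [CommRing R] (n k : ℕ)

/-- The super tensor product `OΛ_k ⊗ A_n`, with
`(f ⊗ a) (g ⊗ b) = (-1)^{|a||g|} fg ⊗ ab`. -/
abbrev OSymCoeff : Type _ := GradedTensorProduct R (oddSymGrading R k) (coeffGrading R n)

/-- The super tensor product `OΛ_k ⊗ OΛ_l`, with
`(f ⊗ s) (g ⊗ t) = (-1)^{|s||g|} fg ⊗ st`. -/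
abbrev OSymOSym (k l : ℕ) : Type _ :=
  GradedTensorProduct R (oddSymGrading R k) (oddSymGrading R l)

/-- The element `f ⊗ a` of `OΛ_k ⊗ A_n`. -/
def tmulCoeff (f : OSym R k) (a : CoeffAlg R n) : OSymCoeff R n k :=
  GradedTensorProduct.tmul R f a

/-- The element `f ⊗ s` of `OΛ_k ⊗ OΛ_l`. -/
def tmulOSym {k l : ℕ} (f : OSym R k) (s : OSym R l) : OSymOSym R k l :=
  GradedTensorProduct.tmul R f s

/-- The element `h'_m = ∑_r (-1)^r h_{m-r} ⊗ c_r` of `OΛ_k ⊗ A_n`. -/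
def hPrime (m : ℕ) : OSymCoeff R n k :=
  ∑ r ∈ Finset.range (m + 1), (-1 : R) ^ r • tmulCoeff R n k (hSym R k (m - r)) (cElt R n r)

/-- The relations `h'_m = 0` for `n - k + 1 ≤ m ≤ n`. -/
inductive GrassRel : OSymCoeff R n k → OSymCoeff R n k → Prop
  | of (m : ℕ) (h1 : n - k + 1 ≤ m) (h2 : m ≤ n) : GrassRel (hPrime R n k m) 0

/-- The odd equivariant Grassmannian cohomology superalgebra `M_k^n`, the quotient of
`OΛ_k ⊗ A_n` by the two-sided ideal generated by the `h'_m` with `n - k + 1 ≤ m ≤ n`. -/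
def GrassAlg : Type _ := RingQuot (GrassRel R n k)

instance : Ring (GrassAlg R n k) := inferInstanceAs (Ring (RingQuot (GrassRel R n k)))

instance : Algebra R (GrassAlg R n k) := inferInstanceAs (Algebra R (RingQuot (GrassRel R n k)))

/-- The quotient map from `OΛ_k ⊗ A_n` to `M_k^n`. -/
def GrassAlg.proj : OSymCoeff R n k →ₐ[R] GrassAlg R n k := RingQuot.mkAlgHom R (GrassRel R n k)

/-- The class of `f ⊗ a` in `M_k^n`. -/
def GrassAlg.mk (f : OSym R k) (a : CoeffAlg R n) : GrassAlg R n k :=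
  GrassAlg.proj R n k (tmulCoeff R n k f a)

/-- The map `a ↦ 1 ⊗ a` from `A_n` to `M_k^n`. -/
def GrassAlg.coeff : CoeffAlg R n →ₐ[R] GrassAlg R n k :=
  (GrassAlg.proj R n k).comp
    (GradedTensorProduct.includeRight (oddSymGrading R k) (coeffGrading R n))

/-- The (right) `A_n`-module structure of `M_k^n`, by right multiplication with `1 ⊗ a`. As `A_n`
is commutative, it is written on the left. -/
instance : Module (CoeffAlg R n) (GrassAlg R n k) where
  smul a x := x * GrassAlg.coeff R n k a
  one_smul x := by
    change x * GrassAlg.coeff R n k 1 = x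
    rw [map_one, mul_one]
  mul_smul a b x := by
    change x * GrassAlg.coeff R n k (a * b) =
      (x * GrassAlg.coeff R n k b) * GrassAlg.coeff R n k a
    rw [mul_comm a b, map_mul, mul_assoc]
  smul_zero a := zero_mul _
  smul_add a x y := add_mul _ _ _
  add_smul a b x := by
    change x * GrassAlg.coeff R n k (a + b) = _
    rw [map_add, mul_add]
    rfl
  zero_smul x := by
    change x * GrassAlg.coeff R n k 0 = 0
    rw [map_zero, mul_zero]

theorem GrassAlg.smul_def (a : CoeffAlg R n) (x : GrassAlg R n k) :
    a • x = x * GrassAlg.coeff R n k a := rfl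

/-- The elements of weight `m` of `M_k^n`; they have `ℤ`-degree `2m` and parity `m` modulo `2`. -/
def grassAlgGrading (m : ℕ) : Submodule R (GrassAlg R n k) :=
  Submodule.span R {x | ∃ i j, i + j = m ∧ ∃ f ∈ oddSymGrading R k i, ∃ a ∈ coeffGrading R n j,
    x = GrassAlg.mk R n k f a}

/-- An algebra homomorphism `ρ` from `OΛ_n` to `OΛ_k ⊗ OΛ_{n-k}` with
`ρ(ε_r) = ∑_j (-1)^{(r-j)j} ε_{r-j} ⊗ ε_j`. Right multiplication by `ρ(x)` is the twisted right
action of `OΛ_n` on `OΛ_k ⊗ OΛ_{n-k}`. -/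
def IsTwistedAction (ρ : OSym R n →ₐ[R] OSymOSym R k (n - k)) : Prop :=
  ∀ r, ρ (eps R n r) = ∑ j ∈ Finset.range (r + 1),
    (-1 : R) ^ ((r - j) * j) • tmulOSym R (eps R k (r - j)) (eps R (n - k) j)

/-- An algebra homomorphism `π` from `OΛ_n` to `A_n` with `π(ε_r) = (-1)^{r choose 2} c_r`. -/
def IsBarMap (π : OSym R n →ₐ[R] CoeffAlg R n) : Prop :=
  ∀ r, π (eps R n r) = (-1) ^ r.choose 2 * cElt R n r

variable {R n k}

/-- The relations `b ρ(x) ⊗ a = b ⊗ π(x) a` of a tensor product over `OΛ_n`. The factors of the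
underlying tensor product over `R` are written in the opposite order. -/
def balancedRel (ρ : OSym R n →ₐ[R] OSymOSym R k (n - k)) (π : OSym R n →ₐ[R] CoeffAlg R n) :
    Submodule (CoeffAlg R n) (CoeffAlg R n ⊗[R] OSymOSym R k (n - k)) :=
  Submodule.span (CoeffAlg R n) {t | ∃ (x : OSym R n) (b : OSymOSym R k (n - k))
    (a : CoeffAlg R n), t = a ⊗ₜ[R] (b * ρ x) - (π x * a) ⊗ₜ[R] b}

/-- The odd equivariant Grassmannian bimodule `(OΛ_k ⊗ OΛ_{n-k}) ⊗_{OΛ_n} A_n`, where `OΛ_n` acts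
on the right of `OΛ_k ⊗ OΛ_{n-k}` through `ρ` and on the left of `A_n` through `π`. -/
def GrassBimod (ρ : OSym R n →ₐ[R] OSymOSym R k (n - k))
    (π : OSym R n →ₐ[R] CoeffAlg R n) : Type _ :=
  (CoeffAlg R n ⊗[R] OSymOSym R k (n - k)) ⧸ balancedRel ρ π

instance (ρ : OSym R n →ₐ[R] OSymOSym R k (n - k)) (π : OSym R n →ₐ[R] CoeffAlg R n) :
    AddCommGroup (GrassBimod ρ π) :=
  inferInstanceAs (AddCommGroup ((CoeffAlg R n ⊗[R] OSymOSym R k (n - k)) ⧸ balancedRel ρ π))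

/-- The (right) `A_n`-module structure of the odd equivariant Grassmannian bimodule, by
multiplication on the factor `A_n`. -/
instance (ρ : OSym R n →ₐ[R] OSymOSym R k (n - k)) (π : OSym R n →ₐ[R] CoeffAlg R n) :
    Module (CoeffAlg R n) (GrassBimod ρ π) :=
  inferInstanceAs (Module (CoeffAlg R n)
    ((CoeffAlg R n ⊗[R] OSymOSym R k (n - k)) ⧸ balancedRel ρ π))

instance (ρ : OSym R n →ₐ[R] OSymOSym R k (n - k)) (π : OSym R n →ₐ[R] CoeffAlg R n) :
    Module R (GrassBimod ρ π) :=
  inferInstanceAs (Module R ((CoeffAlg R n ⊗[R] OSymOSym R k (n - k)) ⧸ balancedRel ρ π))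

instance (ρ : OSym R n →ₐ[R] OSymOSym R k (n - k)) (π : OSym R n →ₐ[R] CoeffAlg R n) :
    IsScalarTower R (CoeffAlg R n) (GrassBimod ρ π) :=
  inferInstanceAs (IsScalarTower R (CoeffAlg R n)
    ((CoeffAlg R n ⊗[R] OSymOSym R k (n - k)) ⧸ balancedRel ρ π))

/-- The quotient map onto the odd equivariant Grassmannian bimodule. -/
def GrassBimod.proj (ρ : OSym R n →ₐ[R] OSymOSym R k (n - k))
    (π : OSym R n →ₐ[R] CoeffAlg R n) :
    CoeffAlg R n ⊗[R] OSymOSym R k (n - k) →ₗ[CoeffAlg R n] GrassBimod ρ π :=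
  (balancedRel ρ π).mkQ

/-- The element `f ⊗ s ⊗ a` of the odd equivariant Grassmannian bimodule. -/
def GrassBimod.mk (ρ : OSym R n →ₐ[R] OSymOSym R k (n - k)) (π : OSym R n →ₐ[R] CoeffAlg R n)
    (f : OSym R k) (s : OSym R (n - k)) (a : CoeffAlg R n) : GrassBimod ρ π :=
  GrassBimod.proj ρ π (a ⊗ₜ[R] tmulOSym R f s)

/-- The elements of weight `m` of the odd equivariant Grassmannian bimodule; they have `ℤ`-degree
`2m` and parity `m` modulo `2`. -/
def grassBimodGrading (ρ : OSym R n →ₐ[R] OSymOSym R k (n - k))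
    (π : OSym R n →ₐ[R] CoeffAlg R n) (m : ℕ) : Submodule R (GrassBimod ρ π) :=
  Submodule.span R {x | ∃ i j l, i + j + l = m ∧ ∃ f ∈ oddSymGrading R k i,
    ∃ s ∈ oddSymGrading R (n - k) j, ∃ a ∈ coeffGrading R n l, x = GrassBimod.mk ρ π f s a}

end Grassmannian

section GradedRank

/-- The ring `ℤ[q, q⁻¹, π] / (π² - 1)`, as the group ring of `ℤ × ℤ/2`. -/
abbrev QPi : Type := AddMonoidAlgebra ℤ (ℤ × ZMod 2)

/-- The monomial `q^a π^b`. -/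
def qpMonomial (a : ℤ) (b : ZMod 2) : QPi := AddMonoidAlgebra.single (a, b) 1

theorem qpMonomial_mul (a b : ℤ) (s t : ZMod 2) :
    qpMonomial a s * qpMonomial b t = qpMonomial (a + b) (s + t) := by
  simp [qpMonomial, AddMonoidAlgebra.single_mul_single]

theorem qpMonomial_zero : qpMonomial 0 0 = 1 := rfl

/-- The `(q, π)`-integer `q^{n-1} + π q^{n-3} + ⋯ + π^{n-1} q^{1-n}`. -/
def qpInt (n : ℕ) : QPi := ∑ i ∈ Finset.range n, qpMonomial ((n : ℤ) - 1 - 2 * i) i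

/-- The `(q, π)`-factorial. -/
def qpFactorial : ℕ → QPi
  | 0 => 1
  | n + 1 => qpInt (n + 1) * qpFactorial n

/-- The `(q, π)`-binomial coefficient `[n]! / ([r]! [n-r]!)`, given by its Pascal recursion. The
quotient formula is `qpBinom_mul`. -/
def qpBinom : ℕ → ℕ → QPi
  | _, 0 => 1
  | 0, _ + 1 => 0
  | n + 1, r + 1 => qpMonomial ((n : ℤ) - r) 0 * qpBinom n r +
      qpMonomial (-((r : ℤ) + 1)) (r + 1) * qpBinom n (r + 1)

theorem qpInt_add (a b : ℕ) :
    qpInt (a + b) = qpMonomial b 0 * qpInt a + qpMonomial (-(a : ℤ)) a * qpInt b := by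
  unfold qpInt
  rw [Finset.sum_range_add, Finset.mul_sum, Finset.mul_sum]
  congr 1
  · refine Finset.sum_congr rfl fun i _ => ?_
    rw [qpMonomial_mul]
    congr 1
    · push_cast
      ring
    · simp
  · refine Finset.sum_congr rfl fun i _ => ?_
    rw [qpMonomial_mul]
    congr 1
    · push_cast
      ring
    · push_cast
      rfl

theorem qpBinom_of_lt (n : ℕ) : ∀ r, n < r → qpBinom n r = 0 := by
  induction n with
  | zero =>
    intro r hr
    obtain ⟨r, rfl⟩ := Nat.exists_eq_succ_of_ne_zero (by omega : r ≠ 0)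
    rfl
  | succ n ih =>
    intro r hr
    obtain ⟨r, rfl⟩ := Nat.exists_eq_succ_of_ne_zero (by omega : r ≠ 0)
    rw [qpBinom, ih r (by omega), ih (r + 1) (by omega)]
    simp

theorem qpBinom_mul (n : ℕ) : ∀ r, r ≤ n →
    qpBinom n r * (qpFactorial r * qpFactorial (n - r)) = qpFactorial n := by
  induction n with
  | zero =>
    intro r hr
    obtain rfl : r = 0 := by omega
    simp [qpBinom, qpFactorial]
  | succ n ih =>
    intro r hr
    cases r with
    | zero => simp [qpBinom, qpFactorial]
    | succ r =>
      have hrn : r ≤ n := by omega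
      have h1 := ih r hrn
      have e0 : n + 1 - (r + 1) = n - r := by omega
      rw [qpBinom, e0]
      have e1 : qpFactorial (r + 1) = qpInt (r + 1) * qpFactorial r := rfl
      have e2 : qpFactorial (n + 1) = qpInt (n + 1) * qpFactorial n := rfl
      have e3 : qpInt (n + 1) = qpMonomial ((n : ℤ) - r) 0 * qpInt (r + 1) +
          qpMonomial (-((r : ℤ) + 1)) (r + 1) * qpInt (n - r) := by
        have := qpInt_add (r + 1) (n - r)
        rw [show r + 1 + (n - r) = n + 1 by omega] at this
        rw [this]
        push_cast [hrn]
        rfl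
      rcases Nat.lt_or_ge r n with hlt | hge
      · have h2 := ih (r + 1) hlt
        obtain ⟨m, hm⟩ : ∃ m, n - r = m + 1 := ⟨n - r - 1, by omega⟩
        have e4 : n - (r + 1) = m := by omega
        have e5 : qpFactorial (m + 1) = qpInt (m + 1) * qpFactorial m := rfl
        rw [e4] at h2
        rw [hm] at h1 e3 ⊢
        calc _ = qpMonomial ((n : ℤ) - r) 0 * qpInt (r + 1) *
                (qpBinom n r * (qpFactorial r * qpFactorial (m + 1))) +
              qpMonomial (-((r : ℤ) + 1)) (r + 1) * qpInt (m + 1) *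
                (qpBinom n (r + 1) * (qpFactorial (r + 1) * qpFactorial m)) := by
                rw [e5, e1]; ring
          _ = _ := by rw [h1, h2, e2, e3]; ring
      · obtain rfl : r = n := by omega
        rw [qpBinom_of_lt r (r + 1) (by omega), mul_zero, add_zero, sub_self, qpMonomial_zero,
          one_mul, e1]
        calc _ = qpInt (r + 1) * (qpBinom r r * (qpFactorial r * qpFactorial (r - r))) := by ring
          _ = _ := by rw [h1]

/-- The module `M` over the algebra `A`, with homogeneous parts `𝒢 m` of weight `m` (that is, of
`ℤ`-degree `2m` and parity `m`), is a graded module over the graded algebra `A`. -/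
def IsGradedSupermodule {R A M : Type*} [CommRing R] [CommRing A] [Algebra R A] [AddCommGroup M]
    [Module R M] [Module A M] (𝒜 : ℕ → Submodule R A) (𝒢 : ℕ → Submodule R M) : Prop :=
  DirectSum.IsInternal 𝒢 ∧ ∀ i j, ∀ a ∈ 𝒜 i, ∀ x ∈ 𝒢 j, a • x ∈ 𝒢 (i + j)

/-- `M` is a free `A`-module with a finite homogeneous basis such that the sum of the monomials
`q^(ℤ-degree) π^(parity)` of the basis elements is `p`. -/
def HasGradedRank {R A M : Type*} [CommRing R] [CommRing A] [AddCommGroup M]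
    [Module R M] [Module A M] (𝒢 : ℕ → Submodule R M) (p : QPi) : Prop :=
  ∃ (ι : Type) (_ : Fintype ι) (b : Module.Basis ι A M) (deg : ι → ℕ),
    (∀ i, b i ∈ 𝒢 (deg i)) ∧ p = ∑ i, qpMonomial (2 * (deg i : ℤ)) (deg i : ZMod 2)

/-- The family `v` is a basis of the `A`-module `M`. -/
def IsBasis {ι M : Type*} (A : Type*) [CommRing A] [AddCommGroup M] [Module A M] (v : ι → M) :
    Prop :=
  ∃ b : Module.Basis ι A M, ⇑b = v

end GradedRank

end

end OddGrassmannian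

open OddGrassmannian

open scoped TensorProduct DirectSum

/-! The core fact is that `OΛ_k ⊗ OΛ_{n-k}` is a free right module over `OΛ_n`, acting through `ρ`,
with basis the `h_λ ⊗ 1` for `λ` in the `k × (n-k)` box. Base change along `π` makes `OH` free over
`A_n` on the same symbols (`GrassBimod.exists_basis`). On the other side the `h_λ ⊗ 1` span `M_k^n`,
because the relations `h'_m = 0` eliminate every `h_m` with `m > n-k`. Since `β` carries this
spanning family to a basis, `β` is bijective once it is well defined, and the bimodule structure of
`OH` is transported from `M_k^n`.

Freeness comes from spanning and counting: a homogeneous spanning family with as many members in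
each degree as a homogeneous basis is independent, because a surjective endomorphism of a finite
module over a commutative ring is injective (`linearIndependent_of_span_eq_top`). This is applied to
skew polynomials over `OΛ_n` (staircase monomials times products of `ε_r`), which also gives a basis
of `OΛ_n`, and to `OΛ_k ⊗ OΛ_{n-k}` over `OΛ_n`, where the count is a bijective form of the Pascal
recursion (`weightEquiv_box`).

The sequences `ε_r`, `h_r` and `h'_m` satisfy one system of quadratic relations, `OddSeq`. It is
stable under multiplying generating series by suitable linear or even factors, and it allows words
to be sorted. It yields a presentation of `OΛ_n` (`OSym.exists_lift`), hence `π`; the reduction to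
`h_λ` in the box (`hSym_reduce`); and the fact that the left ideal generated by the `h'_m`, `m >
n-k`, is two-sided (`hPrimeIdeal_isTwoSided`). The last point is what makes `β` well defined, as
`OH` is not a ring and only left multiples of the `h'_m` are easy to map to zero.

The map `ρ` arises by embedding `OΛ_k ⊗ OΛ_{n-k}` into skew polynomials in `n` variables, where
generating series factor into blocks. The factorisation gives `1 ⊗ H⁻¹ = (H ⊗ 1) ρ(H⁻¹)`; its
coefficients above `n-k` vanish, which both eliminates `h_m ⊗ 1` and shows that `h'_m` maps to zero
in `OH`.

For the Schur bases, `OΛ_k` is spanned by products of exactly `k` complete functions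
(`span_hSym_pow`). Modulo `ρ` each of these can be traded for an elementary function of the other
factor, and a Pieri rule (`span_eps_pow_le`) writes products of `b` elementary functions in terms of
`s_μ` with parts at most `b`. This gives spanning families of the right size. -/

namespace OddGrassmannian

noncomputable section

/-! ### Quadratic relations of odd symmetric functions, and sorting of words. -/

section OddSequences

/-- The quadratic relations satisfied by the odd elementary and the odd complete symmetric
polynomials, for a sequence indexed by integers and vanishing at negative integers. -/
structure OddSeq {S : Type*} [Ring S] (a : ℤ → S) : Prop where
  neg : ∀ r < 0, a r = 0
  comm : ∀ r s, Even (r + s) → a r * a s = a s * a r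
  evenOdd : ∀ r s, Even r → Odd s →
    a r * a s + a s * a r = a (s - 1) * a (r + 1) + a (r + 1) * a (s - 1)
  oddEven : ∀ r s, Odd r → Even s →
    a r * a s - a s * a r = a (s - 1) * a (r + 1) - a (r + 1) * a (s - 1)

variable {S : Type*} [Ring S]

theorem OddSeq.map {S' F : Type*} [Ring S'] [FunLike F S S'] [RingHomClass F S S'] {a : ℤ → S}
    (ha : OddSeq a) (φ : F) : OddSeq fun r => φ (a r) where
  neg r hr := by rw [ha.neg r hr, map_zero]
  comm r s h := by rw [← map_mul, ha.comm r s h, map_mul]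
  evenOdd r s hr hs := by simp only [← map_mul, ← map_add, ha.evenOdd r s hr hs]
  oddEven r s hr hs := by simp only [← map_mul, ← map_sub, ha.oddEven r s hr hs]

theorem OddSeq.of_map {S' F : Type*} [Ring S'] [FunLike F S S'] [RingHomClass F S S'] {a : ℤ → S}
    (φ : F) (hφ : Function.Injective φ) (ha : OddSeq fun r => φ (a r)) : OddSeq a where
  neg r hr := hφ (by rw [ha.neg r hr, map_zero])
  comm r s h := hφ (by simpa using ha.comm r s h)
  evenOdd r s hr hs := hφ (by simpa using ha.evenOdd r s hr hs)
  oddEven r s hr hs := hφ (by simpa using ha.oddEven r s hr hs)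

/-- For generating series this is left multiplication by `1 + yX`, with `y` an odd element
supercommuting with all `a r`. After moving `y` to the left, each relation becomes an identity in
`1`, `y`, `y * y` whose coefficients follow from relations of `a` at shifted indices. -/
theorem OddSeq.mul_linear {a : ℤ → S} (ha : OddSeq a) (y : S)
    (h0 : ∀ r, Even r → a r * y = y * a r) (h1 : ∀ r, Odd r → a r * y = -(y * a r)) :
    OddSeq fun r => a r + y * a (r - 1) := by
  -- The signs depend on the parity of the first index only, hence the two expansions `pe` and `po`.
  have pe : ∀ p q, Even p → (a p + y * a (p - 1)) * (a q + y * a (q - 1)) =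
      a p * a q + y * (a p * a (q - 1) + a (p - 1) * a q)
        - y * y * (a (p - 1) * a (q - 1)) := by
    intro p q hp
    have e0 := h0 p hp
    have e1 := h1 (p - 1) (hp.sub_odd odd_one)
    calc _ = a p * a q + (a p * y) * a (q - 1) + y * (a (p - 1) * a q)
          + y * (a (p - 1) * y) * a (q - 1) := by noncomm_ring
      _ = _ := by rw [e0, e1]; noncomm_ring
  have po : ∀ p q, Odd p → (a p + y * a (p - 1)) * (a q + y * a (q - 1)) =
      a p * a q + y * (- (a p * a (q - 1)) + a (p - 1) * a q)
        + y * y * (a (p - 1) * a (q - 1)) := by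
    intro p q hp
    have e0 := h1 p hp
    have e1 := h0 (p - 1) (hp.sub_odd odd_one)
    calc _ = a p * a q + (a p * y) * a (q - 1) + y * (a (p - 1) * a q)
          + y * (a (p - 1) * y) * a (q - 1) := by noncomm_ring
      _ = _ := by rw [e0, e1]; noncomm_ring
  refine ⟨fun r hr => ?_, fun r s h => ?_, fun r s hr hs => ?_, fun r s hr hs => ?_⟩
  · rw [ha.neg r hr, ha.neg _ (by omega)]; simp
  · rcases Int.even_or_odd r with hr | hr
    · have hs : Even s := by rwa [Int.even_add, iff_true_left hr] at h
      have k1 := ha.comm r s h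
      have k2 := ha.oddEven (r - 1) s (hr.sub_odd odd_one) hs
      have k3 := ha.comm (r - 1) (s - 1) ((hr.sub_odd odd_one).add_odd (hs.sub_odd odd_one))
      rw [sub_add_cancel] at k2
      -- The coefficient of `y` is symmetric in `r` and `s` by the mixed relation at `(r - 1, s)`.
      have k2' : a r * a (s - 1) + a (r - 1) * a s = a s * a (r - 1) + a (s - 1) * a r := by
        rw [sub_eq_sub_iff_add_eq_add] at k2
        rw [add_comm, k2, add_comm]
      rw [pe r s hr, pe s r hs, k1, k2', k3]
    · have hs : Odd s := by
        rw [Int.even_add] at h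
        rw [← Int.not_even_iff_odd] at hr ⊢
        tauto
      have k1 := ha.comm r s h
      have k2 := ha.evenOdd (r - 1) s (hr.sub_odd odd_one) hs
      have k3 := ha.comm (r - 1) (s - 1) ((hr.sub_odd odd_one).add (hs.sub_odd odd_one))
      rw [sub_add_cancel] at k2
      have k2' : -(a r * a (s - 1)) + a (r - 1) * a s = -(a s * a (r - 1)) + a (s - 1) * a r := by
        rw [neg_add_eq_sub, neg_add_eq_sub, sub_eq_sub_iff_add_eq_add, k2]
      rw [po r s hr, po s r hs, k1, k2', k3]
  · have e1 := pe r s hr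
    have e2 := po s r hs
    have e3 := pe (s - 1) (r + 1) (hs.sub_odd odd_one)
    have e4 := po (r + 1) (s - 1) (hr.add_one)
    have k1 := ha.evenOdd r s hr hs
    have k2 := ha.oddEven (r - 1) (s - 1) (hr.sub_odd odd_one) (hs.sub_odd odd_one)
    have k3 := ha.comm (r - 1) s ((hr.sub_odd odd_one).add_odd hs)
    have k4 := ha.comm r (s - 1) (hr.add (hs.sub_odd odd_one))
    have k5 := ha.comm (s - 1 - 1) (r + 1) (((hs.sub_odd odd_one).sub_odd odd_one).add_odd
      hr.add_one)
    simp only [add_sub_cancel_right, sub_add_cancel] at e1 e2 e3 e4 k1 k2 k3 k4 k5 ⊢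
    rw [e1, e2, e3, e4, k3, k4, k5]
    linear_combination (norm := noncomm_ring) k1 - y * y * k2
  · have e1 := po r s hr
    have e2 := pe s r hs
    have e3 := po (s - 1) (r + 1) (hs.sub_odd odd_one)
    have e4 := pe (r + 1) (s - 1) (hr.add_one)
    have k1 := ha.oddEven r s hr hs
    have k2 := ha.evenOdd (r - 1) (s - 1) (hr.sub_odd odd_one) (hs.sub_odd odd_one)
    have k3 := ha.comm (r - 1) s ((hr.sub_odd odd_one).add hs)
    have k4 := ha.comm r (s - 1) (hr.add_odd (hs.sub_odd odd_one))
    have k5 := ha.comm (s - 1 - 1) (r + 1) (((hs.sub_odd odd_one).sub_odd odd_one).add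
      hr.add_one)
    simp only [add_sub_cancel_right, sub_add_cancel] at e1 e2 e3 e4 k1 k2 k3 k4 k5 ⊢
    rw [e1, e2, e3, e4, k3, k4, k5]
    linear_combination (norm := noncomm_ring) k1 + y * y * k2

/-- For generating series this is multiplication by `∑ f j X^(2j)`. The relations are bilinear and
survive even shifts of either index, so they hold summand by summand once the `f j` commute with
everything in sight. Any `N` with `r < 2 * N` gives the same sum, as `a` vanishes at negative
indices. -/
theorem OddSeq.mul_even {a c : ℤ → S} (ha : OddSeq a) (f : ℕ → S)
    (hf : ∀ i j, f i * f j = f j * f i) (hfa : ∀ i r, a r * f i = f i * a r)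
    (hc : ∀ (r : ℤ) (N : ℕ), r < 2 * N →
      c r = ∑ j ∈ Finset.range N, f j * a (r - 2 * j)) : OddSeq c := by
  have prod : ∀ (N : ℕ) (p q : ℤ), p < 2 * N → q < 2 * N → c p * c q =
      ∑ i ∈ Finset.range N, ∑ j ∈ Finset.range N, f i * f j * (a (p - 2 * i) * a (q - 2 * j)) := by
    intro N p q hp hq
    rw [hc p N hp, hc q N hq, Finset.sum_mul_sum]
    refine Finset.sum_congr rfl fun i _ => Finset.sum_congr rfl fun j _ => ?_
    rw [mul_assoc, ← mul_assoc (a _), hfa, mul_assoc, mul_assoc]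
  have prod' : ∀ (N : ℕ) (p q : ℤ), p < 2 * N → q < 2 * N → c q * c p =
      ∑ i ∈ Finset.range N, ∑ j ∈ Finset.range N, f i * f j * (a (q - 2 * j) * a (p - 2 * i)) := by
    intro N p q hp hq
    rw [prod N q p hq hp, Finset.sum_comm]
    refine Finset.sum_congr rfl fun i _ => Finset.sum_congr rfl fun j _ => ?_
    rw [hf]
  have par : ∀ (r : ℤ) (i : ℕ), (Even (r - 2 * i) ↔ Even r) ∧ (Odd (r - 2 * i) ↔ Odd r) := by
    intro r i
    constructor <;> simp [Int.even_sub, Int.odd_sub]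
  refine ⟨fun r hr => ?_, fun r s h => ?_, fun r s hr hs => ?_, fun r s hr hs => ?_⟩
  · simpa using hc r 0 (by simpa using hr)
  all_goals
    obtain ⟨N, hN⟩ : ∃ N : ℕ, r + 1 < 2 * N ∧ s + 1 < 2 * N :=
      ⟨r.toNat + s.toNat + 2, by omega, by omega⟩
  · rw [prod N r s (by omega) (by omega), prod' N r s (by omega) (by omega)]
    refine Finset.sum_congr rfl fun i _ => Finset.sum_congr rfl fun j _ => ?_
    rw [ha.comm]
    rw [Int.even_add] at h ⊢
    rw [(par r i).1, (par s j).1, h]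
  · rw [prod N r s (by omega) (by omega), prod' N r s (by omega) (by omega),
      prod' N (r + 1) (s - 1) (by omega) (by omega), prod N (r + 1) (s - 1) (by omega) (by omega)]
    simp only [← Finset.sum_add_distrib, ← mul_add]
    refine Finset.sum_congr rfl fun i _ => Finset.sum_congr rfl fun j _ => ?_
    have := ha.evenOdd (r - 2 * i) (s - 2 * j) ((par r i).1.2 hr) ((par s j).2.2 hs)
    rw [this, show s - 1 - 2 * (j : ℤ) = s - 2 * j - 1 by ring,
      show r + 1 - 2 * (i : ℤ) = r - 2 * i + 1 by ring]
  · rw [prod N r s (by omega) (by omega), prod' N r s (by omega) (by omega),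
      prod' N (r + 1) (s - 1) (by omega) (by omega), prod N (r + 1) (s - 1) (by omega) (by omega)]
    simp only [← Finset.sum_sub_distrib, ← mul_sub]
    refine Finset.sum_congr rfl fun i _ => Finset.sum_congr rfl fun j _ => ?_
    have := ha.oddEven (r - 2 * i) (s - 2 * j) ((par r i).2.2 hr) ((par s j).1.2 hs)
    rw [this, show s - 1 - 2 * (j : ℤ) = s - 2 * j - 1 by ring,
      show r + 1 - 2 * (i : ℤ) = r - 2 * i + 1 by ring]

variable {R : Type*} [CommRing R] [Algebra R S]

-- Exchanging `a (r + 1)` and `a s` costs only terms in `a r` and `a (s + 1)`: the indices move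
-- apart. The induction on the smaller index ends at `a 0`, which commutes with every `a s`.
variable (R) in
theorem OddSeq.mul_mem_span_outer {a : ℤ → S} (ha : OddSeq a) (r : ℕ) : ∀ s : ℕ, r < s →
    a r * a s ∈ Submodule.span R {x | ∃ r' s' : ℕ, s ≤ s' ∧ r' + s' = r + s ∧ x = a s' * a r'} ∧
    a s * a r ∈ Submodule.span R {x | ∃ r' s' : ℕ, s ≤ s' ∧ r' + s' = r + s ∧ x = a r' * a s'} := by
  induction r with
  | zero =>
    intro s hs
    have h : a (0 : ℕ) * a s = a s * a (0 : ℕ) := by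
      rcases Int.even_or_odd (s : ℤ) with h | h
      · exact ha.comm _ _ (by simpa using h)
      -- The left side vanishes because `a (-1) = 0`; what remains is the commutation of `a 0` with
      -- `a s`.
      · have := ha.oddEven (-1) (s + 1) (by decide) h.add_one
        rw [ha.neg (-1) (by omega)] at this
        simp only [zero_mul, mul_zero, sub_self, add_sub_cancel_right] at this
        simpa using (sub_eq_zero.mp this.symm).symm
    have m1 : a s * a (0 : ℕ) ∈ Submodule.span R {x | ∃ r' s' : ℕ, s ≤ s' ∧ r' + s' = 0 + s ∧
        x = a s' * a r'} := Submodule.subset_span ⟨0, s, le_rfl, rfl, rfl⟩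
    have m2 : a (0 : ℕ) * a s ∈ Submodule.span R {x | ∃ r' s' : ℕ, s ≤ s' ∧ r' + s' = 0 + s ∧
        x = a r' * a s'} := Submodule.subset_span ⟨0, s, le_rfl, rfl, rfl⟩
    exact ⟨by rw [h]; exact m1, by rw [← h]; exact m2⟩
  | succ r ih =>
    intro s hs
    obtain ⟨i1, i2⟩ := ih (s + 1) (by omega)
    have mono1 : Submodule.span R {x | ∃ r' s' : ℕ, s + 1 ≤ s' ∧ r' + s' = r + (s + 1) ∧
        x = a s' * a r'} ≤ Submodule.span R {x | ∃ r' s' : ℕ, s ≤ s' ∧ r' + s' = r + 1 + s ∧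
        x = a s' * a r'} := Submodule.span_mono (by
      rintro x ⟨r', s', h1, h2, h3⟩
      exact ⟨r', s', by omega, by omega, h3⟩)
    have mono2 : Submodule.span R {x | ∃ r' s' : ℕ, s + 1 ≤ s' ∧ r' + s' = r + (s + 1) ∧
        x = a r' * a s'} ≤ Submodule.span R {x | ∃ r' s' : ℕ, s ≤ s' ∧ r' + s' = r + 1 + s ∧
        x = a r' * a s'} := Submodule.span_mono (by
      rintro x ⟨r', s', h1, h2, h3⟩
      exact ⟨r', s', by omega, by omega, h3⟩)
    have n1 : a s * a (r + 1 : ℕ) ∈ Submodule.span R {x | ∃ r' s' : ℕ, s ≤ s' ∧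
        r' + s' = r + 1 + s ∧ x = a s' * a r'} :=
      Submodule.subset_span ⟨r + 1, s, le_rfl, rfl, rfl⟩
    have n2 : a (r + 1 : ℕ) * a s ∈ Submodule.span R {x | ∃ r' s' : ℕ, s ≤ s' ∧
        r' + s' = r + 1 + s ∧ x = a r' * a s'} :=
      Submodule.subset_span ⟨r + 1, s, le_rfl, rfl, rfl⟩
    have p1 : a (s + 1 : ℕ) * a r ∈ Submodule.span R {x | ∃ r' s' : ℕ, s ≤ s' ∧
        r' + s' = r + 1 + s ∧ x = a s' * a r'} :=
      Submodule.subset_span ⟨r, s + 1, by omega, by omega, rfl⟩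
    have p2 : a r * a (s + 1 : ℕ) ∈ Submodule.span R {x | ∃ r' s' : ℕ, s ≤ s' ∧
        r' + s' = r + 1 + s ∧ x = a r' * a s'} :=
      Submodule.subset_span ⟨r, s + 1, by omega, by omega, rfl⟩
    have q1 := mono1 i1
    have q2 := mono2 i2
    rcases Int.even_or_odd (r + 1 : ℤ) with hr | hr <;> rcases Int.even_or_odd (s : ℤ) with h | h
    · have k := ha.comm (r + 1 : ℕ) s (by push_cast; exact hr.add h)
      exact ⟨by rw [k]; exact n1, by rw [← k]; exact n2⟩
    · have k := ha.oddEven r (s + 1 : ℕ) (by simpa using hr.sub_odd odd_one)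
        (by push_cast; exact h.add_one)
      have e : a (r + 1 : ℕ) * a s =
          a s * a (r + 1 : ℕ) + a (s + 1 : ℕ) * a r - a r * a (s + 1 : ℕ) := by
        push_cast at k ⊢
        rw [add_sub_cancel_right] at k
        linear_combination (norm := noncomm_ring) k
      have e' : a s * a (r + 1 : ℕ) =
          a (r + 1 : ℕ) * a s - a (s + 1 : ℕ) * a r + a r * a (s + 1 : ℕ) := by
        rw [e]; noncomm_ring
      exact ⟨by rw [e]; exact sub_mem (add_mem n1 p1) q1,
        by rw [e']; exact add_mem (sub_mem n2 q2) p2⟩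
    · have k := ha.evenOdd r (s + 1 : ℕ) (by simpa using hr.sub_odd odd_one)
        (by push_cast; exact h.add_one)
      have e : a (r + 1 : ℕ) * a s =
          - (a s * a (r + 1 : ℕ)) + a (s + 1 : ℕ) * a r + a r * a (s + 1 : ℕ) := by
        push_cast at k ⊢
        rw [add_sub_cancel_right] at k
        linear_combination (norm := noncomm_ring) -k
      have e' : a s * a (r + 1 : ℕ) =
          - (a (r + 1 : ℕ) * a s) + a (s + 1 : ℕ) * a r + a r * a (s + 1 : ℕ) := by
        rw [e]; abel
      exact ⟨by rw [e]; exact add_mem (add_mem (neg_mem n1) p1) q1,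
        by rw [e']; exact add_mem (add_mem (neg_mem n2) q2) p2⟩
    · have k := ha.comm (r + 1 : ℕ) s (by push_cast; exact hr.add_odd h)
      exact ⟨by rw [k]; exact n1, by rw [← k]; exact n2⟩

/-- The product of the entries of a sequence with indices in a given word. -/
def wordProd (a : ℤ → S) (w : List ℕ) : S := (w.map fun r : ℕ => a r).prod

@[simp]
theorem wordProd_nil (a : ℤ → S) : wordProd a [] = 1 := rfl

@[simp]
theorem wordProd_cons (a : ℤ → S) (r : ℕ) (w : List ℕ) :
    wordProd a (r :: w) = a r * wordProd a w := by simp [wordProd]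

@[simp]
theorem wordProd_append (a : ℤ → S) (v w : List ℕ) :
    wordProd a (v ++ w) = wordProd a v * wordProd a w := by simp [wordProd]

variable (R) in
/-- The span of the products over words of length `p` and weight `d` with a given property. -/
def wordSpan (a : ℤ → S) (p d : ℕ) (P : List ℕ → Prop) : Submodule R S :=
  Submodule.span R {x | ∃ w : List ℕ, w.length = p ∧ w.sum = d ∧ P w ∧ x = wordProd a w}

theorem mul_wordSpan {a : ℤ → S} {p d : ℕ} {P : List ℕ → Prop} {N : Submodule R S} (x : S)
    (h : ∀ w : List ℕ, w.length = p → w.sum = d → P w → x * wordProd a w ∈ N) :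
    ∀ y ∈ wordSpan R a p d P, x * y ∈ N := by
  intro y hy
  have : wordSpan R a p d P ≤ N.comap (LinearMap.mulLeft R x) := by
    unfold wordSpan
    rw [Submodule.span_le]
    rintro _ ⟨w, h1, h2, h3, rfl⟩
    exact h w h1 h2 h3
  exact this hy

-- Insertion sort. If the first letter `r` is smaller than the head `s` of the sorted tail, the
-- exchange brings some `s' ≥ s` to the front and leaves a tail of strictly smaller weight, which is
-- the measure of the inner induction.
variable (R) in
theorem OddSeq.wordProd_mem_sorted {a : ℤ → S} (ha : OddSeq a) (p : ℕ) :
    ∀ w : List ℕ, w.length = p →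
      wordProd a w ∈ wordSpan R a p w.sum (List.Pairwise (· ≥ ·)) := by
  induction p with
  | zero =>
    intro w hw
    obtain rfl := List.length_eq_zero_iff.mp hw
    exact Submodule.subset_span ⟨[], rfl, rfl, List.Pairwise.nil, rfl⟩
  | succ p ih =>
    suffices h : ∀ d r : ℕ, ∀ w : List ℕ, w.length = p → w.sum = d →
        a r * wordProd a w ∈ wordSpan R a (p + 1) (r + d) (List.Pairwise (· ≥ ·)) by
      intro w hw
      obtain ⟨r, w, rfl⟩ := List.exists_cons_of_length_eq_add_one hw
      rw [wordProd_cons]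
      exact h _ _ w (by simpa using hw) rfl
    intro d
    induction d using Nat.strong_induction_on with
    | _ d ihd =>
      intro r w hw hd
      have hs := ih w hw
      rw [hd] at hs
      refine mul_wordSpan (a r) ?_ _ hs
      intro w hw hd hsort
      cases w with
      | nil =>
        refine Submodule.subset_span ⟨[r], ?_, ?_, by simp, by simp⟩
        · simpa [eq_comm] using hw
        · simpa [eq_comm] using hd
      | cons s w =>
        by_cases hrs : s ≤ r
        · refine Submodule.subset_span ⟨r :: s :: w, by simpa using hw, by simpa using hd, ?_,
            by simp⟩
          rw [List.pairwise_cons] at hsort ⊢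
          refine ⟨?_, List.pairwise_cons.2 hsort⟩
          intro t ht
          rcases List.mem_cons.mp ht with rfl | ht
          · exact hrs
          · exact (hsort.1 t ht).trans hrs
        · have h2 := (ha.mul_mem_span_outer R r s (by omega)).1
          rw [wordProd_cons, ← mul_assoc]
          have : Submodule.span R {x | ∃ r' s' : ℕ, s ≤ s' ∧ r' + s' = r + s ∧
              x = a s' * a r'} ≤ (wordSpan R a (p + 1) (r + d) (List.Pairwise (· ≥ ·))).comap
                (LinearMap.mulRight R (wordProd a w)) := by
            rw [Submodule.span_le]
            rintro _ ⟨r', s', h3, h4, rfl⟩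
            change a s' * a r' * wordProd a w ∈
              wordSpan R a (p + 1) (r + d) (List.Pairwise (· ≥ ·))
            rw [mul_assoc, ← wordProd_cons]
            simp only [List.length_cons, List.sum_cons] at hw hd
            have := ihd (r' + w.sum) (by omega) s' (r' :: w) (by simpa using hw) (by simp)
            rwa [show s' + (r' + w.sum) = r + d by omega] at this
          exact this h2

-- Meant for moving an oversized letter to the end of a word, where it can be eliminated behind an
-- arbitrary prefix. A next letter `s ≥ m` takes over the role of `m`; a smaller one is passed by
-- the second exchange, which keeps the right index at least `m`.
variable (R) in
theorem OddSeq.wordProd_mem_last {a : ℤ → S} (ha : OddSeq a) (w : List ℕ) :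
    ∀ m : ℕ, a m * wordProd a w ∈ wordSpan R a (w.length + 1) (m + w.sum)
      (fun v => ∃ u l, v = u ++ [l] ∧ m ≤ l) := by
  induction w with
  | nil =>
    intro m
    exact Submodule.subset_span ⟨[m], rfl, by simp, ⟨[], m, rfl, le_rfl⟩, by simp⟩
  | cons s w ih =>
    intro m
    have step : ∀ r l : ℕ, m ≤ l → r + l = m + s → a r * a l * wordProd a w ∈
        wordSpan R a ((s :: w).length + 1) (m + (s :: w).sum)
          (fun v => ∃ u l, v = u ++ [l] ∧ m ≤ l) := by
      intro r l hl hrl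
      rw [mul_assoc]
      refine mul_wordSpan (a r) ?_ _ (ih l)
      rintro v hv1 hv2 ⟨u, t, rfl, ht⟩
      refine Submodule.subset_span ⟨r :: (u ++ [t]), ?_, ?_, ⟨r :: u, t, rfl, by omega⟩, by simp⟩
      · simp only [List.length_cons] at hv1 ⊢; omega
      · simp only [List.sum_cons] at hv2 ⊢; omega
    rw [wordProd_cons, ← mul_assoc]
    by_cases h : m ≤ s
    · exact step m s h rfl
    · have h2 := (ha.mul_mem_span_outer R s m (by omega)).2
      have : Submodule.span R {x | ∃ r' s' : ℕ, m ≤ s' ∧ r' + s' = s + m ∧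
          x = a r' * a s'} ≤ (wordSpan R a ((s :: w).length + 1) (m + (s :: w).sum)
            (fun v => ∃ u l, v = u ++ [l] ∧ m ≤ l)).comap
              (LinearMap.mulRight R (wordProd a w)) := by
        rw [Submodule.span_le]
        rintro _ ⟨r', s', h3, h4, rfl⟩
        exact step r' s' h3 (by omega)
      exact this h2

/-- Words of length `p` can be reduced to decreasing words with entries at most `b` modulo a
submodule which allows to eliminate larger entries at the end of a word. -/
theorem OddSeq.wordProd_reduce {a : ℤ → S} (ha : OddSeq a) {M : Type*} [AddCommGroup M]
    [Module R M] (Φ : S →ₗ[R] M) (N : Submodule R M) (p b : ℕ)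
    (h1 : ∀ w : List ℕ, w.length = p → w.Pairwise (· ≥ ·) → (∀ r ∈ w, r ≤ b) →
      Φ (wordProd a w) ∈ N)
    (h2 : ∀ (g : S) (m : ℕ), b < m → (∀ r : ℕ, 1 ≤ r → Φ (g * a (m - r)) ∈ N) →
      Φ (g * a m) ∈ N) :
    ∀ w : List ℕ, w.length = p → Φ (wordProd a w) ∈ N := by
  -- Induction on the weight: eliminating the last letter by `h2` produces words with a smaller last
  -- letter.
  suffices h : ∀ d : ℕ, ∀ w : List ℕ, w.length = p → w.sum = d → Φ (wordProd a w) ∈ N from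
    fun w hw => h _ w hw rfl
  intro d
  induction d using Nat.strong_induction_on with
  | _ d ih =>
    have hspan : ∀ P : List ℕ → Prop, (∀ w : List ℕ, w.length = p → w.sum = d → P w →
        Φ (wordProd a w) ∈ N) → wordSpan R a p d P ≤ N.comap Φ := by
      intro P hP
      unfold wordSpan
      rw [Submodule.span_le]
      rintro _ ⟨w, e1, e2, e3, rfl⟩
      exact hP w e1 e2 e3
    have hlast : ∀ w : List ℕ, w.length = p → w.sum = d → (∃ u l, w = u ++ [l] ∧ b + 1 ≤ l) →
        Φ (wordProd a w) ∈ N := by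
      rintro _ hw hd ⟨u, l, rfl, hl⟩
      simp only [List.length_append, List.length_singleton, List.sum_append,
        List.sum_singleton] at hw hd
      rw [wordProd_append]
      simp only [wordProd_cons, wordProd_nil, mul_one]
      refine h2 _ l (by omega) fun r hr => ?_
      by_cases hrl : r ≤ l
      · have := ih (u.sum + (l - r)) (by omega) (u ++ [l - r]) (by simpa using hw) (by simp)
        rw [wordProd_append] at this
        simpa [Nat.cast_sub hrl] using this
      · rw [ha.neg _ (by omega)]
        simp
    intro w hw hd
    have hw' := ha.wordProd_mem_sorted R p w hw
    rw [hd] at hw'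
    refine hspan _ ?_ hw'
    clear hw' hd hw w
    intro w hw hd hsort
    by_cases hb : ∀ r ∈ w, r ≤ b
    · exact h1 w hw hsort hb
    · push Not at hb
      obtain ⟨r, hr, hrb⟩ := hb
      cases w with
      | nil => simp at hr
      | cons m w =>
        -- The head of a decreasing word is its largest letter, so it is the one to be sent to the
        -- end.
        have hm : b < m := by
          rcases List.mem_cons.mp hr with rfl | hr
          · exact hrb
          · exact hrb.trans_le ((List.pairwise_cons.mp hsort).1 r hr)
        have := ha.wordProd_mem_last R w m
        rw [← wordProd_cons] at this
        simp only [List.length_cons, List.sum_cons] at hw hd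
        rw [hw, hd] at this
        refine hspan _ ?_ this
        rintro v e1 e2 ⟨u, l, e3, e4⟩
        exact hlast v e1 e2 ⟨u, l, e3, by omega⟩

end OddSequences

/-! ### Equality and commutation up to sign; monomials in anticommuting elements. -/

section Signs

variable {S : Type*} [Ring S]

/-- Equality up to sign. -/
def SignEq (x y : S) : Prop := x = y ∨ x = -y

theorem SignEq.refl (x : S) : SignEq x x := Or.inl rfl

theorem SignEq.symm {x y : S} (h : SignEq x y) : SignEq y x := by
  rcases h with rfl | rfl
  · exact Or.inl rfl
  · exact Or.inr (neg_neg _).symm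

theorem SignEq.trans {x y z : S} (h : SignEq x y) (h' : SignEq y z) : SignEq x z := by
  rcases h with rfl | rfl <;> rcases h' with rfl | rfl <;> simp [SignEq]

theorem SignEq.mul {x y z w : S} (h : SignEq x y) (h' : SignEq z w) : SignEq (x * z) (y * w) := by
  rcases h with rfl | rfl <;> rcases h' with rfl | rfl <;> simp [SignEq]

theorem SignEq.map {S' F : Type*} [Ring S'] [FunLike F S S'] [AddMonoidHomClass F S S'] {x y : S}
    (h : SignEq x y) (φ : F) : SignEq (φ x) (φ y) := by
  rcases h with rfl | rfl
  · exact Or.inl rfl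
  · exact Or.inr (map_neg _ _)

/-- Submodules do not see signs, so the spanning arguments can work with `SignEq` instead of exact
signs. -/
theorem SignEq.mem_iff {T : Type*} [SetLike T S] [NegMemClass T S] {x y : S} (h : SignEq x y)
    (N : T) : x ∈ N ↔ y ∈ N := by
  rcases h with rfl | rfl
  · rfl
  · exact neg_mem_iff

theorem signEq_neg_one_pow_mul (m : ℕ) (x : S) : SignEq ((-1) ^ m * x) x := by
  rcases neg_one_pow_eq_or S m with h | h <;> simp [h, SignEq]

/-- Commutation up to sign. -/
def SignComm (x y : S) : Prop := SignEq (x * y) (y * x)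

theorem SignComm.symm {x y : S} (h : SignComm x y) : SignComm y x := SignEq.symm h

theorem SignComm.mul_right {x y z : S} (h : SignComm x y) (h' : SignComm x z) :
    SignComm x (y * z) := by
  have h1 := h.mul (SignEq.refl z)
  have h2 := (SignEq.refl y).mul h'
  rw [mul_assoc, mul_assoc] at h1
  rw [← mul_assoc y z x] at h2
  exact h1.trans h2

theorem SignComm.one_right (x : S) : SignComm x 1 := Or.inl (by simp)

theorem SignComm.pow_right {x y : S} (h : SignComm x y) (m : ℕ) : SignComm x (y ^ m) := by
  induction m with
  | zero => simpa using SignComm.one_right x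
  | succ m ih => rw [pow_succ]; exact ih.mul_right h

theorem SignComm.pow_left {x y : S} (h : SignComm x y) (m : ℕ) : SignComm (x ^ m) y :=
  (h.symm.pow_right m).symm

theorem SignComm.list_prod_right {x : S} (l : List S) (h : ∀ y ∈ l, SignComm x y) :
    SignComm x l.prod := by
  induction l with
  | nil => simpa using SignComm.one_right x
  | cons a l ih =>
    rw [List.prod_cons]
    exact (h a (by simp)).mul_right (ih fun y hy => h y (by simp [hy]))

/-- The monomial with given exponents in a family of elements of a ring. -/
def mon {n : ℕ} (v : Fin n → S) (b : Fin n → ℕ) : S := (List.ofFn fun i => v i ^ b i).prod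

@[simp]
theorem mon_zero_vars (v : Fin 0 → S) (b : Fin 0 → ℕ) : mon v b = 1 := by simp [mon]

theorem mon_succ {n : ℕ} (v : Fin (n + 1) → S) (b : Fin (n + 1) → ℕ) :
    mon v b = v 0 ^ b 0 * mon (fun i => v i.succ) (fun i => b i.succ) := by
  simp [mon, List.ofFn_succ]

theorem mon_zero {n : ℕ} (v : Fin n → S) : mon v (fun _ => 0) = 1 := by
  simp [mon, List.ofFn_const]

theorem map_mon {S' F : Type*} [Ring S'] [FunLike F S S'] [RingHomClass F S S'] (φ : F) {n : ℕ}
    (v : Fin n → S) (b : Fin n → ℕ) : φ (mon v b) = mon (fun i => φ (v i)) b := by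
  rw [mon, map_list_prod, List.map_ofFn]
  simp [mon, Function.comp_def]

theorem signComm_mon {n : ℕ} {x : S} (v : Fin n → S) (b : Fin n → ℕ)
    (h : ∀ i, SignComm x (v i)) : SignComm x (mon v b) := by
  apply SignComm.list_prod_right
  intro y hy
  obtain ⟨i, rfl⟩ := (List.mem_ofFn' _ _).mp hy
  exact (h i).pow_right _

/-- The elements of a family anticommute pairwise. -/
def AntiComm {n : ℕ} (v : Fin n → S) : Prop := ∀ i j, i ≠ j → v i * v j = -(v j * v i)

theorem AntiComm.tail {n : ℕ} {v : Fin (n + 1) → S} (h : AntiComm v) :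
    AntiComm fun i => v i.succ := fun _ _ hij => h _ _ fun e => hij (Fin.succ_injective _ e)

theorem AntiComm.signComm {n : ℕ} {v : Fin n → S} (h : AntiComm v) (i j : Fin n) :
    SignComm (v i) (v j) := by
  by_cases hij : i = j
  · subst hij; exact Or.inl rfl
  · exact Or.inr (h i j hij)

theorem mon_mul_mon {n : ℕ} {v : Fin n → S} (h : AntiComm v) (a b : Fin n → ℕ) :
    SignEq (mon v a * mon v b) (mon v fun i => a i + b i) := by
  induction n with
  | zero => simp [SignEq]
  | succ n ih =>
    rw [mon_succ, mon_succ v b, mon_succ v fun i => a i + b i, pow_add]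
    have h1 : SignComm (mon (fun i : Fin n => v i.succ) fun i => a i.succ) (v 0 ^ b 0) :=
      (signComm_mon _ _ fun i => (h.signComm 0 i.succ).pow_left _).symm
    have h2 := (SignEq.refl (v 0 ^ a 0)).mul (h1.mul
      (SignEq.refl (mon (fun i : Fin n => v i.succ) fun i => b i.succ)))
    have h3 := (SignEq.refl (v 0 ^ a 0 * v 0 ^ b 0)).mul
      (ih h.tail (fun i => a i.succ) fun i => b i.succ)
    simp only [mul_assoc] at h2 h3 ⊢
    exact h2.trans h3

end Signs

/-! ### Elementary and complete functions of lists, and their generating series. -/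

section ElementaryLists

variable {S : Type*} [Ring S]

@[simp]
theorem listEps_zero (l : List S) : listEps l 0 = 1 := by simp [listEps]

theorem listEps_nil_succ (r : ℕ) : listEps ([] : List S) (r + 1) = 0 := by simp [listEps]

theorem listEps_cons_succ (a : S) (l : List S) (r : ℕ) :
    listEps (a :: l) (r + 1) = listEps l (r + 1) + a * listEps l r := by
  simp [listEps, List.sublistsLen_succ_cons, List.sum_map_mul_left, Function.comp_def]

theorem listEps_eq_zero (l : List S) (r : ℕ) (h : l.length < r) : listEps l r = 0 := by
  induction l generalizing r with
  | nil =>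
    obtain ⟨r, rfl⟩ := Nat.exists_eq_add_of_lt h
    simpa using listEps_nil_succ (S := S) r
  | cons a l ih =>
    obtain ⟨r, rfl⟩ : ∃ m, r = m + 1 := ⟨r - 1, by simp at h; omega⟩
    simp only [List.length_cons] at h
    rw [listEps_cons_succ, ih _ (by omega), ih _ (by omega)]
    simp

theorem map_listEps {S' F : Type*} [Ring S'] [FunLike F S S'] [RingHomClass F S S'] (φ : F)
    (l : List S) (r : ℕ) : φ (listEps l r) = listEps (l.map φ) r := by
  induction l generalizing r with
  | nil => cases r <;> simp [listEps_nil_succ]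
  | cons a l ih => cases r <;> simp [listEps_cons_succ, ih]

theorem listEps_mul_of_anticomm (a : S) (l : List S) (h : ∀ b ∈ l, b * a = -(a * b)) (r : ℕ) :
    listEps l r * a = (-1) ^ r * (a * listEps l r) := by
  induction l generalizing r with
  | nil => cases r <;> simp [listEps_nil_succ]
  | cons b l ih =>
    cases r with
    | zero => simp
    | succ r =>
      have ih' := ih fun c hc => h c (by simp [hc])
      have hb := h b (by simp)
      rw [listEps_cons_succ, add_mul, mul_assoc, ih', ih', mul_add]
      rcases neg_one_pow_eq_or S r with e | e
      · rw [pow_succ, e]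
        simp only [one_mul, ← mul_assoc, hb]
        noncomm_ring
      · rw [pow_succ, e]
        simp only [one_mul, mul_neg, neg_mul, ← mul_assoc, hb]
        noncomm_ring

theorem listEps_append_singleton (a : S) (l : List S) (r : ℕ) :
    listEps (l ++ [a]) (r + 1) = listEps l (r + 1) + listEps l r * a := by
  induction l generalizing r with
  | nil => cases r <;> simp [listEps_cons_succ, listEps_nil_succ]
  | cons b l ih =>
    rw [List.cons_append, listEps_cons_succ, ih, listEps_cons_succ]
    cases r with
    | zero => simp; abel
    | succ r => rw [ih, listEps_cons_succ]; noncomm_ring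

/-- Moving a variable from the end to the front of a product of `r` others costs `(-1)^r`, and
`r.choose 2 + r = (r + 1).choose 2`. -/
theorem listEps_reverse (l : List S) (h : l.Pairwise fun a b => b * a = -(a * b)) (r : ℕ) :
    listEps l.reverse r = (-1) ^ r.choose 2 * listEps l r := by
  induction l generalizing r with
  | nil => cases r <;> simp [listEps_nil_succ]
  | cons a l ih =>
    rw [List.pairwise_cons] at h
    cases r with
    | zero => simp
    | succ r =>
      rw [List.reverse_cons, listEps_append_singleton, ih h.2, ih h.2, listEps_cons_succ, mul_assoc,
        listEps_mul_of_anticomm a l h.1, mul_add, ← mul_assoc ((-1) ^ r.choose 2), ← pow_add,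
        Nat.choose_succ_succ' r 1, Nat.choose_one_right, add_comm (r.choose 2)]

theorem listEps_map_neg (l : List S) (r : ℕ) :
    listEps (l.map fun a => -a) r = (-1) ^ r * listEps l r := by
  induction l generalizing r with
  | nil => cases r <;> simp [listEps_nil_succ]
  | cons a l ih =>
    cases r with
    | zero => simp
    | succ r =>
      rw [List.map_cons, listEps_cons_succ, listEps_cons_succ, ih, ih]
      rcases neg_one_pow_eq_or S r with e | e <;> rw [pow_succ, e] <;> noncomm_ring

/-- The coefficients of a power series, extended by zero to negative indices. -/
def zCoeff (F : PowerSeries S) (r : ℤ) : S := if r < 0 then 0 else PowerSeries.coeff r.toNat F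

@[simp]
theorem zCoeff_natCast (F : PowerSeries S) (r : ℕ) : zCoeff F r = PowerSeries.coeff r F := by
  simp [zCoeff]

theorem zCoeff_neg (F : PowerSeries S) (r : ℤ) (h : r < 0) : zCoeff F r = 0 := by simp [zCoeff, h]

theorem zCoeff_linear_mul (a : S) (F : PowerSeries S) (r : ℤ) :
    zCoeff ((1 + PowerSeries.C a * PowerSeries.X) * F) r = zCoeff F r + a * zCoeff F (r - 1) := by
  rcases lt_trichotomy r 0 with h | rfl | h
  · rw [zCoeff_neg _ _ h, zCoeff_neg _ _ h, zCoeff_neg _ _ (by omega)]; simp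
  · rw [zCoeff_neg _ (0 - 1) (by omega)]
    simp [zCoeff, add_mul, mul_assoc]
  · obtain ⟨m, rfl⟩ : ∃ m : ℕ, r = (m + 1 : ℕ) := ⟨(r - 1).toNat, by omega⟩
    rw [show ((m + 1 : ℕ) : ℤ) - 1 = m by push_cast; ring, zCoeff_natCast, zCoeff_natCast,
      zCoeff_natCast, add_mul, one_mul, map_add, mul_assoc, PowerSeries.coeff_C_mul,
      PowerSeries.coeff_succ_X_mul]

/-- The geometric series `∑ a^r X^r`. -/
def geomSeries (a : S) : PowerSeries S := PowerSeries.mk fun r => a ^ r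

theorem linear_mul_geomSeries (a : S) :
    (1 + PowerSeries.C (-a) * PowerSeries.X) * geomSeries a = 1 := by
  ext r
  rcases r with _ | r
  · simp [geomSeries, add_mul, mul_assoc]
  · rw [add_mul, one_mul, map_add, mul_assoc, PowerSeries.coeff_C_mul,
      PowerSeries.coeff_succ_X_mul]
    simp [geomSeries, PowerSeries.coeff_one, pow_succ']

theorem geomSeries_mul_linear (a : S) :
    geomSeries a * (1 + PowerSeries.C (-a) * PowerSeries.X) = 1 := by
  ext r
  rcases r with _ | r
  · simp [geomSeries, mul_add, ← mul_assoc]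
  · rw [mul_add, mul_one, map_add, ← mul_assoc, PowerSeries.coeff_succ_mul_X,
      PowerSeries.coeff_mul_C]
    simp [geomSeries, PowerSeries.coeff_one, pow_succ]

/-- The generating series of the elementary functions of a list. -/
def epsSeries (l : List S) : PowerSeries S :=
  (l.map fun a => 1 + PowerSeries.C a * PowerSeries.X).prod

/-- The generating series of the complete functions of a list. -/
def hSeries (l : List S) : PowerSeries S := (l.map geomSeries).prod

theorem coeff_epsSeries (l : List S) (r : ℕ) : PowerSeries.coeff r (epsSeries l) = listEps l r := by
  rw [epsSeries, ← mk_listEps, PowerSeries.coeff_mk]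

/-- The factors `1 - aX` inverse to the geometric series must be multiplied in the opposite order,
hence the reversed list. -/
theorem hSeries_mul_epsSeries (l : List S) :
    hSeries l * epsSeries (l.reverse.map fun a => -a) = 1 := by
  induction l with
  | nil => simp [hSeries, epsSeries]
  | cons a l ih =>
    have : epsSeries ((a :: l).reverse.map fun a => -a) =
        epsSeries (l.reverse.map fun a => -a) * (1 + PowerSeries.C (-a) * PowerSeries.X) := by
      simp [epsSeries]
    rw [this, hSeries, List.map_cons, List.prod_cons, mul_assoc, ← mul_assoc _ (epsSeries _)]
    rw [hSeries] at ih
    rw [ih, one_mul, geomSeries_mul_linear]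

theorem epsSeries_mul_hSeries (l : List S) :
    epsSeries (l.reverse.map fun a => -a) * hSeries l = 1 := by
  induction l with
  | nil => simp [hSeries, epsSeries]
  | cons a l ih =>
    have : epsSeries ((a :: l).reverse.map fun a => -a) =
        epsSeries (l.reverse.map fun a => -a) * (1 + PowerSeries.C (-a) * PowerSeries.X) := by
      simp [epsSeries]
    rw [this, hSeries, List.map_cons, List.prod_cons, mul_assoc, ← mul_assoc _ (geomSeries a),
      linear_mul_geomSeries, one_mul]
    exact ih

theorem mul_of_list_anticomm {a : S} {l : List S} (h : ∀ b ∈ l, b * a = -(a * b)) :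
    (∀ r, Even r → zCoeff (epsSeries l) r * a = a * zCoeff (epsSeries l) r) ∧
    (∀ r, Odd r → zCoeff (epsSeries l) r * a = -(a * zCoeff (epsSeries l) r)) := by
  constructor <;> intro r hr <;> unfold zCoeff <;> split_ifs with h0
  · simp
  · have : Even r.toNat := by
      rw [← Int.even_coe_nat, Int.toNat_of_nonneg (by omega)]; exact hr
    rw [coeff_epsSeries, listEps_mul_of_anticomm a l h, this.neg_one_pow, one_mul]
  · simp
  · have : Odd r.toNat := by
      rw [← Int.odd_coe_nat, Int.toNat_of_nonneg (by omega)]; exact hr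
    rw [coeff_epsSeries, listEps_mul_of_anticomm a l h, this.neg_one_pow, neg_one_mul]

/-- Each new variable multiplies the series by `1 + aX`, the situation of `OddSeq.mul_linear`. For
the empty list, odd indices give zero and the relations are trivial. -/
theorem oddSeq_epsSeries (l : List S) (h : l.Pairwise fun a b => b * a = -(a * b)) :
    OddSeq (zCoeff (epsSeries l)) := by
  induction l with
  | nil =>
    have key : ∀ r : ℤ, zCoeff (epsSeries ([] : List S)) r = if r = 0 then 1 else 0 := by
      intro r
      unfold zCoeff epsSeries
      simp only [List.map_nil, List.prod_nil, PowerSeries.coeff_one]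
      split_ifs <;> first | rfl | omega
    have comm : ∀ r s : ℤ, zCoeff (epsSeries ([] : List S)) r * zCoeff (epsSeries []) s =
        zCoeff (epsSeries []) s * zCoeff (epsSeries []) r := by
      intro r s
      rw [key, key]
      split_ifs <;> simp
    refine ⟨fun r hr => zCoeff_neg _ _ hr, fun r s _ => comm r s, fun r s hr hs => ?_,
      fun r s _ _ => by rw [comm r s, comm (r + 1)]; simp⟩
    have h1 : s ≠ 0 := by rintro rfl; simp at hs
    have h2 : r + 1 ≠ 0 := by
      intro h
      have := hr.add_one
      rw [h] at this
      simp at this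
    simp only [key, if_neg h1, if_neg h2, mul_zero, zero_mul]
  | cons a l ih =>
    rw [List.pairwise_cons] at h
    have h1 := mul_of_list_anticomm h.1
    have := (ih h.2).mul_linear a h1.1 h1.2
    convert this using 1
    funext r
    rw [← zCoeff_linear_mul]
    simp [epsSeries]

theorem hSeries_mul_of_list_anticomm {a : S} {l : List S} (h : ∀ b ∈ l, b * a = -(a * b)) (r : ℕ) :
    PowerSeries.coeff r (hSeries l) * a = (-1) ^ r * (a * PowerSeries.coeff r (hSeries l)) := by
  induction l generalizing r with
  | nil =>
    rcases r with _ | r <;> simp [hSeries, PowerSeries.coeff_one]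
  | cons b l ih =>
    have hb := h b (by simp)
    have ih' := fun r => ih (fun c hc => h c (by simp [hc])) r
    have hpow : ∀ j : ℕ, b ^ j * a = (-1) ^ j * (a * b ^ j) := by
      intro j
      induction j with
      | zero => simp
      | succ j ihj =>
        rw [pow_succ, mul_assoc, hb, mul_neg, ← mul_assoc, ihj]
        rcases neg_one_pow_eq_or S j with e | e <;> rw [pow_succ, e] <;> noncomm_ring
    rw [hSeries, List.map_cons, List.prod_cons, PowerSeries.coeff_mul, Finset.sum_mul,
      Finset.mul_sum, Finset.mul_sum]
    refine Finset.sum_congr rfl fun p hp => ?_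
    rw [← Finset.HasAntidiagonal.mem_antidiagonal.mp hp, geomSeries, PowerSeries.coeff_mk, mul_assoc]
    change b ^ p.1 * (PowerSeries.coeff p.2 (hSeries l) * a) = _ * (a * (b ^ p.1 *
      PowerSeries.coeff p.2 (hSeries l)))
    rw [ih']
    have c1 : b ^ p.1 * (-1 : S) ^ p.2 = (-1) ^ p.2 * b ^ p.1 :=
      ((Commute.neg_one_left (b ^ p.1)).pow_left p.2).symm.eq
    rw [← mul_assoc, c1, mul_assoc, ← mul_assoc _ a, hpow, pow_add, ← mul_assoc a, ← mul_assoc]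
    rw [← mul_assoc, ← mul_assoc, ← mul_assoc, (((Commute.refl (-1 : S)).pow_left p.2).pow_right p.1).eq]
    simp only [mul_assoc]

/-- Since `(1 - aX)⁻¹ = (1 - a²X²)⁻¹ (1 + aX)`, a new variable contributes a linear factor, treated
by `OddSeq.mul_linear`, and an even series in `a * a`, which commutes with all coefficients, treated
by `OddSeq.mul_even`. -/
theorem oddSeq_hSeries (l : List S) (h : l.Pairwise fun a b => b * a = -(a * b)) :
    OddSeq (zCoeff (hSeries l)) := by
  induction l with
  | nil => simpa [hSeries, epsSeries] using oddSeq_epsSeries ([] : List S) List.Pairwise.nil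
  | cons a l ih =>
    rw [List.pairwise_cons] at h
    set b := zCoeff (hSeries l) with hb
    have hcomm : ∀ r : ℕ, b r * a = (-1) ^ r * (a * b r) := fun r => by
      rw [hb, zCoeff_natCast]; exact hSeries_mul_of_list_anticomm h.1 r
    have h0 : ∀ r, Even r → b r * a = a * b r := by
      intro r hr
      by_cases hr0 : r < 0
      · rw [hb, zCoeff_neg _ _ hr0]; simp
      · lift r to ℕ using by omega
        rw [hcomm, (by simpa using hr : Even r).neg_one_pow, one_mul]
    have h1 : ∀ r, Odd r → b r * a = -(a * b r) := by
      intro r hr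
      by_cases hr0 : r < 0
      · rw [hb, zCoeff_neg _ _ hr0]; simp
      · lift r to ℕ using by omega
        rw [hcomm, (by simpa using hr : Odd r).neg_one_pow, neg_one_mul]
    have hsq : ∀ r, b r * (a * a) = a * a * b r := by
      intro r
      rcases Int.even_or_odd r with hr | hr
      · rw [← mul_assoc, h0 r hr, mul_assoc, h0 r hr, mul_assoc]
      · rw [← mul_assoc, h1 r hr, neg_mul, mul_assoc, h1 r hr, mul_neg, neg_neg, mul_assoc]
    have hd := (ih h.2).mul_linear a h0 h1
    -- Coefficient form of `(1 - aX) H(a :: l) = H(l)`; using it twice per step below yields the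
    -- expansion in powers of `a * a`.
    have hrec : ∀ r, zCoeff (hSeries (a :: l)) r = b r + a * zCoeff (hSeries (a :: l)) (r - 1) := by
      intro r
      have : (1 + PowerSeries.C (-a) * PowerSeries.X) * hSeries (a :: l) = hSeries l := by
        rw [hSeries, List.map_cons, List.prod_cons, ← mul_assoc, linear_mul_geomSeries, one_mul]
        rfl
      rw [hb, ← this, zCoeff_linear_mul]
      noncomm_ring
    refine hd.mul_even (fun j => (a * a) ^ j) (fun i j => (Commute.pow_pow_self _ _ _).eq)
      (fun i r => ?_) ?_
    · have c1 : Commute (a * a) (b r) := (hsq r).symm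
      have c2 : Commute (a * a) (b (r - 1)) := (hsq (r - 1)).symm
      have c3 : Commute (a * a) a := (mul_assoc a a a)
      exact ((c1.add_right (c3.mul_right c2)).pow_left i).symm.eq
    · intro r N
      induction N generalizing r with
      | zero => intro hr; rw [zCoeff_neg _ _ (by simpa using hr)]; simp
      | succ N ihN =>
        intro hr
        rw [Finset.sum_range_succ', hrec, hrec (r - 1), ihN (r - 1 - 1) (by push_cast at hr; omega),
          mul_add, Finset.mul_sum, Finset.mul_sum]
        simp only [pow_zero, one_mul, Nat.cast_zero, mul_zero, sub_zero]
        rw [← add_assoc, add_comm]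
        congr 1
        refine Finset.sum_congr rfl fun j _ => ?_
        rw [pow_succ', show r - 2 * ((j + 1 : ℕ) : ℤ) = r - 1 - 1 - 2 * j by push_cast; ring]
        simp only [mul_assoc]

end ElementaryLists

/-! ### Spanning families of ordered and of staircase monomials. -/

section Spanning

variable (R : Type*) [CommRing R] {S : Type*} [Ring S] [Algebra R S]

variable {R} in
theorem mul_mem_of_mem_span {s : Set S} {N : Submodule R S} (x : S) (h : ∀ y ∈ s, x * y ∈ N) {y : S}
    (hy : y ∈ Submodule.span R s) : x * y ∈ N := by
  have : Submodule.span R s ≤ N.comap (LinearMap.mulLeft R x) := Submodule.span_le.mpr h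
  exact this hy

theorem mon_single {n : ℕ} (v : Fin n → S) (i : Fin n) : mon v (Pi.single i 1) = v i := by
  induction n with
  | zero => exact i.elim0
  | succ n ih =>
    rw [mon_succ]
    cases i using Fin.cases with
    | zero =>
      have : (fun i : Fin n => (Pi.single 0 1 : Fin (n + 1) → ℕ) i.succ) = fun _ => 0 := by
        funext i
        simp
      rw [this, mon_zero]
      simp
    | succ j =>
      have : (fun i : Fin n => (Pi.single j.succ 1 : Fin (n + 1) → ℕ) i.succ) = Pi.single j 1 := by
        funext i
        simp [Pi.single_apply]
      rw [this, ih]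
      simp

theorem adjoin_le_span_mon {n : ℕ} {v : Fin n → S} (h : AntiComm v) :
    Subalgebra.toSubmodule (Algebra.adjoin R (Set.range v)) ≤
      Submodule.span R (Set.range (mon v)) := by
  intro x hx
  rw [Subalgebra.mem_toSubmodule] at hx
  induction hx using Algebra.adjoin_induction with
  | mem x hx =>
    obtain ⟨i, rfl⟩ := hx
    exact Submodule.subset_span ⟨_, mon_single v i⟩
  | algebraMap r =>
    rw [Algebra.algebraMap_eq_smul_one, ← mon_zero v]
    exact Submodule.smul_mem _ _ (Submodule.subset_span ⟨_, rfl⟩)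
  | add x y _ _ hx hy => exact add_mem hx hy
  | mul x y _ _ hx hy =>
    have h1 := Submodule.mul_mem_mul hx hy
    rw [Submodule.span_mul_span] at h1
    refine Submodule.span_le.mpr ?_ h1
    rintro _ ⟨_, ⟨a, rfl⟩, _, ⟨b, rfl⟩, rfl⟩
    exact ((mon_mul_mon h a b).mem_iff _).mpr (Submodule.subset_span ⟨_, rfl⟩)

/-- The exponent at `i` counts the letters equal to `n - i`, so the largest letter comes first;
letters `0` disappear because `a 0 = 1`. -/
theorem wordProd_sorted_eq_mon (a : ℤ → S) (h0 : a 0 = 1) (n : ℕ) : ∀ w : List ℕ,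
    w.Pairwise (· ≥ ·) → (∀ r ∈ w, r ≤ n) →
      ∃ c : Fin n → ℕ, wordProd a w = mon (fun i : Fin n => a ((n - i : ℕ) : ℤ)) c := by
  induction n with
  | zero =>
    intro w _ hw
    refine ⟨fun _ => 0, ?_⟩
    rw [mon_zero]
    induction w with
    | nil => rfl
    | cons r w ih =>
      have : r = 0 := by simpa using hw r (by simp)
      rw [wordProd_cons, ih (List.Pairwise.of_cons ‹_›) fun s hs => hw s (by simp [hs]), this]
      simp [h0]
  | succ n ihn =>
    intro w
    induction w with
    | nil => exact fun _ _ => ⟨fun _ => 0, by rw [mon_zero]; rfl⟩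
    | cons r w ih =>
      intro hs hw
      have hr := hw r (by simp)
      by_cases hrn : r = n + 1
      · obtain ⟨c, hc⟩ := ih (List.Pairwise.of_cons hs) fun s hs => hw s (by simp [hs])
        refine ⟨Fin.cons (c 0 + 1) fun i => c i.succ, ?_⟩
        rw [wordProd_cons, hc, mon_succ, mon_succ _ (Fin.cons _ _), ← mul_assoc, hrn]
        simp [pow_succ']
      · obtain ⟨c, hc⟩ := ihn (r :: w) hs (by
          intro s hs'
          rcases List.mem_cons.mp hs' with rfl | hs'
          · omega
          · have := (List.pairwise_cons.mp hs).1 s hs'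
            omega)
        refine ⟨Fin.cons 0 c, ?_⟩
        rw [hc, mon_succ]
        simp

/-- Sorting reduces every word to a decreasing one, which vanishes if some letter exceeds `n`. -/
theorem OddSeq.adjoin_le_span_mon {a : ℤ → S} (ha : OddSeq a) (h0 : a 0 = 1) (n : ℕ)
    (hn : ∀ r, (n : ℤ) < r → a r = 0) :
    Subalgebra.toSubmodule (Algebra.adjoin R (Set.range a)) ≤
      Submodule.span R (Set.range (mon fun i : Fin n => a ((n - i : ℕ) : ℤ))) := by
  rw [Algebra.adjoin_eq_span, Submodule.span_le]
  intro x hx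
  have hz : wordProd a [] ∈ Submodule.span R (Set.range (wordProd a)) :=
    Submodule.subset_span ⟨_, rfl⟩
  have h1 : x ∈ Submodule.span R (Set.range (wordProd a)) := by
    induction hx using Submonoid.closure_induction with
    | mem x hx =>
      obtain ⟨r, rfl⟩ := hx
      by_cases hr : r < 0
      · rw [ha.neg r hr]; exact zero_mem _
      · lift r to ℕ using by omega
        exact Submodule.subset_span ⟨[r], by simp⟩
    | one => exact hz
    | mul x y _ _ hx hy =>
      have h1 := Submodule.mul_mem_mul hx hy
      rw [Submodule.span_mul_span] at h1
      refine Submodule.span_mono ?_ h1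
      rintro _ ⟨_, ⟨v, rfl⟩, _, ⟨w, rfl⟩, rfl⟩
      exact ⟨v ++ w, by simp⟩
  refine Submodule.span_le.mpr ?_ h1
  rintro _ ⟨w, rfl⟩
  have h2 := ha.wordProd_mem_sorted R w.length w rfl
  refine Submodule.span_le.mpr ?_ h2
  rintro _ ⟨v, -, -, hs, rfl⟩
  by_cases hv : ∀ r ∈ v, r ≤ n
  · obtain ⟨c, hc⟩ := wordProd_sorted_eq_mon a h0 n v hs hv
    exact Submodule.subset_span ⟨c, hc.symm⟩
  · push Not at hv
    obtain ⟨r, hr, hrn⟩ := hv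
    have : wordProd a v = 0 := by
      apply List.prod_eq_zero
      rw [List.mem_map]
      exact ⟨r, hr, hn _ (by exact_mod_cast hrn)⟩
    rw [this]
    exact zero_mem _

/-- The subalgebra generated by the elementary functions of a list. -/
def epsAdjoin (l : List S) : Subalgebra R S := Algebra.adjoin R (Set.range (listEps l))

variable {R} in
theorem listEps_mem_epsAdjoin (l : List S) (r : ℕ) : listEps l r ∈ epsAdjoin R l :=
  Algebra.subset_adjoin ⟨r, rfl⟩

/-- Division of the series of `y :: l` by `1 + yX` on the left. -/
theorem listEps_eq_sum (y : S) (l : List S) (r : ℕ) :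
    listEps l r = ∑ j ∈ Finset.range (r + 1), (-y) ^ j * listEps (y :: l) (r - j) := by
  induction r with
  | zero => simp
  | succ r ih =>
    rw [Finset.sum_range_succ', eq_sub_of_add_eq (listEps_cons_succ y l r).symm, ih, Finset.mul_sum]
    simp only [pow_succ', pow_zero, one_mul, Nat.sub_zero, Nat.add_sub_add_right, mul_assoc,
      neg_mul, Finset.sum_neg_distrib]
    abel

/-- Powers of the first element of a pairwise anticommuting list, times elementary functions of the
remaining elements, can be expressed by bounded powers and elementary functions of all elements. -/
theorem pow_mul_epsAdjoin_tail {y : S} {l : List S} (h : ∀ b ∈ l, b * y = -(y * b)) (j : ℕ)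
    {e : S} (he : e ∈ epsAdjoin R l) :
    y ^ j * e ∈ Submodule.span R {x | ∃ i < l.length + 1, ∃ e ∈ epsAdjoin R (y :: l),
      x = y ^ i * e} := by
  set V := Submodule.span R {x | ∃ i < l.length + 1, ∃ e ∈ epsAdjoin R (y :: l), x = y ^ i * e}
    with hV
  have gen : ∀ i < l.length + 1, ∀ e ∈ epsAdjoin R (y :: l), y ^ i * e ∈ V :=
    fun i hi e he => Submodule.subset_span ⟨i, hi, e, he, rfl⟩
  -- The elementary function of `l` in degree `l.length + 1` is zero; its expansion in powers of `y`
  -- is therefore a monic equation for `y` over the elementary functions of `y :: l`.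
  have top : ∀ e ∈ epsAdjoin R (y :: l), y ^ (l.length + 1) * e ∈ V := by
    intro e he
    have h1 := listEps_eq_sum y l (l.length + 1)
    rw [listEps_eq_zero l _ (by omega), Finset.sum_range_succ, Nat.sub_self, listEps_zero,
      mul_one] at h1
    have h2 : (-y) ^ (l.length + 1) * e ∈ V := by
      rw [eq_neg_of_add_eq_zero_right h1.symm, neg_mul, Finset.sum_mul]
      refine neg_mem (Submodule.sum_mem _ fun i hi => ?_)
      rw [neg_pow, mul_assoc, mul_assoc]
      exact ((signEq_neg_one_pow_mul _ _).mem_iff _).mpr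
        (gen i (by simpa using hi) _ (mul_mem (listEps_mem_epsAdjoin _ _) he))
    rw [neg_pow, mul_assoc] at h2
    exact ((signEq_neg_one_pow_mul _ _).mem_iff _).mp h2
  have hy : ∀ x ∈ V, y * x ∈ V := by
    intro x hx
    have : V ≤ V.comap (LinearMap.mulLeft R y) := by
      conv_lhs => rw [hV]
      rw [Submodule.span_le]
      rintro _ ⟨i, hi, e, he, rfl⟩
      change y * (y ^ i * e) ∈ V
      rw [← mul_assoc, ← pow_succ']
      rcases Nat.lt_or_ge (i + 1) (l.length + 1) with h | h
      · exact gen _ h e he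
      · rw [show i + 1 = l.length + 1 by omega]
        exact top e he
    exact this hx
  have hpow : ∀ i, ∀ x ∈ V, y ^ i * x ∈ V := by
    intro i
    induction i with
    | zero => simp
    | succ i ih => intro x hx; rw [pow_succ, mul_assoc]; exact ih _ (hy x hx)
  have hE : ∀ e ∈ epsAdjoin R (y :: l), e ∈ V := fun e he => by
    simpa using gen 0 (by omega) e he
  have hr : ∀ e ∈ epsAdjoin R (y :: l), ∀ x ∈ V, x * e ∈ V := by
    intro e he x hx
    have : V ≤ V.comap (LinearMap.mulRight R e) := by
      conv_lhs => rw [hV]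
      rw [Submodule.span_le]
      rintro _ ⟨i, hi, e', he', rfl⟩
      change y ^ i * e' * e ∈ V
      rw [mul_assoc]
      exact gen i hi _ (mul_mem he' he)
    exact this hx
  -- `V` is stable under `y` from the left and under `epsAdjoin R (y :: l)` from the right, so it
  -- contains the elementary functions of `l`. As these pass powers of `y` up to sign, they also
  -- preserve `V` from the left.
  have htail : ∀ r, listEps l r ∈ V := by
    intro r
    rw [listEps_eq_sum y]
    refine Submodule.sum_mem _ fun i _ => ?_
    rw [neg_pow, mul_assoc]
    exact ((signEq_neg_one_pow_mul _ _).mem_iff _).mpr (hpow _ _ (hE _ (listEps_mem_epsAdjoin _ _)))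
  have hleft : ∀ r, ∀ x ∈ V, listEps l r * x ∈ V := by
    intro r x hx
    have : V ≤ V.comap (LinearMap.mulLeft R (listEps l r)) := by
      conv_lhs => rw [hV]
      rw [Submodule.span_le]
      rintro _ ⟨i, hi, e', he', rfl⟩
      change listEps l r * (y ^ i * e') ∈ V
      have hc : SignComm (listEps l r) y := by
        unfold SignComm
        rw [listEps_mul_of_anticomm y l h]
        exact signEq_neg_one_pow_mul _ _
      have hc' := (hc.pow_right i).mul (SignEq.refl e')
      rw [mul_assoc, mul_assoc] at hc'
      exact (hc'.mem_iff V).mpr (hpow _ _ (hr _ he' _ (htail r)))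
    exact this hx
  have hall : ∀ x ∈ V, e * x ∈ V := by
    unfold epsAdjoin at he
    induction he using Algebra.adjoin_induction with
    | mem _ hx => obtain ⟨r, rfl⟩ := hx; exact hleft r
    | algebraMap r => intro x hx; rw [← Algebra.smul_def]; exact Submodule.smul_mem _ _ hx
    | add a b _ _ ha hb => intro x hx; rw [add_mul]; exact add_mem (ha x hx) (hb x hx)
    | mul a b _ _ ha hb => intro x hx; rw [mul_assoc]; exact ha _ (hb x hx)
  exact hpow _ _ (by simpa using hall 1 (hE 1 (one_mem _)))

/-- The spanning half of the classical freeness of polynomials over symmetric ones. Induction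
reduces the remaining variables to a staircase with coefficients in their own elementary functions;
`pow_mul_epsAdjoin_tail` rewrites these, together with the power of the first variable, over the
elementary functions of all variables. -/
theorem mon_mem_span_staircase {n : ℕ} {v : Fin n → S} (h : AntiComm v) (b : Fin n → ℕ) :
    mon v b ∈ Submodule.span R {x | ∃ κ : Fin n → ℕ, (∀ i, κ i < n - i) ∧
      ∃ e ∈ epsAdjoin R (List.ofFn v), x = mon v κ * e} := by
  induction n with
  | zero => exact Submodule.subset_span ⟨b, fun i => i.elim0, 1, one_mem _, by simp⟩
  | succ n ih =>
    rw [mon_succ]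
    have ih' := ih h.tail fun i => b i.succ
    refine mul_mem_of_mem_span _ ?_ ih'
    rintro _ ⟨κ, hκ, e, he, rfl⟩
    have hc : ∀ j, SignComm (v 0 ^ j) (mon (fun i : Fin n => v i.succ) κ) := fun j =>
      signComm_mon _ _ fun i => (h.signComm 0 i.succ).pow_left _
    have hc' := (hc (b 0)).mul (SignEq.refl e)
    rw [mul_assoc, mul_assoc] at hc'
    rw [hc'.mem_iff]
    have ht := pow_mul_epsAdjoin_tail R (y := v 0) (l := List.ofFn fun i : Fin n => v i.succ)
      (by
        intro c hc
        obtain ⟨i, rfl⟩ := (List.mem_ofFn' _ _).mp hc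
        exact h _ _ (Fin.succ_ne_zero i)) (b 0) he
    refine mul_mem_of_mem_span _ ?_ ht
    rintro _ ⟨j, hj, e', he', rfl⟩
    have hc'' := (hc j).mul (SignEq.refl e')
    rw [mul_assoc, mul_assoc] at hc''
    rw [← hc''.mem_iff]
    refine Submodule.subset_span ⟨Fin.cons j κ, ?_, e', ?_, ?_⟩
    · intro i
      cases i using Fin.cases with
      | zero => simpa using hj
      | succ i => simpa using hκ i
    · rwa [List.ofFn_succ]
    · rw [mon_succ, mul_assoc]
      simp

/-- Only squarefree monomials occur, which is what the Pieri rule needs. -/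
theorem listEps_mem_span_mon {n : ℕ} (v : Fin n → S) (r : ℕ) :
    listEps (List.ofFn v) r ∈ Submodule.span R {x | ∃ α : Fin n → ℕ, (∀ i, α i ≤ 1) ∧
      x = mon v α} := by
  induction n generalizing r with
  | zero =>
    cases r with
    | zero => exact Submodule.subset_span ⟨fun _ => 0, by simp, by simp⟩
    | succ r => simp [listEps_nil_succ]
  | succ n ih =>
    have key : ∀ c ≤ 1, ∀ r, v 0 ^ c * listEps (List.ofFn fun i : Fin n => v i.succ) r ∈
        Submodule.span R {x | ∃ α : Fin (n + 1) → ℕ, (∀ i, α i ≤ 1) ∧ x = mon v α} := by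
      intro c hc r
      refine mul_mem_of_mem_span _ ?_ (ih (fun i => v i.succ) r)
      rintro _ ⟨α, hα, rfl⟩
      refine Submodule.subset_span ⟨Fin.cons c α, ?_, by simp [mon_succ]⟩
      intro i
      cases i using Fin.cases with
      | zero => simpa using hc
      | succ i => simpa using hα i
    rw [List.ofFn_succ]
    cases r with
    | zero => simpa using key 0 (by omega) 0
    | succ r =>
      rw [listEps_cons_succ]
      exact add_mem (by simpa using key 0 (by omega) (r + 1)) (by simpa using key 1 le_rfl r)

end Spanning

/-! ### Linear independence by counting in each degree. -/

section GradedBases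

variable {R V : Type*} [CommRing R] [AddCommGroup V] [Module R V] {ι : Type*}

theorem basis_induction (b : Module.Basis ι R V) {motive : V → Prop} (zero : motive 0)
    (add : ∀ x y, motive x → motive y → motive (x + y)) (smul : ∀ (r : R) i, motive (r • b i))
    (x : V) : motive x := by
  rw [← b.linearCombination_repr x, Finsupp.linearCombination_apply]
  exact Finset.sum_induction _ motive add zero fun i _ => smul _ i

/-- The projection to the span of the basis vectors of a given degree. -/
def gradedProj (b : Module.Basis ι R V) (deg : ι → ℕ) (m : ℕ) : V →ₗ[R] V :=
  b.constr R fun i => if deg i = m then b i else 0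

theorem gradedProj_basis (b : Module.Basis ι R V) (deg : ι → ℕ) (m : ℕ) (i : ι) :
    gradedProj b deg m (b i) = if deg i = m then b i else 0 := by
  simp [gradedProj]

theorem repr_gradedProj (b : Module.Basis ι R V) (deg : ι → ℕ) (m : ℕ) (x : V) (i : ι) :
    b.repr (gradedProj b deg m x) i = if deg i = m then b.repr x i else 0 := by
  classical
  induction x using basis_induction b with
  | zero => simp
  | add x y hx hy => rw [map_add, map_add, Finsupp.add_apply, hx, hy]; split_ifs <;> simp
  | smul r j =>
    rw [map_smul, map_smul, gradedProj_basis]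
    split_ifs <;> simp [Finsupp.single_apply] <;> aesop

theorem eq_zero_of_gradedProj (b : Module.Basis ι R V) (deg : ι → ℕ) (x : V)
    (h : ∀ m, gradedProj b deg m x = 0) : x = 0 := by
  apply b.repr.injective
  ext i
  have := repr_gradedProj b deg (deg i) x i
  rw [h, if_pos rfl] at this
  simpa using this.symm

/-- Homogeneity with respect to a grading can be tested with a homogeneous basis. -/
theorem gradedProj_of_mem {W : Type*} [AddCommGroup W] [Module R W] (𝒢 : ℕ → Submodule R W)
    [DirectSum.Decomposition 𝒢] (Ψ : V →ₗ[R] W) (hΨ : Function.Injective Ψ)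
    (b : Module.Basis ι R V) (deg : ι → ℕ) (hb : ∀ i, Ψ (b i) ∈ 𝒢 (deg i)) {x : V} {m : ℕ}
    (hx : Ψ x ∈ 𝒢 m) (l : ℕ) : gradedProj b deg l x = if l = m then x else 0 := by
  have key : ∀ x, Ψ (gradedProj b deg l x) = (DirectSum.decompose 𝒢 (Ψ x) l : W) := by
    intro x
    induction x using basis_induction b with
    | zero => simp
    | add x y hx hy => simp [hx, hy]
    | smul r i =>
      rw [map_smul, map_smul, map_smul, DirectSum.decompose_smul, gradedProj_basis]
      rw [DirectSum.smul_apply, Submodule.coe_smul]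
      congr 1
      split_ifs with h
      · subst h
        rw [DirectSum.decompose_of_mem_same _ (hb i)]
      · rw [DirectSum.decompose_of_mem_ne _ (hb i) h, map_zero]
  apply hΨ
  rw [key]
  split_ifs with h
  · subst h
    rw [DirectSum.decompose_of_mem_same _ hx]
  · rw [DirectSum.decompose_of_mem_ne _ hx (Ne.symm h), map_zero]

/-- A homogeneous spanning family with as many members of each degree as a homogeneous basis is
linearly independent. -/
theorem linearIndependent_of_span_eq_top {W : Type*} [AddCommGroup W] [Module R W]
    (𝒢 : ℕ → Submodule R W) [DirectSum.Decomposition 𝒢] (Ψ : V →ₗ[R] W)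
    (hΨ : Function.Injective Ψ) (b : Module.Basis ι R V) (deg : ι → ℕ)
    (hfin : ∀ m, {i | deg i = m}.Finite) (hb : ∀ i, Ψ (b i) ∈ 𝒢 (deg i))
    (v : ι → V) (hv : ∀ i, Ψ (v i) ∈ 𝒢 (deg i)) (hspan : Submodule.span R (Set.range v) = ⊤) :
    LinearIndependent R v := by
  -- `T` maps the basis to the family, is surjective, and commutes with the projections to the
  -- graded pieces. Each piece is a finite module, on which a surjective endomorphism is injective.
  let T : V →ₗ[R] V := b.constr R v
  have hT : ∀ i, T (b i) = v i := fun i => by simp [T]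
  have hTsurj : Function.Surjective T := by
    rw [← LinearMap.range_eq_top, eq_top_iff, ← hspan, Submodule.span_le]
    rintro _ ⟨i, rfl⟩
    exact ⟨b i, hT i⟩
  have hcomm : ∀ m x, T (gradedProj b deg m x) = gradedProj b deg m (T x) := by
    intro m x
    induction x using basis_induction b with
    | zero => simp
    | add x y hx hy => simp [hx, hy]
    | smul r i =>
      simp only [map_smul, hT, gradedProj_basis]
      rw [gradedProj_of_mem 𝒢 Ψ hΨ b deg hb (hv i) m]
      by_cases h : deg i = m
      · simp [h, hT]
      · rw [if_neg h, if_neg (Ne.symm h), map_zero]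
  have hinj : Function.Injective T := by
    rw [injective_iff_map_eq_zero]
    intro x hx
    apply eq_zero_of_gradedProj b deg
    intro m
    -- `V` carries no grading of its own: its piece of degree `m` is the range of the projection
    -- defined by the basis.
    let Vm := LinearMap.range (gradedProj b deg m)
    have hfinm : Module.Finite R Vm := by
      have : Vm = Submodule.span R (b '' {i | deg i = m}) := by
        apply le_antisymm
        · rintro _ ⟨x, rfl⟩
          induction x using basis_induction b with
          | zero => simp
          | add x y hx hy => rw [map_add]; exact add_mem hx hy
          | smul r i =>
            rw [map_smul, gradedProj_basis]
            refine Submodule.smul_mem _ _ ?_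
            split_ifs with h
            · exact Submodule.subset_span ⟨i, h, rfl⟩
            · exact zero_mem _
        · rw [Submodule.span_le]
          rintro _ ⟨i, hi, rfl⟩
          exact ⟨b i, by rw [gradedProj_basis]; exact if_pos hi⟩
      rw [this]
      exact Module.Finite.span_of_finite R ((hfin m).image _)
    have hmap : ∀ y ∈ Vm, T y ∈ Vm := by
      rintro _ ⟨y, rfl⟩
      exact ⟨T y, (hcomm m y).symm⟩
    have hidem : ∀ y ∈ Vm, gradedProj b deg m y = y := by
      rintro _ ⟨y, rfl⟩
      apply b.repr.injective
      ext i
      rw [repr_gradedProj, repr_gradedProj]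
      split_ifs <;> rfl
    have hsurj : Function.Surjective (T.restrict hmap) := by
      rintro ⟨y, hy⟩
      obtain ⟨x, hx⟩ := hTsurj y
      refine ⟨⟨gradedProj b deg m x, x, rfl⟩, Subtype.ext ?_⟩
      change T (gradedProj b deg m x) = y
      rw [hcomm, hx, hidem y hy]
    have hinjm := OrzechProperty.injective_of_surjective_endomorphism _ hsurj
    have h0 : T.restrict hmap ⟨gradedProj b deg m x, x, rfl⟩ = T.restrict hmap 0 := by
      apply Subtype.ext
      change T (gradedProj b deg m x) = T 0
      rw [hcomm, hx, map_zero, map_zero]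
    exact congrArg Subtype.val (hinjm h0)
  have : v = T ∘ b := funext fun i => (hT i).symm
  rw [this]
  exact b.linearIndependent.map' T (LinearMap.ker_eq_bot.mpr hinj)

end GradedBases

/-! ### The monomial basis of skew polynomials. -/

section MonomialBasis

variable (R : Type*) [CommRing R] (n : ℕ)

theorem antiComm_xVar : AntiComm (xVar R n) := fun i j hij =>
  eq_neg_of_add_eq_zero_left (X_anticomm R n i j hij)

theorem signEq_xTilde (i : Fin n) : SignEq (xTilde R n i) (xVar R n i) :=
  signEq_neg_one_pow_mul _ _

theorem antiComm_xTilde : AntiComm (xTilde R n) := by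
  intro i j hij
  have h := antiComm_xVar R n i j hij
  unfold xTilde
  rcases neg_one_pow_eq_or (OPol R n) (i : ℕ) with hi | hi <;>
    rcases neg_one_pow_eq_or (OPol R n) (j : ℕ) with hj | hj <;> simp [hi, hj, h]

theorem AntiComm.pairwise_ofFn {S : Type*} [Ring S] {n : ℕ} {v : Fin n → S} (h : AntiComm v) :
    (List.ofFn v).Pairwise fun a b => b * a = -(a * b) := by
  rw [List.pairwise_ofFn]
  intro i j hij
  exact h j i (ne_of_gt hij)

theorem signEq_mon_xTilde (b : Fin n → ℕ) : SignEq (mon (xTilde R n) b) (mon (xVar R n) b) := by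
  have : ∀ (m : ℕ) (v w : Fin m → OPol R n) (_ : ∀ i, SignEq (v i) (w i)) (b : Fin m → ℕ),
      SignEq (mon v b) (mon w b) := by
    intro m
    induction m with
    | zero => intro v w _ b; simp [SignEq]
    | succ m ih =>
      intro v w h b
      rw [mon_succ, mon_succ]
      refine SignEq.mul ?_ (ih _ _ (fun i => h i.succ) _)
      generalize b 0 = k
      induction k with
      | zero => simp [SignEq]
      | succ k ihk => rw [pow_succ, pow_succ]; exact ihk.mul (h 0)
  exact this n _ _ (signEq_xTilde R n) b

/-- The action of a variable on the free module with basis the exponents of monomials. -/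
def expAct (i : Fin n) : Module.End R ((Fin n → ℕ) →₀ R) :=
  Finsupp.linearCombination R fun a =>
    Finsupp.single (a + Pi.single i 1) ((-1 : R) ^ ∑ j ∈ Finset.Iio i, a j)

theorem expAct_single (i : Fin n) (a : Fin n → ℕ) (r : R) : expAct R n i (Finsupp.single a r) =
    Finsupp.single (a + Pi.single i 1) (r * (-1 : R) ^ ∑ j ∈ Finset.Iio i, a j) := by
  simp [expAct]

/-- The sign counts the variables of smaller index which `x_i` has to cross. For `i < j`,
multiplying by `x_i` first changes the sign for `x_j`, but not conversely. -/
theorem expAct_anticomm (i j : Fin n) (hij : i ≠ j) :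
    expAct R n i * expAct R n j + expAct R n j * expAct R n i = 0 := by
  wlog h : i < j generalizing i j
  · rw [add_comm]
    exact this j i hij.symm (lt_of_le_of_ne (not_lt.mp h) hij.symm)
  apply Finsupp.lhom_ext
  intro a r
  simp only [LinearMap.add_apply, Module.End.mul_apply, expAct_single, LinearMap.zero_apply]
  have e1 : ∑ l ∈ Finset.Iio i, (a + Pi.single j 1 : Fin n → ℕ) l = ∑ l ∈ Finset.Iio i, a l := by
    refine Finset.sum_congr rfl fun l hl => ?_
    have : l ≠ j := ne_of_lt ((Finset.mem_Iio.mp hl).trans h)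
    simp [this]
  have e2 : ∑ l ∈ Finset.Iio j, (a + Pi.single i 1 : Fin n → ℕ) l =
      ∑ l ∈ Finset.Iio j, a l + 1 := by
    simp [Finset.sum_add_distrib, Finset.sum_pi_single', h]
  rw [e1, e2, pow_succ, add_right_comm, ← Finsupp.single_add]
  exact Finsupp.single_eq_zero.mpr (by ring)

/-- The action of skew polynomials on the free module with basis the exponents of monomials. -/
def expRep : OPol R n →ₐ[R] Module.End R ((Fin n → ℕ) →₀ R) :=
  OPol.lift R n (expAct R n) (expAct_anticomm R n)

theorem expRep_xTilde (i : Fin n) (a : Fin n → ℕ) (u : Rˣ) :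
    ∃ u' : Rˣ, expRep R n (xTilde R n i) (Finsupp.single a (u : R)) =
      Finsupp.single (a + Pi.single i 1) (u' : R) := by
  have h : expRep R n (xVar R n i) (Finsupp.single a (u : R)) =
      Finsupp.single (a + Pi.single i 1) ((u * (-1) ^ ∑ j ∈ Finset.Iio i, a j : Rˣ) : R) := by
    rw [expRep, OPol.lift_X, expAct_single]
    simp
  rcases signEq_xTilde R n i with e | e
  · exact ⟨_, by rw [e, h]⟩
  · exact ⟨-(u * (-1) ^ ∑ j ∈ Finset.Iio i, a j), by
      rw [e, map_neg, LinearMap.neg_apply, h, ← Finsupp.single_neg, Units.val_neg]⟩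

theorem expRep_mon (b : Fin n → ℕ) :
    ∃ u : Rˣ, expRep R n (mon (xTilde R n) b) (Finsupp.single 0 1) = Finsupp.single b (u : R) := by
  have key : ∀ (m : ℕ) (f : Fin m → Fin n) (b : Fin m → ℕ), ∃ u : Rˣ,
      expRep R n (mon (fun i => xTilde R n (f i)) b) (Finsupp.single 0 1) =
        Finsupp.single (∑ i, b i • (Pi.single (f i) 1 : Fin n → ℕ)) (u : R) := by
    intro m
    induction m with
    | zero => intro f b; exact ⟨1, by simp⟩
    | succ m ih =>
      intro f b
      obtain ⟨u, hu⟩ := ih (fun i => f i.succ) fun i => b i.succ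
      rw [mon_succ, map_mul, Module.End.mul_apply, hu, Fin.sum_univ_succ]
      generalize b 0 = k
      induction k with
      | zero => exact ⟨u, by simp⟩
      | succ k ihk =>
        obtain ⟨u', hu'⟩ := ihk
        obtain ⟨u'', hu''⟩ := expRep_xTilde R n (f 0) (k • (Pi.single (f 0) 1 : Fin n → ℕ) +
          ∑ i : Fin m, b i.succ • (Pi.single (f i.succ) 1 : Fin n → ℕ)) u'
        refine ⟨u'', ?_⟩
        rw [pow_succ', map_mul, Module.End.mul_apply, hu', hu'', succ_nsmul]
        congr 1
        abel
  obtain ⟨u, hu⟩ := key n id b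
  refine ⟨u, ?_⟩
  simp only [id] at hu
  rw [hu]
  congr 1
  funext j
  simp [Finset.sum_apply, Pi.single_apply]

/-- In the representation `expRep`, the monomials send the vector of exponent `0` to distinct basis
vectors, up to units. -/
theorem linearIndependent_mon : LinearIndependent R (mon (xTilde R n)) := by
  choose u hu using expRep_mon R n
  refine LinearIndependent.of_comp ((LinearMap.applyₗ (Finsupp.single 0 1)).comp
    (expRep R n).toLinearMap) ?_
  have h1 : LinearIndependent R fun b : Fin n → ℕ => (Finsupp.single b (1 : R)) :=
    Finsupp.basisSingleOne.linearIndependent (ι := Fin n → ℕ) (R := R)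
  have h2 := h1.units_smul u
  convert h2 using 1
  funext b
  change expRep R n (mon (xTilde R n) b) (Finsupp.single 0 1) = _
  rw [hu]
  simp [Units.smul_def]

theorem adjoin_xTilde : Algebra.adjoin R (Set.range (xTilde R n)) = ⊤ := by
  rw [eq_top_iff]
  intro f _
  induction f using OPol.induction with
  | algebraMap r => exact algebraMap_mem _ r
  | X j =>
    exact ((signEq_xTilde R n j).mem_iff _).mp (Algebra.subset_adjoin ⟨j, rfl⟩)
  | mul f g hf hg => exact mul_mem (hf trivial) (hg trivial)
  | add f g hf hg => exact add_mem (hf trivial) (hg trivial)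

theorem span_mon_xTilde : Submodule.span R (Set.range (mon (xTilde R n))) = ⊤ := by
  rw [eq_top_iff]
  have := adjoin_le_span_mon R (antiComm_xTilde R n)
  rwa [adjoin_xTilde] at this

/-- The basis of skew polynomials formed by the monomials in the signed variables. -/
def monBasis : Module.Basis (Fin n → ℕ) R (OPol R n) :=
  Module.Basis.mk (linearIndependent_mon R n) (span_mon_xTilde R n).ge

theorem monBasis_apply (b : Fin n → ℕ) : monBasis R n b = mon (xTilde R n) b := by
  simp [monBasis]

theorem mon_mem_graded {S : Type*} [Ring S] [Algebra R S] (𝒜 : ℕ → Submodule R S)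
    [SetLike.GradedMonoid 𝒜] {m : ℕ} (v : Fin m → S) (d : Fin m → ℕ) (hv : ∀ i, v i ∈ 𝒜 (d i))
    (b : Fin m → ℕ) : mon v b ∈ 𝒜 (∑ i, d i * b i) := by
  have := SetLike.list_prod_ofFn_mem_graded (A := 𝒜) (fun i => b i • d i) (fun i => v i ^ b i)
    fun i => SetLike.pow_mem_graded _ (hv i)
  rw [List.sum_ofFn] at this
  simpa [mon, mul_comm] using this

theorem listEps_mem_graded {S : Type*} [Ring S] [Algebra R S] (𝒜 : ℕ → Submodule R S)
    [SetLike.GradedMonoid 𝒜] (l : List S) (hl : ∀ a ∈ l, a ∈ 𝒜 1) (r : ℕ) :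
    listEps l r ∈ 𝒜 r := by
  induction l generalizing r with
  | nil =>
    cases r with
    | zero => simpa using SetLike.GradedOne.one_mem (A := 𝒜)
    | succ r => rw [listEps_nil_succ]; exact zero_mem _
  | cons a l ih =>
    have ih' := ih fun b hb => hl b (by simp [hb])
    cases r with
    | zero => simpa using SetLike.GradedOne.one_mem (A := 𝒜)
    | succ r =>
      rw [listEps_cons_succ]
      refine add_mem (ih' _) ?_
      rw [add_comm r 1]
      exact SetLike.GradedMul.mul_mem (hl a (by simp)) (ih' r)

theorem xVar_mem_skewGrading (i : Fin n) : xVar R n i ∈ skewGrading R n 1 := X_mem R n i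

theorem xTilde_mem_skewGrading (i : Fin n) : xTilde R n i ∈ skewGrading R n 1 :=
  ((signEq_xTilde R n i).mem_iff _).mpr (xVar_mem_skewGrading R n i)

theorem epsPoly_mem_skewGrading (r : ℕ) : epsPoly R n r ∈ skewGrading R n r := by
  refine listEps_mem_graded R (skewGrading R n) _ ?_ r
  intro a ha
  obtain ⟨i, rfl⟩ := (List.mem_ofFn' _ _).mp ha
  exact xTilde_mem_skewGrading R n i

theorem hPoly_mem_skewGrading (r : ℕ) : hPoly R n r ∈ skewGrading R n r := by
  refine Submodule.sum_mem _ fun a ha => ?_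
  have := mon_mem_graded R (skewGrading R n) (xTilde R n) (fun _ => 1)
    (xTilde_mem_skewGrading R n) a
  rw [Finset.Nat.mem_antidiagonalTuple] at ha
  simp only [one_mul, ha] at this
  exact this

end MonomialBasis

/-! ### Divided differences, the longest word, and generation by the `ε_r`. -/

section DividedDifferences

variable (R : Type*) [CommRing R] (n : ℕ)

/-- A divided difference operator with an index which may be out of range. -/
def divOp (i : ℕ) : OPol R n →ₗ[R] OPol R n := if hi : i + 1 < n then divDiff R n i hi else 0

/-- The composition of the divided difference operators in a word; the rightmost operator is
applied first. -/
def wordOp (w : List ℕ) : OPol R n →ₗ[R] OPol R n :=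
  w.foldr (fun i T => divOp R n i ∘ₗ T) LinearMap.id

@[simp]
theorem wordOp_nil (f : OPol R n) : wordOp R n [] f = f := rfl

@[simp]
theorem wordOp_cons (i : ℕ) (w : List ℕ) (f : OPol R n) :
    wordOp R n (i :: w) f = divOp R n i (wordOp R n w f) := rfl

theorem wordOp_append (v w : List ℕ) (f : OPol R n) :
    wordOp R n (v ++ w) f = wordOp R n v (wordOp R n w f) := by
  induction v with
  | nil => rfl
  | cons i v ih => rw [List.cons_append, wordOp_cons, ih, wordOp_cons]

theorem divDiffLongest_eq (f : OPol R n) :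
    divDiffLongest R n f = wordOp R n (longestWord n) f := by
  unfold divDiffLongest
  induction longestWord n with
  | nil => rfl
  | cons i w ih =>
    rw [List.foldr_cons, ih, wordOp_cons, divOp]
    split_ifs <;> rfl

variable {R n}

/-- The second term of the Leibniz rule vanishes, so divided differences are right linear over
`OΛ_n`; all later arguments with `∂_{w_0}` rest on this. -/
theorem divOp_mul_of_mem (i : ℕ) (f : OPol R n) {e : OPol R n} (he : e ∈ OSym R n) :
    divOp R n i (f * e) = divOp R n i f * e := by
  unfold divOp
  split_ifs with hi
  · rw [divDiff_mul, he i hi, mul_zero, add_zero]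
  · simp

theorem wordOp_mul_of_mem (w : List ℕ) (f : OPol R n) {e : OPol R n} (he : e ∈ OSym R n) :
    wordOp R n w (f * e) = wordOp R n w f * e := by
  induction w with
  | nil => rfl
  | cons i w ih => rw [wordOp_cons, ih, divOp_mul_of_mem i _ he, wordOp_cons]

theorem divOp_mem_graded (i m : ℕ) {f : OPol R n} (hf : f ∈ skewGrading R n m) :
    divOp R n i f ∈ skewGrading R n (m - 1) ∧ (m = 0 → divOp R n i f = 0) := by
  unfold divOp
  split_ifs with hi
  · cases m with
    | zero =>
      have := divDiff_skewGrading_zero R n i hi f hf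
      exact ⟨by rw [this]; exact zero_mem _, fun _ => this⟩
    | succ m => exact ⟨divDiff_skewGrading R n i hi m f hf, by omega⟩
  · exact ⟨zero_mem _, fun _ => rfl⟩

theorem wordOp_mem_graded (w : List ℕ) (m : ℕ) {f : OPol R n} (hf : f ∈ skewGrading R n m) :
    wordOp R n w f ∈ skewGrading R n (m - w.length) ∧ (m < w.length → wordOp R n w f = 0) := by
  induction w with
  | nil => simpa using hf
  | cons i w ih =>
    rw [wordOp_cons, List.length_cons, ← Nat.sub_sub]
    have h := divOp_mem_graded i _ ih.1
    refine ⟨h.1, fun hm => ?_⟩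
    rcases Nat.lt_or_ge m w.length with h' | h'
    · rw [ih.2 h', map_zero]
    · exact h.2 (by omega)

theorem mem_skewGrading_zero {f : OPol R n} (hf : f ∈ skewGrading R n 0) :
    ∃ r : R, f = algebraMap R _ r := by
  unfold skewGrading at hf
  rw [pow_zero] at hf
  obtain ⟨r, rfl⟩ := Submodule.mem_one.mp hf
  exact ⟨r, rfl⟩

theorem longestWord_succ (m : ℕ) :
    longestWord (m + 1) = longestWord m ++ (List.range m).reverse := by
  simp [longestWord, List.range_succ]

theorem longestWord_length (m : ℕ) : (longestWord m).length = ∑ i ∈ Finset.range m, i := by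
  induction m with
  | zero => rfl
  | succ m ih => rw [longestWord_succ, List.length_append, ih, Finset.sum_range_succ]; simp

theorem sum_staircase (m : ℕ) : ∑ i : Fin m, (m - 1 - i : ℕ) = ∑ i ∈ Finset.range m, i := by
  rw [Fin.sum_univ_eq_sum_range fun i => m - 1 - i, Finset.sum_range_reflect (fun i => i)]

variable (R n)

/-- The kernel of a divided difference operator. -/
def divKer (i : ℕ) (hi : i + 1 < n) : Subalgebra R (OPol R n) where
  carrier := {f | divDiff R n i hi f = 0}
  mul_mem' := by
    intro f g (hf : _ = _) (hg : _ = _)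
    change _ = _
    rw [divDiff_mul, hf, hg, zero_mul, mul_zero, add_zero]
  add_mem' := by
    intro f g (hf : _ = _) (hg : _ = _)
    change _ = _
    rw [map_add, hf, hg, add_zero]
  algebraMap_mem' := fun r => divDiff_algebraMap R n i hi r

variable {R n}

theorem mem_divKer {i : ℕ} {hi : i + 1 < n} {f : OPol R n} :
    f ∈ divKer R n i hi ↔ divDiff R n i hi f = 0 := Iff.rfl

theorem var_mul_mon (i : Fin n) (b : Fin n → ℕ) :
    SignEq (xVar R n i * mon (xVar R n) b) (mon (xVar R n) (b + Pi.single i 1)) := by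
  have := mon_mul_mon (antiComm_xVar R n) (Pi.single i 1) b
  rw [mon_single] at this
  convert this using 2
  rw [add_comm]
  rfl

/-- Monomials with equal exponents at two neighbouring variables are killed by the corresponding
divided difference operator. -/
theorem mon_mem_divKer (i : ℕ) (hi : i + 1 < n) (b : Fin n → ℕ)
    (h : b ⟨i, by omega⟩ = b ⟨i + 1, hi⟩) : mon (xVar R n) b ∈ divKer R n i hi := by
  obtain ⟨a, ha⟩ : ∃ a, a = b ⟨i + 1, hi⟩ := ⟨_, rfl⟩
  induction a generalizing b with
  | zero =>
    refine Subalgebra.list_prod_mem _ fun x hx => ?_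
    obtain ⟨j, rfl⟩ := (List.mem_ofFn' _ _).mp hx
    change xVar R n j ^ b j ∈ _
    by_cases h1 : j = ⟨i, by omega⟩
    · rw [h1, h, ← ha, pow_zero]; exact one_mem _
    · by_cases h2 : j = ⟨i + 1, hi⟩
      · rw [h2, ← ha, pow_zero]; exact one_mem _
      · apply pow_mem
        rw [mem_divKer, divDiff_X, if_neg]
        simpa [Fin.ext_iff] using And.intro h1 h2
  | succ a ih =>
    set p : Fin n := ⟨i, by omega⟩ with hp
    set q : Fin n := ⟨i + 1, hi⟩ with hq
    have hpq : p ≠ q := by simp [hp, hq]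
    have hb : b = (b - Pi.single p 1 - Pi.single q 1) + Pi.single q 1 + Pi.single p 1 := by
      funext j
      by_cases h1 : j = p
      · subst h1; simp [hpq]; omega
      · by_cases h2 : j = q
        · subst h2; simp [hpq.symm]; omega
        · simp [h1, h2]
    have e1 := var_mul_mon (R := R) p (b - Pi.single p 1 - Pi.single q 1 + Pi.single q 1)
    have e2 := var_mul_mon (R := R) q (b - Pi.single p 1 - Pi.single q 1)
    have e3 := ((SignEq.refl (xVar R n p)).mul e2).trans e1
    rw [hb, ← e3.mem_iff, ← mul_assoc]
    -- The split-off factor is killed because `∂_i(x_i x_{i+1}) = x_{i+1} + s_i(x_i) = x_{i+1} -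
    -- x_{i+1}`, and the kernel is a subalgebra.
    refine mul_mem ?_ (ih _ ?_ ?_)
    · rw [mem_divKer, divDiff_mul, divDiff_X, divDiff_X, permAct_simpleSwap_X, if_pos (Or.inl rfl),
        if_pos (Or.inr rfl)]
      have : simpleSwap i hi p = q := Equiv.swap_apply_left _ _
      rw [this]
      simp
    · simp [hpq, hpq.symm, h]
    · simp [hpq.symm]; omega

/-- Splitting off one `x_i` leaves a monomial `g` with equal exponents at the two places, so `∂_i g
= 0` and `∂_i(x_i g) = g`. -/
theorem divOp_mon (i : ℕ) (hi : i + 1 < n) (b : Fin n → ℕ)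
    (h : b ⟨i, by omega⟩ = b ⟨i + 1, hi⟩ + 1) :
    SignEq (divOp R n i (mon (xVar R n) b))
      (mon (xVar R n) (b - Pi.single (⟨i, by omega⟩ : Fin n) 1)) := by
  set p : Fin n := ⟨i, by omega⟩ with hp
  have hb : b = (b - Pi.single p 1) + Pi.single p 1 := by
    funext j
    by_cases h1 : j = p
    · subst h1; simp; omega
    · simp [h1]
  have e1 := (var_mul_mon (R := R) p (b - Pi.single p 1)).map (divOp R n i)
  rw [← hb] at e1
  refine e1.symm.trans ?_
  have h0 : divDiff R n i hi (mon (xVar R n) (b - Pi.single p 1)) = 0 := by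
    apply mon_mem_divKer
    have : (⟨i + 1, hi⟩ : Fin n) ≠ p := by simp [hp]
    simp [this, ← hp, h]
  rw [divOp, dif_pos hi, divDiff_mul, h0, divDiff_X, if_pos (Or.inl rfl), one_mul, mul_zero,
    add_zero]
  exact SignEq.refl _

variable (R n)

/-- Each operator of the block meets two exponents differing by one and lowers the first of them. At
`j = m` the staircase starting with exponent `m` has become the one starting with `m - 1`; truncated
subtraction supplies the zero exponents. -/
theorem wordOp_block (m : ℕ) (hm : m < n) (j : ℕ) (hj : j ≤ m) :
    SignEq (wordOp R n (List.range j).reverse (mon (xVar R n) fun i => m - i))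
      (mon (xVar R n) fun i => if (i : ℕ) < j then m - 1 - i else m - i) := by
  induction j with
  | zero => simp [SignEq]
  | succ j ih =>
    rw [List.range_succ, List.reverse_append, List.reverse_singleton, List.singleton_append,
      wordOp_cons]
    refine ((ih (by omega)).map (divOp R n j)).trans ?_
    refine (divOp_mon j (by omega) _ ?_).trans (Or.inl ?_)
    · simp; omega
    · congr 1
      funext l
      by_cases h1 : l = ⟨j, by omega⟩
      · subst h1; simp; omega
      · have h2 : (l : ℕ) ≠ j := fun h => h1 (Fin.ext h)
        simp only [Pi.sub_apply, Pi.single_apply, if_neg h1, Nat.sub_zero]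
        split_ifs <;> omega

theorem wordOp_longest_mon (m : ℕ) (hm : m ≤ n) :
    SignEq (wordOp R n (longestWord m) (mon (xVar R n) fun i => m - 1 - i)) 1 := by
  induction m with
  | zero => exact Or.inl (by simpa [longestWord] using mon_zero (xVar R n))
  | succ m ih =>
    rw [longestWord_succ, wordOp_append]
    refine ((wordOp_block R n m (by omega) m le_rfl).map _).trans ?_
    convert ih (by omega) using 3
    funext i
    split_ifs <;> omega

variable {R n}

/-- No braid relations are needed, only degrees. Staircase monomials have degree at most the length
of the longest word, so `∂_{w_0}` maps them to scalars and one further operator kills them. Right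
linearity and `mon_mem_span_staircase` extend this to all skew polynomials. -/
theorem wordOp_longest_mem_epsAdjoin (f : OPol R n) :
    wordOp R n (longestWord n) f ∈ epsAdjoin R (List.ofFn (xTilde R n)) ∧
      ∀ i, wordOp R n (longestWord n) (divOp R n i f) = 0 := by
  have hE : ∀ e ∈ epsAdjoin R (List.ofFn (xTilde R n)), e ∈ OSym R n := by
    have : epsAdjoin R (List.ofFn (xTilde R n)) ≤ OSym R n := by
      unfold epsAdjoin
      rw [Algebra.adjoin_le_iff]
      rintro _ ⟨r, rfl⟩
      exact epsPoly_mem R n r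
    exact fun e he => this he
  have key : ∀ κ : Fin n → ℕ, (∀ i, κ i < n - i) →
      ∃ m ≤ (longestWord n).length, mon (xTilde R n) κ ∈ skewGrading R n m := by
    intro κ hκ
    refine ⟨_, ?_, mon_mem_graded R (skewGrading R n) (xTilde R n) (fun _ => 1)
      (xTilde_mem_skewGrading R n) κ⟩
    rw [longestWord_length, ← sum_staircase]
    exact Finset.sum_le_sum fun i _ => by have := hκ i; omega
  have hf : ∀ f : OPol R n, f ∈ Submodule.span R {x | ∃ κ : Fin n → ℕ, (∀ i, κ i < n - i) ∧
      ∃ e ∈ epsAdjoin R (List.ofFn (xTilde R n)), x = mon (xTilde R n) κ * e} := by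
    intro f
    have h : f ∈ Submodule.span R (Set.range (mon (xTilde R n))) := by
      rw [span_mon_xTilde]; trivial
    refine Submodule.span_le.mpr ?_ h
    rintro _ ⟨b, rfl⟩
    exact mon_mem_span_staircase R (antiComm_xTilde R n) b
  constructor
  · have h := hf f
    induction h using Submodule.span_induction with
    | mem x hx =>
      obtain ⟨κ, hκ, e, he, rfl⟩ := hx
      rw [wordOp_mul_of_mem _ _ (hE e he)]
      obtain ⟨m, hm, hmem⟩ := key κ hκ
      have := (wordOp_mem_graded (longestWord n) m hmem).1
      rw [Nat.sub_eq_zero_of_le hm] at this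
      obtain ⟨r, hr⟩ := mem_skewGrading_zero this
      rw [hr]
      exact mul_mem (algebraMap_mem _ r) he
    | zero => rw [map_zero]; exact zero_mem _
    | add x y _ _ hx hy => rw [map_add]; exact add_mem hx hy
    | smul r x _ hx => rw [map_smul]; exact Subalgebra.smul_mem _ hx r
  · intro i
    have h := hf f
    induction h using Submodule.span_induction with
    | mem x hx =>
      obtain ⟨κ, hκ, e, he, rfl⟩ := hx
      rw [divOp_mul_of_mem _ _ (hE e he), wordOp_mul_of_mem _ _ (hE e he)]
      obtain ⟨m, hm, hmem⟩ := key κ hκ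
      have := (wordOp_mem_graded (longestWord n ++ [i]) m hmem).2 (by simp; omega)
      rw [wordOp_append] at this
      rw [show divOp R n i (mon (xTilde R n) κ) = wordOp R n [i] (mon (xTilde R n) κ) from rfl, this,
        zero_mul]
    | zero => rw [map_zero, map_zero]
    | add x y _ _ hx hy => rw [map_add, map_add, hx, hy, add_zero]
    | smul r x _ hx => rw [map_smul, map_smul, hx, smul_zero]

/-- An element of the kernel of `∂_i` also lies in its image, namely `f = ∂_i(x_i f)`, and `∂_{w_0}
∂_i = 0`. -/
theorem wordOp_longest_of_mem_divKer {i : ℕ} {hi : i + 1 < n} {f : OPol R n}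
    (hf : f ∈ divKer R n i hi) : wordOp R n (longestWord n) f = 0 := by
  have h := (wordOp_longest_mem_epsAdjoin (xVar R n ⟨i, by omega⟩ * f)).2 i
  rwa [divOp, dif_pos hi, divDiff_mul, mem_divKer.mp hf, divDiff_X, if_pos (Or.inl rfl), one_mul,
    mul_zero, add_zero] at h

variable (R n)

/-- The algebra of odd symmetric polynomials is generated by the odd elementary symmetric
polynomials. -/
theorem OSym_eq_epsAdjoin : OSym R n = epsAdjoin R (List.ofFn (xTilde R n)) := by
  apply le_antisymm
  · intro f hf
    -- Right linearity gives `∂_{w_0}(x^δ f) = ± f` for the staircase monomial `x^δ`, since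
    -- `∂_{w_0}(x^δ) = ± 1`.
    have h := (wordOp_longest_mem_epsAdjoin ((mon (xVar R n) fun i => n - 1 - i) * f)).1
    rw [wordOp_mul_of_mem _ _ hf] at h
    have := (wordOp_longest_mon R n n le_rfl).mul (SignEq.refl f)
    rw [one_mul] at this
    exact (this.mem_iff _).mp h
  · unfold epsAdjoin
    rw [Algebra.adjoin_le_iff]
    rintro _ ⟨r, rfl⟩
    exact epsPoly_mem R n r

theorem wordOp_longest_mem (f : OPol R n) : wordOp R n (longestWord n) f ∈ OSym R n := by
  rw [OSym_eq_epsAdjoin]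
  exact (wordOp_longest_mem_epsAdjoin f).1

end DividedDifferences

/-! ### Freeness over odd symmetric polynomials, and the basis of products of `ε_r`. -/

section ElementaryBasis

variable (R : Type*) [CommRing R] (n : ℕ)

/-- The weight of a multiset with parts at most `n`, the multiplicity of `n - i` being `b i`. -/
def partsWeight {n : ℕ} (b : Fin n → ℕ) : ℕ := ∑ i : Fin n, (n - i) * b i

theorem finite_sum_eq (n m : ℕ) : {b : Fin n → ℕ | ∑ i, b i = m}.Finite := by
  refine (Finset.Nat.antidiagonalTuple n m).finite_toSet.subset fun b hb => ?_
  exact Finset.Nat.mem_antidiagonalTuple.mpr hb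

theorem finite_partsWeight_eq (n m : ℕ) : {b : Fin n → ℕ | partsWeight b = m}.Finite := by
  refine (Set.finite_Iic (fun _ : Fin n => m)).subset fun b hb i => ?_
  have h1 : (n - i) * b i ≤ m := by
    rw [← show partsWeight b = m from hb]
    exact Finset.single_le_sum (f := fun i : Fin n => (n - i) * b i) (fun _ _ => Nat.zero_le _)
      (Finset.mem_univ i)
  have h2 : 1 ≤ n - i := by have := i.2; omega
  exact le_trans (Nat.le_mul_of_pos_left _ h2) h1

/-- The family combining bounded powers of the variables with odd elementary symmetric
polynomials. -/
def stairFamily (a : Fin n → ℕ) : OPol R n :=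
  mon (xTilde R n) (fun i => a i % (n - i)) *
    mon (fun i : Fin n => epsPoly R n (n - i)) (fun i => a i / (n - i))

theorem epsAdjoin_le_span :
    Subalgebra.toSubmodule (epsAdjoin R (List.ofFn (xTilde R n))) ≤
      Submodule.span R (Set.range (mon fun i : Fin n => epsPoly R n (n - i))) := by
  have h1 := oddSeq_epsSeries _ (antiComm_xTilde R n).pairwise_ofFn
  have h2 : ∀ r : ℕ, zCoeff (epsSeries (List.ofFn (xTilde R n))) r = epsPoly R n r := by
    intro r
    rw [zCoeff_natCast, coeff_epsSeries]
    rfl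
  have h3 := h1.adjoin_le_span_mon R (by simpa [epsPoly] using h2 0) n (by
    intro r hr
    lift r to ℕ using by omega
    rw [h2, epsPoly, listEps_eq_zero]
    simpa using hr)
  simp only [h2] at h3
  refine le_trans ?_ h3
  refine fun x hx => Algebra.adjoin_mono ?_ hx
  rintro _ ⟨r, rfl⟩
  exact ⟨r, h2 r⟩

/-- Division with remainder by `n - i` encodes a staircase exponent `κ i < n - i` and a multiplicity
`c i` in the single number `κ i + (n - i) * c i`. -/
theorem span_stairFamily : Submodule.span R (Set.range (stairFamily R n)) = ⊤ := by
  rw [eq_top_iff, ← span_mon_xTilde, Submodule.span_le]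
  rintro _ ⟨b, rfl⟩
  refine Submodule.span_le.mpr ?_ (mon_mem_span_staircase R (antiComm_xTilde R n) b)
  rintro _ ⟨κ, hκ, e, he, rfl⟩
  refine mul_mem_of_mem_span _ ?_ (epsAdjoin_le_span R n he)
  rintro _ ⟨c, rfl⟩
  refine Submodule.subset_span ⟨fun i => κ i + (n - i) * c i, ?_⟩
  unfold stairFamily
  congr 2 <;> funext i
  · rw [Nat.add_mul_mod_self_left, Nat.mod_eq_of_lt (hκ i)]
  · rw [Nat.add_mul_div_left _ _ (by have := i.2; omega), Nat.div_eq_of_lt (hκ i), zero_add]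

/-- In this encoding the member of index `a` has degree `∑ i, a i`, the same as the monomial with
exponents `a`; hence spanning implies independence. -/
theorem linearIndependent_stairFamily : LinearIndependent R (stairFamily R n) := by
  refine linearIndependent_of_span_eq_top (skewGrading R n) LinearMap.id
    Function.injective_id (monBasis R n) (fun a => ∑ i, a i) (finite_sum_eq n) ?_ _ ?_
    (span_stairFamily R n)
  · intro b
    have := mon_mem_graded R (skewGrading R n) (xTilde R n) (fun _ => 1)
      (xTilde_mem_skewGrading R n) b
    simpa [monBasis_apply] using this
  · intro a
    have h1 := mon_mem_graded R (skewGrading R n) (xTilde R n) (fun _ => 1)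
      (xTilde_mem_skewGrading R n) fun i => a i % (n - i)
    have h2 := mon_mem_graded R (skewGrading R n) (fun i : Fin n => epsPoly R n (n - i))
      (fun i => n - i) (fun i => epsPoly_mem_skewGrading R n _) fun i => a i / (n - i)
    have h3 := SetLike.GradedMul.mul_mem h1 h2
    rw [← Finset.sum_add_distrib] at h3
    simp only [one_mul, Nat.mod_add_div] at h3
    exact h3

/-- The products of odd elementary symmetric polynomials, the multiplicity of `ε_{n-i}` being
`b i`. -/
def epsMon (b : Fin n → ℕ) : OSym R n := mon (fun i : Fin n => eps R n (n - i)) b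

theorem epsMon_coe (b : Fin n → ℕ) :
    (epsMon R n b : OPol R n) = mon (fun i : Fin n => epsPoly R n (n - i)) b :=
  map_mon (OSym R n).val _ _

/-- These are the members of the staircase family with all remainders zero. -/
theorem linearIndependent_epsMon : LinearIndependent R (epsMon R n) := by
  refine LinearIndependent.of_comp (OSym R n).val.toLinearMap ?_
  have h := (linearIndependent_stairFamily R n).comp (fun (c : Fin n → ℕ) i => (n - i) * c i) (by
    intro c d hcd
    funext i
    have := congrFun hcd i
    exact Nat.eq_of_mul_eq_mul_left (by have := i.2; omega) this)
  convert h using 1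
  funext c
  change (epsMon R n c : OPol R n) = stairFamily R n _
  rw [epsMon_coe, stairFamily]
  have : (fun i : Fin n => (n - i) * c i % (n - i)) = fun _ => 0 := by
    funext i
    simp
  rw [this, mon_zero, one_mul]
  congr 1
  funext i
  rw [Nat.mul_div_cancel_left]
  have := i.2
  omega

theorem span_epsMon : Submodule.span R (Set.range (epsMon R n)) = ⊤ := by
  rw [eq_top_iff]
  rintro ⟨f, hf⟩ -
  have h := epsAdjoin_le_span R n (by rw [← OSym_eq_epsAdjoin]; exact hf)
  have h2 : Set.range (mon fun i : Fin n => epsPoly R n (n - i)) =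
      (OSym R n).val.toLinearMap '' Set.range (epsMon R n) := by
    rw [← Set.range_comp]
    congr 1
    funext b
    exact (epsMon_coe R n b).symm
  rw [h2, ← Submodule.map_span] at h
  obtain ⟨g, hg, e⟩ := h
  have : g = ⟨f, hf⟩ := Subtype.ext e
  rwa [← this]

/-- The basis of odd symmetric polynomials formed by products of odd elementary symmetric
polynomials. -/
def epsBasis : Module.Basis (Fin n → ℕ) R (OSym R n) :=
  Module.Basis.mk (linearIndependent_epsMon R n) (span_epsMon R n).ge

theorem epsBasis_apply (b : Fin n → ℕ) : epsBasis R n b = epsMon R n b := by simp [epsBasis]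

theorem eps_mem_oddSymGrading (r : ℕ) : eps R n r ∈ oddSymGrading R n r :=
  epsPoly_mem_skewGrading R n r

theorem hSym_mem_oddSymGrading (r : ℕ) : hSym R n r ∈ oddSymGrading R n r :=
  hPoly_mem_skewGrading R n r

theorem epsMon_mem_oddSymGrading (b : Fin n → ℕ) :
    epsMon R n b ∈ oddSymGrading R n (partsWeight b) :=
  mon_mem_graded R (oddSymGrading R n) _ (fun i : Fin n => n - i)
    (fun _ => eps_mem_oddSymGrading R n _) b

theorem eps_zero : eps R n 0 = 1 := Subtype.ext (listEps_zero _)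

theorem eps_eq_zero (r : ℕ) (h : n < r) : eps R n r = 0 :=
  Subtype.ext (listEps_eq_zero _ _ (by simpa using h))

theorem adjoin_eps : Algebra.adjoin R (Set.range (eps R n)) = ⊤ := by
  rw [eq_top_iff]
  intro f _
  have h : f ∈ Submodule.span R (Set.range (epsMon R n)) := by rw [span_epsMon]; trivial
  have h2 : Submodule.span R (Set.range (epsMon R n)) ≤
      Subalgebra.toSubmodule (Algebra.adjoin R (Set.range (eps R n))) := by
    rw [Submodule.span_le]
    rintro _ ⟨b, rfl⟩
    refine Subalgebra.list_prod_mem _ fun x hx => ?_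
    obtain ⟨j, rfl⟩ := (List.mem_ofFn' _ _).mp hx
    exact pow_mem (Algebra.subset_adjoin (Set.mem_range_self _)) _
  exact h2 h

variable {R n} in
theorem OSym.algHom_ext {S : Type*} [Ring S] [Algebra R S] {φ ψ : OSym R n →ₐ[R] S}
    (h : ∀ r, φ (eps R n r) = ψ (eps R n r)) : φ = ψ := by
  refine AlgHom.ext_of_adjoin_eq_top (adjoin_eps R n) fun x hx => ?_
  obtain ⟨r, rfl⟩ := hx
  exact h r

end ElementaryBasis

/-! ### Generators and relations for odd symmetric polynomials. -/

section Presentation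

variable (R : Type*) [CommRing R] (n : ℕ)

/-- The relations between the odd elementary symmetric polynomials. -/
inductive OSymRel : FreeAlgebra R ℤ → FreeAlgebra R ℤ → Prop
  | neg (r : ℤ) (h : r < 0) : OSymRel (FreeAlgebra.ι R r) 0
  | zero : OSymRel (FreeAlgebra.ι R 0) 1
  | top (r : ℤ) (h : n < r) : OSymRel (FreeAlgebra.ι R r) 0
  | comm (r s : ℤ) (h : Even (r + s)) :
      OSymRel (FreeAlgebra.ι R r * FreeAlgebra.ι R s) (FreeAlgebra.ι R s * FreeAlgebra.ι R r)
  | evenOdd (r s : ℤ) (hr : Even r) (hs : Odd s) :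
      OSymRel (FreeAlgebra.ι R r * FreeAlgebra.ι R s + FreeAlgebra.ι R s * FreeAlgebra.ι R r)
        (FreeAlgebra.ι R (s - 1) * FreeAlgebra.ι R (r + 1) +
          FreeAlgebra.ι R (r + 1) * FreeAlgebra.ι R (s - 1))
  | oddEven (r s : ℤ) (hr : Odd r) (hs : Even s) :
      OSymRel (FreeAlgebra.ι R r * FreeAlgebra.ι R s - FreeAlgebra.ι R s * FreeAlgebra.ι R r)
        (FreeAlgebra.ι R (s - 1) * FreeAlgebra.ι R (r + 1) -
          FreeAlgebra.ι R (r + 1) * FreeAlgebra.ι R (s - 1))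

/-- The algebra with generators and relations of the odd elementary symmetric polynomials. -/
abbrev OSymPres : Type _ := RingQuot (OSymRel R n)

/-- The generators of the presented algebra. -/
def OSymPres.gen (r : ℤ) : OSymPres R n := RingQuot.mkAlgHom R (OSymRel R n) (FreeAlgebra.ι R r)

theorem OSymPres.oddSeq : OddSeq (OSymPres.gen R n) where
  neg r h := by simpa [OSymPres.gen] using RingQuot.mkAlgHom_rel R (OSymRel.neg (R := R) (n := n) r h)
  comm r s h := by simpa [OSymPres.gen] using RingQuot.mkAlgHom_rel R (OSymRel.comm (R := R) (n := n) r s h)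
  evenOdd r s hr hs := by
    simpa [OSymPres.gen] using RingQuot.mkAlgHom_rel R (OSymRel.evenOdd (R := R) (n := n) r s hr hs)
  oddEven r s hr hs := by
    simpa [OSymPres.gen] using RingQuot.mkAlgHom_rel R (OSymRel.oddEven (R := R) (n := n) r s hr hs)

theorem OSymPres.gen_zero : OSymPres.gen R n 0 = 1 := by
  simpa [OSymPres.gen] using RingQuot.mkAlgHom_rel R (OSymRel.zero (R := R) (n := n))

theorem OSymPres.gen_top (r : ℤ) (h : n < r) : OSymPres.gen R n r = 0 := by
  simpa [OSymPres.gen] using RingQuot.mkAlgHom_rel R (OSymRel.top (R := R) (n := n) r h)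

variable {R n} in
theorem OSymPres.exists_lift {S : Type*} [Ring S] [Algebra R S] (a : ℤ → S) (ha : OddSeq a)
    (h0 : a 0 = 1) (htop : ∀ r, (n : ℤ) < r → a r = 0) :
    ∃ φ : OSymPres R n →ₐ[R] S, ∀ r, φ (OSymPres.gen R n r) = a r := by
  refine ⟨RingQuot.liftAlgHom R ⟨FreeAlgebra.lift R a, ?_⟩, fun r => ?_⟩
  · intro x y h
    cases h with
    | neg r h => simpa using ha.neg r h
    | zero => simpa using h0
    | top r h => simpa using htop r h
    | comm r s h => simpa using ha.comm r s h
    | evenOdd r s hr hs => simpa using ha.evenOdd r s hr hs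
    | oddEven r s hr hs => simpa using ha.oddEven r s hr hs
  · unfold OSymPres.gen
    erw [RingQuot.liftAlgHom_mkAlgHom_apply]
    simp

theorem OSymPres.adjoin_gen : Algebra.adjoin R (Set.range (OSymPres.gen R n)) = ⊤ := by
  rw [eq_top_iff]
  intro x _
  obtain ⟨y, rfl⟩ := RingQuot.mkAlgHom_surjective R (OSymRel R n) x
  induction y using FreeAlgebra.induction with
  | grade0 r => rw [AlgHom.commutes]; exact algebraMap_mem _ r
  | grade1 j => exact Algebra.subset_adjoin ⟨j, rfl⟩
  | mul a b ha hb => rw [map_mul]; exact mul_mem (ha trivial) (hb trivial)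
  | add a b ha hb => rw [map_add]; exact add_mem (ha trivial) (hb trivial)

/-- The odd elementary symmetric polynomials, indexed by the integers. -/
def epsZ (r : ℤ) : OSym R n := if r < 0 then 0 else eps R n r.toNat

theorem epsZ_natCast (r : ℕ) : epsZ R n r = eps R n r := by simp [epsZ]

theorem epsZ_coe (r : ℤ) :
    (epsZ R n r : OPol R n) = zCoeff (epsSeries (List.ofFn (xTilde R n))) r := by
  unfold epsZ zCoeff
  split_ifs
  · rfl
  · rw [coeff_epsSeries]; rfl

theorem oddSeq_epsZ : OddSeq (epsZ R n) := by
  refine OddSeq.of_map (OSym R n).val Subtype.val_injective ?_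
  have := oddSeq_epsSeries _ (antiComm_xTilde R n).pairwise_ofFn
  convert this using 1
  funext r
  exact epsZ_coe R n r

theorem epsZ_top (r : ℤ) (h : n < r) : epsZ R n r = 0 := by
  lift r to ℕ using by omega
  rw [epsZ_natCast, eps_eq_zero R n r (by exact_mod_cast h)]

variable {R n} in
/-- Odd symmetric polynomials have a presentation with the odd elementary symmetric polynomials as
generators. -/
theorem OSym.exists_lift {S : Type*} [Ring S] [Algebra R S] (a : ℤ → S) (ha : OddSeq a)
    (h0 : a 0 = 1) (htop : ∀ r, (n : ℤ) < r → a r = 0) :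
    ∃ φ : OSym R n →ₐ[R] S, ∀ r : ℕ, φ (eps R n r) = a r := by
  obtain ⟨ψ, hψ⟩ := OSymPres.exists_lift (R := R) (epsZ R n) (oddSeq_epsZ R n)
    (by rw [← eps_zero]; exact epsZ_natCast R n 0) (epsZ_top R n)
  obtain ⟨φ, hφ⟩ := OSymPres.exists_lift (R := R) a ha h0 htop
  have hmon : ∀ b, ψ (mon (fun i : Fin n => OSymPres.gen R n ((n - i : ℕ) : ℤ)) b) =
      epsMon R n b := by
    intro b
    rw [map_mon]
    simp only [hψ, epsZ_natCast]
    rfl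
  -- Sorting shows that the presented algebra is spanned by ordered monomials; their images are
  -- independent, so there are no further relations.
  have hinj : Function.Injective ψ := by
    rw [injective_iff_map_eq_zero]
    intro x hx
    have h := (OSymPres.oddSeq R n).adjoin_le_span_mon R (OSymPres.gen_zero R n) n
      (OSymPres.gen_top R n) (x := x) (by rw [OSymPres.adjoin_gen]; trivial)
    rw [Finsupp.mem_span_range_iff_exists_finsupp] at h
    obtain ⟨c, rfl⟩ := h
    rw [Finsupp.sum, map_sum] at hx
    simp only [map_smul, hmon] at hx
    have hc : c = 0 := by
      apply linearIndependent_iff.mp (linearIndependent_epsMon R n)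
      rw [Finsupp.linearCombination_apply]
      exact hx
    rw [hc, Finsupp.sum_zero_index]
  have hsurj : Function.Surjective ψ := by
    rw [← AlgHom.range_eq_top, eq_top_iff, ← adjoin_eps, Algebra.adjoin_le_iff]
    rintro _ ⟨r, rfl⟩
    exact ⟨OSymPres.gen R n r, (hψ r).trans (epsZ_natCast R n r)⟩
  refine ⟨φ.comp (AlgEquiv.ofBijective ψ ⟨hinj, hsurj⟩).symm.toAlgHom, fun r => ?_⟩
  have : (AlgEquiv.ofBijective ψ ⟨hinj, hsurj⟩).symm (eps R n r) = OSymPres.gen R n r := by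
    rw [AlgEquiv.symm_apply_eq]
    change _ = ψ _
    rw [hψ, epsZ_natCast]
  change φ ((AlgEquiv.ofBijective ψ ⟨hinj, hsurj⟩).symm (eps R n r)) = _
  rw [this, hφ]

end Presentation

/-! ### Odd complete functions, their reversed form, and the inverse series. -/

section CompleteFunctions

variable (R : Type*) [CommRing R] (n : ℕ)

/-- The reversed odd complete symmetric polynomials, the sums of all `x̃_{i_1} ⋯ x̃_{i_r}` with
`i_1 ≥ ⋯ ≥ i_r`. -/
def kPoly (r : ℕ) : OPol R n := PowerSeries.coeff r (hSeries (List.ofFn (xTilde R n)).reverse)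

theorem coeff_hSeries_xTilde (r : ℕ) :
    PowerSeries.coeff r (hSeries (List.ofFn (xTilde R n))) = hPoly R n r := by
  have := congrArg (PowerSeries.coeff r) (mk_complete n (xTilde R n))
  rw [PowerSeries.coeff_mk] at this
  rw [hPoly, this, hSeries, List.map_ofFn]
  rfl

/-- The signed elementary functions `(-1)^r ε_r`, whose generating series is inverse to that of the
reversed odd complete symmetric polynomials. -/
def eNeg (r : ℕ) : OSym R n := (-1) ^ r * eps R n r

/-- The signed elementary functions `(-1)^{r+1 choose 2} ε_r`, whose generating series is inverse to
that of the odd complete symmetric polynomials. -/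
def eAlt (r : ℕ) : OSym R n := (-1) ^ r * ((-1) ^ r.choose 2 * eps R n r)

theorem eNeg_zero : eNeg R n 0 = 1 := by simp [eNeg, eps_zero]

theorem eAlt_zero : eAlt R n 0 = 1 := by simp [eAlt, eps_zero]

theorem signEq_eNeg (r : ℕ) : SignEq (eNeg R n r) (eps R n r) := signEq_neg_one_pow_mul _ _

theorem signEq_eAlt (r : ℕ) : SignEq (eAlt R n r) (eps R n r) :=
  (signEq_neg_one_pow_mul _ _).trans (signEq_neg_one_pow_mul _ _)

theorem eNeg_coe (r : ℕ) : (eNeg R n r : OPol R n) =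
    PowerSeries.coeff r (epsSeries ((List.ofFn (xTilde R n)).map fun a => -a)) := by
  rw [coeff_epsSeries, listEps_map_neg]
  simp [eNeg, eps, epsPoly]

/-- Reversing the list accounts for `(-1)^(r choose 2)` and negating its entries for `(-1)^r`. -/
theorem eAlt_coe (r : ℕ) : (eAlt R n r : OPol R n) =
    PowerSeries.coeff r (epsSeries ((List.ofFn (xTilde R n)).reverse.map fun a => -a)) := by
  rw [coeff_epsSeries, listEps_map_neg, listEps_reverse _ (antiComm_xTilde R n).pairwise_ofFn]
  simp [eAlt, eps, epsPoly]

/-- The series of the `kPoly` is inverse to a series with constant term one and odd symmetric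
coefficients, so its coefficients are odd symmetric by recursion. -/
theorem kPoly_mem (r : ℕ) : kPoly R n r ∈ OSym R n := by
  have h := hSeries_mul_epsSeries (List.ofFn (xTilde R n)).reverse
  rw [List.reverse_reverse] at h
  induction r using Nat.strong_induction_on with
  | _ r ih =>
    have h1 := congrArg (PowerSeries.coeff r) h
    rw [PowerSeries.coeff_mul, Finset.Nat.sum_antidiagonal_eq_sum_range_succ_mk,
      Finset.sum_range_succ, Nat.sub_self, PowerSeries.coeff_one] at h1
    simp only [← eNeg_coe, eNeg_zero, OneMemClass.coe_one, mul_one] at h1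
    have h2 : kPoly R n r = (if r = 0 then 1 else 0) - ∑ i ∈ Finset.range r,
        kPoly R n i * (eNeg R n (r - i) : OPol R n) := by
      rw [← h1]
      simp [kPoly]
    rw [h2]
    refine sub_mem ?_ (sum_mem fun i hi => mul_mem (ih i (by simpa using hi)) (SetLike.coe_mem _))
    split_ifs
    · exact one_mem _
    · exact zero_mem _

/-- The reversed odd complete symmetric polynomials as elements of the algebra of odd symmetric
polynomials. -/
def kSym (r : ℕ) : OSym R n := ⟨kPoly R n r, kPoly_mem R n r⟩

/-- Generating series of sequences of odd symmetric polynomials. -/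
abbrev osymSeries (a : ℕ → OSym R n) : PowerSeries (OSym R n) := PowerSeries.mk a

theorem map_val_injective {S : Type*} [Ring S] [Algebra R S] (A : Subalgebra R S) :
    Function.Injective (PowerSeries.map (A.val : A →+* S)) := by
  intro F G h
  ext r
  have := congrArg (PowerSeries.coeff r) h
  simpa using this

theorem map_val_hSym : PowerSeries.map ((OSym R n).val : OSym R n →+* OPol R n)
    (osymSeries R n (hSym R n)) = hSeries (List.ofFn (xTilde R n)) := by
  ext r
  rw [PowerSeries.coeff_map, PowerSeries.coeff_mk, coeff_hSeries_xTilde]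
  rfl

theorem map_val_kSym : PowerSeries.map ((OSym R n).val : OSym R n →+* OPol R n)
    (osymSeries R n (kSym R n)) = hSeries (List.ofFn (xTilde R n)).reverse := by
  ext r
  rw [PowerSeries.coeff_map, PowerSeries.coeff_mk]
  rfl

theorem map_val_eNeg : PowerSeries.map ((OSym R n).val : OSym R n →+* OPol R n)
    (osymSeries R n (eNeg R n)) = epsSeries ((List.ofFn (xTilde R n)).map fun a => -a) := by
  ext r
  rw [PowerSeries.coeff_map, PowerSeries.coeff_mk, ← eNeg_coe]
  rfl

theorem map_val_eAlt : PowerSeries.map ((OSym R n).val : OSym R n →+* OPol R n)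
    (osymSeries R n (eAlt R n)) = epsSeries ((List.ofFn (xTilde R n)).reverse.map fun a => -a) := by
  ext r
  rw [PowerSeries.coeff_map, PowerSeries.coeff_mk, ← eAlt_coe]
  rfl

theorem hSym_mul_eAlt : osymSeries R n (hSym R n) * osymSeries R n (eAlt R n) = 1 := by
  apply map_val_injective R (OSym R n)
  rw [map_mul, map_val_hSym, map_val_eAlt, hSeries_mul_epsSeries, map_one]

theorem eAlt_mul_hSym : osymSeries R n (eAlt R n) * osymSeries R n (hSym R n) = 1 := by
  apply map_val_injective R (OSym R n)
  rw [map_mul, map_val_hSym, map_val_eAlt, epsSeries_mul_hSeries, map_one]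

theorem eNeg_mul_kSym : osymSeries R n (eNeg R n) * osymSeries R n (kSym R n) = 1 := by
  apply map_val_injective R (OSym R n)
  rw [map_mul, map_val_kSym, map_val_eNeg, map_one]
  have := epsSeries_mul_hSeries (List.ofFn (xTilde R n)).reverse
  rwa [List.reverse_reverse] at this

/-- The odd complete symmetric polynomials, indexed by the integers. -/
def hZ (r : ℤ) : OSym R n := if r < 0 then 0 else hSym R n r.toNat

theorem hZ_natCast (r : ℕ) : hZ R n r = hSym R n r := by simp [hZ]

theorem oddSeq_hZ : OddSeq (hZ R n) := by
  refine OddSeq.of_map (OSym R n).val Subtype.val_injective ?_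
  have := oddSeq_hSeries _ (antiComm_xTilde R n).pairwise_ofFn
  convert this using 1
  funext r
  unfold hZ zCoeff
  split_ifs
  · rfl
  · rw [coeff_hSeries_xTilde]; rfl

end CompleteFunctions

/-! ### The action of the longest permutation on the generating functions. -/

section Reversal

variable (R : Type*) [CommRing R] (n : ℕ)

/-- The action of the longest permutation. -/
abbrev revAct : OPol R n →ₐ[R] OPol R n := permAct R n Fin.revPerm

/-- The sign of the permutation and the signs built into the two signed variables combine to a sign
which does not depend on `i`. Hence the action amounts to reversing the list, up to one global sign
of the variables. -/
theorem revAct_xTilde : ∃ τ : ℕ, ∀ i,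
    revAct R n (xTilde R n i) = (-1) ^ τ * xTilde R n (Fin.rev i) := by
  have hs : ∃ t : ℕ, ∀ i, revAct R n (xVar R n i) = (-1) ^ t * xVar R n (Fin.rev i) := by
    rcases Int.units_eq_one_or (Equiv.Perm.sign (Fin.revPerm (n := n))) with h | h
    · exact ⟨0, fun i => by rw [permAct_X, h]; simp⟩
    · exact ⟨1, fun i => by rw [permAct_X, h]; simp⟩
  obtain ⟨t, ht⟩ := hs
  refine ⟨t + (n - 1), fun i => ?_⟩
  unfold xTilde
  rw [map_mul, map_pow, map_neg, map_one, ht, ← mul_assoc, ← mul_assoc, ← pow_add, ← pow_add,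
    Fin.val_rev]
  congr 1
  have : t + (n - 1) + (n - (i + 1)) = (i + t) + 2 * (n - (i + 1)) := by
    have := i.2
    omega
  rw [this, pow_add _ _ (2 * _), pow_mul]
  simp

theorem revAct_revAct (f : OPol R n) : revAct R n (revAct R n f) = f := by
  have : (revAct R n).comp (revAct R n) = AlgHom.id R _ := by
    apply OPol.algHom_ext
    intro i
    rw [AlgHom.comp_apply, permAct_X]
    rcases Int.units_eq_one_or (Equiv.Perm.sign (Fin.revPerm (n := n))) with h | h <;> rw [h] <;>
      simp [permAct_X, h]
  exact DFunLike.congr_fun this f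

theorem reverse_ofFn {α : Type*} {n : ℕ} (f : Fin n → α) :
    (List.ofFn f).reverse = List.ofFn fun i => f (Fin.rev i) := by
  apply List.ext_getElem
  · simp
  · intro i h1 h2
    simp only [List.getElem_reverse, List.getElem_ofFn, List.length_ofFn]
    congr 1
    simp [Fin.ext_iff, Fin.val_rev]
    omega

theorem map_revAct_reverse : ∃ τ : ℕ, (List.ofFn (xTilde R n)).reverse.map (revAct R n) =
    (List.ofFn (xTilde R n)).map fun a => (-1) ^ τ * a := by
  obtain ⟨τ, h⟩ := revAct_xTilde R n
  refine ⟨τ, ?_⟩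
  rw [reverse_ofFn, List.map_ofFn, List.map_ofFn]
  congr 1
  funext i
  simp [h]

theorem coeff_hSeries_map_neg {S : Type*} [Ring S] (l : List S) (r : ℕ) :
    PowerSeries.coeff r (hSeries (l.map fun a => -a)) =
      (-1) ^ r * PowerSeries.coeff r (hSeries l) := by
  induction l generalizing r with
  | nil => cases r <;> simp [hSeries, PowerSeries.coeff_one]
  | cons a l ih =>
    have e : ∀ (b : S) (m : List S), hSeries (b :: m) = geomSeries b * hSeries m := fun b m => by
      simp [hSeries]
    rw [List.map_cons, e, e, PowerSeries.coeff_mul, PowerSeries.coeff_mul, Finset.mul_sum]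
    refine Finset.sum_congr rfl fun p hp => ?_
    rw [ih, ← Finset.HasAntidiagonal.mem_antidiagonal.mp hp, geomSeries, geomSeries,
      PowerSeries.coeff_mk, PowerSeries.coeff_mk, neg_pow, pow_add]
    have c : a ^ p.1 * (-1) ^ p.2 = (-1) ^ p.2 * a ^ p.1 :=
      ((Commute.neg_one_left (a ^ p.1)).pow_left p.2).symm.eq
    rw [mul_assoc, ← mul_assoc (a ^ p.1), c]
    simp only [mul_assoc]

theorem signEq_coeff_map {S : Type*} [Ring S] (F : List S → ℕ → S)
    (hF : ∀ l r, F (l.map fun a => -a) r = (-1) ^ r * F l r) (l : List S) (τ r : ℕ) :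
    SignEq (F (l.map fun a => (-1) ^ τ * a) r) (F l r) := by
  rcases neg_one_pow_eq_or S τ with h | h
  · simp [h, SignEq]
  · simp only [h, neg_one_mul, hF]
    exact signEq_neg_one_pow_mul _ _

theorem map_hSeries {S S' : Type*} [Ring S] [Ring S'] (φ : S →+* S') (l : List S) :
    PowerSeries.map φ (hSeries l) = hSeries (l.map φ) := by
  rw [hSeries, map_list_prod, hSeries, List.map_map, List.map_map]
  congr 2
  funext a
  ext r
  simp [geomSeries]

/-- This transfers spanning results from the reversed complete functions to the `hSym`. -/
theorem revAct_kPoly (r : ℕ) : SignEq (revAct R n (kPoly R n r)) (hPoly R n r) := by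
  obtain ⟨τ, h⟩ := map_revAct_reverse R n
  have h1 : revAct R n (kPoly R n r) = PowerSeries.coeff r
      (hSeries ((List.ofFn (xTilde R n)).reverse.map (revAct R n))) := by
    rw [kPoly]
    have := map_hSeries (revAct R n : OPol R n →+* OPol R n) (List.ofFn (xTilde R n)).reverse
    have := congrArg (PowerSeries.coeff r) this
    rw [PowerSeries.coeff_map] at this
    exact this
  rw [h1, h, ← coeff_hSeries_xTilde]
  exact signEq_coeff_map (fun l r => PowerSeries.coeff r (hSeries l)) coeff_hSeries_map_neg _ _ _

theorem revAct_epsPoly (r : ℕ) : SignEq (revAct R n (epsPoly R n r)) (epsPoly R n r) := by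
  obtain ⟨τ, h⟩ := map_revAct_reverse R n
  have h1 := map_listEps (revAct R n) (List.ofFn (xTilde R n)).reverse r
  rw [h, listEps_reverse _ (antiComm_xTilde R n).pairwise_ofFn] at h1
  have h2 := (signEq_neg_one_pow_mul (r.choose 2) (epsPoly R n r)).map (revAct R n)
  rw [epsPoly] at h2 ⊢
  rw [h1] at h2
  exact h2.symm.trans (signEq_coeff_map listEps listEps_map_neg _ _ _)

theorem revAct_mem {f : OPol R n} (hf : f ∈ OSym R n) : revAct R n f ∈ OSym R n := by
  rw [OSym_eq_epsAdjoin] at hf ⊢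
  have : epsAdjoin R (List.ofFn (xTilde R n)) ≤
      (epsAdjoin R (List.ofFn (xTilde R n))).comap (revAct R n) := by
    conv_lhs => unfold epsAdjoin
    rw [Algebra.adjoin_le_iff]
    rintro _ ⟨r, rfl⟩
    exact ((revAct_epsPoly R n r).mem_iff _).mpr (listEps_mem_epsAdjoin _ r)
  exact this hf

end Reversal

/-! ### Changing the list of variables in products of spans. -/

section SpanProducts

variable {R : Type*} [CommRing R] {S : Type*} [Ring S] [Algebra R S]

theorem SignComm.span_mul_span_le {ι κ : Type*} {a : ι → S} {b : κ → S}
    (h : ∀ i j, SignComm (a i) (b j)) :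
    Submodule.span R (Set.range a) * Submodule.span R (Set.range b) ≤
      Submodule.span R (Set.range b) * Submodule.span R (Set.range a) := by
  rw [Submodule.span_mul_span, Submodule.span_le]
  rintro _ ⟨_, ⟨i, rfl⟩, _, ⟨j, rfl⟩, rfl⟩
  exact ((h i j).mem_iff _).mpr (Submodule.mul_mem_mul (Submodule.subset_span ⟨j, rfl⟩)
    (Submodule.subset_span ⟨i, rfl⟩))

variable (R) in
/-- The span of the powers of an element. -/
def powSpan (y : S) : Submodule R S := Submodule.span R (Set.range fun j : ℕ => y ^ j)

theorem pow_mem_powSpan (y : S) (j : ℕ) : y ^ j ∈ powSpan R y := Submodule.subset_span ⟨j, rfl⟩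

theorem one_le_powSpan (y : S) : 1 ≤ powSpan R y :=
  Submodule.one_le.mpr (by simpa using pow_mem_powSpan (R := R) y 0)

theorem powSpan_mul_self (y : S) : powSpan R y * powSpan R y = powSpan R y := by
  refine le_antisymm ?_ (le_mul_of_one_le_right' (one_le_powSpan y))
  conv_lhs => unfold powSpan
  rw [Submodule.span_mul_span, Submodule.span_le]
  rintro _ ⟨_, ⟨i, rfl⟩, _, ⟨j, rfl⟩, rfl⟩
  change y ^ i * y ^ j ∈ _
  rw [← pow_add]
  exact pow_mem_powSpan y _

variable (R) in
/-- The span of the coefficients of the generating series of complete functions. -/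
def hSpan (l : List S) : Submodule R S :=
  Submodule.span R (Set.range fun r => PowerSeries.coeff r (hSeries l))

theorem coeff_mem_hSpan (l : List S) (r : ℕ) : PowerSeries.coeff r (hSeries l) ∈ hSpan R l :=
  Submodule.subset_span ⟨r, rfl⟩

theorem signComm_coeff_hSeries {y : S} {l : List S} (h : ∀ b ∈ l, b * y = -(y * b)) (r j : ℕ) :
    SignComm (PowerSeries.coeff r (hSeries l)) (y ^ j) := by
  refine SignComm.pow_right ?_ j
  have := signEq_neg_one_pow_mul r (y * PowerSeries.coeff r (hSeries l))
  rwa [← hSeries_mul_of_list_anticomm h] at this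

/-- The identity `H(l ++ [y]) = H(l) (1 - yX)⁻¹` is solved recursively for the coefficients of
`H(l)`; powers of `y` move to the left up to sign. -/
theorem hSpan_le {y : S} {l : List S} (h : ∀ b ∈ l, b * y = -(y * b)) :
    hSpan R l ≤ powSpan R y * hSpan R (l ++ [y]) := by
  conv_lhs => unfold hSpan
  rw [Submodule.span_le]
  rintro _ ⟨r, rfl⟩
  change PowerSeries.coeff r (hSeries l) ∈ _
  induction r using Nat.strong_induction_on with
  | _ r ih =>
    have e : PowerSeries.coeff r (hSeries (l ++ [y])) =
        ∑ i ∈ Finset.range r, PowerSeries.coeff i (hSeries l) * y ^ (r - i) +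
          PowerSeries.coeff r (hSeries l) := by
      have : hSeries (l ++ [y]) = hSeries l * geomSeries y := by simp [hSeries]
      rw [this, PowerSeries.coeff_mul, Finset.Nat.sum_antidiagonal_eq_sum_range_succ_mk,
        Finset.sum_range_succ]
      simp [geomSeries]
    rw [← sub_eq_iff_eq_add'] at e
    rw [← e]
    refine sub_mem ?_ (sum_mem fun i hi => ?_)
    · have := Submodule.mul_mem_mul (pow_mem_powSpan (R := R) y 0) (coeff_mem_hSpan (R := R) (l ++ [y]) r)
      simpa using this
    · refine ((signComm_coeff_hSeries h i (r - i)).mem_iff _).mpr ?_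
      rw [← powSpan_mul_self, mul_assoc]
      exact Submodule.mul_mem_mul (pow_mem_powSpan y _) (ih i (by simpa using hi))

/-- All powers of `y` merge on the left while the number `p` of complete functions is preserved;
this number matters later. -/
theorem hSpan_pow_le {y : S} {l : List S} (h : ∀ b ∈ l, b * y = -(y * b)) (p : ℕ) :
    hSpan R l ^ p ≤ powSpan R y * hSpan R (l ++ [y]) ^ p := by
  induction p with
  | zero => simpa using one_le_powSpan y
  | succ p ih =>
    calc hSpan R l ^ (p + 1) ≤ hSpan R l * (powSpan R y * hSpan R (l ++ [y]) ^ p) := by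
          rw [pow_succ']; gcongr
      _ = hSpan R l * powSpan R y * hSpan R (l ++ [y]) ^ p := (mul_assoc _ _ _).symm
      _ ≤ powSpan R y * hSpan R l * hSpan R (l ++ [y]) ^ p := by
          exact mul_le_mul_left (SignComm.span_mul_span_le (R := R) fun r j =>
            signComm_coeff_hSeries h r j) _
      _ ≤ powSpan R y * (powSpan R y * hSpan R (l ++ [y])) * hSpan R (l ++ [y]) ^ p := by
          gcongr
          exact hSpan_le h
      _ = _ := by
          rw [← mul_assoc (powSpan R y), powSpan_mul_self, mul_assoc, ← pow_succ']

/-- An elementary function of `y :: l` is linear in `y` over those of `l`, and `y` can be moved to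
the left past elementary functions of `l` up to sign. -/
theorem epsAdjoin_cons_le {y : S} {l : List S} (h : ∀ b ∈ l, b * y = -(y * b)) :
    Subalgebra.toSubmodule (epsAdjoin R (y :: l)) ≤
      powSpan R y * Subalgebra.toSubmodule (epsAdjoin R l) := by
  have hswap : Submodule.span R (Set.range (listEps l)) * powSpan R y ≤
      powSpan R y * Submodule.span R (Set.range (listEps l)) := by
    refine SignComm.span_mul_span_le fun r j => SignComm.pow_right ?_ j
    have := signEq_neg_one_pow_mul r (y * listEps l r)
    rwa [← listEps_mul_of_anticomm y l h] at this
  have hE : Submodule.span R (Set.range (listEps l)) * Subalgebra.toSubmodule (epsAdjoin R l) ≤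
      Subalgebra.toSubmodule (epsAdjoin R l) := by
    refine Submodule.mul_le.mpr fun x hx z hz => ?_
    have : Submodule.span R (Set.range (listEps l)) ≤ Subalgebra.toSubmodule (epsAdjoin R l) :=
      Submodule.span_le.mpr Algebra.subset_adjoin
    exact mul_mem (S := Subalgebra R S) (this hx) hz
  have hgen : ∀ r, listEps (y :: l) r ∈
      powSpan R y * Submodule.span R (Set.range (listEps l)) := by
    have h0 : ∀ j r, y ^ j * listEps l r ∈
        powSpan R y * Submodule.span R (Set.range (listEps l)) := fun j r =>
      Submodule.mul_mem_mul (pow_mem_powSpan y j) (Submodule.subset_span ⟨r, rfl⟩)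
    rintro (_ | r)
    · simpa [listEps_zero] using h0 0 0
    · rw [listEps_cons_succ]
      exact add_mem (by simpa using h0 0 (r + 1)) (by simpa using h0 1 r)
  have key : ∀ e ∈ epsAdjoin R (y :: l), ∀ z ∈ powSpan R y * Subalgebra.toSubmodule (epsAdjoin R l),
      e * z ∈ powSpan R y * Subalgebra.toSubmodule (epsAdjoin R l) := by
    intro e he
    unfold epsAdjoin at he
    induction he using Algebra.adjoin_induction with
    | mem x hx =>
      obtain ⟨r, rfl⟩ := hx
      intro z hz
      refine le_trans ?_ (le_of_eq (by rw [← mul_assoc, powSpan_mul_self] :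
        powSpan R y * (powSpan R y * Subalgebra.toSubmodule (epsAdjoin R l)) = _))
        (Submodule.mul_mem_mul (hgen r) hz)
      rw [mul_assoc]
      refine mul_le_mul_right ?_ (powSpan R y)
      rw [← mul_assoc]
      refine (mul_le_mul_left hswap _).trans ?_
      rw [mul_assoc]
      exact mul_le_mul_right hE _
    | algebraMap r => intro z hz; rw [← Algebra.smul_def]; exact Submodule.smul_mem _ r hz
    | add x x' _ _ hx hx' => intro z hz; rw [add_mul]; exact add_mem (hx z hz) (hx' z hz)
    | mul x x' _ _ hx hx' => intro z hz; rw [mul_assoc]; exact hx _ (hx' z hz)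
  intro e he
  have := key e he 1 (by
    simpa using Submodule.mul_mem_mul (pow_mem_powSpan (R := R) y 0) (one_mem (epsAdjoin R l)))
  simpa using this

end SpanProducts

/-! ### Odd symmetric polynomials as combinations of products of exactly `n` complete functions. -/

section CompleteSpan

variable (R : Type*) [CommRing R] (n : ℕ)

variable {R n} in
/-- The homomorphism from skew polynomials determined by an anticommuting family. -/
def OPol.liftTilde {S : Type*} [Ring S] [Algebra R S] (v : Fin n → S) (hv : AntiComm v) :
    OPol R n →ₐ[R] S :=
  OPol.lift R n (fun i => (-1) ^ (i : ℕ) * v i) (by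
    intro i j hij
    have := hv i j hij
    rcases neg_one_pow_eq_or S (i : ℕ) with h | h <;>
    rcases neg_one_pow_eq_or S (j : ℕ) with h' | h' <;>
    simp [h, h', this])

variable {R n} in
theorem OPol.liftTilde_xTilde {S : Type*} [Ring S] [Algebra R S] (v : Fin n → S) (hv : AntiComm v)
    (i : Fin n) : OPol.liftTilde (R := R) v hv (xTilde R n i) = v i := by
  rw [xTilde, map_mul, map_pow, map_neg, map_one, OPol.liftTilde, OPol.lift_X, ← mul_assoc,
    ← pow_add, Even.neg_one_pow ⟨_, rfl⟩, one_mul]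

variable {R n} in
theorem OPol.map_liftTilde_ofFn {S : Type*} [Ring S] [Algebra R S] (v : Fin n → S)
    (hv : AntiComm v) : (List.ofFn (xTilde R n)).map (OPol.liftTilde (R := R) v hv) =
      List.ofFn v := by
  rw [List.map_ofFn]
  congr 1
  funext i
  exact OPol.liftTilde_xTilde v hv i

theorem stairFamily_eq (κ c : Fin n → ℕ) (hκ : ∀ i, κ i < n - i) :
    stairFamily R n (fun i => κ i + (n - i) * c i) = mon (xTilde R n) κ * epsMon R n c := by
  rw [stairFamily, epsMon_coe]
  congr 2 <;> funext i
  · rw [Nat.add_mul_mod_self_left, Nat.mod_eq_of_lt (hκ i)]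
  · rw [Nat.add_mul_div_left _ _ (by have := i.2; omega), Nat.div_eq_of_lt (hκ i), zero_add]

/-- The basis of skew polynomials exhibiting them as a free module over odd symmetric
polynomials. -/
def stairBasis : Module.Basis (Fin n → ℕ) R (OPol R n) :=
  Module.Basis.mk (linearIndependent_stairFamily R n) (span_stairFamily R n).ge

/-- The coefficient of a staircase monomial in the expansion of a skew polynomial over odd symmetric
polynomials. -/
def stairCoeff (κ : Fin n → ℕ) : OPol R n →ₗ[R] OPol R n :=
  (stairBasis R n).constr R fun a =>
    if (fun i => a i % (n - i)) = κ then (epsMon R n fun i => a i / (n - i) : OPol R n) else 0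

theorem stairCoeff_stairFamily (κ a : Fin n → ℕ) :
    stairCoeff R n κ (stairFamily R n a) =
      if (fun i => a i % (n - i)) = κ then (epsMon R n fun i => a i / (n - i) : OPol R n) else 0 := by
  have h : stairBasis R n a = stairFamily R n a := Module.Basis.mk_apply _ _ _
  rw [← h]
  exact (stairBasis R n).constr_basis R _ a

theorem stairCoeff_mon_mul_epsMon (κ κ' c : Fin n → ℕ) (hκ : ∀ i, κ' i < n - i) :
    stairCoeff R n κ (mon (xTilde R n) κ' * epsMon R n c) =
      if κ' = κ then (epsMon R n c : OPol R n) else 0 := by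
  have h2 : (fun i : Fin n => (κ' i + (n - i) * c i) % (n - i)) = κ' := by
    funext i
    rw [Nat.add_mul_mod_self_left, Nat.mod_eq_of_lt (hκ i)]
  have h3 : (fun i : Fin n => (κ' i + (n - i) * c i) / (n - i)) = c := by
    funext i
    rw [Nat.add_mul_div_left _ _ (by have := i.2; omega), Nat.div_eq_of_lt (hκ i), zero_add]
  rw [← stairFamily_eq R n κ' c hκ, stairCoeff_stairFamily, h2, h3]

theorem stairCoeff_mon_mul (κ κ' : Fin n → ℕ) (hκ : ∀ i, κ' i < n - i) {e : OPol R n}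
    (he : e ∈ OSym R n) :
    stairCoeff R n κ (mon (xTilde R n) κ' * e) = if κ' = κ then e else 0 := by
  have h : (⟨e, he⟩ : OSym R n) ∈ Submodule.span R (Set.range (epsMon R n)) := by
    rw [span_epsMon]; trivial
  let F : OSym R n →ₗ[R] OPol R n :=
    stairCoeff R n κ ∘ₗ LinearMap.mulLeft R (mon (xTilde R n) κ') ∘ₗ (OSym R n).val.toLinearMap
  let G : OSym R n →ₗ[R] OPol R n := if κ' = κ then (OSym R n).val.toLinearMap else 0
  have hFG : Set.EqOn F G (Set.range (epsMon R n)) := by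
    rintro _ ⟨c, rfl⟩
    refine (stairCoeff_mon_mul_epsMon R n κ κ' c hκ).trans ?_
    by_cases hk : κ' = κ
    · simp only [G, if_pos hk]; rfl
    · simp only [G, if_neg hk]; rfl
  refine (LinearMap.eqOn_span hFG h).trans ?_
  by_cases hk : κ' = κ
  · simp only [G, if_pos hk]; rfl
  · simp only [G, if_neg hk]; rfl

/-- Skew polynomials form a free right module over `OΛ_n` on the staircase monomials, and
`stairCoeff` is a coordinate of this module. -/
theorem stairCoeff_mul (κ : Fin n → ℕ) (f : OPol R n) {e : OPol R n} (he : e ∈ OSym R n) :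
    stairCoeff R n κ (f * e) = stairCoeff R n κ f * e := by
  have h : f ∈ Submodule.span R (Set.range (stairFamily R n)) := by rw [span_stairFamily]; trivial
  induction h using Submodule.span_induction with
  | mem x hx =>
    obtain ⟨a, rfl⟩ := hx
    rw [stairFamily, ← epsMon_coe, mul_assoc]
    have h1 : ∀ i : Fin n, a i % (n - i) < n - i := fun i =>
      Nat.mod_lt _ (by have := i.2; omega)
    rw [stairCoeff_mon_mul R n κ _ h1 (mul_mem (SetLike.coe_mem _) he),
      stairCoeff_mon_mul R n κ _ h1 (SetLike.coe_mem _)]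
    split_ifs <;> simp
  | zero => simp
  | add x y _ _ hx hy => rw [add_mul, map_add, map_add, hx, hy, add_mul]
  | smul r x _ hx => rw [smul_mul_assoc, map_smul, map_smul, hx, smul_mul_assoc]

/-- The coefficient of the highest power of the first variable. -/
def topCoeff (m : ℕ) : OPol R (m + 1) →ₗ[R] OPol R (m + 1) :=
  stairCoeff R (m + 1) (Pi.single 0 m)

theorem topCoeff_pow_mul (m : ℕ) (b : ℕ) (hb : b ≤ m) {e : OPol R (m + 1)}
    (he : e ∈ OSym R (m + 1)) :
    topCoeff R m (xTilde R (m + 1) 0 ^ b * e) = if b = m then e else 0 := by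
  have h : mon (xTilde R (m + 1)) (Pi.single 0 b) = xTilde R (m + 1) 0 ^ b := by
    rw [mon_succ]
    simp only [Pi.single_eq_same, Pi.single_eq_of_ne (Fin.succ_ne_zero _), mon_zero, mul_one]
  rw [← h, topCoeff, stairCoeff_mon_mul R _ _ _ _ he]
  · have : (Pi.single 0 b : Fin (m + 1) → ℕ) = Pi.single 0 m ↔ b = m :=
      (Pi.single_injective (M := fun _ : Fin (m + 1) => ℕ) 0).eq_iff
    simp only [this]
  · intro i
    refine Fin.cases ?_ (fun j => ?_) i
    · simp; omega
    · rw [Pi.single_eq_of_ne (Fin.succ_ne_zero _)]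
      have := j.succ.2
      omega

/-- Let `y` be the first variable. The geometric series of `y` times `EN` is the elementary series
of the remaining negated variables, a polynomial of degree at most `m`. Applying the right linear
`topCoeff` coefficientwise shows that the left-hand series times `EN` is `X^m`, and `EN` is inverse
to the series of the `kPoly`. -/
theorem topCoeff_pow (m : ℕ) : PowerSeries.mk (fun b => topCoeff R m (xTilde R (m + 1) 0 ^ b)) =
    PowerSeries.X ^ m * PowerSeries.mk (kPoly R (m + 1)) := by
  have hK : PowerSeries.mk (kPoly R (m + 1)) =
      hSeries (List.ofFn (xTilde R (m + 1))).reverse := by ext r; simp [kPoly]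
  have hKE := hSeries_mul_epsSeries (List.ofFn (xTilde R (m + 1))).reverse
  have hEK := epsSeries_mul_hSeries (List.ofFn (xTilde R (m + 1))).reverse
  rw [List.reverse_reverse, ← hK] at hKE hEK
  set EN := epsSeries ((List.ofFn (xTilde R (m + 1))).map fun a => -a) with hEN
  suffices h : PowerSeries.mk (fun b => topCoeff R m (xTilde R (m + 1) 0 ^ b)) * EN =
      PowerSeries.X ^ m by
    rw [← h, mul_assoc, hEK, mul_one]
  set l := List.ofFn fun i : Fin m => xTilde R (m + 1) i.succ
  have hl : EN = (1 + PowerSeries.C (-xTilde R (m + 1) 0) * PowerSeries.X) *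
      epsSeries (l.map fun a => -a) := by
    rw [hEN, List.ofFn_succ]
    simp [epsSeries, l]
  have hmem : ∀ r, PowerSeries.coeff r EN ∈ OSym R (m + 1) := fun r => by
    rw [hEN, ← eNeg_coe]; exact SetLike.coe_mem _
  have hcomp : ∀ r, PowerSeries.coeff r (PowerSeries.mk
      (fun b => topCoeff R m (xTilde R (m + 1) 0 ^ b)) * EN) =
        topCoeff R m (PowerSeries.coeff r (epsSeries (l.map fun a => -a))) := by
    intro r
    have : epsSeries (l.map fun a => -a) = geomSeries (xTilde R (m + 1) 0) * EN := by
      rw [hl, ← mul_assoc, geomSeries_mul_linear, one_mul]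
    rw [this, PowerSeries.coeff_mul, PowerSeries.coeff_mul, map_sum]
    refine Finset.sum_congr rfl fun p _ => ?_
    rw [PowerSeries.coeff_mk, geomSeries, PowerSeries.coeff_mk, topCoeff,
      stairCoeff_mul R _ _ _ (hmem _)]
  ext r
  rw [PowerSeries.coeff_X_pow]
  rcases lt_or_ge m r with h | h
  -- Only `m` variables remain, so there is no elementary function above degree `m`.
  · rw [hcomp, coeff_epsSeries, listEps_eq_zero _ _ (by simpa [l] using h), map_zero,
      if_neg (by omega)]
  -- Up to degree `m` the powers of `y` are themselves staircase monomials, and only `y^m` has a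
  -- nonzero top coefficient.
  · rw [PowerSeries.coeff_mul, Finset.Nat.sum_antidiagonal_eq_sum_range_succ_mk,
      Finset.sum_eq_single r]
    · simp only [PowerSeries.coeff_mk, Nat.sub_self]
      have e0 : PowerSeries.coeff 0 EN = 1 := by
        rw [hEN, coeff_epsSeries, listEps_zero]
      have := topCoeff_pow_mul R m r h (one_mem _)
      rw [e0, mul_one]
      rwa [mul_one] at this
    · intro b hb hbr
      have hb' : b < r := by simp at hb; omega
      have := topCoeff_pow_mul R m b (by omega) (one_mem _)
      rw [mul_one, if_neg (by omega)] at this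
      simp [this]
    · intro hr; simp at hr

/-- Induction on the number of variables. With `y` the first of `m + 1` variables, `y^m f` is a
combination of powers of `y` times symmetric functions of the other variables; by induction these
are products of `m` complete functions, which can be rewritten in all variables at the cost of
powers of `y`. Taking the coefficient of `y^m` returns `f` and turns each `y^b` into zero or one
more complete function. -/
theorem OSym_le_hSpan_reverse_pow :
    Subalgebra.toSubmodule (OSym R n) ≤ hSpan R (List.ofFn (xTilde R n)).reverse ^ n := by
  induction n with
  | zero =>
    rw [pow_zero, OSym_eq_epsAdjoin]
    change Subalgebra.toSubmodule (Algebra.adjoin R _) ≤ _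
    have : (Algebra.adjoin R (Set.range (listEps (List.ofFn (xTilde R 0)))) : Subalgebra R _) ≤ ⊥ := by
      rw [Algebra.adjoin_le_iff]
      rintro _ ⟨r, rfl⟩
      rcases r with _ | r
      · rw [listEps_zero]; exact one_mem _
      · rw [listEps_eq_zero _ _ (by simp)]; exact zero_mem _
    intro x hx
    obtain ⟨r, rfl⟩ := Algebra.mem_bot.mp (this hx)
    exact Submodule.algebraMap_mem r
  | succ m ih =>
    set y := xTilde R (m + 1) 0 with hy
    set l := List.ofFn fun i : Fin m => xTilde R (m + 1) i.succ with hl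
    have hyl : List.ofFn (xTilde R (m + 1)) = y :: l := by rw [List.ofFn_succ]
    have hanti : ∀ b ∈ l, b * y = -(y * b) := by
      intro b hb
      obtain ⟨i, rfl⟩ := (List.mem_ofFn' _ _).mp hb
      exact antiComm_xTilde R (m + 1) _ _ (Fin.succ_ne_zero i)
    have hvar : AntiComm fun i : Fin m => xTilde R (m + 1) i.succ := (antiComm_xTilde R _).tail
    let θ : OPol R m →ₐ[R] OPol R (m + 1) := OPol.liftTilde _ hvar
    have hθl : (List.ofFn (xTilde R m)).map θ = l := OPol.map_liftTilde_ofFn _ hvar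
    -- The induction hypothesis, carried to the last `m` variables by the homomorphism `θ`.
    have hle : Subalgebra.toSubmodule (epsAdjoin R l) ≤ hSpan R l.reverse ^ m := by
      have h1 : epsAdjoin R l = (OSym R m).map θ := by
        rw [OSym_eq_epsAdjoin, epsAdjoin, epsAdjoin, AlgHom.map_adjoin, ← Set.range_comp, ← hθl]
        congr 2
        funext r
        exact (map_listEps θ _ r).symm
      have h2 : hSpan R l.reverse =
          (hSpan R (List.ofFn (xTilde R m)).reverse).map θ.toLinearMap := by
        rw [hSpan, hSpan, Submodule.map_span, ← Set.range_comp]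
        congr 2
        funext r
        have := congrArg (PowerSeries.coeff r)
          (map_hSeries (θ : OPol R m →+* OPol R (m + 1)) (List.ofFn (xTilde R m)).reverse)
        rw [PowerSeries.coeff_map, List.map_reverse] at this
        rw [← hθl]
        exact this.symm
      rw [h1, h2, ← Submodule.map_pow]
      rintro _ ⟨f, hf, rfl⟩
      exact ⟨f, ih hf, rfl⟩
    intro f hf
    have h1 : y ^ m * f ∈ powSpan R y * hSpan R (List.ofFn (xTilde R (m + 1))).reverse ^ m := by
      have hf' := hf
      rw [OSym_eq_epsAdjoin, hyl] at hf'
      have h2 := Submodule.mul_mem_mul (pow_mem_powSpan (R := R) y m) (epsAdjoin_cons_le hanti hf')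
      rw [← mul_assoc, powSpan_mul_self] at h2
      have h3 : hSpan R l.reverse ^ m ≤
          powSpan R y * hSpan R (List.ofFn (xTilde R (m + 1))).reverse ^ m := by
        have := hSpan_pow_le (R := R) (l := l.reverse) (y := y)
          (fun b hb => hanti b (by simpa using hb)) m
        rwa [hyl, List.reverse_cons]
      have h4 := (mul_le_mul_right (hle.trans h3) (powSpan R y)) h2
      rwa [← mul_assoc, powSpan_mul_self] at h4
    have hK : ∀ x ∈ hSpan R (List.ofFn (xTilde R (m + 1))).reverse ^ m, x ∈ OSym R (m + 1) := by
      have h5 : hSpan R (List.ofFn (xTilde R (m + 1))).reverse ≤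
          Subalgebra.toSubmodule (OSym R (m + 1)) := by
        rw [hSpan, Submodule.span_le]
        rintro _ ⟨r, rfl⟩
        exact kPoly_mem R (m + 1) r
      have h6 : ∀ p, hSpan R (List.ofFn (xTilde R (m + 1))).reverse ^ p ≤
          Subalgebra.toSubmodule (OSym R (m + 1)) := by
        intro p
        induction p with
        | zero =>
          rw [pow_zero, Submodule.one_le]
          exact one_mem (OSym R (m + 1))
        | succ p ihp =>
          rw [pow_succ, Submodule.mul_le]
          exact fun x hx z hz => mul_mem (S := Subalgebra R _) (ihp hx) (h5 hz)
      exact fun x hx => h6 m hx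
    have h7 : topCoeff R m (y ^ m * f) = f := by
      rw [hy, topCoeff_pow_mul R m m le_rfl hf, if_pos rfl]
    change f ∈ _
    rw [← h7, pow_succ']
    -- `topCoeff` is right linear over the product of `m` complete functions, and by `topCoeff_pow`
    -- it maps `y^b` to `k_{b-m}` or to zero: the factor number `m + 1`.
    have h8 : powSpan R y * hSpan R (List.ofFn (xTilde R (m + 1))).reverse ^ m ≤
        (hSpan R (List.ofFn (xTilde R (m + 1))).reverse *
          hSpan R (List.ofFn (xTilde R (m + 1))).reverse ^ m).comap (topCoeff R m) := by
      rw [Submodule.mul_le]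
      intro u hu e he
      rw [Submodule.mem_comap, topCoeff, stairCoeff_mul R _ _ _ (hK e he)]
      refine Submodule.mul_mem_mul ?_ he
      change u ∈ (hSpan R (List.ofFn (xTilde R (m + 1))).reverse).comap
        (stairCoeff R (m + 1) (Pi.single 0 m))
      refine Submodule.span_le.mpr ?_ hu
      rintro _ ⟨b, rfl⟩
      have h9 := congrArg (PowerSeries.coeff b) (topCoeff_pow R m)
      rw [PowerSeries.coeff_mk, PowerSeries.coeff_X_pow_mul'] at h9
      change topCoeff R m (y ^ b) ∈ hSpan R (List.ofFn (xTilde R (m + 1))).reverse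
      rw [h9]
      split_ifs
      · rw [PowerSeries.coeff_mk]
        exact coeff_mem_hSpan _ _
      · exact zero_mem _
    exact h8 h1

/-- Every odd symmetric polynomial is a combination of products of `n` reversed odd complete
symmetric polynomials. -/
theorem span_kSym_pow : Submodule.span R (Set.range (kSym R n)) ^ n = ⊤ := by
  rw [eq_top_iff]
  rintro ⟨f, hf⟩ -
  have h := OSym_le_hSpan_reverse_pow R n hf
  have e : hSpan R (List.ofFn (xTilde R n)).reverse =
      (Submodule.span R (Set.range (kSym R n))).map (OSym R n).val.toLinearMap := by
    rw [Submodule.map_span, ← Set.range_comp]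
    rfl
  rw [e, ← Submodule.map_pow] at h
  obtain ⟨g, hg, e⟩ := h
  have : g = ⟨f, hf⟩ := Subtype.ext e
  rwa [← this]

/-- Every odd symmetric polynomial is a combination of products of `n` odd complete symmetric
polynomials. -/
theorem span_hSym_pow : Submodule.span R (Set.range (hSym R n)) ^ n = ⊤ := by
  rw [eq_top_iff]
  rintro ⟨f, hf⟩ -
  have h := OSym_le_hSpan_reverse_pow R n (revAct_mem R n hf)
  have h2 : revAct R n (revAct R n f) ∈
      (hSpan R (List.ofFn (xTilde R n)).reverse ^ n).map (revAct R n).toLinearMap := ⟨_, h, rfl⟩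
  rw [revAct_revAct, Submodule.map_pow] at h2
  have e : (hSpan R (List.ofFn (xTilde R n)).reverse).map (revAct R n).toLinearMap ≤
      (Submodule.span R (Set.range (hSym R n))).map (OSym R n).val.toLinearMap := by
    rw [hSpan, Submodule.map_span, Submodule.span_le]
    rintro _ ⟨_, ⟨r, rfl⟩, rfl⟩
    refine ((revAct_kPoly R n r).mem_iff _).mpr ?_
    exact ⟨hSym R n r, Submodule.subset_span ⟨r, rfl⟩, rfl⟩
  have h3 := pow_le_pow_left' e n h2
  rw [← Submodule.map_pow] at h3
  obtain ⟨g, hg, e⟩ := h3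
  have : g = ⟨f, hf⟩ := Subtype.ext e
  rwa [← this]

end CompleteSpan

/-! ### Odd Schur polynomials and a Pieri rule. -/

section Schur

variable (R : Type*) [CommRing R] (n : ℕ)

theorem BoxPartition.exists_part_eq {k m : ℕ} (l : Fin k → ℕ) (h : Antitone l) (hm : ∀ i, l i ≤ m) :
    ∃ μ : BoxPartition k m, μ.part = l :=
  ⟨⟨fun i => ⟨l i, Nat.lt_succ_of_le (hm i)⟩, fun _ _ hij => h hij⟩, rfl⟩

theorem BoxPartition.part_antitone {k m : ℕ} (μ : BoxPartition k m) : Antitone μ.part :=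
  fun _ _ hij => μ.2 hij

theorem BoxPartition.part_le {k m : ℕ} (μ : BoxPartition k m) (i : Fin k) : μ.part i ≤ m :=
  Nat.le_of_lt_succ (μ.1 i).2

theorem schurPoly_mem (l : Fin n → ℕ) : schurPoly R n l ∈ OSym R n := by
  unfold schurPoly
  refine mul_mem (pow_mem (neg_mem (one_mem _)) _) (revAct_mem R n ?_)
  rw [divDiffLongest_eq]
  exact wordOp_longest_mem R n _

theorem signEq_schurPoly (l : Fin n → ℕ) : SignEq (schurPoly R n l)
    (revAct R n (wordOp R n (longestWord n) (mon (xVar R n) fun i => l i + (n - 1 - i)))) := by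
  unfold schurPoly
  refine (signEq_neg_one_pow_mul _ _).trans ?_
  rw [divDiffLongest_eq]
  exact ((mon_mul_mon (antiComm_xVar R n) l fun i : Fin n => n - 1 - (i : ℕ)).map _).map _

theorem signEq_schurPoly_zero : SignEq (schurPoly R n fun _ => 0) 1 := by
  refine (signEq_schurPoly R n _).trans ?_
  simp only [zero_add]
  simpa using (wordOp_longest_mon R n n le_rfl).map (revAct R n)

theorem antitone_or_exists_lt (l : Fin n → ℕ) : Antitone l ∨
    ∃ (i : ℕ) (hi : i + 1 < n), l ⟨i, by omega⟩ < l ⟨i + 1, hi⟩ := by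
  rcases n with _ | n
  · exact Or.inl fun i => i.elim0
  · by_contra! h
    refine h.1 (Fin.antitone_iff_succ_le.mpr fun i => ?_)
    exact h.2 i (by omega)

/-- Right linearity of `∂_{w_0}`, and invariance of `ε_r` under reversal up to sign, move `ε_r`
inside `∂_{w_0}(x^{μ+δ} ε_r)`. The squarefree monomials of `ε_r` add at most one to each part of
`μ`, whence the bound `b + 1`. -/
theorem schurPoly_mul_eps_mem (b : ℕ) (μ : BoxPartition n b) (r : ℕ) :
    schurPoly R n μ.part * epsPoly R n r ∈
      Submodule.span R (Set.range fun ν : BoxPartition n (b + 1) => schurPoly R n ν.part) := by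
  set N := Submodule.span R (Set.range fun ν : BoxPartition n (b + 1) => schurPoly R n ν.part)
  have h1 := (signEq_schurPoly R n μ.part).mul (revAct_epsPoly R n r).symm
  rw [← map_mul, ← wordOp_mul_of_mem _ _ (epsPoly_mem R n r)] at h1
  rw [h1.mem_iff N]
  let F : OPol R n →ₗ[R] OPol R n := (revAct R n).toLinearMap ∘ₗ wordOp R n (longestWord n) ∘ₗ
    LinearMap.mulLeft R (mon (xVar R n) fun i => μ.part i + (n - 1 - i))
  change epsPoly R n r ∈ N.comap F
  refine Submodule.span_le.mpr ?_ (listEps_mem_span_mon (R := R) (xTilde R n) r)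
  rintro _ ⟨α, hα, rfl⟩
  refine ((signEq_mon_xTilde R n α).mem_iff (N.comap F)).mpr ?_
  have h2 := ((mon_mul_mon (antiComm_xVar R n) (fun i => μ.part i + (n - 1 - i)) α).map
    (wordOp R n (longestWord n))).map (revAct R n)
  refine (h2.mem_iff N).mpr ?_
  have h3 : (fun i : Fin n => μ.part i + (n - 1 - i) + α i) =
      fun i => (μ.part i + α i) + (n - 1 - i) := by
    funext i
    omega
  rw [h3]
  rcases antitone_or_exists_lt n (fun i => μ.part i + α i) with h | ⟨i, hi, h⟩
  · obtain ⟨ν, hν⟩ := BoxPartition.exists_part_eq (m := b + 1) (fun i => μ.part i + α i) h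
      fun i => add_le_add (μ.part_le i) (hα i)
    have h4 := signEq_schurPoly R n fun i => μ.part i + α i
    refine (h4.mem_iff N).mp (Submodule.subset_span ⟨ν, ?_⟩)
    simp only [hν]
  -- If `μ + α` is not a partition, then at some place `μ_i = μ_{i+1}`, `α_i = 0`, `α_{i+1} = 1`.
  -- Since `δ` drops by one there, the exponents of `μ + α + δ` agree and the monomial is killed.
  · have h5 : μ.part ⟨i + 1, hi⟩ ≤ μ.part ⟨i, by omega⟩ :=
      μ.part_antitone (by simp [Fin.le_def])
    have h6 := hα ⟨i + 1, hi⟩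
    rw [wordOp_longest_of_mem_divKer (mon_mem_divKer i hi _ _), map_zero]
    · exact zero_mem _
    · simp only at h ⊢
      omega

/-- Products of `b` odd elementary symmetric polynomials are combinations of odd Schur polynomials
of partitions with parts of size at most `b`. -/
theorem span_eps_pow_le (b : ℕ) : Submodule.span R (Set.range (eps R n)) ^ b ≤
    Submodule.span R (Set.range fun ν : BoxPartition n b =>
      schur R n ν.part (schurPoly_mem R n ν.part)) := by
  induction b with
  | zero =>
    rw [pow_zero, Submodule.one_le]
    have h : SignEq (schur R n (fun _ => 0) (schurPoly_mem R n _)) 1 := by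
      rcases signEq_schurPoly_zero R n with h | h
      · exact Or.inl (Subtype.ext h)
      · exact Or.inr (Subtype.ext h)
    refine (h.mem_iff _).mp (Submodule.subset_span ⟨⟨fun _ => 0, fun _ _ _ => le_rfl⟩, rfl⟩)
  | succ b ih =>
    rw [pow_succ]
    refine (mul_le_mul_left ih _).trans ?_
    rw [Submodule.span_mul_span, Submodule.span_le]
    rintro _ ⟨_, ⟨μ, rfl⟩, _, ⟨r, rfl⟩, rfl⟩
    have h := schurPoly_mul_eps_mem R n b μ r
    have e : (Set.range fun ν : BoxPartition n (b + 1) => schurPoly R n ν.part) =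
        (OSym R n).val.toLinearMap '' Set.range fun ν : BoxPartition n (b + 1) =>
          schur R n ν.part (schurPoly_mem R n ν.part) := by
      rw [← Set.range_comp]
      rfl
    rw [e, ← Submodule.map_span] at h
    obtain ⟨g, hg, h⟩ := h
    have h2 : g = schur R n μ.part (schurPoly_mem R n μ.part) * eps R n r := Subtype.ext h
    rw [h2] at hg
    exact hg

end Schur

/-! ### Super tensor products. -/

section GradedTensor

variable {R A B : Type*} [CommRing R] [Ring A] [Ring B] [Algebra R A] [Algebra R B]
  {𝒜 : ℕ → Submodule R A} {ℬ : ℕ → Submodule R B} [GradedAlgebra 𝒜] [GradedAlgebra ℬ]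

/-- Graded tensor products carry signs in `ℤˣ`; elsewhere signs are scalars of `R`. -/
theorem neg_one_units_pow_smul {M : Type*} [AddCommGroup M] [Module R M] (m : ℕ) (x : M) :
    (-1 : ℤˣ) ^ m • x = (-1 : R) ^ m • x := by
  rcases Nat.even_or_odd m with h | h
  · rw [h.neg_one_pow, h.neg_one_pow, one_smul, one_smul]
  · rw [h.neg_one_pow, h.neg_one_pow, Units.neg_smul, one_smul, neg_smul, one_smul]

theorem tmul_mul_tmul {i j : ℕ} (a₁ : A) {b₁ : B} (hb : b₁ ∈ ℬ j) {a₂ : A} (ha : a₂ ∈ 𝒜 i)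
    (b₂ : B) : (GradedTensorProduct.tmul R a₁ b₁ * GradedTensorProduct.tmul R a₂ b₂ :
      GradedTensorProduct R 𝒜 ℬ) =
        (-1 : R) ^ (j * i) • GradedTensorProduct.tmul R (a₁ * a₂) (b₁ * b₂) := by
  have h := GradedTensorProduct.tmul_coe_mul_coe_tmul 𝒜 ℬ a₁ ⟨b₁, hb⟩ ⟨a₂, ha⟩ b₂
  rw [← neg_one_units_pow_smul]
  exact h

theorem includeLeft_mul_includeRight (a : A) (b : B) :
    GradedTensorProduct.includeLeft 𝒜 ℬ a * GradedTensorProduct.includeRight 𝒜 ℬ b =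
      GradedTensorProduct.tmul R a b :=
  GradedTensorProduct.tmul_one_mul_one_tmul 𝒜 ℬ a b

theorem includeRight_mul_includeLeft {i j : ℕ} {a : A} {b : B} (hb : b ∈ ℬ j) (ha : a ∈ 𝒜 i) :
    GradedTensorProduct.includeRight 𝒜 ℬ b * GradedTensorProduct.includeLeft 𝒜 ℬ a =
      (-1 : R) ^ (j * i) • GradedTensorProduct.tmul R a b := by
  have := tmul_mul_tmul (R := R) (𝒜 := 𝒜) (ℬ := ℬ) (1 : A) hb ha (1 : B)
  rwa [one_mul, mul_one] at this

theorem signComm_includeRight_includeLeft {i j : ℕ} {a : A} {b : B} (hb : b ∈ ℬ j)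
    (ha : a ∈ 𝒜 i) : SignComm (GradedTensorProduct.includeRight 𝒜 ℬ b)
      (GradedTensorProduct.includeLeft 𝒜 ℬ a) := by
  unfold SignComm
  rw [includeRight_mul_includeLeft hb ha, includeLeft_mul_includeRight]
  rcases neg_one_pow_eq_or R (j * i) with h | h <;> simp [h, SignEq]

theorem GradedTensorProduct.induction {motive : GradedTensorProduct R 𝒜 ℬ → Prop} (zero : motive 0)
    (add : ∀ x y, motive x → motive y → motive (x + y))
    (tmul : ∀ a b, motive (GradedTensorProduct.tmul R a b)) (x : GradedTensorProduct R 𝒜 ℬ) :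
    motive x := by
  have h : ∀ y : A ⊗[R] B, motive (GradedTensorProduct.of R 𝒜 ℬ y) := fun y => by
    induction y using TensorProduct.induction_on with
    | zero => exact zero
    | tmul a b => exact tmul a b
    | add x y hx hy => rw [map_add]; exact add _ _ hx hy
  exact h x

theorem range_includeLeft_mul_range_includeRight :
    Subalgebra.toSubmodule (GradedTensorProduct.includeLeft 𝒜 ℬ).range *
      Subalgebra.toSubmodule (GradedTensorProduct.includeRight 𝒜 ℬ).range = ⊤ := by
  rw [eq_top_iff]
  rintro x -
  induction x using GradedTensorProduct.induction with
  | zero => exact zero_mem _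
  | add x y hx hy => exact add_mem hx hy
  | tmul a b =>
    rw [← includeLeft_mul_includeRight]
    exact Submodule.mul_mem_mul ⟨a, rfl⟩ ⟨b, rfl⟩

end GradedTensor

/-! ### Embedding `OΛ_k ⊗ OΛ_l` into skew polynomials in `l + k` variables. -/

section SuperEmbedding

variable (R : Type*) [CommRing R] (k l : ℕ)

theorem antiComm_head : AntiComm fun i => xTilde R (l + k) (Fin.castAdd k i) := fun _ _ hij =>
  antiComm_xTilde R _ _ _ fun h => hij (Fin.castAdd_injective l k h)

theorem antiComm_tail : AntiComm fun i => xTilde R (l + k) (Fin.natAdd l i) := fun _ _ hij =>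
  antiComm_xTilde R _ _ _ fun h => hij (Fin.natAdd_injective k l h)

/-- The first `l` of `l + k` signed variables. -/
def headMap : OPol R l →ₐ[R] OPol R (l + k) := OPol.liftTilde _ (antiComm_head R k l)

/-- The last `k` of `l + k` signed variables. -/
def tailMap : OPol R k →ₐ[R] OPol R (l + k) := OPol.liftTilde _ (antiComm_tail R k l)

theorem ofFn_xTilde_add : List.ofFn (xTilde R (l + k)) =
    (List.ofFn (xTilde R l)).map (headMap R k l) ++ (List.ofFn (xTilde R k)).map (tailMap R k l) := by
  rw [headMap, tailMap, OPol.map_liftTilde_ofFn, OPol.map_liftTilde_ofFn, List.ofFn_add]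
  rfl

theorem mul_eq_neg_one_pow_mul {S : Type*} [Ring S] [Algebra R S] {V W : Submodule R S}
    (h : ∀ v ∈ V, ∀ w ∈ W, v * w = -(w * v)) (i j : ℕ) :
    ∀ x ∈ V ^ i, ∀ y ∈ W ^ j, x * y = (-1 : R) ^ (j * i) • (y * x) := by
  have h1 : ∀ v ∈ V, ∀ j, ∀ y ∈ W ^ j, v * y = (-1 : R) ^ j • (y * v) := by
    intro v hv j
    induction j with
    | zero =>
      intro y hy
      obtain ⟨r, rfl⟩ := Submodule.mem_one.mp (by simpa using hy)
      rw [pow_zero, one_smul, Algebra.commutes]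
    | succ j ih =>
      intro y hy
      rw [pow_succ] at hy
      induction hy using Submodule.mul_induction_on' with
      | mem_mul_mem y hy w hw =>
        rw [← mul_assoc, ih y hy, smul_mul_assoc, mul_assoc, h v hv w hw, pow_succ, mul_assoc]
        simp
      | add y _ z _ hy hz => rw [mul_add, hy, hz, add_mul, smul_add]
  induction i with
  | zero =>
    intro x hx y hy
    obtain ⟨r, rfl⟩ := Submodule.mem_one.mp (by simpa using hx)
    rw [mul_zero, pow_zero, one_smul, Algebra.commutes]
  | succ i ih =>
    intro x hx y hy
    rw [pow_succ] at hx
    induction hx using Submodule.mul_induction_on' with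
    | mem_mul_mem x hx v hv =>
      rw [mul_assoc, h1 v hv j y hy, mul_smul_comm, ← mul_assoc, ih x hx y hy, smul_mul_assoc,
        smul_smul, mul_assoc, ← pow_add, mul_add, mul_one, add_comm]
    | add x _ z _ hx hz => rw [add_mul, hx, hz, ← smul_add, ← mul_add]

theorem liftTilde_mem_pow {S : Type*} [Ring S] [Algebra R S] {m : ℕ} (v : Fin m → S)
    (hv : AntiComm v) (i : ℕ) {f : OPol R m} (hf : f ∈ skewGrading R m i) :
    OPol.liftTilde (R := R) v hv f ∈ Submodule.span R (Set.range v) ^ i := by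
  have h : skewGrading R m i ≤ (Submodule.span R (Set.range v) ^ i).comap
      (OPol.liftTilde (R := R) v hv).toLinearMap := by
    unfold skewGrading
    rw [← Submodule.map_le_iff_le_comap, Submodule.map_pow]
    refine pow_le_pow_left' ?_ _
    rw [Submodule.map_span, Submodule.span_le]
    rintro _ ⟨_, ⟨i, rfl⟩, rfl⟩
    have h := (signEq_xTilde R m i).map (OPol.liftTilde (R := R) v hv)
    rw [OPol.liftTilde_xTilde] at h
    exact (h.mem_iff (Submodule.span R (Set.range v))).mp (Submodule.subset_span ⟨i, rfl⟩)
  exact h hf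

theorem tailMap_mul_headMap (i j : ℕ) {f : OPol R k} (hf : f ∈ skewGrading R k i) {g : OPol R l}
    (hg : g ∈ skewGrading R l j) : tailMap R k l f * headMap R k l g =
      (-1 : R) ^ (j * i) • (headMap R k l g * tailMap R k l f) := by
  refine mul_eq_neg_one_pow_mul R ?_ i j _ (liftTilde_mem_pow R _ _ i hf) _
    (liftTilde_mem_pow R _ _ j hg)
  intro v hv w hw
  rw [← sub_eq_zero, sub_neg_eq_add]
  induction hv using Submodule.span_induction with
  | mem v hv =>
    obtain ⟨a, rfl⟩ := hv
    induction hw using Submodule.span_induction with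
    | mem w hw =>
      obtain ⟨b, rfl⟩ := hw
      rw [antiComm_xTilde R _ _ _ (fun h => by
        have := congrArg Fin.val h
        simp at this
        omega), neg_add_cancel]
    | zero => simp
    | add w w' _ _ h h' => rw [mul_add, add_mul, add_add_add_comm, h, h', add_zero]
    | smul r w _ h => rw [mul_smul_comm, smul_mul_assoc, ← smul_add, h, smul_zero]
  | zero => simp
  | add w w' _ _ h h' => rw [mul_add, add_mul, add_add_add_comm, h, h', add_zero]
  | smul r w _ h => rw [mul_smul_comm, smul_mul_assoc, ← smul_add, h, smul_zero]

/-- The embedding of `OΛ_k ⊗ OΛ_l` into skew polynomials in `l + k` variables, the factor `OΛ_l`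
using the first `l` variables. -/
def superEmb : OSymOSym R k l →ₐ[R] OPol R (l + k) :=
  GradedTensorProduct.lift _ _ ((tailMap R k l).comp (OSym R k).val)
    ((headMap R k l).comp (OSym R l).val) (fun i j a b => by
      refine (tailMap_mul_headMap R k l i j a.2 b.2).trans ?_
      exact (neg_one_units_pow_smul _ _).symm)

theorem superEmb_tmul (f : OSym R k) (g : OSym R l) :
    superEmb R k l (tmulOSym R f g) = tailMap R k l f * headMap R k l g := rfl

theorem headMap_mon (b : Fin l → ℕ) : headMap R k l (mon (xTilde R l) b) =
    mon (fun i => xTilde R (l + k) (Fin.castAdd k i)) b := by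
  rw [map_mon]
  congr 1
  funext i
  exact OPol.liftTilde_xTilde _ _ i

theorem tailMap_mon (b : Fin k → ℕ) : tailMap R k l (mon (xTilde R k) b) =
    mon (fun i => xTilde R (l + k) (Fin.natAdd l i)) b := by
  rw [map_mon]
  congr 1
  funext i
  exact OPol.liftTilde_xTilde _ _ i

theorem mon_append {S : Type*} [Ring S] (v : Fin (l + k) → S) (b : Fin l → ℕ) (a : Fin k → ℕ) :
    mon v (Fin.append b a) =
      mon (fun i => v (Fin.castAdd k i)) b * mon (fun i => v (Fin.natAdd l i)) a := by
  rw [mon, List.ofFn_add, List.prod_append]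
  have h1 : ∀ i : Fin l, Fin.append b a (Fin.castLE (Nat.le_add_right l k) i) = b i :=
    fun i => Fin.append_left b a i
  simp only [h1, Fin.append_right]
  rfl

theorem linearIndependent_of_signEq {M ι : Type*} [Ring M] [Algebra R M] {v w : ι → M}
    (h : ∀ i, SignEq (v i) (w i)) (hw : LinearIndependent R w) : LinearIndependent R v := by
  choose u hu using fun i => show ∃ u : Rˣ, v i = u • w i from by
    rcases h i with e | e
    · exact ⟨1, by simp [e]⟩
    · exact ⟨-1, by simp [e]⟩
  have : v = u • w := funext hu
  rw [this]
  exact hw.units_smul u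

/-- Products of monomials in the two blocks are, up to sign, distinct monomials, so the full tensor
product of skew polynomials embeds. The inclusion of the tensor product of the subalgebras stays
injective because `OPol_k` and `OΛ_l` are free, hence flat. -/
theorem superEmb_injective : Function.Injective (superEmb R k l) := by
  let μ : OPol R k ⊗[R] OPol R l →ₗ[R] OPol R (l + k) :=
    LinearMap.mul' R _ ∘ₗ TensorProduct.map (tailMap R k l).toLinearMap (headMap R k l).toLinearMap
  have hμ : Function.Injective μ := by
    let b := (monBasis R k).tensorProduct (monBasis R l)
    have hli : LinearIndependent R (μ ∘ b) := by
      refine linearIndependent_of_signEq R (w := fun p : (Fin k → ℕ) × (Fin l → ℕ) =>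
        mon (xTilde R (l + k)) (Fin.append p.2 p.1)) (fun p => ?_)
        ((linearIndependent_mon R (l + k)).comp (fun p : (Fin k → ℕ) × (Fin l → ℕ) =>
          Fin.append p.2 p.1) ?_)
      · simp only [Function.comp_apply, b, Module.Basis.tensorProduct_apply', monBasis_apply, μ,
          LinearMap.comp_apply, TensorProduct.map_tmul, LinearMap.mul'_apply,
          AlgHom.toLinearMap_apply, headMap_mon, tailMap_mon, mon_append]
        refine SignComm.symm (signComm_mon (S := OPol R (l + k)) _ _ fun i =>
          SignComm.symm (signComm_mon _ _ fun j => ?_))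
        exact (antiComm_xTilde R (l + k)).signComm _ _
      · rintro ⟨a, b⟩ ⟨a', b'⟩ h
        have h1 : b = b' := by
          funext i
          simpa using congrFun h (Fin.castAdd k i)
        have h2 : a = a' := by
          funext i
          simpa using congrFun h (Fin.natAdd l i)
        rw [h1, h2]
    rw [← LinearMap.ker_eq_bot]
    exact LinearMap.ker_eq_bot_of_injective (by
      have := hli
      rw [injective_iff_map_eq_zero]
      intro x hx
      have h3 : Finsupp.linearCombination R (μ ∘ b) (b.repr x) = 0 := by
        rw [← hx]
        conv_rhs => rw [← b.linearCombination_repr x]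
        exact (Finsupp.apply_linearCombination R μ b (b.repr x)).symm
      have h4 := linearIndependent_iff.mp hli _ h3
      simpa using h4)
  have : Module.Free R (OPol R k) := Module.Free.of_basis (monBasis R k)
  have : Module.Free R (OSym R l) := Module.Free.of_basis (epsBasis R l)
  have h2 : Function.Injective (TensorProduct.map (OSym R k).val.toLinearMap
      (OSym R l).val.toLinearMap) :=
    TensorProduct.map_injective_of_flat_flat _ _ Subtype.val_injective Subtype.val_injective
  have h3 : ∀ x : OSym R k ⊗[R] OSym R l,
      superEmb R k l (GradedTensorProduct.of R _ _ x) = μ (TensorProduct.map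
        (OSym R k).val.toLinearMap (OSym R l).val.toLinearMap x) := by
    have : (superEmb R k l).toLinearMap ∘ₗ (GradedTensorProduct.of R (oddSymGrading R k)
        (oddSymGrading R l)).toLinearMap = μ ∘ₗ TensorProduct.map
        (OSym R k).val.toLinearMap (OSym R l).val.toLinearMap :=
      TensorProduct.ext' fun a b => rfl
    exact fun x => DFunLike.congr_fun this x
  intro x y hxy
  exact h2 (hμ ((h3 x).symm.trans (hxy.trans (h3 y))))

end SuperEmbedding

/-! ### The homomorphism `ρ` and factorisations of generating series. -/

section TwistedEmbedding

variable (R : Type*) [CommRing R] (k l : ℕ)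

/-- The embedding `f ↦ f ⊗ 1`. -/
abbrev inl : OSym R k →ₐ[R] OSymOSym R k l :=
  GradedTensorProduct.includeLeft (oddSymGrading R k) (oddSymGrading R l)

/-- The embedding `s ↦ 1 ⊗ s`. -/
abbrev inr : OSym R l →ₐ[R] OSymOSym R k l :=
  GradedTensorProduct.includeRight (oddSymGrading R k) (oddSymGrading R l)

variable {k l} in
theorem inl_mul_inr (f : OSym R k) (s : OSym R l) : inl R k l f * inr R k l s = tmulOSym R f s :=
  includeLeft_mul_includeRight f s

theorem superEmb_inl (f : OSym R k) : superEmb R k l (inl R k l f) = tailMap R k l f := by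
  refine (superEmb_tmul R k l f 1).trans ?_
  simp

theorem superEmb_inr (s : OSym R l) : superEmb R k l (inr R k l s) = headMap R k l s := by
  refine (superEmb_tmul R k l 1 s).trans ?_
  simp

/-- The elementary series of a concatenated list is the product of the series of its blocks. -/
theorem OSym_le_range_superEmb : OSym R (l + k) ≤ (superEmb R k l).range := by
  rw [OSym_eq_epsAdjoin, epsAdjoin, Algebra.adjoin_le_iff]
  rintro _ ⟨r, rfl⟩
  refine ⟨∑ p ∈ Finset.HasAntidiagonal.antidiagonal r,
    inr R k l (eps R l p.1) * inl R k l (eps R k p.2), ?_⟩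
  rw [← coeff_epsSeries, ofFn_xTilde_add]
  have : epsSeries ((List.ofFn (xTilde R l)).map (headMap R k l) ++
      (List.ofFn (xTilde R k)).map (tailMap R k l)) =
      epsSeries ((List.ofFn (xTilde R l)).map (headMap R k l)) *
        epsSeries ((List.ofFn (xTilde R k)).map (tailMap R k l)) := by simp [epsSeries]
  change superEmb R k l _ = _
  rw [this, PowerSeries.coeff_mul, map_sum]
  refine Finset.sum_congr rfl fun p _ => ?_
  rw [map_mul, superEmb_inr, superEmb_inl, coeff_epsSeries, coeff_epsSeries, ← map_listEps,
    ← map_listEps]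
  rfl

/-- The homomorphism `OΛ_{l+k} → OΛ_k ⊗ OΛ_l` compatible with the embeddings into skew
polynomials. -/
def twistMap : OSym R (l + k) →ₐ[R] OSymOSym R k l :=
  (AlgEquiv.ofInjective (superEmb R k l) (superEmb_injective R k l)).symm.toAlgHom.comp
    (Subalgebra.inclusion (OSym_le_range_superEmb R k l))

theorem superEmb_twistMap (x : OSym R (l + k)) : superEmb R k l (twistMap R k l x) = x := by
  have := (AlgEquiv.ofInjective (superEmb R k l) (superEmb_injective R k l)).apply_symm_apply
    (Subalgebra.inclusion (OSym_le_range_superEmb R k l) x)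
  exact congrArg Subtype.val this

variable {k l} in
theorem superEmb_series_ext {F G : PowerSeries (OSymOSym R k l)}
    (h : PowerSeries.map (superEmb R k l : OSymOSym R k l →+* OPol R (l + k)) F =
      PowerSeries.map (superEmb R k l : OSymOSym R k l →+* OPol R (l + k)) G) : F = G := by
  ext r
  have := congrArg (PowerSeries.coeff r) h
  rw [PowerSeries.coeff_map, PowerSeries.coeff_map] at this
  exact superEmb_injective R k l this

/-- The image of a generating series of `OΛ_k`. -/
abbrev inlSeries (a : ℕ → OSym R k) : PowerSeries (OSymOSym R k l) :=
  PowerSeries.mk fun r => inl R k l (a r)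

/-- The image of a generating series of `OΛ_l`. -/
abbrev inrSeries (a : ℕ → OSym R l) : PowerSeries (OSymOSym R k l) :=
  PowerSeries.mk fun r => inr R k l (a r)

/-- The image of a generating series of `OΛ_{l+k}`. -/
abbrev twistSeries (a : ℕ → OSym R (l + k)) : PowerSeries (OSymOSym R k l) :=
  PowerSeries.mk fun r => twistMap R k l (a r)

theorem map_inlSeries (a : ℕ → OSym R k) :
    PowerSeries.map (superEmb R k l : OSymOSym R k l →+* OPol R (l + k)) (inlSeries R k l a) =
      PowerSeries.map (tailMap R k l : OPol R k →+* OPol R (l + k))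
        (PowerSeries.map ((OSym R k).val : OSym R k →+* OPol R k) (osymSeries R k a)) := by
  ext r
  simp only [PowerSeries.coeff_map, PowerSeries.coeff_mk]
  exact superEmb_inl R k l (a r)

theorem map_inrSeries (a : ℕ → OSym R l) :
    PowerSeries.map (superEmb R k l : OSymOSym R k l →+* OPol R (l + k)) (inrSeries R k l a) =
      PowerSeries.map (headMap R k l : OPol R l →+* OPol R (l + k))
        (PowerSeries.map ((OSym R l).val : OSym R l →+* OPol R l) (osymSeries R l a)) := by
  ext r
  simp only [PowerSeries.coeff_map, PowerSeries.coeff_mk]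
  exact superEmb_inr R k l (a r)

theorem map_twistSeries (a : ℕ → OSym R (l + k)) :
    PowerSeries.map (superEmb R k l : OSymOSym R k l →+* OPol R (l + k)) (twistSeries R k l a) =
      PowerSeries.map ((OSym R (l + k)).val : OSym R (l + k) →+* OPol R (l + k))
        (osymSeries R (l + k) a) := by
  ext r
  simp only [PowerSeries.coeff_map, PowerSeries.coeff_mk]
  exact superEmb_twistMap R k l (a r)

theorem map_epsSeries {S S' : Type*} [Ring S] [Ring S'] (φ : S →+* S') (m : List S) :
    PowerSeries.map φ (epsSeries m) = epsSeries (m.map φ) := by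
  ext r
  rw [PowerSeries.coeff_map, coeff_epsSeries, coeff_epsSeries, map_listEps]

theorem map_map_neg {S S' : Type*} [Ring S] [Ring S'] (φ : S →+* S') (m : List S) :
    (m.map fun a => -a).map φ = (m.map φ).map fun a => -a := by simp

theorem epsSeries_append {S : Type*} [Ring S] (m m' : List S) :
    epsSeries (m ++ m') = epsSeries m * epsSeries m' := by simp [epsSeries]

theorem hSeries_append {S : Type*} [Ring S] (m m' : List S) :
    hSeries (m ++ m') = hSeries m * hSeries m' := by simp [hSeries]

/-- The block of `OΛ_l` comes first in the list. Series of the unreversed list therefore factor as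
`inr * inl`, as here and for `eNeg`, and those of the reversed list as `inl * inr`, as for `kSym`
and `eAlt`. -/
theorem twistSeries_hSym : twistSeries R k l (hSym R (l + k)) =
    inrSeries R k l (hSym R l) * inlSeries R k l (hSym R k) := by
  apply superEmb_series_ext
  rw [map_mul, map_twistSeries, map_inlSeries, map_inrSeries, map_val_hSym, map_val_hSym,
    map_val_hSym, map_hSeries, map_hSeries, ofFn_xTilde_add, hSeries_append]
  rfl

theorem twistSeries_kSym : twistSeries R k l (kSym R (l + k)) =
    inlSeries R k l (kSym R k) * inrSeries R k l (kSym R l) := by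
  apply superEmb_series_ext
  rw [map_mul, map_twistSeries, map_inlSeries, map_inrSeries, map_val_kSym, map_val_kSym,
    map_val_kSym, map_hSeries, map_hSeries, ofFn_xTilde_add, List.reverse_append, hSeries_append,
    ← List.map_reverse, ← List.map_reverse]
  rfl

theorem twistSeries_eNeg : twistSeries R k l (eNeg R (l + k)) =
    inrSeries R k l (eNeg R l) * inlSeries R k l (eNeg R k) := by
  apply superEmb_series_ext
  rw [map_mul, map_twistSeries, map_inlSeries, map_inrSeries, map_val_eNeg, map_val_eNeg,
    map_val_eNeg, map_epsSeries, map_epsSeries, ofFn_xTilde_add, List.map_append,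
    epsSeries_append, map_map_neg, map_map_neg]
  rfl

theorem twistSeries_eAlt : twistSeries R k l (eAlt R (l + k)) =
    inlSeries R k l (eAlt R k) * inrSeries R k l (eAlt R l) := by
  apply superEmb_series_ext
  rw [map_mul, map_twistSeries, map_inlSeries, map_inrSeries, map_val_eAlt, map_val_eAlt,
    map_val_eAlt, map_epsSeries, map_epsSeries, ofFn_xTilde_add, List.reverse_append,
    List.map_append, epsSeries_append, map_map_neg, map_map_neg, ← List.map_reverse,
    ← List.map_reverse]
  rfl

theorem map_osymSeries {A : Type*} [Ring A] [Algebra R A] (n : ℕ) (φ : OSym R n →ₐ[R] A)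
    (a : ℕ → OSym R n) : PowerSeries.map (φ : OSym R n →+* A) (osymSeries R n a) =
      PowerSeries.mk fun r => φ (a r) := by
  ext r
  simp

theorem mk_mul_mk_eq_one {A : Type*} [Ring A] [Algebra R A] {n : ℕ} (φ : OSym R n →ₐ[R] A)
    {a b : ℕ → OSym R n} (h : osymSeries R n a * osymSeries R n b = 1) :
    (PowerSeries.mk fun r => φ (a r)) * (PowerSeries.mk fun r => φ (b r)) = 1 := by
  rw [← map_osymSeries, ← map_osymSeries, ← map_mul, h, map_one]

/-- Cancelling one factor expresses functions of one tensor factor by functions of the other and the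
image of `ρ` on the right. This identity and the next two carry the spanning arguments; this one
also explains why the `h'_m` vanish in `OH`. -/
theorem inrSeries_eAlt : inrSeries R k l (eAlt R l) =
    inlSeries R k l (hSym R k) * twistSeries R k l (eAlt R (l + k)) := by
  rw [twistSeries_eAlt, ← mul_assoc, mk_mul_mk_eq_one R (inl R k l) (hSym_mul_eAlt R k), one_mul]

theorem inlSeries_hSym : inlSeries R k l (hSym R k) =
    inrSeries R k l (eAlt R l) * twistSeries R k l (hSym R (l + k)) := by
  rw [twistSeries_hSym, ← mul_assoc, mk_mul_mk_eq_one R (inr R k l) (eAlt_mul_hSym R l), one_mul]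

theorem inrSeries_kSym : inrSeries R k l (kSym R l) =
    inlSeries R k l (eNeg R k) * twistSeries R k l (kSym R (l + k)) := by
  rw [twistSeries_kSym, ← mul_assoc, mk_mul_mk_eq_one R (inl R k l) (eNeg_mul_kSym R k), one_mul]

/-- The factorisation of `eNeg` has a common sign `(-1)^r`; the remaining sign is the cost of
rewriting `(1 ⊗ ε_j)(ε_{r-j} ⊗ 1)` as a pure tensor. -/
theorem twistMap_eps (r : ℕ) : twistMap R k l (eps R (l + k) r) =
    ∑ j ∈ Finset.range (r + 1),
      (-1 : R) ^ ((r - j) * j) • tmulOSym R (eps R k (r - j)) (eps R l j) := by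
  have h := congrArg (PowerSeries.coeff r) (twistSeries_eNeg R k l)
  rw [PowerSeries.coeff_mk, PowerSeries.coeff_mul,
    Finset.Nat.sum_antidiagonal_eq_sum_range_succ_mk] at h
  have h2 : ∀ (m : ℕ) (s : ℕ), eNeg R m s = (-1 : R) ^ s • eps R m s := by
    intro m s
    rw [eNeg]
    rcases neg_one_pow_eq_or R s with e | e <;>
      rcases Nat.even_or_odd s with e' | e' <;> simp [e'.neg_one_pow]
  simp only [PowerSeries.coeff_mk, h2, map_smul] at h
  have h3 : ∀ x y : OSymOSym R k l, (-1 : R) ^ r • x = (-1 : R) ^ r • y → x = y := by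
    intro x y hxy
    have := congrArg (fun z => (-1 : R) ^ r • z) hxy
    simpa [smul_smul, ← mul_pow] using this
  apply h3
  rw [h, Finset.smul_sum]
  refine Finset.sum_congr rfl fun j hj => ?_
  have hj' : j ≤ r := by simpa [Nat.lt_succ_iff] using hj
  rw [smul_mul_smul_comm, ← pow_add, Nat.add_sub_cancel' hj']
  congr 1
  rw [mul_comm (r - j) j]
  exact includeRight_mul_includeLeft (eps_mem_oddSymGrading R l j)
    (eps_mem_oddSymGrading R k (r - j))

variable {R k l} in
theorem eq_twistMap {ρ : OSym R (l + k) →ₐ[R] OSymOSym R k l}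
    (h : ∀ r, ρ (eps R (l + k) r) = ∑ j ∈ Finset.range (r + 1),
      (-1 : R) ^ ((r - j) * j) • tmulOSym R (eps R k (r - j)) (eps R l j)) :
    ρ = twistMap R k l :=
  OSym.algHom_ext fun r => (h r).trans (twistMap_eps R k l r).symm

end TwistedEmbedding

/-! ### Generators of `OΛ_k ⊗ OΛ_l` as a right module over `OΛ_{l+k}`. -/

section Spanning

/-- Each factor from `A` is traded for one from `B`, with the elements of `P` collected on the
right. The number of factors is preserved, which later bounds the parts of partitions. -/
theorem pow_le_pow_mul {R S : Type*} [CommRing R] [Ring S] [Algebra R S] {A B P : Submodule R S}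
    (hAB : A * B ≤ B * A) (hA : A ≤ B * P) (hP : P * P ≤ P) (h1 : 1 ≤ P) (j : ℕ) :
    A ^ j ≤ B ^ j * P := by
  have hAB' : ∀ j, A * B ^ j ≤ B ^ j * A := by
    intro j
    induction j with
    | zero => simp
    | succ j ih =>
      calc A * B ^ (j + 1) = A * B ^ j * B := by rw [pow_succ, mul_assoc]
        _ ≤ B ^ j * A * B := mul_le_mul_left ih _
        _ = B ^ j * (A * B) := mul_assoc _ _ _
        _ ≤ B ^ j * (B * A) := mul_le_mul_right hAB _
        _ = B ^ (j + 1) * A := by rw [pow_succ, mul_assoc]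
  induction j with
  | zero => simpa using h1
  | succ j ih =>
    calc A ^ (j + 1) = A * A ^ j := pow_succ' _ _
      _ ≤ A * (B ^ j * P) := mul_le_mul_right ih _
      _ = A * B ^ j * P := (mul_assoc _ _ _).symm
      _ ≤ B ^ j * A * P := mul_le_mul_left (hAB' j) _
      _ ≤ B ^ j * (B * P) * P := mul_le_mul_left (mul_le_mul_right hA _) _
      _ = B ^ (j + 1) * (P * P) := by simp only [pow_succ, mul_assoc]
      _ ≤ B ^ (j + 1) * P := mul_le_mul_right hP _

section

variable {R S : Type*} [CommRing R] [Ring S] [Algebra R S] {A B : Submodule R S}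

theorem mul_le_mul_of_le_left (h : A ≤ B) (P : Submodule R S) : A * P ≤ B * P :=
  mul_le_mul_left h P

theorem mul_le_mul_of_le_right (h : A ≤ B) (P : Submodule R S) : P * A ≤ P * B :=
  mul_le_mul_right h P

end

variable (R : Type*) [CommRing R] (k l : ℕ)

/-- The image of `OΛ_{l+k}` in `OΛ_k ⊗ OΛ_l`. -/
def twistRange : Submodule R (OSymOSym R k l) := Subalgebra.toSubmodule (twistMap R k l).range

theorem twistMap_mem (x : OSym R (l + k)) : twistMap R k l x ∈ twistRange R k l := ⟨x, rfl⟩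

theorem twistRange_mul : twistRange R k l * twistRange R k l = twistRange R k l :=
  (Subalgebra.isIdempotentElem_toSubmodule _).eq

theorem twistRange_mul_le : twistRange R k l * twistRange R k l ≤ twistRange R k l :=
  Submodule.mul_le.mpr fun _ hx _ hy => mul_mem (S := Subalgebra R _) hx hy

theorem one_le_twistRange : 1 ≤ twistRange R k l := Submodule.one_le.mpr (one_mem (twistMap R k l).range)

/-- The span of a sequence in `OΛ_k ⊗ 1`. -/
def inlSpan (a : ℕ → OSym R k) : Submodule R (OSymOSym R k l) :=
  (Submodule.span R (Set.range a)).map (inl R k l).toLinearMap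

/-- The span of a sequence in `1 ⊗ OΛ_l`. -/
def inrSpan (a : ℕ → OSym R l) : Submodule R (OSymOSym R k l) :=
  (Submodule.span R (Set.range a)).map (inr R k l).toLinearMap

variable {R k l}

theorem inlSpan_le_iff {a : ℕ → OSym R k} {N : Submodule R (OSymOSym R k l)} :
    inlSpan R k l a ≤ N ↔ ∀ r, inl R k l (a r) ∈ N := by
  rw [inlSpan, Submodule.map_span, Submodule.span_le, ← Set.range_comp, Set.range_subset_iff]
  rfl

theorem inrSpan_le_iff {a : ℕ → OSym R l} {N : Submodule R (OSymOSym R k l)} :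
    inrSpan R k l a ≤ N ↔ ∀ r, inr R k l (a r) ∈ N := by
  rw [inrSpan, Submodule.map_span, Submodule.span_le, ← Set.range_comp, Set.range_subset_iff]
  rfl

theorem inl_mem_inlSpan (a : ℕ → OSym R k) (r : ℕ) : inl R k l (a r) ∈ inlSpan R k l a :=
  Submodule.mem_map_of_mem (f := (inl R k l).toLinearMap) (Submodule.subset_span ⟨r, rfl⟩)

theorem inr_mem_inrSpan (a : ℕ → OSym R l) (r : ℕ) : inr R k l (a r) ∈ inrSpan R k l a :=
  Submodule.mem_map_of_mem (f := (inr R k l).toLinearMap) (Submodule.subset_span ⟨r, rfl⟩)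

theorem inlSpan_mul_inrSpan_comm {a : ℕ → OSym R k} {b : ℕ → OSym R l}
    (ha : ∀ r, ∃ i, a r ∈ oddSymGrading R k i) (hb : ∀ r, ∃ i, b r ∈ oddSymGrading R l i) :
    inlSpan R k l a * inrSpan R k l b ≤ inrSpan R k l b * inlSpan R k l a ∧
    inrSpan R k l b * inlSpan R k l a ≤ inlSpan R k l a * inrSpan R k l b := by
  have h : ∀ r s, SignComm (inr R k l (b r)) (inl R k l (a s)) := fun r s => by
    obtain ⟨i, hi⟩ := ha s
    obtain ⟨j, hj⟩ := hb r
    exact signComm_includeRight_includeLeft hj hi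
  rw [inlSpan, inrSpan, Submodule.map_span, Submodule.map_span, ← Set.range_comp, ← Set.range_comp]
  exact ⟨SignComm.span_mul_span_le fun r s => (h s r).symm, SignComm.span_mul_span_le h⟩

theorem mem_mul_twistRange_of_series {A : Submodule R (OSymOSym R k l)}
    {F : PowerSeries (OSymOSym R k l)} {f : ℕ → OSymOSym R k l} {a : ℕ → OSym R (l + k)}
    (hf : ∀ r, f r ∈ A) (h : F = PowerSeries.mk f * twistSeries R k l a) (r : ℕ) :
    PowerSeries.coeff r F ∈ A * twistRange R k l := by
  rw [h, PowerSeries.coeff_mul]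
  refine sum_mem fun p _ => ?_
  rw [PowerSeries.coeff_mk, PowerSeries.coeff_mk]
  exact Submodule.mul_mem_mul (hf _) (twistMap_mem R k l _)

theorem SignEq.exists_mem {n : ℕ} {x y : OSym R n} {i : ℕ} (h : SignEq x y)
    (hy : y ∈ oddSymGrading R n i) : ∃ i, x ∈ oddSymGrading R n i := ⟨i, (h.mem_iff _).mpr hy⟩

theorem kSym_mem_oddSymGrading (n r : ℕ) : ∃ i, kSym R n r ∈ oddSymGrading R n i := by
  refine ⟨r, ?_⟩
  have key : ∀ m : List (OPol R n), (∀ a ∈ m, a ∈ skewGrading R n 1) → ∀ r,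
      PowerSeries.coeff r (hSeries m) ∈ skewGrading R n r := by
    intro m hm
    induction m with
    | nil =>
      intro r
      rw [hSeries, List.map_nil, List.prod_nil, PowerSeries.coeff_one]
      split_ifs with h
      · subst h; exact SetLike.GradedOne.one_mem
      · exact zero_mem _
    | cons a m ih =>
      intro r
      rw [hSeries, List.map_cons, List.prod_cons, PowerSeries.coeff_mul]
      refine sum_mem fun p hp => ?_
      rw [← Finset.HasAntidiagonal.mem_antidiagonal.mp hp]
      refine SetLike.GradedMul.mul_mem ?_ (ih (fun b hb => hm b (by simp [hb])) _)
      rw [geomSeries, PowerSeries.coeff_mk]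
      have := SetLike.pow_mem_graded (A := skewGrading R n) p.1 (hm a (by simp))
      simpa using this
  refine key _ (fun a ha => ?_) r
  obtain ⟨i, rfl⟩ := (List.mem_ofFn' _ _).mp (List.mem_reverse.mp ha)
  exact xTilde_mem_skewGrading R n i

variable (R k l)

theorem range_inl_eq_pow : Subalgebra.toSubmodule (inl R k l).range = inlSpan R k l (hSym R k) ^ k := by
  rw [inlSpan, ← Submodule.map_pow, span_hSym_pow, Submodule.map_top]
  rfl

theorem range_inr_eq_pow : Subalgebra.toSubmodule (inr R k l).range = inrSpan R k l (kSym R l) ^ l := by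
  rw [inrSpan, ← Submodule.map_pow, span_kSym_pow, Submodule.map_top]
  rfl

/-- Products of `k` complete functions span `OΛ_k`, and modulo the image of `ρ` each becomes an
elementary function of the other factor. -/
theorem range_inl_le : Subalgebra.toSubmodule (inl R k l).range ≤
    inrSpan R k l (eAlt R l) ^ k * twistRange R k l := by
  rw [range_inl_eq_pow]
  refine pow_le_pow_mul (inlSpan_mul_inrSpan_comm (fun r => ⟨r, hSym_mem_oddSymGrading R k r⟩)
    fun r => (signEq_eAlt R l r).exists_mem (eps_mem_oddSymGrading R l r)).1 ?_
    (twistRange_mul_le R k l) (one_le_twistRange R k l) k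
  rw [inlSpan_le_iff]
  intro r
  have := mem_mul_twistRange_of_series (inr_mem_inrSpan _) (inlSeries_hSym R k l) r
  rwa [PowerSeries.coeff_mk] at this

/-- The reversed complete functions are needed here: `inrSeries_kSym` is the identity with the image
of `ρ` on the right. -/
theorem range_inr_le : Subalgebra.toSubmodule (inr R k l).range ≤
    inlSpan R k l (eNeg R k) ^ l * twistRange R k l := by
  rw [range_inr_eq_pow]
  refine pow_le_pow_mul (inlSpan_mul_inrSpan_comm
    (fun r => (signEq_eNeg R k r).exists_mem (eps_mem_oddSymGrading R k r))
    (kSym_mem_oddSymGrading l)).2 ?_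
    (twistRange_mul_le R k l) (one_le_twistRange R k l) l
  rw [inrSpan_le_iff]
  intro r
  have := mem_mul_twistRange_of_series (inl_mem_inlSpan _) (inrSeries_kSym R k l) r
  rwa [PowerSeries.coeff_mk] at this

theorem inlSpan_pow_le_range (a : ℕ → OSym R k) (j : ℕ) :
    inlSpan R k l a ^ j ≤ Subalgebra.toSubmodule (inl R k l).range := by
  rw [inlSpan, ← Submodule.map_pow]
  rintro _ ⟨f, -, rfl⟩
  exact ⟨f, rfl⟩

theorem inrSpan_pow_le_range (a : ℕ → OSym R l) (j : ℕ) :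
    inrSpan R k l a ^ j ≤ Subalgebra.toSubmodule (inr R k l).range := by
  rw [inrSpan, ← Submodule.map_pow]
  rintro _ ⟨f, -, rfl⟩
  exact ⟨f, rfl⟩

theorem range_inr_mul_range_inl : Subalgebra.toSubmodule (inr R k l).range *
    Subalgebra.toSubmodule (inl R k l).range = ⊤ := by
  rw [eq_top_iff]
  rintro x -
  have key : ∀ (f : OSym R k) (s : OSym R l), tmulOSym R f s ∈
      Subalgebra.toSubmodule (inr R k l).range * Subalgebra.toSubmodule (inl R k l).range := by
    intro f s
    let N := Subalgebra.toSubmodule (inr R k l).range * Subalgebra.toSubmodule (inl R k l).range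
    induction f using DirectSum.Decomposition.inductionOn (oddSymGrading R k) with
    | zero => rw [← inl_mul_inr, map_zero, zero_mul]; exact zero_mem _
    | add f g hf hg =>
      rw [← inl_mul_inr, map_add, add_mul, inl_mul_inr, inl_mul_inr]
      exact add_mem hf hg
    | @homogeneous i f =>
      induction s using DirectSum.Decomposition.inductionOn (oddSymGrading R l) with
      | zero => rw [← inl_mul_inr, map_zero, mul_zero]; exact zero_mem _
      | add f g hf hg =>
        rw [← inl_mul_inr, map_add, mul_add, inl_mul_inr, inl_mul_inr]
        exact add_mem hf hg
      | @homogeneous j s =>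
        rw [← inl_mul_inr]
        have h := (signComm_includeRight_includeLeft (R := R) s.2 f.2).symm
        exact (SignEq.mem_iff h N).mpr (Submodule.mul_mem_mul ⟨s, rfl⟩ ⟨f, rfl⟩)
  induction x using GradedTensorProduct.induction with
  | zero => exact zero_mem _
  | add x y hx hy => exact add_mem hx hy
  | tmul a b => exact key a b

/-- In a product `(f ⊗ 1)(1 ⊗ s)` the second factor is replaced by elements of `OΛ_k ⊗ 1` times the
image of `ρ`. -/
theorem range_inl_mul_twistRange :
    Subalgebra.toSubmodule (inl R k l).range * twistRange R k l = ⊤ := by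
  rw [eq_top_iff, ← range_includeLeft_mul_range_includeRight]
  refine (mul_le_mul_of_le_right (range_inr_le R k l) _).trans ?_
  rw [← mul_assoc]
  refine mul_le_mul_of_le_left ?_ _
  refine (mul_le_mul_of_le_right (inlSpan_pow_le_range R k l _ _) _).trans ?_
  exact (Subalgebra.isIdempotentElem_toSubmodule _).le

theorem range_inr_mul_twistRange :
    Subalgebra.toSubmodule (inr R k l).range * twistRange R k l = ⊤ := by
  rw [eq_top_iff, ← range_inr_mul_range_inl]
  refine (mul_le_mul_of_le_right (range_inl_le R k l) _).trans ?_
  rw [← mul_assoc]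
  refine mul_le_mul_of_le_left ?_ _
  refine (mul_le_mul_of_le_right (inrSpan_pow_le_range R k l _ _) _).trans ?_
  exact (Subalgebra.isIdempotentElem_toSubmodule _).le

theorem span_eAlt_le (n j : ℕ) : Submodule.span R (Set.range (eAlt R n)) ^ j ≤
    Submodule.span R (Set.range fun ν : BoxPartition n j =>
      schur R n ν.part (schurPoly_mem R n ν.part)) := by
  refine le_trans (pow_le_pow_left' ?_ j) (span_eps_pow_le R n j)
  rw [Submodule.span_le]
  rintro _ ⟨r, rfl⟩
  exact ((signEq_eAlt R n r).mem_iff (Submodule.span R _)).mpr (Submodule.subset_span ⟨r, rfl⟩)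

theorem span_eNeg_le (n j : ℕ) : Submodule.span R (Set.range (eNeg R n)) ^ j ≤
    Submodule.span R (Set.range fun ν : BoxPartition n j =>
      schur R n ν.part (schurPoly_mem R n ν.part)) := by
  refine le_trans (pow_le_pow_left' ?_ j) (span_eps_pow_le R n j)
  rw [Submodule.span_le]
  rintro _ ⟨r, rfl⟩
  exact ((signEq_eNeg R n r).mem_iff (Submodule.span R _)).mpr (Submodule.subset_span ⟨r, rfl⟩)

/-- The elements `1 ⊗ s_μ` generate the right module `OΛ_k ⊗ OΛ_l` over `OΛ_{l+k}`. -/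
theorem span_inr_schur_mul : Submodule.span R (Set.range fun μ : BoxPartition l k =>
    inr R k l (schur R l μ.part (schurPoly_mem R l μ.part))) * twistRange R k l = ⊤ := by
  have h : inrSpan R k l (eAlt R l) ^ k ≤ Submodule.span R (Set.range fun μ : BoxPartition l k =>
      inr R k l (schur R l μ.part (schurPoly_mem R l μ.part))) := by
    rw [inrSpan, ← Submodule.map_pow]
    refine (Submodule.map_mono (span_eAlt_le R l k)).trans ?_
    rw [Submodule.map_span, ← Set.range_comp]
    rfl
  rw [eq_top_iff, ← range_inl_mul_twistRange]
  refine (mul_le_mul_of_le_left (range_inl_le R k l) _).trans ?_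
  rw [mul_assoc, twistRange_mul]
  exact mul_le_mul_of_le_left h _

/-- The elements `s_λ ⊗ 1` generate the right module `OΛ_k ⊗ OΛ_l` over `OΛ_{l+k}`. -/
theorem span_inl_schur_mul : Submodule.span R (Set.range fun μ : BoxPartition k l =>
    inl R k l (schur R k μ.part (schurPoly_mem R k μ.part))) * twistRange R k l = ⊤ := by
  have h : inlSpan R k l (eNeg R k) ^ l ≤ Submodule.span R (Set.range fun μ : BoxPartition k l =>
      inl R k l (schur R k μ.part (schurPoly_mem R k μ.part))) := by
    rw [inlSpan, ← Submodule.map_pow]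
    refine (Submodule.map_mono (span_eNeg_le R k l)).trans ?_
    rw [Submodule.map_span, ← Set.range_comp]
    rfl
  rw [eq_top_iff, ← range_inr_mul_twistRange]
  refine (mul_le_mul_of_le_left (range_inr_le R k l) _).trans ?_
  rw [mul_assoc, twistRange_mul]
  exact mul_le_mul_of_le_left h _

end Spanning

/-! ### Reduction to complete functions of partitions in a box. -/

section CompleteSpanning

variable (R : Type*) [CommRing R] (k l : ℕ)

variable {R k l} in
theorem wordProd_hZ_sorted (w : List ℕ) (hw : w.length = k) (hs : w.Pairwise (· ≥ ·))
    (hl : ∀ r ∈ w, r ≤ l) : ∃ μ : BoxPartition k l, wordProd (hZ R k) w = hPart R μ.part := by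
  subst hw
  obtain ⟨μ, hμ⟩ := BoxPartition.exists_part_eq (m := l) (fun i : Fin w.length => w[i])
    (fun i j hij => by
      rcases eq_or_lt_of_le hij with rfl | h
      · exact le_rfl
      · exact List.pairwise_iff_getElem.mp hs i j i.2 j.2 h)
    fun i => hl _ (List.getElem_mem i.2)
  refine ⟨μ, ?_⟩
  rw [hμ, wordProd, hPart]
  simp only [hZ_natCast]
  congr 1
  apply List.ext_getElem <;> simp

/-- Reduction of a module generated by products of `k` odd complete symmetric polynomials. -/
theorem hSym_reduce {M : Type*} [AddCommGroup M] [Module R M] (Φ : OSym R k →ₗ[R] M)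
    (N : Submodule R M) (h1 : ∀ μ : BoxPartition k l, Φ (hPart R μ.part) ∈ N)
    (h2 : ∀ (g : OSym R k) (m : ℕ), l < m →
      (∀ i < m, Φ (g * hSym R k i) ∈ N) → Φ (g * hSym R k m) ∈ N) (f : OSym R k) : Φ f ∈ N := by
  -- Words of length exactly `k` suffice by `span_hSym_pow`; those that are decreasing with letters
  -- at most `l` are partitions in the box.
  have h3 := (oddSeq_hZ R k).wordProd_reduce Φ N k l (fun w hw hs hl => by
    obtain ⟨μ, hμ⟩ := wordProd_hZ_sorted (R := R) w hw hs hl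
    rw [hμ]
    exact h1 μ) (fun g m hm hr => by
    rw [hZ_natCast]
    refine h2 g m hm fun i hi => ?_
    have := hr (m - i) (by omega)
    rwa [show ((m : ℤ) - ((m - i : ℕ) : ℤ)) = (i : ℕ) by omega, hZ_natCast] at this)
  have h4 : ∀ p, Submodule.span R (Set.range (hSym R k)) ^ p ≤
      Submodule.span R {x | ∃ w : List ℕ, w.length = p ∧ x = wordProd (hZ R k) w} := by
    intro p
    induction p with
    | zero =>
      rw [pow_zero, Submodule.one_le]
      exact Submodule.subset_span ⟨[], rfl, rfl⟩
    | succ p ih =>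
      rw [pow_succ']
      refine (mul_le_mul_of_le_right ih _).trans ?_
      rw [Submodule.span_mul_span, Submodule.span_le]
      rintro _ ⟨_, ⟨r, rfl⟩, _, ⟨w, hw, rfl⟩, rfl⟩
      refine Submodule.subset_span ⟨r :: w, by simp [hw], ?_⟩
      rw [wordProd_cons, hZ_natCast]
  have h5 : f ∈ Submodule.span R (Set.range (hSym R k)) ^ k := by rw [span_hSym_pow]; trivial
  have h6 : Submodule.span R {x | ∃ w : List ℕ, w.length = k ∧ x = wordProd (hZ R k) w} ≤
      N.comap Φ := by
    rw [Submodule.span_le]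
    rintro _ ⟨w, hw, rfl⟩
    exact h3 w hw
  exact h6 (h4 k h5)

/-- The elements `h_λ ⊗ 1` generate the right module `OΛ_k ⊗ OΛ_l` over `OΛ_{l+k}`. -/
theorem span_inl_hPart_mul : Submodule.span R (Set.range fun μ : BoxPartition k l =>
    inl R k l (hPart R μ.part)) * twistRange R k l = ⊤ := by
  set N := Submodule.span R (Set.range fun μ : BoxPartition k l =>
    inl R k l (hPart R μ.part)) * twistRange R k l with hN
  have hNP : ∀ x ∈ N, ∀ y, x * twistMap R k l y ∈ N := by
    intro x hx y
    have := Submodule.mul_mem_mul hx (twistMap_mem R k l y)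
    rwa [hN, mul_assoc, twistRange_mul] at this
  have h := hSym_reduce R k l (inl R k l).toLinearMap N (fun μ => by
    have := Submodule.mul_mem_mul (Submodule.subset_span ⟨μ, rfl⟩ :
      inl R k l (hPart R μ.part) ∈ Submodule.span R (Set.range fun μ : BoxPartition k l =>
        inl R k l (hPart R μ.part))) (twistMap_mem R k l 1)
    rwa [map_one, mul_one] at this) (fun g m hm hi => by
    -- As `ε_m = 0` in `OΛ_l` for `m > l`, this coefficient expresses `h_m ⊗ 1` by lower `h_i ⊗ 1`
    -- times elements of the image of `ρ`.
    have h1 := congrArg (PowerSeries.coeff m) (inrSeries_eAlt R k l)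
    rw [PowerSeries.coeff_mk, PowerSeries.coeff_mul,
      Finset.Nat.sum_antidiagonal_eq_sum_range_succ_mk, Finset.sum_range_succ] at h1
    simp only [PowerSeries.coeff_mk, Nat.sub_self, eAlt_zero, map_one, mul_one] at h1
    have h2 : eAlt R l m = 0 := by rw [eAlt, eps_eq_zero R l m hm, mul_zero, mul_zero]
    rw [h2, map_zero] at h1
    have h3 := eq_neg_of_add_eq_zero_right h1.symm
    change inl R k l (g * hSym R k m) ∈ N
    rw [map_mul, h3, mul_neg, Finset.mul_sum]
    refine neg_mem (sum_mem fun i hi' => ?_)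
    rw [← mul_assoc, ← map_mul]
    exact hNP _ (hi i (by simpa using hi')) _)
  rw [eq_top_iff, ← range_inl_mul_twistRange, Submodule.mul_le]
  rintro _ ⟨f, rfl⟩ _ ⟨y, rfl⟩
  exact hNP _ (h f) y

end CompleteSpanning

/-! ### Counting partitions in a box. -/

section WeightEquivalences

/-- There is an equivalence compatible with the weight functions. -/
def WeightEquiv {α β : Type*} (f : α → ℕ) (g : β → ℕ) : Prop := ∃ e : α ≃ β, ∀ x, g (e x) = f x

variable {α β γ δ ε : Type*} {f : α → ℕ} {g : β → ℕ} {h : γ → ℕ} {i : δ → ℕ}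

theorem WeightEquiv.symm (hf : WeightEquiv f g) : WeightEquiv g f := by
  obtain ⟨e, he⟩ := hf
  exact ⟨e.symm, fun x => by rw [← he, e.apply_symm_apply]⟩

theorem WeightEquiv.trans (hf : WeightEquiv f g) (hg : WeightEquiv g h) : WeightEquiv f h := by
  obtain ⟨e, he⟩ := hf
  obtain ⟨e', he'⟩ := hg
  exact ⟨e.trans e', fun x => by rw [Equiv.trans_apply, he', he]⟩

theorem WeightEquiv.refl (f : α → ℕ) : WeightEquiv f f := ⟨Equiv.refl _, fun _ => rfl⟩

/-- The weight on a product. -/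
def prodWeight (f : α → ℕ) (g : β → ℕ) (p : α × β) : ℕ := f p.1 + g p.2

theorem WeightEquiv.prod (hf : WeightEquiv f h) (hg : WeightEquiv g i) :
    WeightEquiv (prodWeight f g) (prodWeight h i) := by
  obtain ⟨e, he⟩ := hf
  obtain ⟨e', he'⟩ := hg
  exact ⟨Equiv.prodCongr e e', fun x => by simp [prodWeight, he, he']⟩

theorem WeightEquiv.prod_comm (f : α → ℕ) (g : β → ℕ) :
    WeightEquiv (prodWeight f g) (prodWeight g f) :=
  ⟨Equiv.prodComm _ _, fun x => by simp [prodWeight, add_comm]⟩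

theorem WeightEquiv.unique_prod [Unique α] (hf : ∀ x, f x = 0) (g : β → ℕ) :
    WeightEquiv (prodWeight f g) g :=
  ⟨Equiv.uniqueProd _ _, fun x => by simp [prodWeight, hf]⟩

/-- A bijection for `q^b/((1-q^b)(1-q^(a+b))) + 1/((1-q^a)(1-q^(a+b))) = 1/((1-q^a)(1-q^b))`. A pair
of multiplicities `(m, m')` of `a` and `b` splits into the common part `t`, of weight `(a + b) * t`,
and an excess: of `m`, possibly zero, or of `m'`, at least one, which accounts for the summand `b`.
-/
theorem WeightEquiv.pascal {s₁ : α → ℕ} {s₂ : β → ℕ} {p : γ → ℕ} {u : δ → ℕ} {v : ε → ℕ} (a b : ℕ)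
    (h₁ : WeightEquiv (prodWeight s₁ p) (prodWeight u (prodWeight (b * ·) v)))
    (h₂ : WeightEquiv (prodWeight s₂ p) (prodWeight (prodWeight (a * ·) u) v)) :
    WeightEquiv (prodWeight (Sum.elim (fun x => s₁ x + b) s₂) (prodWeight ((a + b) * ·) p))
      (prodWeight (prodWeight (a * ·) u) (prodWeight (b * ·) v)) := by
  obtain ⟨e₁, he₁⟩ := h₁
  obtain ⟨e₂, he₂⟩ := h₂
  let F : (α ⊕ β) × (ℕ × γ) → (ℕ × δ) × (ℕ × ε) := fun x => Sum.elim
    (fun y => ((x.2.1, (e₁ (y, x.2.2)).1),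
      (x.2.1 + (e₁ (y, x.2.2)).2.1 + 1, (e₁ (y, x.2.2)).2.2)))
    (fun y => ((x.2.1 + (e₂ (y, x.2.2)).1.1, (e₂ (y, x.2.2)).1.2), (x.2.1, (e₂ (y, x.2.2)).2))) x.1
  let G : (ℕ × δ) × (ℕ × ε) → (α ⊕ β) × (ℕ × γ) := fun z =>
    if z.2.1 ≤ z.1.1 then
      (Sum.inr (e₂.symm ((z.1.1 - z.2.1, z.1.2), z.2.2)).1,
        (z.2.1, (e₂.symm ((z.1.1 - z.2.1, z.1.2), z.2.2)).2))
    else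
      (Sum.inl (e₁.symm (z.1.2, (z.2.1 - z.1.1 - 1, z.2.2))).1,
        (z.1.1, (e₁.symm (z.1.2, (z.2.1 - z.1.1 - 1, z.2.2))).2))
  refine ⟨⟨F, G, ?_, ?_⟩, ?_⟩
  · rintro ⟨y | y, t, c⟩
    · have h : ¬ t + (e₁ (y, c)).2.1 + 1 ≤ t := by omega
      have h' : t + (e₁ (y, c)).2.1 + 1 - t - 1 = (e₁ (y, c)).2.1 := by omega
      simp [F, G, h, h']
    · simp [F, G]
  · rintro ⟨⟨m, x⟩, ⟨m', y⟩⟩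
    by_cases h : m' ≤ m
    · simp [F, G, h]
    · have h' : m + (m' - m - 1) + 1 = m' := by omega
      simp [F, G, h, h']
  · rintro ⟨y | y, t, c⟩
    · have := he₁ (y, c)
      simp only [prodWeight] at this
      simp only [prodWeight, Equiv.coe_fn_mk, F, Sum.elim_inl]
      linarith
    · have := he₂ (y, c)
      simp only [prodWeight] at this
      simp only [prodWeight, Equiv.coe_fn_mk, F, Sum.elim_inr]
      linarith

theorem weightEquiv_parts_succ (n : ℕ) : WeightEquiv
    (partsWeight : (Fin (n + 1) → ℕ) → ℕ)
    (prodWeight ((n + 1) * ·) (partsWeight : (Fin n → ℕ) → ℕ)) := by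
  refine ⟨(Fin.consEquiv fun _ : Fin (n + 1) => ℕ).symm, fun b => ?_⟩
  simp only [prodWeight, partsWeight, Fin.sum_univ_succ, Fin.consEquiv]
  simp [Fin.tail]

/-- Adding a row of full length, or enlarging the box. -/
def BoxPartition.pascalMap (k m : ℕ) :
    BoxPartition k (m + 1) ⊕ BoxPartition (k + 1) m → BoxPartition (k + 1) (m + 1) :=
  Sum.elim
    (fun μ => ⟨Fin.cons (Fin.last (m + 1)) μ.1, by
      intro i j hij
      cases i using Fin.cases with
      | zero => exact Fin.le_last _
      | succ i =>
        cases j using Fin.cases with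
        | zero => exact absurd hij (by simp)
        | succ j => simpa using μ.2 (Fin.succ_le_succ_iff.mp hij)⟩)
    (fun μ => ⟨fun i => (μ.1 i).castSucc, fun _ _ hij => Fin.castSucc_le_castSucc_iff.mpr (μ.2 hij)⟩)

theorem BoxPartition.pascalMap_inl_zero {k m : ℕ} (μ : BoxPartition k (m + 1)) :
    (pascalMap k m (Sum.inl μ)).1 0 = Fin.last (m + 1) := rfl

theorem BoxPartition.pascalMap_inl_succ {k m : ℕ} (μ : BoxPartition k (m + 1)) (i : Fin k) :
    (pascalMap k m (Sum.inl μ)).1 i.succ = μ.1 i := rfl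

theorem BoxPartition.pascalMap_inr {k m : ℕ} (μ : BoxPartition (k + 1) m) (i : Fin (k + 1)) :
    (pascalMap k m (Sum.inr μ)).1 i = (μ.1 i).castSucc := rfl

/-- A partition in the larger box either has a full first row or fits into the narrower box. -/
theorem BoxPartition.pascalMap_bijective (k m : ℕ) :
    Function.Bijective (BoxPartition.pascalMap k m) := by
  constructor
  · have key : ∀ (μ : BoxPartition k (m + 1)) (ν : BoxPartition (k + 1) m),
        pascalMap k m (Sum.inl μ) ≠ pascalMap k m (Sum.inr ν) := by
      intro μ ν h
      have := congrFun (congrArg Subtype.val h) 0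
      exact (Fin.castSucc_lt_last (ν.1 0)).ne this.symm
    rintro (μ | μ) (ν | ν) h
    · congr 1
      apply Subtype.ext
      funext i
      have := congrFun (congrArg Subtype.val h) i.succ
      rwa [pascalMap_inl_succ, pascalMap_inl_succ] at this
    · exact absurd h (key _ _)
    · exact absurd h.symm (key _ _)
    · congr 1
      apply Subtype.ext
      funext i
      have := congrFun (congrArg Subtype.val h) i
      rw [pascalMap_inr, pascalMap_inr] at this
      exact Fin.castSucc_injective _ this
  · intro μ
    by_cases h : μ.1 0 = Fin.last (m + 1)
    · refine ⟨Sum.inl ⟨fun i => μ.1 i.succ, fun _ _ hij => μ.2 (Fin.succ_le_succ_iff.mpr hij)⟩, ?_⟩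
      apply Subtype.ext
      funext i
      cases i using Fin.cases with
      | zero => exact h.symm
      | succ i => rfl
    · have h' : ∀ i, μ.1 i ≠ Fin.last (m + 1) := fun i e =>
        h (le_antisymm (Fin.le_last _) (e ▸ μ.2 (Fin.zero_le i)))
      refine ⟨Sum.inr ⟨fun i => (μ.1 i).castPred (h' i), fun _ _ hij =>
        Fin.castPred_le_castPred_iff.mpr (μ.2 hij)⟩, ?_⟩
      apply Subtype.ext
      funext i
      exact Fin.castSucc_castPred _ (h' i)

theorem BoxPartition.size_pascalMap (k m : ℕ) (x : BoxPartition k (m + 1) ⊕ BoxPartition (k + 1) m) :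
    (pascalMap k m x).size = Sum.elim (fun μ => μ.size + (m + 1)) BoxPartition.size x := by
  rcases x with μ | μ
  · simp only [BoxPartition.size, BoxPartition.part, Fin.sum_univ_succ, pascalMap_inl_zero,
      pascalMap_inl_succ, Sum.elim_inl, Fin.val_last]
    exact add_comm _ _
  · simp only [BoxPartition.size, BoxPartition.part, pascalMap_inr, Sum.elim_inr, Fin.val_castSucc]

instance (m : ℕ) : Unique (BoxPartition 0 m) where
  default := ⟨fun _ => 0, fun _ _ _ => le_rfl⟩
  uniq _ := Subtype.ext (funext fun i => i.elim0)

instance (k : ℕ) : Unique (BoxPartition k 0) where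
  default := ⟨fun _ => 0, fun _ _ _ => le_rfl⟩
  uniq _ := Subtype.ext (funext fun _ => Subsingleton.elim (α := Fin 1) _ _)

instance (k m : ℕ) : Finite (BoxPartition k m) := inferInstanceAs (Finite (Subtype _))

noncomputable instance (k m : ℕ) : Fintype (BoxPartition k m) := Fintype.ofFinite _

theorem BoxPartition.size_eq_zero_left (m : ℕ) (μ : BoxPartition 0 m) : μ.size = 0 := by
  simp [BoxPartition.size]

theorem BoxPartition.size_eq_zero_right (k : ℕ) (μ : BoxPartition k 0) : μ.size = 0 :=
  Finset.sum_eq_zero fun i _ => Nat.le_zero.mp (μ.part_le i)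

/-- The count behind freeness over `OΛ_n`: the generating function of the box times `∏_{i ≤ n} (1 -
q^i)⁻¹` is the product of `∏_{i ≤ k} (1 - q^i)⁻¹` and `∏_{i ≤ l} (1 - q^i)⁻¹`. Induction along the
Pascal recursion on both sides. -/
theorem weightEquiv_box (n : ℕ) : ∀ k l, l + k = n →
    WeightEquiv (prodWeight (BoxPartition.size : BoxPartition k l → ℕ)
      (partsWeight : (Fin n → ℕ) → ℕ))
    (prodWeight (partsWeight : (Fin k → ℕ) → ℕ) (partsWeight : (Fin l → ℕ) → ℕ)) := by
  have hk : ∀ l, WeightEquiv (prodWeight (BoxPartition.size : BoxPartition 0 l → ℕ)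
      (partsWeight : (Fin l → ℕ) → ℕ))
      (prodWeight (partsWeight : (Fin 0 → ℕ) → ℕ) (partsWeight : (Fin l → ℕ) → ℕ)) := fun l =>
    (WeightEquiv.unique_prod (BoxPartition.size_eq_zero_left l) _).trans
      (WeightEquiv.unique_prod (fun _ => by simp [partsWeight]) _).symm
  have hl : ∀ k, WeightEquiv (prodWeight (BoxPartition.size : BoxPartition k 0 → ℕ)
      (partsWeight : (Fin k → ℕ) → ℕ))
      (prodWeight (partsWeight : (Fin k → ℕ) → ℕ) (partsWeight : (Fin 0 → ℕ) → ℕ)) := fun k =>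
    ((WeightEquiv.unique_prod (BoxPartition.size_eq_zero_right k) _).trans
      (WeightEquiv.unique_prod (fun _ => by simp [partsWeight]) _).symm).trans
      (WeightEquiv.prod_comm _ _)
  induction n with
  | zero =>
    intro k l h
    obtain rfl : k = 0 := by omega
    obtain rfl : l = 0 := by omega
    exact hk 0
  | succ n ih =>
    intro k l h
    rcases k with _ | k
    · obtain rfl : l = n + 1 := by omega
      exact hk _
    rcases l with _ | l
    · obtain rfl : k = n := by omega
      exact hl _
    have h1 := (ih k (l + 1) (by omega)).trans
      ((WeightEquiv.refl _).prod (weightEquiv_parts_succ l))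
    have h2 := (ih (k + 1) l (by omega)).trans
      ((weightEquiv_parts_succ k).prod (WeightEquiv.refl _))
    have h3 := WeightEquiv.pascal (k + 1) (l + 1) h1 h2
    have h4 : WeightEquiv (Sum.elim (fun μ : BoxPartition k (l + 1) => μ.size + (l + 1))
        (BoxPartition.size : BoxPartition (k + 1) l → ℕ)) BoxPartition.size :=
      ⟨Equiv.ofBijective _ (BoxPartition.pascalMap_bijective k l),
        BoxPartition.size_pascalMap k l⟩
    have h5 := weightEquiv_parts_succ n
    have e : n + 1 = k + 1 + (l + 1) := by omega
    have h6 : WeightEquiv (partsWeight : (Fin (n + 1) → ℕ) → ℕ)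
      (prodWeight ((k + 1 + (l + 1)) * ·) (partsWeight : (Fin n → ℕ) → ℕ)) := by
      rw [← e]; exact h5
    exact ((h4.symm.prod h6).trans h3).trans
      ((weightEquiv_parts_succ k).symm.prod (weightEquiv_parts_succ l).symm)

/-- The number of partitions in a box is symmetric in its sides. -/
theorem BoxPartition.card_comm (k m : ℕ) :
    Fintype.card (BoxPartition k m) = Fintype.card (BoxPartition m k) := by
  suffices H : ∀ n k m, k + m = n →
      Fintype.card (BoxPartition k m) = Fintype.card (BoxPartition m k) from H _ k m rfl
  intro n
  induction n with
  | zero =>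
    intro k m h
    obtain rfl : k = 0 := by omega
    obtain rfl : m = 0 := by omega
    rfl
  | succ n ih =>
    intro k m h
    rcases k with _ | k
    · rw [Fintype.card_unique, Fintype.card_unique]
    rcases m with _ | m
    · rw [Fintype.card_unique, Fintype.card_unique]
    rw [← Fintype.card_of_bijective (BoxPartition.pascalMap_bijective k m),
      ← Fintype.card_of_bijective (BoxPartition.pascalMap_bijective m k), Fintype.card_sum,
      Fintype.card_sum, ih k (m + 1) (by omega), ih (k + 1) m (by omega), add_comm]

/-- Splitting by whether the first row is full matches the Pascal recursion of `qpBinom`, after a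
shift by the monomial `(πq)^(kl)`. -/
theorem sum_box_qpMonomial (n : ℕ) : ∀ k l, l + k = n →
    ∑ μ : BoxPartition k l, qpMonomial (2 * (μ.size : ℤ)) (μ.size : ZMod 2) =
      qpMonomial ((k : ℤ) * l) (k * l : ℕ) * qpBinom n k := by
  induction n with
  | zero =>
    intro k l h
    obtain rfl : k = 0 := by omega
    obtain rfl : l = 0 := by omega
    simp [BoxPartition.size_eq_zero_left, qpMonomial_zero, qpBinom]
  | succ n ih =>
    intro k l h
    rcases k with _ | k
    · simp [BoxPartition.size_eq_zero_left, qpMonomial_zero, qpBinom]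
    rcases l with _ | l
    · obtain rfl : k = n := by omega
      have h1 := ih k 0 (by omega)
      simp only [Fintype.sum_unique, BoxPartition.size_eq_zero_right] at h1 ⊢
      rw [qpBinom, qpBinom_of_lt k (k + 1) (by omega)]
      simpa [qpMonomial_zero] using h1
    have h1 := ih k (l + 1) (by omega)
    have h2 := ih (k + 1) l (by omega)
    rw [← (Equiv.ofBijective _ (BoxPartition.pascalMap_bijective k l)).sum_comp]
    simp only [Equiv.ofBijective_apply, BoxPartition.size_pascalMap, Fintype.sum_sum_type,
      Sum.elim_inl, Sum.elim_inr]
    have h3 : ∀ μ : BoxPartition k (l + 1),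
        qpMonomial (2 * ((μ.size + (l + 1) : ℕ) : ℤ)) ((μ.size + (l + 1) : ℕ) : ZMod 2) =
        qpMonomial (2 * ((l + 1 : ℕ) : ℤ)) ((l + 1 : ℕ) : ZMod 2) *
          qpMonomial (2 * (μ.size : ℤ)) (μ.size : ZMod 2) := by
      intro μ
      rw [qpMonomial_mul]
      congr 1
      · push_cast; ring
      · push_cast; ring
    rw [Finset.sum_congr rfl fun μ _ => h3 μ, ← Finset.mul_sum, h1, h2, qpBinom]
    have hn : (n : ℤ) = k + l + 1 := by omega
    have e1 : qpMonomial (2 * ((l + 1 : ℕ) : ℤ)) ((l + 1 : ℕ) : ZMod 2) *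
        qpMonomial ((k : ℤ) * (l + 1 : ℕ)) (k * (l + 1) : ℕ) =
        qpMonomial (((k + 1 : ℕ) : ℤ) * (l + 1 : ℕ)) ((k + 1) * (l + 1) : ℕ) *
          qpMonomial ((n : ℤ) - k) 0 := by
      rw [qpMonomial_mul, qpMonomial_mul, hn]
      congr 1
      · push_cast; ring
      · push_cast; ring
    have e2 : qpMonomial (((k + 1 : ℕ) : ℤ) * l) ((k + 1) * l : ℕ) =
        qpMonomial (((k + 1 : ℕ) : ℤ) * (l + 1 : ℕ)) ((k + 1) * (l + 1) : ℕ) *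
          qpMonomial (-((k : ℤ) + 1)) (k + 1) := by
      -- The parities on the two sides differ by `2(k + 1)`, which is invisible since `π² = 1`.
      have h4 : ((k + 1 : ℕ) : ZMod 2) + ((k + 1 : ℕ) : ZMod 2) = 0 := CharTwo.add_self_eq_zero _
      rw [qpMonomial_mul]
      congr 1
      · push_cast; ring
      · push_cast at h4 ⊢
        linear_combination -h4
    linear_combination qpBinom n k * e1 + qpBinom n (k + 1) * e2

end WeightEquivalences

/-! ### `OΛ_k ⊗ OΛ_l` as a free right module over `OΛ_{l+k}`. -/

section TwistedBasis

variable (R : Type*) [CommRing R] (k l : ℕ)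

variable {R k l} in
theorem superEmb_tmul_mem {i j : ℕ} {f : OSym R k} (hf : f ∈ oddSymGrading R k i) {s : OSym R l}
    (hs : s ∈ oddSymGrading R l j) :
    superEmb R k l (tmulOSym R f s) ∈ skewGrading R (l + k) (i + j) := by
  have key : ∀ {m : ℕ} (v : Fin m → OPol R (l + k)) (hv : AntiComm v)
      (_ : ∀ a, v a ∈ skewGrading R (l + k) 1) {p : ℕ} {g : OPol R m}
      (_ : g ∈ skewGrading R m p), OPol.liftTilde v hv g ∈ skewGrading R (l + k) p := by
    intro m v hv h1 p g hg
    have hle : Submodule.span R (Set.range v) ≤ Submodule.span R (Set.range (xVar R (l + k))) := by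
      rw [Submodule.span_le]
      rintro _ ⟨a, rfl⟩
      have := h1 a
      rw [skewGrading, pow_one] at this
      exact this
    exact pow_le_pow_left' hle p (liftTilde_mem_pow R v hv p hg)
  rw [superEmb_tmul]
  exact SetLike.GradedMul.mul_mem (key _ _ (fun _ => xTilde_mem_skewGrading R _ _) hf)
    (key _ _ (fun _ => xTilde_mem_skewGrading R _ _) hs)

theorem hPart_mem_oddSymGrading {k : ℕ} (a : Fin k → ℕ) :
    hPart R a ∈ oddSymGrading R k (∑ i, a i) := by
  have h := SetLike.list_prod_map_mem_graded (A := oddSymGrading R k) (List.finRange k) a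
    (fun i => hSym R k (a i)) fun i _ => hSym_mem_oddSymGrading R k (a i)
  rw [hPart, List.ofFn_eq_map]
  rwa [← List.ofFn_eq_map, List.sum_ofFn] at h

/-- The products `(h_λ ⊗ 1) ρ(ε^μ)`. -/
def twistFamily (p : BoxPartition k l × (Fin (l + k) → ℕ)) : OSymOSym R k l :=
  inl R k l (hPart R p.1.part) * twistMap R k l (epsMon R (l + k) p.2)

theorem span_twistFamily : Submodule.span R (Set.range (twistFamily R k l)) = ⊤ := by
  rw [eq_top_iff, ← span_inl_hPart_mul, twistRange]
  have h : Subalgebra.toSubmodule (twistMap R k l).range =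
      Submodule.span R (Set.range fun μ => twistMap R k l (epsMon R (l + k) μ)) := by
    have : Submodule.map (twistMap R k l).toLinearMap ⊤ =
        Submodule.span R (Set.range fun μ => twistMap R k l (epsMon R (l + k) μ)) := by
      rw [← span_epsMon, Submodule.map_span, ← Set.range_comp]
      rfl
    rw [← this, Submodule.map_top]
    rfl
  rw [h, Submodule.span_mul_span, Submodule.span_le]
  rintro _ ⟨_, ⟨μ, rfl⟩, _, ⟨a, rfl⟩, rfl⟩
  exact Submodule.subset_span ⟨(μ, a), rfl⟩

/-- The weight of the products `(h_λ ⊗ 1) ρ(ε^μ)`. -/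
abbrev twistWeight : BoxPartition k l × (Fin (l + k) → ℕ) → ℕ :=
  prodWeight BoxPartition.size partsWeight

/-- The tensor basis of products of `ε_r` in both factors, reindexed so that its degrees match those
of `twistFamily`. -/
theorem exists_twistBasis : ∃ b : Module.Basis (BoxPartition k l × (Fin (l + k) → ℕ)) R
    (OSymOSym R k l), ∀ p, superEmb R k l (b p) ∈ skewGrading R (l + k) (twistWeight k l p) := by
  obtain ⟨e, he⟩ := weightEquiv_box (l + k) k l rfl
  let b := (((epsBasis R k).tensorProduct (epsBasis R l)).map
    (GradedTensorProduct.of R (oddSymGrading R k) (oddSymGrading R l))).reindex e.symm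
  have hb : ∀ p, b p = tmulOSym R (epsMon R k (e p).1) (epsMon R l (e p).2) := by
    intro p
    rw [Module.Basis.reindex_apply, Module.Basis.map_apply, Equiv.symm_symm,
      Module.Basis.tensorProduct_apply', epsBasis_apply, epsBasis_apply]
    rfl
  refine ⟨b, fun p => ?_⟩
  have h := superEmb_tmul_mem (epsMon_mem_oddSymGrading R k (e p).1)
    (epsMon_mem_oddSymGrading R l (e p).2)
  have h2 : partsWeight (e p).1 + partsWeight (e p).2 = twistWeight k l p := he p
  rw [hb, ← h2]
  exact h

theorem superEmb_twistFamily_mem (p : BoxPartition k l × (Fin (l + k) → ℕ)) :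
    superEmb R k l (twistFamily R k l p) ∈ skewGrading R (l + k) (twistWeight k l p) := by
  rw [twistFamily, map_mul, superEmb_twistMap]
  refine SetLike.GradedMul.mul_mem ?_ (epsMon_mem_oddSymGrading R (l + k) p.2)
  have h := superEmb_tmul_mem (hPart_mem_oddSymGrading R p.1.part)
    (SetLike.GradedOne.one_mem (A := oddSymGrading R l))
  rwa [add_zero] at h

theorem finite_twistWeight_eq (m : ℕ) : {p | twistWeight k l p = m}.Finite := by
  refine ((Set.finite_univ (α := BoxPartition k l)).prod
    ((Set.finite_Iic m).biUnion fun j _ => finite_partsWeight_eq (l + k) j)).subset ?_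
  rintro ⟨μ, a⟩ h
  have h' : μ.size + partsWeight a = m := h
  exact ⟨trivial, Set.mem_biUnion (show partsWeight a ∈ Set.Iic m from by
    rw [Set.mem_Iic]; omega) rfl⟩

/-- Spanning and counting once more, with the grading borrowed from skew polynomials through
`superEmb`. -/
theorem linearIndependent_twistFamily : LinearIndependent R (twistFamily R k l) := by
  obtain ⟨b, hb⟩ := exists_twistBasis R k l
  exact linearIndependent_of_span_eq_top (skewGrading R (l + k)) (superEmb R k l).toLinearMap
    (superEmb_injective R k l) b (twistWeight k l) (finite_twistWeight_eq k l) hb _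
    (superEmb_twistFamily_mem R k l) (span_twistFamily R k l)

/-- The basis of `OΛ_k ⊗ OΛ_l` formed by the products `(h_λ ⊗ 1) ρ(ε^μ)`. -/
def twistBasis : Module.Basis (BoxPartition k l × (Fin (l + k) → ℕ)) R (OSymOSym R k l) :=
  Module.Basis.mk (linearIndependent_twistFamily R k l) (span_twistFamily R k l).ge

theorem twistBasis_apply (p : BoxPartition k l × (Fin (l + k) → ℕ)) :
    twistBasis R k l p = twistFamily R k l p := Module.Basis.mk_apply _ _ _

open Classical in
/-- The coordinates of `OΛ_k ⊗ OΛ_l` as a free right module over `OΛ_{l+k}` with basis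
`h_λ ⊗ 1`. -/
def twistCoord (μ : BoxPartition k l) : OSymOSym R k l →ₗ[R] OSym R (l + k) :=
  (twistBasis R k l).constr R fun p => if p.1 = μ then epsMon R (l + k) p.2 else 0

variable {R k l}

open Classical in
theorem twistCoord_inl_mul (μ ν : BoxPartition k l) (x : OSym R (l + k)) :
    twistCoord R k l μ (inl R k l (hPart R ν.part) * twistMap R k l x) =
      if ν = μ then x else 0 := by
  have h : x ∈ Submodule.span R (Set.range (epsMon R (l + k))) := by rw [span_epsMon]; trivial
  induction h using Submodule.span_induction with
  | mem x hx =>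
    obtain ⟨a, rfl⟩ := hx
    have := (twistBasis R k l).constr_basis R
      (fun p => if p.1 = μ then epsMon R (l + k) p.2 else 0) (ν, a)
    rwa [twistBasis_apply] at this
  | zero => simp
  | add x y _ _ hx hy =>
    rw [map_add, mul_add, map_add, hx, hy]
    split_ifs <;> simp
  | smul r x _ hx =>
    rw [map_smul, mul_smul_comm, map_smul, hx]
    split_ifs <;> simp

theorem twistCoord_mul (μ : BoxPartition k l) (b : OSymOSym R k l) (x : OSym R (l + k)) :
    twistCoord R k l μ (b * twistMap R k l x) = twistCoord R k l μ b * x := by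
  have h : b ∈ Submodule.span R (Set.range (twistFamily R k l)) := by
    rw [span_twistFamily]; trivial
  induction h using Submodule.span_induction with
  | mem b hb =>
    obtain ⟨⟨ν, a⟩, rfl⟩ := hb
    rw [twistFamily, mul_assoc, ← map_mul, twistCoord_inl_mul, twistCoord_inl_mul]
    split_ifs <;> simp
  | zero => simp
  | add b c _ _ hb hc => rw [add_mul, map_add, map_add, hb, hc, add_mul]
  | smul r b _ hb => rw [smul_mul_assoc, map_smul, map_smul, hb, smul_mul_assoc]

/-- Only basis vectors of weight `m` occur in `b`; those belonging to `μ` leave weight `m - μ.size`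
for the coordinate. -/
theorem twistCoord_mem {m : ℕ} {b : OSymOSym R k l}
    (hb : superEmb R k l b ∈ skewGrading R (l + k) m) (μ : BoxPartition k l) :
    (μ.size ≤ m → twistCoord R k l μ b ∈
      Submodule.span R {x | ∃ a, partsWeight a = m - μ.size ∧ x = epsMon R (l + k) a}) ∧
    (m < μ.size → twistCoord R k l μ b = 0) := by
  have h1 : ∀ p, twistWeight k l p ≠ m → (twistBasis R k l).repr b p = 0 := by
    intro p hp
    have h2 := gradedProj_of_mem (skewGrading R (l + k)) (superEmb R k l).toLinearMap
      (superEmb_injective R k l) (twistBasis R k l) (twistWeight k l)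
      (fun p => by rw [twistBasis_apply]; exact superEmb_twistFamily_mem R k l p) hb
      (twistWeight k l p)
    rw [if_neg hp] at h2
    have h3 := repr_gradedProj (twistBasis R k l) (twistWeight k l) (twistWeight k l p) b p
    rw [h2, if_pos rfl] at h3
    simpa using h3.symm
  have h2 : ∀ N : Submodule R (OSym R (l + k)), (∀ a, μ.size + partsWeight a = m →
      epsMon R (l + k) a ∈ N) → twistCoord R k l μ b ∈ N := by
    intro N hN
    rw [twistCoord, Module.Basis.constr_apply]
    refine sum_mem fun p _ => ?_
    beta_reduce
    split_ifs with h
    · by_cases hp : twistWeight k l p = m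
      · exact Submodule.smul_mem _ _ (hN _ (by rw [← hp, ← h]; rfl))
      · rw [h1 p hp, zero_smul]; exact zero_mem _
    · rw [smul_zero]; exact zero_mem _
  refine ⟨fun hm => h2 _ fun a ha => Submodule.subset_span ⟨a, by omega, rfl⟩, fun hm => ?_⟩
  have := h2 ⊥ fun a ha => by omega
  simpa using this

/-- The coordinates of `OΛ_k ⊗ OΛ_l` as a free right module over `OΛ_n`. -/
theorem exists_coords {n : ℕ} (h : l + k = n) {ρ : OSym R n →ₐ[R] OSymOSym R k l}
    (hρ : ∀ r, ρ (eps R n r) = ∑ j ∈ Finset.range (r + 1),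
      (-1 : R) ^ ((r - j) * j) • tmulOSym R (eps R k (r - j)) (eps R l j)) :
    ∃ φ : BoxPartition k l → OSymOSym R k l →ₗ[R] OSym R n,
      (∀ μ b x, φ μ (b * ρ x) = φ μ b * x) ∧
      (∀ μ, φ μ (tmulOSym R (hPart R μ.part) 1) = 1) ∧
      (∀ μ ν, ν ≠ μ → φ μ (tmulOSym R (hPart R ν.part) 1) = 0) ∧
      (∀ i j, ∀ f ∈ oddSymGrading R k i, ∀ s ∈ oddSymGrading R l j, ∀ μ,
        (μ.size ≤ i + j → φ μ (tmulOSym R f s) ∈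
          Submodule.span R {x | ∃ a, partsWeight a = i + j - μ.size ∧ x = epsMon R n a}) ∧
        (i + j < μ.size → φ μ (tmulOSym R f s) = 0)) := by
  -- The statement uses `l` with `l + k = n` because `n - k + k` equals `n` only propositionally.
  subst h
  obtain rfl := eq_twistMap hρ
  have h1 : ∀ f, tmulOSym R f 1 = inl R k l f * twistMap R k l 1 := by
    intro f
    rw [map_one, mul_one]
    rfl
  refine ⟨twistCoord R k l, twistCoord_mul, fun μ => ?_, fun μ ν hμ => ?_, fun i j f hf s hs μ =>
    twistCoord_mem (superEmb_tmul_mem hf hs) μ⟩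
  · rw [h1, twistCoord_inl_mul, if_pos rfl]
  · rw [h1, twistCoord_inl_mul, if_neg hμ]

end TwistedBasis

/-! ### Bases and gradings of free modules over a graded algebra. -/

section GradedFree

variable {R A M ι : Type*} [CommRing R] [CommRing A] [Algebra R A] [AddCommGroup M] [Module R M]
  [Module A M] [Fintype ι]

/-- A surjective endomorphism of a finite module is injective, so a generating family of the size of
a basis is a basis. -/
theorem isBasis_of_span_eq_top {A M ι κ : Type*} [CommRing A] [AddCommGroup M] [Module A M]
    [Finite ι] (b : Module.Basis ι A M) (v : κ → M) (e : ι ≃ κ)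
    (hv : Submodule.span A (Set.range v) = ⊤) : IsBasis A v := by
  let T : M →ₗ[A] M := b.constr A (v ∘ e)
  have hT : ∀ i, T (b i) = v (e i) := fun i => b.constr_basis A _ i
  have hs : Function.Surjective T := by
    rw [← LinearMap.range_eq_top, eq_top_iff, ← hv, Submodule.span_le]
    rintro _ ⟨i, rfl⟩
    exact ⟨b (e.symm i), by rw [hT, e.apply_symm_apply]⟩
  have : Module.Finite A M := Module.Finite.of_basis b
  let E := LinearEquiv.ofBijective T
    ⟨OrzechProperty.injective_of_surjective_endomorphism T hs, hs⟩
  refine ⟨(b.map E).reindex e, funext fun i => ?_⟩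
  rw [Module.Basis.reindex_apply, Module.Basis.map_apply]
  exact (hT _).trans (by rw [e.apply_symm_apply])

variable {𝒜 : ℕ → Submodule R A} {b : Module.Basis ι A M} {deg : ι → ℕ}
  {𝒢 : ℕ → Submodule R M}

/-- An element is homogeneous if its coordinates in a homogeneous basis are. -/
theorem mem_of_repr_mem (hb : ∀ i, b i ∈ 𝒢 (deg i))
    (hs : ∀ i j, ∀ a ∈ 𝒜 i, ∀ x ∈ 𝒢 j, a • x ∈ 𝒢 (i + j)) {m : ℕ} {x : M}
    (hx : ∀ i, (deg i ≤ m → b.repr x i ∈ 𝒜 (m - deg i)) ∧ (m < deg i → b.repr x i = 0)) :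
    x ∈ 𝒢 m := by
  rw [← b.sum_repr x]
  refine sum_mem fun i _ => ?_
  rcases Nat.lt_or_ge m (deg i) with h | h
  · rw [(hx i).2 h, zero_smul]; exact zero_mem _
  · have := hs _ _ _ ((hx i).1 h) _ (hb i)
    rwa [Nat.sub_add_cancel h] at this

theorem isInternal_of_basis [GradedAlgebra 𝒜] (hb : ∀ i, b i ∈ 𝒢 (deg i))
    (hs : ∀ i j, ∀ a ∈ 𝒜 i, ∀ x ∈ 𝒢 j, a • x ∈ 𝒢 (i + j))
    (hx : ∀ m, ∀ x ∈ 𝒢 m, ∀ i,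
      (deg i ≤ m → b.repr x i ∈ 𝒜 (m - deg i)) ∧ (m < deg i → b.repr x i = 0)) :
    DirectSum.IsInternal 𝒢 := by
  classical
  -- The projection to degree `m` takes the component of degree `m - deg i` of the coordinate at
  -- `i`; the guard discards the indices where the truncated subtraction is meaningless.
  let P : ℕ → M → M := fun m x => ∑ i, (if deg i ≤ m then
    (DirectSum.decompose 𝒜 (b.repr x i) (m - deg i) : A) else 0) • b i
  have hP : ∀ m m' (x : 𝒢 m'), P m x = if m' = m then (x : M) else 0 := by
    intro m m' x
    have h1 := hx m' x x.2
    split_ifs with h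
    · subst h
      conv_rhs => rw [← b.sum_repr (x : M)]
      refine Finset.sum_congr rfl fun i _ => ?_
      congr 1
      split_ifs with h2
      · exact DirectSum.decompose_of_mem_same _ ((h1 i).1 h2)
      · exact ((h1 i).2 (by omega)).symm
    · refine Finset.sum_eq_zero fun i _ => ?_
      split_ifs with h2
      · rcases Nat.lt_or_ge m' (deg i) with h3 | h3
        · rw [(h1 i).2 h3]; simp
        · rw [DirectSum.decompose_of_mem_ne _ ((h1 i).1 h3) (by omega), zero_smul]
      · rw [zero_smul]
  have hPadd : ∀ m x y, P m (x + y) = P m x + P m y := by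
    intro m x y
    rw [← Finset.sum_add_distrib]
    refine Finset.sum_congr rfl fun i _ => ?_
    rw [← add_smul]
    split_ifs <;> simp
  have hPz : ∀ m (z : ⨁ m, 𝒢 m), P m (DirectSum.coeAddMonoidHom 𝒢 z) = (z m : M) := by
    intro m z
    induction z using DirectSum.induction_on with
    | zero => simp [P]
    | of m' x =>
      rw [DirectSum.coeAddMonoidHom_of, hP]
      split_ifs with h
      · subst h; rw [DirectSum.of_eq_same]
      · rw [DirectSum.of_eq_of_ne _ _ _ (Ne.symm h)]; rfl
    | add z z' h h' => rw [map_add, hPadd, h, h', DirectSum.add_apply, Submodule.coe_add]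
  refine ⟨fun z z' h => ?_, fun x => ?_⟩
  · ext m
    rw [← hPz, ← hPz, h]
  · rw [← b.sum_repr x]
    refine sum_mem (S := AddMonoidHom.mrange (DirectSum.coeAddMonoidHom 𝒢)) fun i _ => ?_
    rw [← DirectSum.sum_support_decompose 𝒜 (b.repr x i), Finset.sum_smul]
    exact sum_mem (S := AddMonoidHom.mrange (DirectSum.coeAddMonoidHom 𝒢)) fun j _ =>
      ⟨DirectSum.of (fun m => 𝒢 m) (j + deg i) ⟨_, hs j (deg i) _ (SetLike.coe_mem _) _ (hb i)⟩,
        DirectSum.coeAddMonoidHom_of _ _ _⟩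

end GradedFree

/-! ### The algebra `A_n`. -/

section CoefficientElements

variable (R : Type*) [CommRing R] (n : ℕ)

/-- The odd generator `d` of `A_n`. -/
def dElt : CoeffAlg R n := CoeffAlg.mk R n (dPoly R n)

/-- The elements `χ_i` of `A_n`. -/
def chiElt (i : ℕ) : CoeffAlg R n := CoeffAlg.mk R n (chiPoly R n i)

theorem dElt_mul_self : dElt R n * dElt R n = 0 := by
  rw [dElt, ← map_mul, ← pow_two]
  exact Ideal.Quotient.eq_zero_iff_mem.mpr (Ideal.subset_span (Or.inl rfl))

theorem dElt_mul_chiElt (h : Even n) : dElt R n * chiElt R n (n / 2) = 0 := by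
  rw [dElt, chiElt, ← map_mul]
  exact Ideal.Quotient.eq_zero_iff_mem.mpr (Ideal.subset_span (Or.inr ⟨h, rfl⟩))

theorem cElt_two_mul (i : ℕ) : cElt R n (2 * i) = chiElt R n i := by
  rw [cElt, if_pos (even_two_mul i), Nat.mul_div_cancel_left _ two_pos, chiElt]

theorem cElt_two_mul_add_one (i : ℕ) : cElt R n (2 * i + 1) = dElt R n * chiElt R n i := by
  rw [cElt, if_neg (by simp), Nat.add_sub_cancel, Nat.mul_div_cancel_left _ two_pos, map_mul,
    chiElt, dElt]

theorem chiElt_zero : chiElt R n 0 = 1 := by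
  rw [chiElt, chiPoly, if_pos rfl, map_one]

theorem chiElt_eq_zero {i : ℕ} (h : n / 2 < i) : chiElt R n i = 0 := by
  rw [chiElt, chiPoly, if_neg (by omega), dif_neg (by omega), map_zero]

/-- For `n` even and `r = n + 1` this is the relation `d χ_{n/2} = 0`; otherwise `χ_i = 0` for `i >
n/2` suffices. -/
theorem cElt_eq_zero {r : ℕ} (h : n < r) : cElt R n r = 0 := by
  obtain ⟨i, rfl | rfl⟩ := r.even_or_odd'
  · rw [cElt_two_mul, chiElt_eq_zero R n (by omega)]
  · rw [cElt_two_mul_add_one]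
    rcases Nat.lt_or_ge (n / 2) i with h2 | h2
    · rw [chiElt_eq_zero R n h2, mul_zero]
    · obtain rfl : i = n / 2 := by omega
      exact dElt_mul_chiElt R n (Nat.even_iff.mpr (by omega))

theorem cElt_zero : cElt R n 0 = 1 := (cElt_two_mul R n 0).trans (chiElt_zero R n)

theorem chiElt_mem (i : ℕ) : chiElt R n i ∈ coeffGrading R n (2 * i) :=
  ⟨_, chiPoly_homogeneous R n i, rfl⟩

theorem dElt_mem : dElt R n ∈ coeffGrading R n 1 := ⟨_, dPoly_homogeneous R n, rfl⟩

theorem cElt_mem (r : ℕ) : cElt R n r ∈ coeffGrading R n r := by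
  obtain ⟨i, rfl | rfl⟩ := r.even_or_odd'
  · rw [cElt_two_mul]; exact chiElt_mem R n i
  · rw [cElt_two_mul_add_one, add_comm]
    exact SetLike.GradedMul.mul_mem (dElt_mem R n) (chiElt_mem R n i)

/-- Elements of odd weight of `A_n` are multiples of `d`. -/
theorem exists_eq_dElt_mul {m : ℕ} (hm : Odd m) {a : CoeffAlg R n} (ha : a ∈ coeffGrading R n m) :
    ∃ b, a = dElt R n * b := by
  obtain ⟨p, hp, rfl⟩ := ha
  have h : p ∈ Ideal.span {dPoly R n} := by
    rw [p.as_sum]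
    refine sum_mem fun u hu => ?_
    -- A monomial without `d` has even weight.
    have h0 : u none ≠ 0 := by
      intro h0
      have h1 := hp (MvPolynomial.mem_support_iff.mp hu)
      rw [Finsupp.weight_apply, Finsupp.sum_fintype _ _ (by simp), Fintype.sum_option, h0,
        zero_smul, zero_add] at h1
      have h2 : Even m := by
        rw [← h1]
        refine Finset.even_sum _ fun i _ => ?_
        simp only [coeffWeight, smul_eq_mul]
        exact (even_two_mul _).mul_left _
      exact Nat.not_even_iff_odd.mpr hm h2
    rw [Ideal.mem_span_singleton, dPoly, MvPolynomial.X_dvd_monomial]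
    exact Or.inr h0
  obtain ⟨q, rfl⟩ := Ideal.mem_span_singleton'.mp h
  exact ⟨CoeffAlg.mk R n q, by
    rw [AlgHom.toLinearMap_apply, map_mul, mul_comm]; rfl⟩

/-- Both factors are multiples of `d`, and `d² = 0`. Signs between homogeneous elements of `A_n` can
therefore be inserted or dropped at will. -/
theorem mul_eq_zero_of_odd {i j : ℕ} (hi : Odd i) (hj : Odd j) {a b : CoeffAlg R n}
    (ha : a ∈ coeffGrading R n i) (hb : b ∈ coeffGrading R n j) : a * b = 0 := by
  obtain ⟨a, rfl⟩ := exists_eq_dElt_mul R n hi ha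
  obtain ⟨b, rfl⟩ := exists_eq_dElt_mul R n hj hb
  rw [mul_mul_mul_comm, dElt_mul_self, zero_mul]

/-- The algebra `A_n` is supercommutative. -/
theorem coeff_superComm {i j : ℕ} {a b : CoeffAlg R n}
    (ha : a ∈ coeffGrading R n i) (hb : b ∈ coeffGrading R n j) :
    (-1 : R) ^ (i * j) • (a * b) = a * b := by
  rcases Nat.even_or_odd (i * j) with h | h
  · rw [h.neg_one_pow, one_smul]
  · obtain ⟨hi, hj⟩ := Nat.odd_mul.mp h
    rw [mul_eq_zero_of_odd R n hi hj ha hb, smul_zero]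

variable {R n}

theorem IsBarMap.map_eps_mem {π : OSym R n →ₐ[R] CoeffAlg R n} (hπ : IsBarMap R n π) (r : ℕ) :
    π (eps R n r) ∈ coeffGrading R n r := by
  rw [hπ]
  rcases neg_one_pow_eq_or (CoeffAlg R n) (r.choose 2) with h | h
  · rw [h, one_mul]; exact cElt_mem R n r
  · rw [h, neg_one_mul]; exact neg_mem (cElt_mem R n r)

theorem IsBarMap.map_epsMon_mem {π : OSym R n →ₐ[R] CoeffAlg R n} (hπ : IsBarMap R n π)
    (a : Fin n → ℕ) : π (epsMon R n a) ∈ coeffGrading R n (partsWeight a) := by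
  rw [epsMon, map_mon π]
  exact mon_mem_graded R (coeffGrading R n) _ (fun i : Fin n => n - i)
    (fun i => hπ.map_eps_mem (n - i)) a

end CoefficientElements

/-! ### Bases and grading of `OH`. -/

section Bimodule

variable {R : Type*} [CommRing R] {n k : ℕ} {ρ : OSym R n →ₐ[R] OSymOSym R k (n - k)}
  {π : OSym R n →ₐ[R] CoeffAlg R n}

theorem GrassBimod.proj_surjective : Function.Surjective (GrassBimod.proj ρ π) :=
  Submodule.mkQ_surjective _

theorem GrassBimod.proj_tmul_mul (a : CoeffAlg R n) (b : OSymOSym R k (n - k)) (x : OSym R n) :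
    GrassBimod.proj ρ π (a ⊗ₜ[R] (b * ρ x)) = GrassBimod.proj ρ π ((π x * a) ⊗ₜ[R] b) := by
  rw [← sub_eq_zero, ← map_sub]
  exact (Submodule.Quotient.mk_eq_zero _).mpr (Submodule.subset_span ⟨x, b, a, rfl⟩)

theorem GrassBimod.proj_tmul (a : CoeffAlg R n) (b : OSymOSym R k (n - k)) :
    GrassBimod.proj ρ π (a ⊗ₜ[R] b) = a • GrassBimod.proj ρ π (1 ⊗ₜ[R] b) := by
  rw [← map_smul, TensorProduct.smul_tmul', smul_eq_mul, mul_one]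

theorem GrassBimod.smul_mk (c a : CoeffAlg R n) (f : OSym R k) (s : OSym R (n - k)) :
    c • GrassBimod.mk ρ π f s a = GrassBimod.mk ρ π f s (c * a) := by
  rw [GrassBimod.mk, ← map_smul, TensorProduct.smul_tmul', smul_eq_mul]
  rfl

/-- Linear maps out of the odd equivariant Grassmannian bimodule. -/
def GrassBimod.lift {N : Type*} [AddCommGroup N] [Module R N] [Module (CoeffAlg R n) N]
    [IsScalarTower R (CoeffAlg R n) N] (φ : OSymOSym R k (n - k) →ₗ[R] N)
    (hφ : ∀ b x, φ (b * ρ x) = π x • φ b) : GrassBimod ρ π →ₗ[CoeffAlg R n] N :=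
  (balancedRel ρ π).liftQ (φ.liftBaseChange (CoeffAlg R n)) (by
    rw [balancedRel, Submodule.span_le]
    rintro _ ⟨x, b, a, rfl⟩
    rw [SetLike.mem_coe, LinearMap.mem_ker, map_sub, LinearMap.liftBaseChange_tmul,
      LinearMap.liftBaseChange_tmul, hφ, smul_smul, mul_comm, sub_self])

theorem GrassBimod.lift_proj {N : Type*} [AddCommGroup N] [Module R N] [Module (CoeffAlg R n) N]
    [IsScalarTower R (CoeffAlg R n) N] (φ : OSymOSym R k (n - k) →ₗ[R] N)
    (hφ : ∀ b x, φ (b * ρ x) = π x • φ b) (a : CoeffAlg R n) (b : OSymOSym R k (n - k)) :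
    GrassBimod.lift (ρ := ρ) φ hφ (GrassBimod.proj ρ π (a ⊗ₜ[R] b)) = a • φ b :=
  LinearMap.liftBaseChange_tmul ..

/-- A factor `ρ(x)` on the right becomes the scalar `π(x)`, so generators over the image of `ρ`
become generators over `A_n`. -/
theorem GrassBimod.span_eq_top {ι : Type*} (g : ι → OSymOSym R k (n - k))
    (hg : Submodule.span R (Set.range g) * Subalgebra.toSubmodule ρ.range = ⊤) :
    Submodule.span (CoeffAlg R n) (Set.range fun i => GrassBimod.proj ρ π (1 ⊗ₜ[R] g i)) = ⊤ := by
  rw [eq_top_iff]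
  rintro x -
  obtain ⟨t, rfl⟩ := GrassBimod.proj_surjective x
  induction t using TensorProduct.induction_on with
  | zero => rw [map_zero]; exact zero_mem _
  | add t t' h h' => rw [map_add]; exact add_mem h h'
  | tmul a b =>
    have hb : b ∈ Submodule.span R (Set.range g) * Subalgebra.toSubmodule ρ.range := by
      rw [hg]; trivial
    induction hb using Submodule.mul_induction_on' with
    | add x _ y _ hx hy => rw [TensorProduct.tmul_add, map_add]; exact add_mem hx hy
    | mem_mul_mem u hu y hy =>
      obtain ⟨y, rfl⟩ := hy
      change GrassBimod.proj ρ π (a ⊗ₜ[R] (u * ρ y)) ∈ _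
      rw [GrassBimod.proj_tmul_mul, GrassBimod.proj_tmul]
      refine Submodule.smul_mem _ _ ?_
      induction hu using Submodule.span_induction with
      | mem u hu => obtain ⟨i, rfl⟩ := hu; exact Submodule.subset_span ⟨i, rfl⟩
      | zero => rw [TensorProduct.tmul_zero, map_zero]; exact zero_mem _
      | add u v _ _ hu hv => rw [TensorProduct.tmul_add, map_add]; exact add_mem hu hv
      | smul r u _ hu =>
        rw [← TensorProduct.smul_tmul, GrassBimod.proj_tmul]
        exact Submodule.smul_mem _ _ hu

theorem span_mul_range {l : ℕ} (h : l + k = n) {ρ : OSym R n →ₐ[R] OSymOSym R k l}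
    (hρ : ∀ r, ρ (eps R n r) = ∑ j ∈ Finset.range (r + 1),
      (-1 : R) ^ ((r - j) * j) • tmulOSym R (eps R k (r - j)) (eps R l j))
    {ι : Type*} (g : ι → OSymOSym R k l)
    (hg : Submodule.span R (Set.range g) * twistRange R k l = ⊤) :
    Submodule.span R (Set.range g) * Subalgebra.toSubmodule ρ.range = ⊤ := by
  subst h
  obtain rfl := eq_twistMap hρ
  exact hg

theorem GrassBimod.span_hPart (hk : k ≤ n) (hρ : IsTwistedAction R n k ρ) :
    Submodule.span (CoeffAlg R n) (Set.range fun μ : BoxPartition k (n - k) =>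
      GrassBimod.mk ρ π (hPart R μ.part) 1 1) = ⊤ :=
  GrassBimod.span_eq_top _ (span_mul_range (Nat.sub_add_cancel hk) hρ _
    (span_inl_hPart_mul R k (n - k)))

theorem GrassBimod.span_schur_left (hk : k ≤ n) (hρ : IsTwistedAction R n k ρ) :
    Submodule.span (CoeffAlg R n) (Set.range fun μ : BoxPartition k (n - k) =>
      GrassBimod.mk ρ π (schur R k μ.part (schurPoly_mem R k μ.part)) 1 1) = ⊤ :=
  GrassBimod.span_eq_top _ (span_mul_range (Nat.sub_add_cancel hk) hρ _
    (span_inl_schur_mul R k (n - k)))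

theorem GrassBimod.span_schur_right (hk : k ≤ n) (hρ : IsTwistedAction R n k ρ) :
    Submodule.span (CoeffAlg R n) (Set.range fun μ : BoxPartition (n - k) k =>
      GrassBimod.mk ρ π 1 (schur R (n - k) μ.part (schurPoly_mem R (n - k) μ.part)) 1) = ⊤ :=
  GrassBimod.span_eq_top _ (span_mul_range (Nat.sub_add_cancel hk) hρ _
    (span_inr_schur_mul R k (n - k)))

/-- The coordinates over `OΛ_n`, followed by `π`, respect the relations of the tensor product and
descend to `A_n`-linear forms `Φ μ` dual to the spanning family. They are the coordinates of the
resulting basis and are compatible with weights. -/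
theorem GrassBimod.exists_basis (hk : k ≤ n) (hρ : IsTwistedAction R n k ρ)
    (hπ : IsBarMap R n π) :
    ∃ b : Module.Basis (BoxPartition k (n - k)) (CoeffAlg R n) (GrassBimod ρ π),
      (∀ μ, b μ = GrassBimod.mk ρ π (hPart R μ.part) 1 1) ∧
      ∀ m, ∀ x ∈ grassBimodGrading ρ π m, ∀ μ,
        (μ.size ≤ m → b.repr x μ ∈ coeffGrading R n (m - μ.size)) ∧
        (m < μ.size → b.repr x μ = 0) := by
  obtain ⟨φ, h1, h2, h3, h4⟩ := exists_coords (Nat.sub_add_cancel hk) hρ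
  let Φ : BoxPartition k (n - k) → GrassBimod ρ π →ₗ[CoeffAlg R n] CoeffAlg R n := fun μ =>
    GrassBimod.lift (π.toLinearMap ∘ₗ φ μ) fun b x => by
      rw [LinearMap.comp_apply, h1, AlgHom.toLinearMap_apply, map_mul, mul_comm]
      rfl
  have hΦ : ∀ μ f s a, Φ μ (GrassBimod.mk ρ π f s a) = a * π (φ μ (tmulOSym R f s)) :=
    fun μ f s a => GrassBimod.lift_proj _ _ _ _
  have hself : ∀ μ, Φ μ (GrassBimod.mk ρ π (hPart R μ.part) 1 1) = 1 := fun μ => by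
    rw [hΦ, h2, map_one, mul_one]
  have hne : ∀ μ ν, ν ≠ μ → Φ μ (GrassBimod.mk ρ π (hPart R ν.part) 1 1) = 0 :=
    fun μ ν h => by rw [hΦ, h3 _ _ h, map_zero, mul_zero]
  have hli : LinearIndependent (CoeffAlg R n) fun μ : BoxPartition k (n - k) =>
      GrassBimod.mk ρ π (hPart R μ.part) 1 1 := by
    rw [Fintype.linearIndependent_iff]
    intro c hc μ
    have h := congrArg (Φ μ) hc
    rw [map_sum, Finset.sum_eq_single μ (fun ν _ hν => by rw [map_smul, hne _ _ hν, smul_zero])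
      (fun h => absurd (Finset.mem_univ _) h), map_smul, hself, map_zero, smul_eq_mul,
      mul_one] at h
    exact h
  let b := Module.Basis.mk hli (GrassBimod.span_hPart hk hρ).ge
  have hb : ∀ μ, b μ = GrassBimod.mk ρ π (hPart R μ.part) 1 1 := fun μ =>
    Module.Basis.mk_apply _ _ _
  have hrepr : ∀ x μ, b.repr x μ = Φ μ x := by
    intro x μ
    have : Finsupp.lapply μ ∘ₗ b.repr.toLinearMap = Φ μ := b.ext fun ν => by
      classical
      rw [LinearMap.comp_apply, LinearEquiv.coe_coe, b.repr_self, Finsupp.lapply_apply,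
        Finsupp.single_apply, hb]
      split_ifs with h
      · rw [h, hself]
      · rw [hne _ _ h]
    exact LinearMap.congr_fun this x
  refine ⟨b, hb, fun m x hx μ => ?_⟩
  have key : ∀ N : Submodule R (CoeffAlg R n), (∀ i j l, i + j + l = m →
      ∀ f ∈ oddSymGrading R k i, ∀ s ∈ oddSymGrading R (n - k) j, ∀ a ∈ coeffGrading R n l,
      a * π (φ μ (tmulOSym R f s)) ∈ N) → b.repr x μ ∈ N := by
    intro N hN
    rw [hrepr]
    induction hx using Submodule.span_induction with
    | mem x hx =>
      obtain ⟨i, j, l, h, f, hf, s, hs, a, ha, rfl⟩ := hx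
      rw [hΦ]
      exact hN i j l h f hf s hs a ha
    | zero => rw [map_zero]; exact zero_mem _
    | add x y _ _ hx hy => rw [map_add]; exact add_mem hx hy
    | smul r x _ hx =>
      rw [(Φ μ).map_smul_of_tower]
      exact N.smul_mem r hx
  have hmem : ∀ i j, ∀ f ∈ oddSymGrading R k i, ∀ s ∈ oddSymGrading R (n - k) j,
      μ.size ≤ i + j → π (φ μ (tmulOSym R f s)) ∈ coeffGrading R n (i + j - μ.size) := by
    intro i j f hf s hs h
    have h5 := (h4 i j f hf s hs μ).1 h
    generalize φ μ (tmulOSym R f s) = y at h5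
    induction h5 using Submodule.span_induction with
    | mem x hx => obtain ⟨a, ha, rfl⟩ := hx; rw [← ha]; exact hπ.map_epsMon_mem a
    | zero => rw [map_zero]; exact zero_mem _
    | add x y _ _ hx hy => rw [map_add]; exact add_mem hx hy
    | smul r x _ hx => rw [map_smul]; exact Submodule.smul_mem _ r hx
  refine ⟨fun hm => key _ fun i j l h f hf s hs a ha => ?_, fun hm => ?_⟩
  · rcases Nat.lt_or_ge (i + j) μ.size with h6 | h6
    · rw [(h4 i j f hf s hs μ).2 h6, map_zero, mul_zero]; exact zero_mem _
    · have := SetLike.GradedMul.mul_mem ha (hmem i j f hf s hs h6)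
      rwa [show l + (i + j - μ.size) = m - μ.size by omega] at this
  · have := key ⊥ fun i j l h f hf s hs a ha => by
      rw [(h4 i j f hf s hs μ).2 (by omega), map_zero, mul_zero]; exact zero_mem _
    simpa using this

theorem smul_mem_grassBimodGrading (i j : ℕ) (a : CoeffAlg R n) (ha : a ∈ coeffGrading R n i)
    (x : GrassBimod ρ π) (hx : x ∈ grassBimodGrading ρ π j) :
    a • x ∈ grassBimodGrading ρ π (i + j) := by
  induction hx using Submodule.span_induction with
  | mem x hx =>
    obtain ⟨p, q, l, h, f, hf, s, hs, b, hb, rfl⟩ := hx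
    rw [GrassBimod.smul_mk]
    exact Submodule.subset_span ⟨p, q, i + l, by omega, f, hf, s, hs, _,
      SetLike.GradedMul.mul_mem ha hb, rfl⟩
  | zero => rw [smul_zero]; exact zero_mem _
  | add x y _ _ hx hy => rw [smul_add]; exact add_mem hx hy
  | smul r x _ hx => rw [smul_comm]; exact Submodule.smul_mem _ r hx

theorem GrassBimod.mk_hPart_mem (μ : BoxPartition k (n - k)) :
    GrassBimod.mk ρ π (hPart R μ.part) 1 1 ∈ grassBimodGrading ρ π μ.size :=
  Submodule.subset_span ⟨μ.size, 0, 0, rfl, _, hPart_mem_oddSymGrading R μ.part, 1,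
    SetLike.GradedOne.one_mem, 1, SetLike.GradedOne.one_mem, rfl⟩

theorem grassBimod_isGradedSupermodule (hk : k ≤ n) (hρ : IsTwistedAction R n k ρ)
    (hπ : IsBarMap R n π) : IsGradedSupermodule (coeffGrading R n) (grassBimodGrading ρ π) := by
  obtain ⟨b, hb, hr⟩ := GrassBimod.exists_basis hk hρ hπ
  exact ⟨isInternal_of_basis (b := b) (deg := BoxPartition.size)
    (fun μ => by rw [hb]; exact GrassBimod.mk_hPart_mem μ) smul_mem_grassBimodGrading hr,
    smul_mem_grassBimodGrading⟩

theorem hasGradedRank_of_boxBasis {M : Type*} [AddCommGroup M] [Module R M]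
    [Module (CoeffAlg R n) M] (hk : k ≤ n) {𝒢 : ℕ → Submodule R M}
    (b : Module.Basis (BoxPartition k (n - k)) (CoeffAlg R n) M) (hb : ∀ μ, b μ ∈ 𝒢 μ.size) :
    HasGradedRank (A := CoeffAlg R n) 𝒢
      (qpMonomial ((k : ℤ) * (n - k)) (k * (n - k) : ℕ) * qpBinom n k) := by
  refine ⟨_, inferInstance, b, BoxPartition.size, hb, ?_⟩
  rw [sum_box_qpMonomial n k (n - k) (Nat.sub_add_cancel hk), Nat.cast_sub hk]

end Bimodule

/-! ### Existence and uniqueness of `ρ` and `π`. -/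

section BarMap

variable (R : Type*) [CommRing R]

variable {R} in
theorem exists_twistedAction {k l n : ℕ} (h : l + k = n) :
    ∃ ρ : OSym R n →ₐ[R] OSymOSym R k l, ∀ r, ρ (eps R n r) = ∑ j ∈ Finset.range (r + 1),
      (-1 : R) ^ ((r - j) * j) • tmulOSym R (eps R k (r - j)) (eps R l j) := by
  subst h
  exact ⟨twistMap R k l, twistMap_eps R k l⟩

theorem existsUnique_twistedAction (n k : ℕ) (hk : k ≤ n) :
    ∃! ρ : OSym R n →ₐ[R] OSymOSym R k (n - k), IsTwistedAction R n k ρ := by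
  obtain ⟨ρ, hρ⟩ := exists_twistedAction (R := R) (Nat.sub_add_cancel hk)
  exact ⟨ρ, hρ, fun ρ' h => OSym.algHom_ext fun r => (h r).trans (hρ r).symm⟩

/-- In a commutative ring only the even-odd relation has content; both of its sides equal `2 d a_r
a_{s-1}`. -/
theorem oddSeq_of_commRing {S : Type*} [CommRing S] {a : ℤ → S} (hneg : ∀ r < 0, a r = 0) (d : S)
    (hd : ∀ r, Even r → a (r + 1) = d * a r) : OddSeq a where
  neg := hneg
  comm _ _ _ := mul_comm _ _
  evenOdd r s hr hs := by
    have h1 := hd (s - 1) (hs.sub_odd odd_one)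
    rw [sub_add_cancel] at h1
    rw [h1, hd r hr]
    ring
  oddEven _ _ _ _ := by ring

/-- Existence is a matter of the presentation. The binomial coefficients of `2i` and `2i + 1` over
two differ by `2i`, so the signs do not disturb `c_{2i+1} = d c_{2i}`. -/
theorem existsUnique_barMap (n : ℕ) : ∃! π : OSym R n →ₐ[R] CoeffAlg R n, IsBarMap R n π := by
  let a : ℤ → CoeffAlg R n := fun r =>
    if r < 0 then 0 else (-1) ^ r.toNat.choose 2 * cElt R n r.toNat
  have ha : ∀ r : ℕ, a r = (-1) ^ r.choose 2 * cElt R n r := fun r => by simp [a]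
  have hodd : OddSeq a := by
    refine oddSeq_of_commRing (fun r hr => if_pos hr) (dElt R n) fun r hr => ?_
    rcases lt_or_ge r 0 with h | h
    · have : r + 1 < 0 := by
        obtain ⟨i, rfl⟩ := hr
        omega
      simp [a, h, this]
    · lift r to ℕ using h
      obtain ⟨i, rfl⟩ := (even_iff_exists_two_mul.mp ((Int.even_coe_nat r).mp hr))
      have h1 := ha (2 * i + 1)
      push_cast at h1
      rw [ha (2 * i)]
      push_cast
      rw [h1, cElt_two_mul, cElt_two_mul_add_one, Nat.choose_succ_succ' (2 * i) 1, pow_add,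
        Nat.choose_one_right, (even_two_mul i).neg_one_pow]
      ring
  obtain ⟨π, hπ⟩ := OSym.exists_lift (R := R) (n := n) a hodd
    (by have := ha 0; simpa [cElt_zero] using this) (fun r hr => by
      lift r to ℕ using by omega
      rw [ha, cElt_eq_zero R n (by exact_mod_cast hr), mul_zero])
  refine ⟨π, fun r => (hπ r).trans (ha r), fun π' h => OSym.algHom_ext fun r => ?_⟩
  rw [h r, hπ, ha]

end BarMap

/-! ### The elements `h'_m` and the ideal they generate. -/

section Relations

variable (R : Type*) [CommRing R] (n k : ℕ)

/-- The embedding `f ↦ f ⊗ 1` of `OΛ_k` into `OΛ_k ⊗ A_n`. -/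
abbrev inlC : OSym R k →ₐ[R] OSymCoeff R n k :=
  GradedTensorProduct.includeLeft (oddSymGrading R k) (coeffGrading R n)

/-- The embedding `a ↦ 1 ⊗ a` of `A_n` into `OΛ_k ⊗ A_n`. -/
abbrev inrC : CoeffAlg R n →ₐ[R] OSymCoeff R n k :=
  GradedTensorProduct.includeRight (oddSymGrading R k) (coeffGrading R n)

variable {R n k} in
theorem inlC_mul_inrC (f : OSym R k) (a : CoeffAlg R n) :
    inlC R n k f * inrC R n k a = tmulCoeff R n k f a := includeLeft_mul_includeRight f a

variable {R n k} in
theorem inrC_mul_inlC {i j : ℕ} {f : OSym R k} {a : CoeffAlg R n} (ha : a ∈ coeffGrading R n j)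
    (hf : f ∈ oddSymGrading R k i) :
    inrC R n k a * inlC R n k f = (-1 : R) ^ (j * i) • (inlC R n k f * inrC R n k a) := by
  rw [inlC_mul_inrC]
  exact includeRight_mul_includeLeft ha hf

variable {R n k} in
theorem inrC_mul_inrC_comm (a b : CoeffAlg R n) :
    inrC R n k a * inrC R n k b = inrC R n k b * inrC R n k a := by
  rw [← map_mul, mul_comm, map_mul]

theorem hPrime_eq (m : ℕ) : hPrime R n k m = ∑ r ∈ Finset.range (m + 1),
    (-1 : R) ^ r • (inlC R n k (hSym R k (m - r)) * inrC R n k (cElt R n r)) := by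
  simp only [inlC_mul_inrC]
  rfl

/-- The elements `h'_m`, for integers `m`. -/
def hPrimeZ (m : ℤ) : OSymCoeff R n k := if m < 0 then 0 else hPrime R n k m.toNat

theorem hPrimeZ_natCast (m : ℕ) : hPrimeZ R n k m = hPrime R n k m := by simp [hPrimeZ]

theorem hZ_neg {r : ℤ} (h : r < 0) : hZ R k r = 0 := if_pos h

theorem sum_range_two_mul {M : Type*} [AddCommMonoid M] (F : ℕ → M) (N : ℕ) :
    ∑ s ∈ Finset.range (2 * N), F s = ∑ j ∈ Finset.range N, (F (2 * j) + F (2 * j + 1)) := by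
  induction N with
  | zero => simp
  | succ N ih =>
    rw [Finset.sum_range_succ, ← ih, Nat.mul_succ, Finset.sum_range_succ, Finset.sum_range_succ,
      add_assoc]

theorem hPrimeZ_eq_sum (m : ℤ) (N : ℕ) (h : m < N) : hPrimeZ R n k m =
    ∑ s ∈ Finset.range N, (-1 : R) ^ s • (inlC R n k (hZ R k (m - s)) *
      inrC R n k (cElt R n s)) := by
  rcases lt_or_ge m 0 with h0 | h0
  · rw [hPrimeZ, if_pos h0]
    refine (Finset.sum_eq_zero fun s _ => ?_).symm
    rw [hZ_neg R k (by omega), map_zero, zero_mul, smul_zero]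
  · lift m to ℕ using h0
    rw [hPrimeZ_natCast, hPrime_eq]
    have hN : m + 1 ≤ N := by omega
    rw [← Finset.sum_subset (Finset.range_subset_range.mpr hN) fun s _ hs => by
      rw [Finset.mem_range, not_lt] at hs
      rw [hZ_neg R k (by omega), map_zero, zero_mul, smul_zero]]
    refine Finset.sum_congr rfl fun s hs => ?_
    rw [Finset.mem_range] at hs
    rw [← hZ_natCast, Nat.cast_sub (by omega)]

/-- The relations are invariant under reversing products; this provides linear factors on the right
in `OddSeq.mul_linear_right`. -/
theorem OddSeq.op {S : Type*} [Ring S] {a : ℤ → S} (ha : OddSeq a) :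
    OddSeq fun r => MulOpposite.op (a r) where
  neg r hr := by rw [ha.neg r hr, MulOpposite.op_zero]
  comm r s h := by rw [← MulOpposite.op_mul, ← MulOpposite.op_mul, ha.comm r s h]
  evenOdd r s hr hs := by
    simp only [← MulOpposite.op_mul, ← MulOpposite.op_add]
    rw [add_comm, ha.evenOdd r s hr hs, add_comm]
  oddEven r s hr hs := by
    simp only [← MulOpposite.op_mul, ← MulOpposite.op_sub]
    rw [← neg_sub, ha.oddEven r s hr hs, neg_sub]

theorem OddSeq.of_op {S : Type*} [Ring S] {a : ℤ → S}
    (ha : OddSeq fun r => MulOpposite.op (a r)) : OddSeq a where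
  neg r hr := MulOpposite.op_injective (ha.neg r hr)
  comm r s h := MulOpposite.op_injective (ha.comm r s h).symm
  evenOdd r s hr hs := MulOpposite.op_injective (by
    simpa only [MulOpposite.op_add, MulOpposite.op_mul, add_comm] using ha.evenOdd r s hr hs)
  oddEven r s hr hs := by
    have := congrArg MulOpposite.unop (ha.oddEven r s hr hs)
    simp only [MulOpposite.unop_sub, MulOpposite.unop_mul, MulOpposite.unop_op] at this
    rw [← neg_sub, this, neg_sub]

theorem OddSeq.mul_linear_right {S : Type*} [Ring S] {a : ℤ → S} (ha : OddSeq a) (y : S)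
    (h0 : ∀ r, Even r → a r * y = y * a r) (h1 : ∀ r, Odd r → a r * y = -(y * a r)) :
    OddSeq fun r => a r + a (r - 1) * y :=
  OddSeq.of_op (ha.op.mul_linear (MulOpposite.op y)
    (fun r hr => by rw [← MulOpposite.op_mul, ← MulOpposite.op_mul, h0 r hr])
    (fun r hr => by
      rw [← MulOpposite.op_mul, ← MulOpposite.op_mul, h1 r hr, MulOpposite.op_neg, neg_neg]))

theorem inrC_mul_inlC_hZ {j : ℕ} {a : CoeffAlg R n} (ha : a ∈ coeffGrading R n j) (r : ℤ) :
    inrC R n k a * inlC R n k (hZ R k r) =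
      (-1 : R) ^ (j * r.toNat) • (inlC R n k (hZ R k r) * inrC R n k a) := by
  rcases lt_or_ge r 0 with h | h
  · rw [hZ_neg R k h, map_zero, zero_mul, mul_zero, smul_zero]
  · lift r to ℕ using h
    rw [hZ_natCast]
    exact inrC_mul_inlC ha (hSym_mem_oddSymGrading R k r)

/-- The series of the `h'_m` is `H(X) (1 - dX) ∑ χ_i X^(2i)`: a linear factor with an odd element on
the right, and an even series in central elements. -/
theorem oddSeq_hPrimeZ : OddSeq (hPrimeZ R n k) := by
  have h1 : OddSeq fun r => inlC R n k (hZ R k r) := (oddSeq_hZ R k).map (inlC R n k)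
  have hd := inrC_mul_inlC_hZ R n k (dElt_mem R n)
  have hpar : ∀ {r : ℤ}, ¬ r < 0 → (Even r.toNat ↔ Even r) := by
    intro r h
    rw [← Int.even_coe_nat, Int.toNat_of_nonneg (by omega)]
  have h2 := h1.mul_linear_right (-inrC R n k (dElt R n))
    (fun r hr => by
      have := hd r
      rcases lt_or_ge r 0 with h | h
      · rw [hZ_neg R k h, map_zero, zero_mul, mul_zero]
      · rw [one_mul, ((hpar (by omega)).mpr hr).neg_one_pow, one_smul] at this
        rw [mul_neg, neg_mul, this])
    (fun r hr => by
      have := hd r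
      rcases lt_or_ge r 0 with h | h
      · rw [hZ_neg R k h, map_zero, zero_mul, mul_zero, neg_zero]
      · have h3 : Odd r.toNat := by
          rw [← Nat.not_even_iff_odd, hpar (by omega)]
          exact Int.not_even_iff_odd.mpr hr
        rw [one_mul, h3.neg_one_pow, neg_one_smul] at this
        rw [mul_neg, neg_mul, this, neg_neg])
  have hcomm : ∀ i r, inlC R n k (hZ R k r) * inrC R n k (chiElt R n i) =
      inrC R n k (chiElt R n i) * inlC R n k (hZ R k r) := fun i r => by
    rw [inrC_mul_inlC_hZ R n k (chiElt_mem R n i), mul_assoc, (even_two_mul _).neg_one_pow,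
      one_smul]
  refine h2.mul_even (fun i => inrC R n k (chiElt R n i)) (fun i j => inrC_mul_inrC_comm _ _)
    (fun i r => ?_) fun r N hr => ?_
  · rw [add_mul, mul_add, hcomm, mul_neg, neg_mul, mul_neg, mul_assoc, inrC_mul_inrC_comm,
      ← mul_assoc, hcomm, mul_assoc]
  · rw [hPrimeZ_eq_sum R n k r (2 * N) (by push_cast; exact hr), sum_range_two_mul]
    refine Finset.sum_congr rfl fun j _ => ?_
    rw [cElt_two_mul, cElt_two_mul_add_one, (even_two_mul j).neg_one_pow,
      (odd_two_mul_add_one j).neg_one_pow, one_smul, neg_one_smul, mul_add, map_mul, hcomm,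
      inrC_mul_inrC_comm, ← mul_assoc, hcomm, mul_neg, mul_neg, mul_assoc]
    push_cast
    rw [sub_sub]

/-- In the summand `h_{m-r} ⊗ c_r`, passing `h_{m-r}` costs `(-1)^(j(m-r))`. The missing sign
`(-1)^(jr)` may be inserted because `A_n` is both commutative and supercommutative. -/
theorem inrC_mul_hPrime {j : ℕ} {a : CoeffAlg R n} (ha : a ∈ coeffGrading R n j) (m : ℕ) :
    inrC R n k a * hPrime R n k m = (-1 : R) ^ (j * m) • (hPrime R n k m * inrC R n k a) := by
  rw [hPrime_eq, Finset.mul_sum, Finset.sum_mul, Finset.smul_sum]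
  refine Finset.sum_congr rfl fun r hr => ?_
  rw [Finset.mem_range] at hr
  rw [mul_smul_comm, smul_mul_assoc, ← mul_assoc,
    inrC_mul_inlC ha (hSym_mem_oddSymGrading R k (m - r)), smul_mul_assoc, mul_assoc, mul_assoc,
    ← map_mul, ← map_mul, mul_comm (cElt R n r)]
  have h := coeff_superComm R n ha (cElt_mem R n r)
  conv_lhs => rw [← h]
  rw [map_smul, mul_smul_comm, smul_smul, smul_smul, smul_smul]
  congr 1
  rw [mul_assoc, ← pow_add, ← Nat.mul_add, Nat.sub_add_cancel (by omega), mul_comm]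

/-- The left ideal generated by the elements `h'_m` with `m > l`. -/
def hPrimeIdeal (l : ℕ) : Ideal (OSymCoeff R n k) :=
  Ideal.span {x | ∃ m, l < m ∧ x = hPrime R n k m}

variable {R n k} in
theorem hPrime_mem {l m : ℕ} (h : l < m) : hPrime R n k m ∈ hPrimeIdeal R n k l :=
  Ideal.subset_span ⟨m, h, rfl⟩

theorem smul_mem_ideal {S : Type*} [Ring S] [Algebra R S] (I : Ideal S) (r : R) {x : S}
    (hx : x ∈ I) : r • x ∈ I := by
  rw [Algebra.smul_def]
  exact I.mul_mem_left _ hx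

/-- As `c_0 = 1`, the element `h_s ⊗ 1` is `h'_s` minus terms with smaller complete functions. -/
theorem hSym_mem_adjoin (s : ℕ) : inlC R n k (hSym R k s) ∈ Algebra.adjoin R
    (Set.range (hPrime R n k) ∪ {x | ∃ j, ∃ a ∈ coeffGrading R n j, x = inrC R n k a}) := by
  induction s using Nat.strong_induction_on with
  | _ s ih =>
    have h : inlC R n k (hSym R k s) = hPrime R n k s - ∑ r ∈ Finset.range s,
        (-1 : R) ^ (r + 1) • (inlC R n k (hSym R k (s - (r + 1))) *
          inrC R n k (cElt R n (r + 1))) := by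
      rw [eq_sub_iff_add_eq, hPrime_eq, Finset.sum_range_succ', add_comm, cElt_zero, map_one,
        mul_one, pow_zero, one_smul, Nat.sub_zero]
    rw [h]
    refine sub_mem (Algebra.subset_adjoin (Or.inl ⟨s, rfl⟩)) (sum_mem fun r hr => ?_)
    rw [Finset.mem_range] at hr
    exact Subalgebra.smul_mem _ (mul_mem (ih _ (by omega))
      (Algebra.subset_adjoin (Or.inr ⟨r + 1, _, cElt_mem R n (r + 1), rfl⟩))) _

theorem inrC_mem_of_homogeneous {N : Submodule R (OSymCoeff R n k)}
    (h : ∀ j, ∀ a ∈ coeffGrading R n j, inrC R n k a ∈ N) (a : CoeffAlg R n) :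
    inrC R n k a ∈ N := by
  classical
  rw [← DirectSum.sum_support_decompose (coeffGrading R n) a, map_sum]
  exact sum_mem fun j _ => h j _ (SetLike.coe_mem _)

theorem pow_le_toSubmodule {S : Type*} [Ring S] [Algebra R S] {V : Submodule R S}
    (D : Subalgebra R S) (h : V ≤ Subalgebra.toSubmodule D) (m : ℕ) :
    V ^ m ≤ Subalgebra.toSubmodule D := by
  induction m with
  | zero => rw [pow_zero]; exact Submodule.one_le.mpr (one_mem D)
  | succ m ih =>
    rw [pow_succ]
    exact Submodule.mul_le.mpr fun x hx y hy => mul_mem (S := Subalgebra R S) (ih hx) (h hy)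

theorem adjoin_hPrime : Algebra.adjoin R
    (Set.range (hPrime R n k) ∪ {x | ∃ j, ∃ a ∈ coeffGrading R n j, x = inrC R n k a}) = ⊤ := by
  set D := Algebra.adjoin R
    (Set.range (hPrime R n k) ∪ {x | ∃ j, ∃ a ∈ coeffGrading R n j, x = inrC R n k a}) with hD
  have h1 : ∀ f, inlC R n k f ∈ D := by
    intro f
    have hf : f ∈ Submodule.span R (Set.range (hSym R k)) ^ k := by rw [span_hSym_pow]; trivial
    have hle : Submodule.span R (Set.range (hSym R k)) ^ k ≤
        Subalgebra.toSubmodule (D.comap (inlC R n k)) := by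
      refine pow_le_toSubmodule R _ (Submodule.span_le.mpr ?_) k
      rintro _ ⟨s, rfl⟩
      exact hSym_mem_adjoin R n k s
    exact hle hf
  rw [eq_top_iff]
  rintro x -
  induction x using GradedTensorProduct.induction with
  | zero => exact zero_mem _
  | add x y hx hy => exact add_mem hx hy
  | tmul f a =>
    have := inlC_mul_inrC (n := n) f a
    rw [tmulCoeff] at this
    rw [← this]
    exact mul_mem (h1 f) (inrC_mem_of_homogeneous R n k (N := Subalgebra.toSubmodule D)
      (fun j a ha => Algebra.subset_adjoin (Or.inr ⟨j, a, ha, rfl⟩)) a)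

/-- It suffices to multiply a generator `h'_m` on the right by algebra generators. Homogeneous
elements of `A_n` pass it up to sign. For `i ≤ l < m` the quadratic relations write `h'_m h'_i` as a
combination of `h'_{r'} h'_{s'}` with `s' ≥ m`, which ends in a generator again. -/
instance hPrimeIdeal_isTwoSided (l : ℕ) : (hPrimeIdeal R n k l).IsTwoSided where
  mul_mem_of_left {x} y hx := by
    have hy : y ∈ Algebra.adjoin R (Set.range (hPrime R n k) ∪
        {x | ∃ j, ∃ a ∈ coeffGrading R n j, x = inrC R n k a}) := by rw [adjoin_hPrime]; trivial
    induction hy using Algebra.adjoin_induction generalizing x with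
    | algebraMap r =>
      rw [← Algebra.commutes]
      exact Ideal.mul_mem_left _ _ hx
    | add y z _ _ hy hz => rw [mul_add]; exact add_mem (hy hx) (hz hx)
    | mul y z _ _ hy hz => rw [← mul_assoc]; exact hz (hy hx)
    | mem y hy =>
      induction hx using Submodule.span_induction with
      | zero => rw [zero_mul]; exact zero_mem _
      | add x z _ _ hx hz => rw [add_mul]; exact add_mem hx hz
      | smul c x _ hx => rw [smul_mul_assoc]; exact Submodule.smul_mem _ _ hx
      | mem x hx =>
        obtain ⟨m, hm, rfl⟩ := hx
        rcases hy with ⟨i, rfl⟩ | ⟨j, a, ha, rfl⟩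
        · rcases Nat.lt_or_ge l i with hi | hi
          · exact Ideal.mul_mem_left _ _ (hPrime_mem hi)
          · have h := ((oddSeq_hPrimeZ R n k).mul_mem_span_outer R i m (by omega)).2
            rw [hPrimeZ_natCast, hPrimeZ_natCast] at h
            generalize hPrime R n k m * hPrime R n k i = z at h
            induction h using Submodule.span_induction with
            | zero => exact zero_mem _
            | add z w _ _ hz hw => exact add_mem hz hw
            | smul r z _ hz => exact smul_mem_ideal R _ r hz
            | mem z hz =>
              obtain ⟨r', s', hs, -, rfl⟩ := hz
              rw [hPrimeZ_natCast R n k s']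
              exact Ideal.mul_mem_left _ _ (hPrime_mem (by omega))
        · have h := inrC_mul_hPrime R n k ha m
          have h2 : hPrime R n k m * inrC R n k a =
              (-1 : R) ^ (j * m) • (inrC R n k a * hPrime R n k m) := by
            rw [h, smul_smul, ← mul_pow, neg_one_mul, neg_neg, one_pow, one_smul]
          rw [h2]
          exact smul_mem_ideal R _ _ (Ideal.mul_mem_left _ _ (hPrime_mem hm))

/-- Elements of the two-sided ideal defining `M_k^n` are thus combinations of left multiples of the
`h'_m`, a form that can be tested under a linear map into a module that is not a ring. -/
theorem mem_hPrimeIdeal_of_proj_eq {x : OSymCoeff R n k} (hx : GrassAlg.proj R n k x = 0) :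
    x ∈ hPrimeIdeal R n k (n - k) := by
  have hrel : ∀ ⦃x y⦄, GrassRel R n k x y →
      Ideal.Quotient.mk (hPrimeIdeal R n k (n - k)) x = Ideal.Quotient.mk _ y := by
    rintro _ _ ⟨m, h1, -⟩
    rw [map_zero, Ideal.Quotient.eq_zero_iff_mem]
    exact hPrime_mem (by omega)
  have h := RingQuot.lift_mkRingHom_apply _ hrel x
  have h2 : RingQuot.mkRingHom (GrassRel R n k) x = 0 := by
    rw [← RingQuot.mkAlgHom_coe R]
    exact hx
  rw [h2, map_zero] at h
  exact Ideal.Quotient.eq_zero_iff_mem.mp h.symm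

end Relations

/-! ### The comparison map and the bimodule structure. -/

section Comparison

variable {R : Type*} [CommRing R] {n k : ℕ}

theorem eAlt_eq_zero {m r : ℕ} (h : m < r) : eAlt R m r = 0 := by
  rw [eAlt, eps_eq_zero R m r h, mul_zero, mul_zero]

/-- The sign in `π(ε_r)` cancels the one in `eAlt`, and what remains is the coefficient appearing in
`h'_m`. -/
theorem IsBarMap.map_eAlt {π : OSym R n →ₐ[R] CoeffAlg R n} (hπ : IsBarMap R n π) (r : ℕ) :
    π (eAlt R n r) = (-1 : R) ^ r • cElt R n r := by
  rw [eAlt, map_mul, map_mul, hπ, map_pow, map_pow, map_neg, map_one, ← mul_assoc ((-1 : CoeffAlg R n) ^ r.choose 2),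
    ← mul_pow, neg_one_mul, neg_neg, one_pow, one_mul, Algebra.smul_def, map_pow, map_neg,
    map_one]

theorem sum_inl_hSym_mul {l : ℕ} (h : l + k = n) {ρ : OSym R n →ₐ[R] OSymOSym R k l}
    (hρ : ∀ r, ρ (eps R n r) = ∑ j ∈ Finset.range (r + 1),
      (-1 : R) ^ ((r - j) * j) • tmulOSym R (eps R k (r - j)) (eps R l j)) (m : ℕ) :
    ∑ r ∈ Finset.range (m + 1), inl R k l (hSym R k (m - r)) * ρ (eAlt R n r) =
      inr R k l (eAlt R l m) := by
  subst h
  obtain rfl := eq_twistMap hρ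
  have h := congrArg (PowerSeries.coeff m) (inrSeries_eAlt R k l)
  rw [PowerSeries.coeff_mk, PowerSeries.coeff_mul, ← Finset.Nat.sum_antidiagonal_swap,
    Finset.Nat.sum_antidiagonal_eq_sum_range_succ_mk] at h
  rw [h]
  refine Finset.sum_congr rfl fun r _ => ?_
  rw [PowerSeries.coeff_mk, PowerSeries.coeff_mk]
  rfl

/-- The series of the `h'_m` is `H(X)` times that of `(-1)^r c_r`; multiply by the inverse of `H`.
-/
theorem sum_eAlt_mul_hPrime (m : ℕ) :
    ∑ j ∈ Finset.range (m + 1), inlC R n k (eAlt R k j) * hPrime R n k (m - j) =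
      (-1 : R) ^ m • inrC R n k (cElt R n m) := by
  have h1 : (PowerSeries.mk fun r => hPrime R n k r) =
      (PowerSeries.mk fun r => inlC R n k (hSym R k r)) *
        PowerSeries.mk fun r => (-1 : R) ^ r • inrC R n k (cElt R n r) := by
    ext m
    rw [PowerSeries.coeff_mul, ← Finset.Nat.sum_antidiagonal_swap,
      Finset.Nat.sum_antidiagonal_eq_sum_range_succ_mk, PowerSeries.coeff_mk, hPrime_eq]
    refine Finset.sum_congr rfl fun r _ => ?_
    rw [PowerSeries.coeff_mk, PowerSeries.coeff_mk, mul_smul_comm]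
    rfl
  have h2 : (PowerSeries.mk fun r => inlC R n k (eAlt R k r)) *
      (PowerSeries.mk fun r => hPrime R n k r) =
        PowerSeries.mk fun r => (-1 : R) ^ r • inrC R n k (cElt R n r) := by
    rw [h1, ← mul_assoc, mk_mul_mk_eq_one R (inlC R n k) (eAlt_mul_hSym R k), one_mul]
  have h3 := congrArg (PowerSeries.coeff m) h2
  rw [PowerSeries.coeff_mul, Finset.Nat.sum_antidiagonal_eq_sum_range_succ_mk,
    PowerSeries.coeff_mk] at h3
  rw [← h3]
  refine Finset.sum_congr rfl fun r _ => ?_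
  rw [PowerSeries.coeff_mk, PowerSeries.coeff_mk]

/-- The relations `h'_m = 0` of `M_k^n` hold for all `m > n - k`. -/
theorem GrassAlg.proj_hPrime (hk : k ≤ n) (m : ℕ) (hm : n - k < m) :
    GrassAlg.proj R n k (hPrime R n k m) = 0 := by
  induction m using Nat.strong_induction_on with
  | _ m ih =>
    rcases Nat.lt_or_ge n m with h | h
    -- Above `n` one has `c_m = 0`, and `eAlt` vanishes above `k`. So `h'_m` is a combination of
    -- left multiples of the `k` preceding elements, whose indices still exceed `n - k`.
    · have h1 := sum_eAlt_mul_hPrime (R := R) (n := n) (k := k) m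
      rw [cElt_eq_zero R n h, map_zero, smul_zero, Finset.sum_range_succ', eAlt_zero, map_one,
        one_mul, Nat.sub_zero] at h1
      rw [eq_neg_of_add_eq_zero_right h1, map_neg, map_sum, neg_eq_zero]
      refine Finset.sum_eq_zero fun j hj => ?_
      rw [map_mul]
      rcases Nat.lt_or_ge k (j + 1) with h2 | h2
      · rw [eAlt_eq_zero h2, map_zero, map_zero, zero_mul]
      · rw [ih _ (by omega) (by omega), mul_zero]
    · have := RingQuot.mkAlgHom_rel R (GrassRel.of (R := R) (k := k) m hm h)
      rw [map_zero] at this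
      exact this

theorem GrassAlg.proj_surjective : Function.Surjective (GrassAlg.proj R n k) :=
  RingQuot.mkAlgHom_surjective R _

theorem GrassAlg.proj_inlC (f : OSym R k) :
    GrassAlg.proj R n k (inlC R n k f) = GrassAlg.mk R n k f 1 := rfl

theorem GrassAlg.mk_one_left (a : CoeffAlg R n) :
    GrassAlg.mk R n k 1 a = GrassAlg.coeff R n k a := rfl

theorem GrassAlg.mk_eq (f : OSym R k) (a : CoeffAlg R n) :
    GrassAlg.mk R n k f a = GrassAlg.mk R n k f 1 * GrassAlg.coeff R n k a := by
  rw [GrassAlg.mk, ← inlC_mul_inrC, map_mul]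
  rfl

theorem GrassAlg.smul_mk (c : CoeffAlg R n) (f : OSym R k) (a : CoeffAlg R n) :
    c • GrassAlg.mk R n k f a = GrassAlg.mk R n k f (c * a) := by
  rw [GrassAlg.smul_def, mk_eq, mk_eq f (c * a), mul_assoc, ← map_mul, mul_comm c]

theorem GrassAlg.mk_mul_mk {i j : ℕ} (f : OSym R k) {a : CoeffAlg R n}
    (ha : a ∈ coeffGrading R n i) {g : OSym R k} (hg : g ∈ oddSymGrading R k j)
    (b : CoeffAlg R n) : GrassAlg.mk R n k f a * GrassAlg.mk R n k g b =
      (-1 : R) ^ (i * j) • GrassAlg.mk R n k (f * g) (a * b) := by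
  rw [GrassAlg.mk, GrassAlg.mk, ← map_mul, tmulCoeff, tmulCoeff, tmul_mul_tmul f ha hg b, map_smul]
  rfl

theorem GrassAlg.mk_one_mul_mk_one (f g : OSym R k) :
    GrassAlg.mk R n k f 1 * GrassAlg.mk R n k g 1 = GrassAlg.mk R n k (f * g) 1 := by
  rw [← proj_inlC, ← proj_inlC, ← map_mul, ← map_mul]
  rfl

instance : IsScalarTower R (CoeffAlg R n) (GrassAlg R n k) where
  smul_assoc r a x := by
    rw [GrassAlg.smul_def, GrassAlg.smul_def, map_smul, mul_smul_comm]

theorem GrassAlg.induction {p : GrassAlg R n k → Prop} (zero : p 0)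
    (add : ∀ x y, p x → p y → p (x + y)) (mk : ∀ f a, p (GrassAlg.mk R n k f a))
    (x : GrassAlg R n k) : p x := by
  obtain ⟨y, rfl⟩ := GrassAlg.proj_surjective x
  induction y using GradedTensorProduct.induction with
  | zero => rw [map_zero]; exact zero
  | add x y hx hy => rw [map_add]; exact add _ _ hx hy
  | tmul f a => exact mk f a

/-- For `m > n - k` the relation `h'_m = 0` expresses `h_m` by lower complete functions with
coefficients in `A_n`, which is the input of `hSym_reduce`. -/
theorem GrassAlg.span_hPart (hk : k ≤ n) :
    Submodule.span (CoeffAlg R n) (Set.range fun μ : BoxPartition k (n - k) =>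
      GrassAlg.mk R n k (hPart R μ.part) 1) = ⊤ := by
  set N := Submodule.span (CoeffAlg R n) (Set.range fun μ : BoxPartition k (n - k) =>
      GrassAlg.mk R n k (hPart R μ.part) 1) with hN
  rw [eq_top_iff]
  rintro x -
  induction x using GrassAlg.induction with
  | zero => exact zero_mem _
  | add x y hx hy => exact add_mem hx hy
  | mk f a =>
    rw [← mul_one a, ← GrassAlg.smul_mk]
    refine N.smul_mem a (hSym_reduce R k (n - k)
      ((GrassAlg.proj R n k).toLinearMap ∘ₗ (inlC R n k).toLinearMap) (N.restrictScalars R)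
      (fun μ => Submodule.subset_span ⟨μ, rfl⟩) (fun g m hm h => ?_) f)
    have h1 := GrassAlg.proj_hPrime (R := R) hk m hm
    rw [hPrime_eq, Finset.sum_range_succ', pow_zero, one_smul, cElt_zero, map_one, mul_one,
      Nat.sub_zero, map_add, map_sum] at h1
    change GrassAlg.proj R n k (inlC R n k (g * hSym R k m)) ∈ N
    rw [map_mul, map_mul, eq_neg_of_add_eq_zero_right h1, mul_neg, Finset.mul_sum]
    refine neg_mem (sum_mem fun r hr => ?_)
    rw [Finset.mem_range] at hr
    have h2 := h (m - (r + 1)) (by omega)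
    rw [map_smul, mul_smul_comm, map_mul (GrassAlg.proj R n k), ← mul_assoc,
      ← map_mul (GrassAlg.proj R n k), ← map_mul (inlC R n k)]
    exact (N.restrictScalars R).smul_mem _ (N.smul_mem (cElt R n (r + 1)) h2)

variable (ρ : OSym R n →ₐ[R] OSymOSym R k (n - k)) (π : OSym R n →ₐ[R] CoeffAlg R n)

/-- The map `f ⊗ a ↦ f ⊗ 1 ⊗ a` on `OΛ_k ⊗ A_n`. -/
def preComparison : OSymCoeff R n k →ₗ[R] GrassBimod ρ π :=
  (GrassBimod.proj ρ π).restrictScalars R ∘ₗ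
    TensorProduct.map LinearMap.id (inl R k (n - k)).toLinearMap ∘ₗ
    (TensorProduct.comm R (OSym R k) (CoeffAlg R n)).toLinearMap ∘ₗ
    (GradedTensorProduct.of R (oddSymGrading R k) (coeffGrading R n)).symm.toLinearMap

theorem preComparison_eq (f : OSym R k) (a : CoeffAlg R n) :
    preComparison ρ π (inlC R n k f * inrC R n k a) =
      GrassBimod.proj ρ π (a ⊗ₜ[R] inl R k (n - k) f) := by
  rw [inlC_mul_inrC]
  rfl

variable {ρ π}

/-- Up to sign, `c_r` is the image under `π` of `eAlt_r` and can be carried across the tensor sign.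
The sum becomes `f (1 ⊗ eAlt_m)`, and `ε_m = 0` in `OΛ_{n-k}`. -/
theorem preComparison_hPrime (hk : k ≤ n) (hρ : IsTwistedAction R n k ρ) (hπ : IsBarMap R n π)
    (f : OSym R k) (a : CoeffAlg R n) (m : ℕ) (hm : n - k < m) :
    preComparison ρ π (inlC R n k f * hPrime R n k m * inrC R n k a) = 0 := by
  have h1 : ∀ r, (-1 : R) ^ r • preComparison ρ π
      (inlC R n k (f * hSym R k (m - r)) * inrC R n k (cElt R n r * a)) =
      GrassBimod.proj ρ π (a ⊗ₜ[R]
        (inl R k (n - k) f * (inl R k (n - k) (hSym R k (m - r)) * ρ (eAlt R n r)))) := by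
    intro r
    rw [← mul_assoc, ← map_mul, GrassBimod.proj_tmul_mul, hπ.map_eAlt, preComparison_eq,
      smul_mul_assoc, ← TensorProduct.smul_tmul', LinearMap.map_smul_of_tower]
  have h2 : inlC R n k f * hPrime R n k m * inrC R n k a = ∑ r ∈ Finset.range (m + 1),
      (-1 : R) ^ r • (inlC R n k (f * hSym R k (m - r)) * inrC R n k (cElt R n r * a)) := by
    rw [hPrime_eq, Finset.mul_sum, Finset.sum_mul]
    refine Finset.sum_congr rfl fun r _ => ?_
    rw [mul_smul_comm, smul_mul_assoc, map_mul, map_mul, mul_assoc, mul_assoc, mul_assoc]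
  rw [h2, map_sum]
  simp only [map_smul]
  rw [Finset.sum_congr rfl fun r _ => h1 r, ← map_sum, ← TensorProduct.tmul_sum,
    ← Finset.mul_sum, sum_inl_hSym_mul (Nat.sub_add_cancel hk) hρ, eAlt_eq_zero hm, map_zero,
    mul_zero, TensorProduct.tmul_zero, map_zero]

/-- A kernel element is a sum of left multiples of the `h'_m`; for a coefficient `f ⊗ a` with `a`
homogeneous, `a` moves to the right of `h'_m` up to sign, where the previous lemma applies. -/
theorem preComparison_eq_zero (hk : k ≤ n) (hρ : IsTwistedAction R n k ρ) (hπ : IsBarMap R n π)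
    {x : OSymCoeff R n k} (hx : GrassAlg.proj R n k x = 0) : preComparison ρ π x = 0 := by
  have h := mem_hPrimeIdeal_of_proj_eq R n k hx
  rw [hPrimeIdeal, Ideal.span, Submodule.mem_span_set'] at h
  obtain ⟨N, c, g, rfl⟩ := h
  rw [map_sum]
  refine Finset.sum_eq_zero fun i _ => ?_
  obtain ⟨m, hm, hg⟩ := (g i).2
  rw [hg, smul_eq_mul]
  generalize c i = y
  induction y using GradedTensorProduct.induction with
  | zero => rw [zero_mul, map_zero]
  | add y z hy hz => rw [add_mul, map_add, hy, hz, add_zero]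
  | tmul f a =>
    have h1 := inlC_mul_inrC (n := n) f a
    rw [tmulCoeff] at h1
    rw [← h1]
    have h2 := inrC_mem_of_homogeneous R n k (N := LinearMap.ker (preComparison ρ π ∘ₗ
      LinearMap.mulLeft R (inlC R n k f) ∘ₗ LinearMap.mulRight R (hPrime R n k m)))
      (fun j a ha => ?_) a
    · rw [mul_assoc]
      exact h2
    · rw [LinearMap.mem_ker, LinearMap.comp_apply, LinearMap.comp_apply,
        LinearMap.mulRight_apply, LinearMap.mulLeft_apply, inrC_mul_hPrime R n k ha,
        mul_smul_comm, ← mul_assoc, map_smul, preComparison_hPrime hk hρ hπ f a m hm, smul_zero]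

theorem exists_comparison (hk : k ≤ n) (hρ : IsTwistedAction R n k ρ) (hπ : IsBarMap R n π) :
    ∃ β : GrassAlg R n k ≃ₗ[CoeffAlg R n] GrassBimod ρ π,
      ∀ f a, β (GrassAlg.mk R n k f a) = GrassBimod.mk ρ π f 1 a := by
  have hker : LinearMap.ker (GrassAlg.proj R n k).toLinearMap ≤
      LinearMap.ker (preComparison ρ π) := fun x hx => preComparison_eq_zero hk hρ hπ hx
  -- The map is defined by a choice of preimages; the preceding lemma makes it independent of the
  -- choice.
  let s := Function.surjInv (GrassAlg.proj_surjective (R := R) (n := n) (k := k))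
  have hs : ∀ x, GrassAlg.proj R n k (s x) = x := Function.surjInv_eq _
  have h0 : ∀ y, preComparison ρ π (s (GrassAlg.proj R n k y)) = preComparison ρ π y := by
    intro y
    rw [← sub_eq_zero, ← map_sub]
    exact preComparison_eq_zero hk hρ hπ (by rw [map_sub, hs, sub_self])
  have hmk : ∀ f a, preComparison ρ π (s (GrassAlg.mk R n k f a)) = GrassBimod.mk ρ π f 1 a :=
    fun f a => h0 _
  have hadd : ∀ x y, preComparison ρ π (s (x + y)) =
      preComparison ρ π (s x) + preComparison ρ π (s y) := by
    intro x y
    rw [← map_add, ← h0 (s x + s y), map_add, hs, hs]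
  let β : GrassAlg R n k →ₗ[CoeffAlg R n] GrassBimod ρ π :=
    { toFun := fun x => preComparison ρ π (s x)
      map_add' := hadd
      map_smul' := fun c x => by
        rw [RingHom.id_apply]
        induction x using GrassAlg.induction with
        | zero =>
          have := hadd 0 0
          rw [add_zero, left_eq_add] at this
          rw [smul_zero, this, smul_zero]
        | add x y hx hy => rw [smul_add, hadd, hadd, hx, hy, smul_add]
        | mk f a => rw [GrassAlg.smul_mk, hmk, hmk, GrassBimod.smul_mk] }
  obtain ⟨b, hb, -⟩ := GrassBimod.exists_basis hk hρ hπ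
  -- `T` is a right inverse of `β` since `OH` has a basis to define it on, and it is surjective
  -- since the `h_λ ⊗ 1` span `M_k^n`. Hence it is a two-sided inverse.
  let T : GrassBimod ρ π →ₗ[CoeffAlg R n] GrassAlg R n k :=
    b.constr (CoeffAlg R n) fun μ => GrassAlg.mk R n k (hPart R μ.part) 1
  have hT : ∀ μ, T (b μ) = GrassAlg.mk R n k (hPart R μ.part) 1 := fun μ =>
    b.constr_basis (CoeffAlg R n) _ μ
  have hβT : β ∘ₗ T = LinearMap.id := b.ext fun μ => by
    rw [LinearMap.comp_apply, hT, LinearMap.id_apply, hb]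
    exact hmk _ _
  have hsurj : Function.Surjective T := by
    rw [← LinearMap.range_eq_top, eq_top_iff, ← GrassAlg.span_hPart hk, Submodule.span_le]
    rintro _ ⟨μ, rfl⟩
    exact ⟨b μ, hT μ⟩
  refine ⟨LinearEquiv.ofLinearMap β T hβT (LinearMap.ext fun x => ?_), hmk⟩
  obtain ⟨y, rfl⟩ := hsurj x
  rw [LinearMap.comp_apply, LinearMap.id_apply]
  congr 1
  exact LinearMap.congr_fun hβT y

theorem smul_mem_grassAlgGrading (i j : ℕ) (a : CoeffAlg R n) (ha : a ∈ coeffGrading R n i)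
    (x : GrassAlg R n k) (hx : x ∈ grassAlgGrading R n k j) :
    a • x ∈ grassAlgGrading R n k (i + j) := by
  induction hx using Submodule.span_induction with
  | mem x hx =>
    obtain ⟨p, l, h, f, hf, b, hb, rfl⟩ := hx
    rw [GrassAlg.smul_mk]
    exact Submodule.subset_span ⟨p, i + l, by omega, f, hf, _, SetLike.GradedMul.mul_mem ha hb, rfl⟩
  | zero => rw [smul_zero]; exact zero_mem _
  | add x y _ _ hx hy => rw [smul_add]; exact add_mem hx hy
  | smul r x _ hx => rw [smul_comm]; exact Submodule.smul_mem _ r hx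

theorem GrassAlg.mk_hPart_mem (μ : BoxPartition k (n - k)) :
    GrassAlg.mk R n k (hPart R μ.part) 1 ∈ grassAlgGrading R n k μ.size :=
  Submodule.subset_span ⟨μ.size, 0, rfl, _, hPart_mem_oddSymGrading R μ.part, 1,
    SetLike.GradedOne.one_mem, rfl⟩

theorem comparison_smul (β : GrassAlg R n k ≃ₗ[CoeffAlg R n] GrassBimod ρ π) (r : R)
    (x : GrassAlg R n k) : β (r • x) = r • β x := β.toLinearMap.map_smul_of_tower r x

theorem comparison_mem {β : GrassAlg R n k ≃ₗ[CoeffAlg R n] GrassBimod ρ π}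
    (hβ : ∀ f a, β (GrassAlg.mk R n k f a) = GrassBimod.mk ρ π f 1 a) {m : ℕ}
    {x : GrassAlg R n k} (hx : x ∈ grassAlgGrading R n k m) : β x ∈ grassBimodGrading ρ π m := by
  induction hx using Submodule.span_induction with
  | mem x hx =>
    obtain ⟨i, j, h, f, hf, a, ha, rfl⟩ := hx
    rw [hβ]
    exact Submodule.subset_span ⟨i, 0, j, by omega, f, hf, 1, SetLike.GradedOne.one_mem, a, ha,
      rfl⟩
  | zero => rw [map_zero]; exact zero_mem _
  | add x y _ _ hx hy => rw [map_add]; exact add_mem hx hy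
  | smul r x _ hx => rw [comparison_smul]; exact Submodule.smul_mem _ r hx

theorem GrassAlg.exists_basis (hk : k ≤ n) (hρ : IsTwistedAction R n k ρ) (hπ : IsBarMap R n π)
    {β : GrassAlg R n k ≃ₗ[CoeffAlg R n] GrassBimod ρ π}
    (hβ : ∀ f a, β (GrassAlg.mk R n k f a) = GrassBimod.mk ρ π f 1 a) :
    ∃ b : Module.Basis (BoxPartition k (n - k)) (CoeffAlg R n) (GrassAlg R n k),
      (∀ μ, b μ = GrassAlg.mk R n k (hPart R μ.part) 1) ∧
      ∀ m x, β x ∈ grassBimodGrading ρ π m → ∀ μ,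
        (μ.size ≤ m → b.repr x μ ∈ coeffGrading R n (m - μ.size)) ∧
        (m < μ.size → b.repr x μ = 0) := by
  obtain ⟨b, hb, hr⟩ := GrassBimod.exists_basis hk hρ hπ
  refine ⟨b.map β.symm, fun μ => ?_, fun m x hx μ => ?_⟩
  · rw [Module.Basis.map_apply, LinearEquiv.symm_apply_eq, hβ, hb]
  · have : (b.map β.symm).repr x = b.repr (β x) := by
      rw [Module.Basis.map_repr]
      rfl
    rw [this]
    exact hr m _ hx μ

/-- For the nontrivial direction, an element of weight `m` in `OH` has homogeneous coordinates, and
`β` identifies the two homogeneous bases. -/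
theorem comparison_mem_iff (hk : k ≤ n) (hρ : IsTwistedAction R n k ρ) (hπ : IsBarMap R n π)
    {β : GrassAlg R n k ≃ₗ[CoeffAlg R n] GrassBimod ρ π}
    (hβ : ∀ f a, β (GrassAlg.mk R n k f a) = GrassBimod.mk ρ π f 1 a) (m : ℕ)
    (x : GrassAlg R n k) : β x ∈ grassBimodGrading ρ π m ↔ x ∈ grassAlgGrading R n k m := by
  refine ⟨fun hx => ?_, comparison_mem hβ⟩
  obtain ⟨b, hb, hr⟩ := GrassAlg.exists_basis hk hρ hπ hβ
  exact mem_of_repr_mem (𝒜 := coeffGrading R n) (b := b) (deg := BoxPartition.size)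
    (fun μ => by rw [hb]; exact GrassAlg.mk_hPart_mem μ) smul_mem_grassAlgGrading (hr m x hx)

theorem grassAlg_isGradedSupermodule (hk : k ≤ n) (hρ : IsTwistedAction R n k ρ)
    (hπ : IsBarMap R n π) : IsGradedSupermodule (coeffGrading R n) (grassAlgGrading R n k) := by
  obtain ⟨β, hβ⟩ := exists_comparison hk hρ hπ
  obtain ⟨b, hb, hr⟩ := GrassAlg.exists_basis hk hρ hπ hβ
  exact ⟨isInternal_of_basis (b := b) (deg := BoxPartition.size)
    (fun μ => by rw [hb]; exact GrassAlg.mk_hPart_mem μ) smul_mem_grassAlgGrading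
    (fun m x hx => hr m x (comparison_mem hβ hx)), smul_mem_grassAlgGrading⟩

/-- Passing `f` gives the sign of its weight; the sign for passing `b` can be added by
supercommutativity of `A_n`, so only the total weight of `x` enters. -/
theorem GrassAlg.coeff_mul {i j : ℕ} {a : CoeffAlg R n} (ha : a ∈ coeffGrading R n i)
    {x : GrassAlg R n k} (hx : x ∈ grassAlgGrading R n k j) :
    GrassAlg.coeff R n k a * x = (-1 : R) ^ (i * j) • (a • x) := by
  induction hx using Submodule.span_induction with
  | mem x hx =>
    obtain ⟨p, q, rfl, f, hf, b, hb, rfl⟩ := hx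
    rw [← GrassAlg.mk_one_left, GrassAlg.mk_mul_mk 1 ha hf, one_mul, GrassAlg.smul_mk,
      Nat.mul_add, pow_add, mul_smul]
    congr 1
    have h := coeff_superComm R n ha hb
    have h2 : GrassAlg.mk R n k f ((-1 : R) ^ (i * q) • (a * b)) =
        (-1 : R) ^ (i * q) • GrassAlg.mk R n k f (a * b) := by
      rw [GrassAlg.mk_eq, map_smul, mul_smul_comm, ← GrassAlg.mk_eq]
    rw [← h2, h]
  | zero => rw [mul_zero, smul_zero, smul_zero]
  | add x y _ _ hx hy => rw [mul_add, hx, hy, smul_add, smul_add]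
  | smul r x _ hx =>
    rw [mul_smul_comm, hx, smul_comm a r x, smul_comm r]

/-- Left multiplication on `OΛ_k ⊗ OΛ_{n-k}` commutes with the right action of `ρ` and descends to
`OH`. It is `A_n`-linear, as is the operator transported from `M_k^n`, and both agree on the basis,
where the middle factor is `1`. -/
theorem comparison_mk_one_mul {β : GrassAlg R n k ≃ₗ[CoeffAlg R n] GrassBimod ρ π}
    (hβ : ∀ f a, β (GrassAlg.mk R n k f a) = GrassBimod.mk ρ π f 1 a) (f : OSym R k)
    (hk : k ≤ n) (hρ : IsTwistedAction R n k ρ) (w : OSymOSym R k (n - k))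
    (b : CoeffAlg R n) :
    β (GrassAlg.mk R n k f 1 * β.symm (GrassBimod.proj ρ π (b ⊗ₜ[R] w))) =
      GrassBimod.proj ρ π (b ⊗ₜ[R] (inl R k (n - k) f * w)) := by
  let D : GrassBimod ρ π →ₗ[CoeffAlg R n] GrassBimod ρ π :=
    GrassBimod.lift ((GrassBimod.proj ρ π).restrictScalars R ∘ₗ
      TensorProduct.mk R (CoeffAlg R n) (OSymOSym R k (n - k)) 1 ∘ₗ
      LinearMap.mulLeft R (inl R k (n - k) f)) fun w x => by
        change GrassBimod.proj ρ π (1 ⊗ₜ[R] (inl R k (n - k) f * (w * ρ x))) =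
          π x • GrassBimod.proj ρ π (1 ⊗ₜ[R] (inl R k (n - k) f * w))
        rw [← mul_assoc, GrassBimod.proj_tmul_mul, mul_one, GrassBimod.proj_tmul]
  have hD : ∀ b w, D (GrassBimod.proj ρ π (b ⊗ₜ[R] w)) =
      GrassBimod.proj ρ π (b ⊗ₜ[R] (inl R k (n - k) f * w)) := fun b w =>
    (GrassBimod.lift_proj _ _ _ _).trans (GrassBimod.proj_tmul _ _).symm
  let E : GrassBimod ρ π →ₗ[CoeffAlg R n] GrassBimod ρ π :=
    { toFun := fun v => β (GrassAlg.mk R n k f 1 * β.symm v)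
      map_add' := fun v w => by rw [map_add, mul_add, map_add]
      map_smul' := fun c v => by
        rw [map_smul, GrassAlg.smul_def, ← mul_assoc, ← GrassAlg.smul_def, map_smul]
        rfl }
  have h : E = D := by
    refine LinearMap.ext_on_range (GrassBimod.span_hPart hk hρ) fun μ => ?_
    change β (GrassAlg.mk R n k f 1 * β.symm _) = D (GrassBimod.proj ρ π (1 ⊗ₜ[R] _))
    rw [hD, ← hβ, LinearEquiv.symm_apply_apply, GrassAlg.mk_one_mul_mk_one, hβ]
    change GrassBimod.proj ρ π (1 ⊗ₜ[R] inl R k (n - k) (f * hPart R μ.part)) = _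
    rw [map_mul]
    rfl
  rw [← hD, ← h]
  rfl

/-- Both actions are transported from left and right multiplication on `M_k^n`, so they commute and
`β` respects them by construction. What needs proof are the formulas, above all the left action on
`g ⊗ s ⊗ b` with `s` arbitrary. -/
theorem exists_bimodule (hk : k ≤ n) (hρ : IsTwistedAction R n k ρ) (hπ : IsBarMap R n π) :
    ∃ (L : GrassAlg R n k →ₐ[R] Module.End R (GrassBimod ρ π))
      (T : (GrassAlg R n k)ᵐᵒᵖ →ₐ[R] Module.End R (GrassBimod ρ π))
      (β : GrassAlg R n k ≃ₗ[CoeffAlg R n] GrassBimod ρ π),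
      (∀ x y, Commute (L x) (T (MulOpposite.op y))) ∧
      (∀ (i j l : ℕ), ∀ a ∈ coeffGrading R n i, ∀ g ∈ oddSymGrading R k j,
        ∀ s ∈ oddSymGrading R (n - k) l, ∀ (f : OSym R k) (b : CoeffAlg R n),
        L (GrassAlg.mk R n k f a) (GrassBimod.mk ρ π g s b) =
          (-1 : R) ^ (i * (j + l)) • GrassBimod.mk ρ π (f * g) s (a * b)) ∧
      (∀ (i j : ℕ), ∀ f ∈ oddSymGrading R k i, ∀ b ∈ coeffGrading R n j,
        ∀ (g : OSym R k) (a : CoeffAlg R n),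
        T (MulOpposite.op (GrassAlg.mk R n k f a)) (GrassBimod.mk ρ π g 1 b) =
          (-1 : R) ^ (i * j) • GrassBimod.mk ρ π (g * f) 1 (b * a)) ∧
      (∀ (a : CoeffAlg R n) (v : GrassBimod ρ π),
        T (MulOpposite.op (GrassAlg.mk R n k 1 a)) v = a • v) ∧
      (∀ (f : OSym R k) (a : CoeffAlg R n),
        β (GrassAlg.mk R n k f a) = GrassBimod.mk ρ π f 1 a) ∧
      (∀ x y z, β (x * y * z) = L x (T (MulOpposite.op z) (β y))) ∧
      (∀ m x, β x ∈ grassBimodGrading ρ π m ↔ x ∈ grassAlgGrading R n k m) := by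
  obtain ⟨β, hβ⟩ := exists_comparison hk hρ hπ
  let e := (β.restrictScalars R).conjAlgEquiv R
  let L : GrassAlg R n k →ₐ[R] Module.End R (GrassBimod ρ π) :=
    e.toAlgHom.comp (Algebra.lmul R (GrassAlg R n k))
  let T : (GrassAlg R n k)ᵐᵒᵖ →ₐ[R] Module.End R (GrassBimod ρ π) :=
    e.toAlgHom.comp (Algebra.lsmul R R (GrassAlg R n k))
  have hL : ∀ x v, L x v = β (x * β.symm v) := fun _ _ => rfl
  have hT : ∀ y v, T (MulOpposite.op y) v = β (β.symm v * y) := fun _ _ => rfl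
  have hLsmul : ∀ x (c : CoeffAlg R n) v, L x (c • v) = c • L x v := by
    intro x c v
    rw [hL, hL, map_smul, GrassAlg.smul_def, ← mul_assoc, ← GrassAlg.smul_def, map_smul]
  refine ⟨L, T, β, fun x y => LinearMap.ext fun v => ?_, ?_, ?_, fun a v => ?_, hβ,
    fun x y z => ?_, comparison_mem_iff hk hρ hπ hβ⟩
  · change L x (T (MulOpposite.op y) v) = T (MulOpposite.op y) (L x v)
    rw [hL, hT, hT, hL, LinearEquiv.symm_apply_apply, LinearEquiv.symm_apply_apply, mul_assoc]
  · intro i j l a ha g hg s hs f b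
    have h1 : GrassBimod.mk ρ π g s 1 ∈ grassBimodGrading ρ π (j + l) :=
      Submodule.subset_span ⟨j, l, 0, rfl, g, hg, s, hs, 1, SetLike.GradedOne.one_mem, rfl⟩
    -- No explicit preimage of `g ⊗ s ⊗ 1` is available; its weight, preserved by the inverse of
    -- `β`, is all that the sign depends on.
    have h2 : β.symm (GrassBimod.mk ρ π g s 1) ∈ grassAlgGrading R n k (j + l) := by
      rw [← comparison_mem_iff hk hρ hπ hβ, LinearEquiv.apply_symm_apply]
      exact h1
    have h3 : L (GrassAlg.coeff R n k a) (GrassBimod.mk ρ π g s 1) =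
        (-1 : R) ^ (i * (j + l)) • GrassBimod.mk ρ π g s a := by
      rw [hL, GrassAlg.coeff_mul ha h2, comparison_smul, map_smul,
        LinearEquiv.apply_symm_apply, GrassBimod.smul_mk, mul_one]
    have h4 : GrassBimod.mk ρ π g s b = b • GrassBimod.mk ρ π g s 1 := by
      rw [GrassBimod.smul_mk, mul_one]
    have h5 : L (GrassAlg.mk R n k f 1) (GrassBimod.mk ρ π g s a) =
        GrassBimod.mk ρ π (f * g) s a := by
      rw [hL, GrassBimod.mk, comparison_mk_one_mul hβ f hk hρ, ← inl_mul_inr, ← mul_assoc,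
        ← map_mul, inl_mul_inr]
      rfl
    rw [h4, hLsmul, GrassAlg.mk_eq, map_mul, Module.End.mul_apply, h3, map_smul, h5, smul_comm,
      GrassBimod.smul_mk, mul_comm a b]
  · intro i j f hf b hb g a
    rw [hT, ← hβ, LinearEquiv.symm_apply_apply, GrassAlg.mk_mul_mk g hb hf,
      comparison_smul, hβ, mul_comm j]
  · rw [hT, GrassAlg.mk_one_left, ← GrassAlg.smul_def, map_smul, LinearEquiv.apply_symm_apply]
  · rw [hL, hT, LinearEquiv.symm_apply_apply, LinearEquiv.symm_apply_apply, mul_assoc]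

end Comparison

end

end OddGrassmannian

open OddGrassmannian
theorem mainTheorem6 {R : Type*} [CommRing R] (n k : ℕ) (hk : k ≤ n) :
    (∃! ρ : OSym R n →ₐ[R] OSymOSym R k (n - k), IsTwistedAction R n k ρ) ∧
    (∃! π : OSym R n →ₐ[R] CoeffAlg R n, IsBarMap R n π) ∧
    ∀ (ρ : OSym R n →ₐ[R] OSymOSym R k (n - k)) (π : OSym R n →ₐ[R] CoeffAlg R n),
      IsTwistedAction R n k ρ → IsBarMap R n π →
      -- both sides are graded supermodules over `A_n`
      IsGradedSupermodule (coeffGrading R n) (grassAlgGrading R n k) ∧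
      IsGradedSupermodule (coeffGrading R n) (grassBimodGrading ρ π) ∧
      -- the bimodule structure and the isomorphism of bimodules
      (∃ (L : GrassAlg R n k →ₐ[R] Module.End R (GrassBimod ρ π))
        (T : (GrassAlg R n k)ᵐᵒᵖ →ₐ[R] Module.End R (GrassBimod ρ π))
        (β : GrassAlg R n k ≃ₗ[CoeffAlg R n] GrassBimod ρ π),
        (∀ x y, Commute (L x) (T (MulOpposite.op y))) ∧
        (∀ (i j l : ℕ), ∀ a ∈ coeffGrading R n i, ∀ g ∈ oddSymGrading R k j,
          ∀ s ∈ oddSymGrading R (n - k) l, ∀ (f : OSym R k) (b : CoeffAlg R n),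
          L (GrassAlg.mk R n k f a) (GrassBimod.mk ρ π g s b) =
            (-1 : R) ^ (i * (j + l)) • GrassBimod.mk ρ π (f * g) s (a * b)) ∧
        (∀ (i j : ℕ), ∀ f ∈ oddSymGrading R k i, ∀ b ∈ coeffGrading R n j,
          ∀ (g : OSym R k) (a : CoeffAlg R n),
          T (MulOpposite.op (GrassAlg.mk R n k f a)) (GrassBimod.mk ρ π g 1 b) =
            (-1 : R) ^ (i * j) • GrassBimod.mk ρ π (g * f) 1 (b * a)) ∧
        (∀ (a : CoeffAlg R n) (v : GrassBimod ρ π),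
          T (MulOpposite.op (GrassAlg.mk R n k 1 a)) v = a • v) ∧
        (∀ (f : OSym R k) (a : CoeffAlg R n),
          β (GrassAlg.mk R n k f a) = GrassBimod.mk ρ π f 1 a) ∧
        (∀ x y z, β (x * y * z) = L x (T (MulOpposite.op z) (β y))) ∧
        (∀ m x, β x ∈ grassBimodGrading ρ π m ↔ x ∈ grassAlgGrading R n k m)) ∧
      -- bases of odd complete functions
      IsBasis (CoeffAlg R n) (fun l : BoxPartition k (n - k) =>
        GrassAlg.mk R n k (hPart R l.part) 1) ∧
      IsBasis (CoeffAlg R n) (fun l : BoxPartition k (n - k) =>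
        GrassBimod.mk ρ π (hPart R l.part) 1 1) ∧
      -- bases of odd Schur functions
      (∃ hs : ∀ l : BoxPartition k (n - k), schurPoly R k l.part ∈ OSym R k,
        IsBasis (CoeffAlg R n) (fun l : BoxPartition k (n - k) =>
          GrassAlg.mk R n k (schur R k l.part (hs l)) 1) ∧
        IsBasis (CoeffAlg R n) (fun l : BoxPartition k (n - k) =>
          GrassBimod.mk ρ π (schur R k l.part (hs l)) 1 1)) ∧
      (∃ hs : ∀ l : BoxPartition (n - k) k, schurPoly R (n - k) l.part ∈ OSym R (n - k),
        IsBasis (CoeffAlg R n) (fun l : BoxPartition (n - k) k =>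
          GrassBimod.mk ρ π 1 (schur R (n - k) l.part (hs l)) 1)) ∧
      -- graded ranks
      HasGradedRank (A := CoeffAlg R n) (grassAlgGrading R n k)
        (qpMonomial ((k : ℤ) * (n - k)) (k * (n - k) : ℕ) * qpBinom n k) ∧
      HasGradedRank (A := CoeffAlg R n) (grassBimodGrading ρ π)
        (qpMonomial ((k : ℤ) * (n - k)) (k * (n - k) : ℕ) * qpBinom n k) := by
  refine ⟨existsUnique_twistedAction R n k hk, existsUnique_barMap R n, fun ρ π hρ hπ => ?_⟩
  obtain ⟨β, hβ⟩ := exists_comparison hk hρ hπ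
  obtain ⟨b, hb, -⟩ := GrassBimod.exists_basis hk hρ hπ
  obtain ⟨c, hc, -⟩ := GrassAlg.exists_basis hk hρ hπ hβ
  -- The Schur families span and have as many members as the basis of `h_λ`, so no comparison of
  -- coefficients is needed.
  have hs := isBasis_of_span_eq_top b _ (Equiv.refl _) (GrassBimod.span_schur_left hk hρ (π := π))
  refine ⟨grassAlg_isGradedSupermodule hk hρ hπ, grassBimod_isGradedSupermodule hk hρ hπ,
    exists_bimodule hk hρ hπ, ⟨c, funext hc⟩, ⟨b, funext hb⟩,
    ⟨fun l => schurPoly_mem R k l.part, ?_, hs⟩,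
    ⟨fun l => schurPoly_mem R (n - k) l.part, isBasis_of_span_eq_top b _
      -- The `s_μ` of the second factor are indexed by the transposed box, which contains equally
      -- many partitions.
      (Fintype.equivOfCardEq (BoxPartition.card_comm k (n - k)))
      (GrassBimod.span_schur_right hk hρ)⟩,
    hasGradedRank_of_boxBasis hk c fun μ => by rw [hc]; exact GrassAlg.mk_hPart_mem μ,
    hasGradedRank_of_boxBasis hk b fun μ => by rw [hb]; exact GrassBimod.mk_hPart_mem μ⟩
  obtain ⟨s, hs⟩ := hs
  refine ⟨s.map β.symm, funext fun μ => ?_⟩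
  rw [Module.Basis.map_apply, LinearEquiv.symm_apply_eq, hβ, hs]
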